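/- Let $\mathbb K$ be an algebraically closed field of characteristic zero and let $A=(A_{ij})_{i,j\in I}$, $I=\{1,\dots,r\}$, $r\ge 1$, be an invertible symmetrisable generalised Cartan matrix. Let $\mathfrak g=\mathfrak g(A)$ be the Lie algebra with Chevalley generators $e_i,f_i,h_i$ given by the Chevalley–Serre presentation, let $\epsilon_i\in\mathbb K$ ($i\in I$) be nonzero numbers such that $A_{ij}/\epsilon_i=A_{ji}/\epsilon_j$, let $\kappa$ be the invariant symmetric form on $\mathfrak g$ with $\kappa(e_i,f_j)=\delta_{ij}\epsilon_i$, and let $\lambda$ be a dominant integral weight with Dynkin labels $\lambda_i\in\mathbb Z_{\ge 0}$. Put $\lambda^{\blacktriangle}=\sum_i\epsilon_i^{-1}\lambda_i\Lambda_i$, and let $B$ be the matrix indexed by $\{0\}\cup I$ with $B_{00}=0$, $B_{i0}=-\lambda_i$, $B_{0j}=-\lambda_j/\epsilon_j$, $B_{ij}=A_{ij}$; assume that $B$ is invertible (so $\lambda\ne 0$). Suppose that $\mathfrak g$ is simple and finite-dimensional, that $\lambda=\lambda^{\blacktriangle}$ (i.e. $\epsilon_i=1$ whenever $\lambda_i\neq0$),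 and that $\lambda$ is pseudo-minuscule, i.e. $\big(\sum_i\epsilon_i\lambda_i\Lambda_i,\alpha\big)\in\{0,\pm1\}$ for every root $\alpha$ of $\mathfrak g$, where $(-,-)$ is the form induced by $\kappa$ on the dual of the Cartan subalgebra (equivalently, $\lambda$ is a fundamental weight with Coxeter label $1$). *The algebra $\mathscr B$.* Let $\mathscr B$ be the Lie superalgebra generated by $e_i,f_i,h_i$, $i\in\{0\}\cup I$, with $e_0,f_0$ odd and the other generators even, modulo $[h_i,e_j]=B_{ij}e_j$, $[h_i,f_j]=-B_{ij}f_j$, $[e_i,f_j]=\delta_{ij}h_j$, and modulo the maximal ideal that is graded and intersects the local part (degrees $0,\pm1$) trivially, for the grading with all $e_i$ in degree $1$, all $f_i$ in degree $-1$ and all $h_i$ in degree $0$. Consider henceforth the consistent $\mathbb Z$-grading of $\mathscr B$, with $e_0$, $f_0$ in degrees $1$, $-1$ and all other generators in degree $0$, and put $L=\sum_i (B^{-1})_{0i}h_i$. *The algebra $W$.* Let $K=\{k\in I:\lambda_k=0\}$, $J=I\setminus K$. Let $\tilde W$ be the Lie superalgebra generated by even elements $e_i,f_i$ ($i\in I$),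 $h_i$ ($i\in\{0\}\cup I$) and odd elements $e_0$, $f_{0i}$ ($i\in\{0\}\cup K$), modulo, for all indices for which the generators exist, $$[e_i,f_j]=\delta_{ij}h_j,\quad [h_i,f_j]=-B_{ij}f_j,\quad [h_i,e_j]=B_{ij}e_j,\quad [e_0,f_{0i}]=h_i,\quad [h_i,f_{0j}]=-B_{i0}f_{0j},$$ $$(\mathrm{ad}\,e_i)^{1-B_{ij}}(e_j)=(\mathrm{ad}\,f_i)^{1-B_{ij}}(f_j)=0\quad(\text{whenever } 1-B_{ij}\ge 0),$$ and, for $i\in\{0\}\cup K$, $j\in J$ and $k,l\in K$, $$[e_k,[f_l,f_{0i}]]=\delta_{kl}B_{il}f_{0k},\quad (\mathrm{ad}\,f_j)^{1-B_{j0}}(f_{0i})=[e_j,f_{0i}]=0,\quad [e_k,[e_k,f_{0i}]]=[f_k,[f_k,f_{0i}]]=0,\quad [e_j,[e_k,f_{0i}]]=0.$$ Let $W$ be the quotient of $\tilde W$ by its maximal graded ideal intersecting the local part trivially, for the consistent $\mathbb Z$-grading ($e_0$ in degree $1$, the $f_{0i}$ in degree $-1$, the other generators in degree $0$). *The cartanification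 $\mathscr B^W$.* Given a bilinear map $\langle-|-\rangle:\mathscr B_{-1}\times\mathscr B_1\to\mathbb K$ that is invariant, $\langle[x,y]|z\rangle=\langle x|[y,z]\rangle$ for $y\in\mathscr B_0$, write $\llbracket-,-\rrbracket$ for the bracket of $\mathscr B$ and put $\langle x|y\rangle=-\langle y|x\rangle$ for $x\in\mathscr B_1$, $y\in\mathscr B_{-1}$. On $\mathscr B_{-1}U(\mathscr B_0)\oplus U(\mathscr B_0)\oplus\mathscr B_1U(\mathscr B_0)$, where $\mathscr B_{\pm1}U(\mathscr B_0)=U(\mathscr B_0)\mathscr B_{\pm1}$ is the degree $\pm1$ part of the enveloping algebra of the semidirect sum of $\mathscr B_0$ and the free Lie superalgebra on $\mathscr B_{\pm1}$, define products of elements of opposite degrees $\pm1$ by $(Xx)(yY)=X(xy)Y$ for $X,Y\in U(\mathscr B_0)$, where $$x_{-1}y_1=-\llbracket y_1,x_{-1}\rrbracket+\langle x_{-1}|y_1\rangle L,\qquad x_1y_{-1}=\llbracket y_{-1},x_1\rrbracket+\langle x_1|y_{-1}\rangle L+\langle x_1|y_{-1}\rangle .$$ With the graded commutator as bracket this is a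 local Lie superalgebra. Take its subalgebra generated by $\{xy: x\in\mathscr B_{-1},\,y\in\mathscr B_0\}$ and $\mathscr B_1$, and factor out the maximal graded ideal intersecting the degree $0$ part trivially. The cartanification $\mathscr B^W$ is the minimal $\mathbb Z$-graded Lie superalgebra with the resulting local part, i.e. the Lie superalgebra freely generated by this local part (subject to its brackets) modulo the maximal graded ideal intersecting the local part trivially. **Theorem.** Under these assumptions there is exactly one invariant bilinear map $\langle-|-\rangle:\mathscr B_{-1}\times\mathscr B_1\to\mathbb K$ with $\langle f_0|e_0\rangle=-1$ (it is the restriction of the invariant form on $\mathscr B$ that extends $\kappa$ and satisfies $\langle e_0|f_0\rangle=-\langle f_0|e_0\rangle=1$), and the cartanification $\mathscr B^W$ formed with it is isomorphic to the tensor hierarchy algebra $W$ as a $\mathbb Z$-graded Lie superalgebra. -/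

import Mathlib

/-! Lie superalgebras with a consistent `ℤ`-grading given by generators and relations, contragredient
Lie superalgebras, tensor hierarchy algebras and cartanifications. -/

open scoped TensorProduct

noncomputable section

namespace Cartanification

universe u v

/-! ### Ideals and quotients for a bilinear bracket -/

section Bracket

variable {K : Type*} [Field K] {L : Type*} [AddCommGroup L] [Module K L]

/-- Two-sided ideals with respect to a bilinear bracket. -/
def IsIdeal (br : L →ₗ[K] L →ₗ[K] L) (I : Submodule K L) : Prop :=
  ∀ x, ∀ y ∈ I, br x y ∈ I ∧ br y x ∈ I

/-- The ideal generated by a set. -/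
def idealGen (br : L →ₗ[K] L →ₗ[K] L) (S : Set L) : Submodule K L :=
  sInf {I | IsIdeal br I ∧ S ⊆ I}

theorem idealGen_isIdeal (br : L →ₗ[K] L →ₗ[K] L) (S : Set L) : IsIdeal br (idealGen br S) := by
  intro x y hy
  simp only [idealGen, Submodule.mem_sInf, Set.mem_ofPred_eq] at hy ⊢
  exact ⟨fun I hI => (hI.1 x y (hy I hI)).1, fun I hI => (hI.1 x y (hy I hI)).2⟩

theorem subset_idealGen (br : L →ₗ[K] L →ₗ[K] L) (S : Set L) : S ⊆ idealGen br S := by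
  intro x hx
  simp only [idealGen, SetLike.mem_coe, Submodule.mem_sInf, Set.mem_ofPred_eq]
  exact fun I hI => hI.2 hx

theorem isIdeal_sSup (br : L →ₗ[K] L →ₗ[K] L) (S : Set (Submodule K L))
    (hS : ∀ I ∈ S, IsIdeal br I) : IsIdeal br (sSup S) := by
  intro x
  have h1 : sSup S ≤ (sSup S).comap (br x) :=
    sSup_le fun I hI y hy => (le_sSup hI : I ≤ sSup S) (hS I hI x y hy).1
  have h2 : sSup S ≤ (sSup S).comap (br.flip x) :=
    sSup_le fun I hI y hy => (le_sSup hI : I ≤ sSup S) (hS I hI x y hy).2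
  exact fun y hy => ⟨h1 hy, h2 hy⟩

/-- The bracket induced on the quotient by an ideal. -/
def quotBracket (br : L →ₗ[K] L →ₗ[K] L) (I : Submodule K L) (hI : IsIdeal br I) :
    (L ⧸ I) →ₗ[K] (L ⧸ I) →ₗ[K] (L ⧸ I) :=
  I.liftQ
    { toFun := fun x => I.mapQ I (br x) fun y hy => (hI x y hy).1
      map_add' := by intro x y; ext z; simp
      map_smul' := by intro c x; ext z; simp }
    (by
      intro x hx
      rw [LinearMap.mem_ker]
      ext z
      simpa using (hI z x hx).2)

@[simp] theorem quotBracket_mk (br : L →ₗ[K] L →ₗ[K] L) (I : Submodule K L) (hI : IsIdeal br I)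
    (x y : L) : quotBracket br I hI (I.mkQ x) (I.mkQ y) = I.mkQ (br x y) := rfl

/-- A subspace is graded, with respect to the grading with homogeneous components `g k`, if it is
spanned by homogeneous elements. -/
def IsGradedSubspace (g : ℤ → Submodule K L) (I : Submodule K L) : Prop :=
  I ≤ ⨆ k, I ⊓ g k

/-- The maximal graded ideal intersecting the local part (degrees `-1`, `0` and `1`) trivially: the
sum of all graded ideals with this property. -/
def maxIdeal (br : L →ₗ[K] L →ₗ[K] L) (g : ℤ → Submodule K L) : Submodule K L :=
  sSup {I | IsIdeal br I ∧ IsGradedSubspace g I ∧ Disjoint I (g (-1) ⊔ g 0 ⊔ g 1)}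

theorem maxIdeal_isIdeal (br : L →ₗ[K] L →ₗ[K] L) (g : ℤ → Submodule K L) :
    IsIdeal br (maxIdeal br g) :=
  isIdeal_sSup br _ fun _ hI => hI.1

end Bracket

/-! ### Graded Lie superalgebras given by generators and relations -/

/-- The degree of a nonassociative word in generators `x` of degree `d x`. -/
def wordDeg {X : Type v} (d : X → ℤ) : FreeMagma X → ℤ
  | FreeMagma.of x => d x
  | FreeMagma.mul a b => wordDeg d a + wordDeg d b

/-- The sign `(-1)^(mn)`. -/
def sgn (m n : ℤ) : ℤ := ((m * n).negOnePow : ℤˣ)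

section Presented

variable {K : Type u} [Field K] {X : Type v}

/-- A nonassociative word as an element of the free nonassociative algebra. -/
def word (a : FreeMagma X) : FreeNonUnitalNonAssocAlgebra K X := MonoidAlgebra.single a 1

variable (K X) in
/-- The product of the free nonassociative algebra, considered as a bracket. -/
def freeBracket : FreeNonUnitalNonAssocAlgebra K X →ₗ[K] FreeNonUnitalNonAssocAlgebra K X →ₗ[K]
    FreeNonUnitalNonAssocAlgebra K X :=
  LinearMap.mul K (FreeNonUnitalNonAssocAlgebra K X)

/-- Left multiplication `ad x : y ↦ xy` in the free nonassociative algebra. -/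
def ad (x : FreeNonUnitalNonAssocAlgebra K X) :
    Module.End K (FreeNonUnitalNonAssocAlgebra K X) :=
  freeBracket K X x

/-- Graded antisymmetry and the graded Jacobi identity, where a word is even or odd according to
its degree with respect to `d`. -/
inductive SuperRel (d : X → ℤ) : FreeNonUnitalNonAssocAlgebra K X → Prop
  | skew (a b : FreeMagma X) :
      SuperRel d (word a * word b + sgn (wordDeg d a) (wordDeg d b) • (word b * word a))
  | jacobi (a b c : FreeMagma X) :
      SuperRel d (word a * (word b * word c) - (word a * word b) * word c
        - sgn (wordDeg d a) (wordDeg d b) • (word b * (word a * word c)))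

/-- The ideal of the free nonassociative algebra generated by the axioms of a Lie superalgebra and
the relators `R`. -/
def relIdeal (d : X → ℤ) (R : Set (FreeNonUnitalNonAssocAlgebra K X)) :
    Submodule K (FreeNonUnitalNonAssocAlgebra K X) :=
  idealGen (freeBracket K X) ({x | SuperRel d x} ∪ R)

theorem relIdeal_isIdeal (d : X → ℤ) (R : Set (FreeNonUnitalNonAssocAlgebra K X)) :
    IsIdeal (freeBracket K X) (relIdeal d R) :=
  idealGen_isIdeal (freeBracket K X) ({x | SuperRel d x} ∪ R)

/-- The Lie superalgebra generated by the set `X` modulo the relators `R`, where a generator `x` is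
even or odd according to `d x`. -/
abbrev Pres (d : X → ℤ) (R : Set (FreeNonUnitalNonAssocAlgebra K X)) : Type (max u v) :=
  FreeNonUnitalNonAssocAlgebra K X ⧸ relIdeal d R

/-- The Lie superbracket. -/
def presBracket (d : X → ℤ) (R : Set (FreeNonUnitalNonAssocAlgebra K X)) :
    Pres d R →ₗ[K] Pres d R →ₗ[K] Pres d R :=
  quotBracket (freeBracket K X) (relIdeal d R) (relIdeal_isIdeal d R)

/-- The homogeneous component of degree `k` for the `ℤ`-grading with a generator `x` in degree
`d' x` (which may be different from the grading `d` that determines the parity). -/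
def presGrade (d : X → ℤ) (R : Set (FreeNonUnitalNonAssocAlgebra K X)) (d' : X → ℤ) (k : ℤ) :
    Submodule K (Pres d R) :=
  Submodule.span K {x | ∃ a : FreeMagma X, wordDeg d' a = k ∧ (relIdeal d R).mkQ (word a) = x}

/-- The minimal quotient: the Lie superalgebra with generators `X` and relators `R` (and parity
given by `d`), modulo its maximal graded ideal intersecting the local part trivially, both with
respect to the grading given by `d'`. -/
def Min (d d' : X → ℤ) (R : Set (FreeNonUnitalNonAssocAlgebra K X)) : Type (max u v) :=
  Pres d R ⧸ maxIdeal (presBracket d R) (presGrade d R d')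

namespace Min

variable (d d' : X → ℤ) (R : Set (FreeNonUnitalNonAssocAlgebra K X))

instance : AddCommGroup (Min d d' R) :=
  inferInstanceAs (AddCommGroup (Pres d R ⧸ maxIdeal (presBracket d R) (presGrade d R d')))

instance : Module K (Min d d' R) :=
  inferInstanceAs (Module K (Pres d R ⧸ maxIdeal (presBracket d R) (presGrade d R d')))

/-- The Lie superbracket. -/
def bracket : Min d d' R →ₗ[K] Min d d' R →ₗ[K] Min d d' R :=
  quotBracket (presBracket d R) (maxIdeal (presBracket d R) (presGrade d R d'))
    (maxIdeal_isIdeal _ _)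

/-- The quotient map from the free nonassociative algebra. -/
def proj : FreeNonUnitalNonAssocAlgebra K X →ₗ[K] Min d d' R :=
  (maxIdeal (presBracket d R) (presGrade d R d')).mkQ ∘ₗ (relIdeal d R).mkQ

/-- The image of a generator. -/
def gen (x : X) : Min d d' R := proj d d' R (FreeNonUnitalNonAssocAlgebra.of K x)

/-- The homogeneous component of degree `k` for the consistent `ℤ`-grading, which is the one given
by `d`. -/
def grade (k : ℤ) : Submodule K (Min d d' R) :=
  Submodule.span K {x | ∃ a : FreeMagma X, wordDeg d a = k ∧ proj d d' R (word a) = x}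

variable {d d' R}

theorem bracket_proj (x y : FreeNonUnitalNonAssocAlgebra K X) :
    bracket d d' R (proj d d' R x) (proj d d' R y) = proj d d' R (x * y) := rfl

theorem proj_rel {x : FreeNonUnitalNonAssocAlgebra K X} (hx : SuperRel d x ∨ x ∈ R) :
    proj d d' R x = 0 := by
  have h : x ∈ relIdeal d R := subset_idealGen _ _ hx
  have h' : (relIdeal d R).mkQ x = 0 := by simpa using h
  change (maxIdeal (presBracket d R) (presGrade d R d')).mkQ ((relIdeal d R).mkQ x) = 0
  rw [h', map_zero]

theorem word_mul (a b : FreeMagma X) :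
    (word (a.mul b) : FreeNonUnitalNonAssocAlgebra K X) = word a * word b := by
  simp only [word, MonoidAlgebra.single_mul_single, mul_one]
  rfl

theorem word_of (x : X) :
    (word (FreeMagma.of x) : FreeNonUnitalNonAssocAlgebra K X) =
      FreeNonUnitalNonAssocAlgebra.of K x := rfl

theorem gen_mem (x : X) : gen d d' R x ∈ grade d d' R (d x) :=
  Submodule.subset_span ⟨FreeMagma.of x, rfl, rfl⟩

theorem bracket_mem {m n : ℤ} {x y : Min d d' R} (hx : x ∈ grade d d' R m)
    (hy : y ∈ grade d d' R n) : bracket d d' R x y ∈ grade d d' R (m + n) := by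
  induction hx, hy using Submodule.span_induction₂ with
  | mem_mem x y hx hy =>
    obtain ⟨a, ha, rfl⟩ := hx
    obtain ⟨b, hb, rfl⟩ := hy
    refine Submodule.subset_span ⟨a.mul b, ?_, ?_⟩
    · simp [wordDeg, ha, hb]
    · rw [word_mul, bracket_proj]
  | zero_left y hy => simp
  | zero_right x hx => simp
  | add_left x y z _ _ _ h1 h2 => simpa using add_mem h1 h2
  | add_right x y z _ _ _ h1 h2 => simpa using add_mem h1 h2
  | smul_left c x y _ _ h => simpa using Submodule.smul_mem _ c h
  | smul_right c x y _ _ h => simpa using Submodule.smul_mem _ c h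

/-- Graded antisymmetry. -/
theorem skew {m n : ℤ} {x y : Min d d' R} (hx : x ∈ grade d d' R m) (hy : y ∈ grade d d' R n) :
    bracket d d' R x y + sgn m n • bracket d d' R y x = 0 := by
  induction hx, hy using Submodule.span_induction₂ with
  | mem_mem x y hx hy =>
    obtain ⟨a, ha, rfl⟩ := hx
    obtain ⟨b, hb, rfl⟩ := hy
    have := proj_rel (d' := d') (R := R) (Or.inl (SuperRel.skew (K := K) (d := d) a b))
    rw [map_add, map_zsmul, ha, hb] at this
    simpa only [bracket_proj] using this
  | zero_left y hy => simp
  | zero_right x hx => simp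
  | add_left x y z _ _ _ h1 h2 =>
    rw [map_add, map_add, LinearMap.add_apply, smul_add, add_add_add_comm, h1, h2, add_zero]
  | add_right x y z _ _ _ h1 h2 =>
    rw [map_add, map_add, LinearMap.add_apply, smul_add, add_add_add_comm, h1, h2, add_zero]
  | smul_left c x y _ _ h =>
    rw [map_smul, map_smul, LinearMap.smul_apply, smul_comm, ← smul_add, h, smul_zero]
  | smul_right c x y _ _ h =>
    rw [map_smul, map_smul, LinearMap.smul_apply, smul_comm, ← smul_add, h, smul_zero]

/-- The graded Jacobi identity. -/
theorem jacobi {m n : ℤ} {x y : Min d d' R} (hx : x ∈ grade d d' R m)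
    (hy : y ∈ grade d d' R n) (z : Min d d' R) :
    bracket d d' R x (bracket d d' R y z) - bracket d d' R (bracket d d' R x y) z
      - sgn m n • bracket d d' R y (bracket d d' R x z) = 0 := by
  let br := bracket d d' R
  let f : Min d d' R → Min d d' R → Min d d' R →ₗ[K] Min d d' R := fun x y =>
    br x ∘ₗ br y - br (br x y) - sgn m n • (br y ∘ₗ br x)
  suffices h : f x y = 0 from LinearMap.congr_fun h z
  clear z
  induction hx, hy using Submodule.span_induction₂ with
  | mem_mem x y hx hy =>
    obtain ⟨a, ha, rfl⟩ := hx
    obtain ⟨b, hb, rfl⟩ := hy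
    have hw : ∀ w : FreeNonUnitalNonAssocAlgebra K X,
        f (proj d d' R (word a)) (proj d d' R (word b)) (proj d d' R w) = 0 := by
      intro w
      induction w using MonoidAlgebra.induction_linear with
      | zero => simp
      | add p q hp hq => rw [map_add, map_add, hp, hq, add_zero]
      | single c t =>
        have := proj_rel (d' := d') (R := R) (Or.inl (SuperRel.jacobi (K := K) (d := d) a b c))
        rw [map_sub, map_sub, map_zsmul, ha, hb] at this
        have h1 : (MonoidAlgebra.single c t : FreeNonUnitalNonAssocAlgebra K X) = t • word c := by
          simp [word]
        rw [h1, map_smul, map_smul]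
        simp only [← bracket_proj] at this
        rw [show f (proj d d' R (word a)) (proj d d' R (word b)) (proj d d' R (word c)) = 0 from
          this, smul_zero]
    ext z
    obtain ⟨p, rfl⟩ := Submodule.mkQ_surjective _ z
    obtain ⟨w, rfl⟩ := Submodule.mkQ_surjective _ p
    exact hw w
  | zero_left y hy => ext; simp [f]
  | zero_right x hx => ext; simp [f]
  | add_left x y z _ _ _ h1 h2 =>
    have : f (x + y) z = f x z + f y z := by
      ext w; simp only [f, LinearMap.sub_apply, LinearMap.add_apply, LinearMap.smul_apply,
        LinearMap.comp_apply, map_add, smul_add]; abel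
    rw [this, h1, h2, add_zero]
  | add_right x y z _ _ _ h1 h2 =>
    have : f x (y + z) = f x y + f x z := by
      ext w; simp only [f, LinearMap.sub_apply, LinearMap.add_apply, LinearMap.smul_apply,
        LinearMap.comp_apply, map_add, smul_add]; abel
    rw [this, h1, h2, add_zero]
  | smul_left c x y _ _ h =>
    have : f (c • x) y = c • f x y := by
      ext w; simp only [f, LinearMap.sub_apply, LinearMap.smul_apply,
        LinearMap.comp_apply, map_smul, smul_sub, smul_comm c]
    rw [this, h, smul_zero]
  | smul_right c x y _ _ h =>
    have : f x (c • y) = c • f x y := by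
      ext w; simp only [f, LinearMap.sub_apply, LinearMap.smul_apply,
        LinearMap.comp_apply, map_smul, smul_sub, smul_comm c]
    rw [this, h, smul_zero]

variable (d d' R)

/-- The component of degree `0`, an ordinary Lie algebra. -/
def Zero : Type (max u v) := grade d d' R 0

/-- The component of degree `1`, an odd module over the component of degree `0`. -/
def Pos : Type (max u v) := grade d d' R 1

/-- The component of degree `-1`, an odd module over the component of degree `0`. -/
def Neg : Type (max u v) := grade d d' R (-1)

instance : AddCommGroup (Zero d d' R) := inferInstanceAs (AddCommGroup (grade d d' R 0))
instance : Module K (Zero d d' R) := inferInstanceAs (Module K (grade d d' R 0))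
instance : AddCommGroup (Pos d d' R) := inferInstanceAs (AddCommGroup (grade d d' R 1))
instance : Module K (Pos d d' R) := inferInstanceAs (Module K (grade d d' R 1))
instance : AddCommGroup (Neg d d' R) := inferInstanceAs (AddCommGroup (grade d d' R (-1)))
instance : Module K (Neg d d' R) := inferInstanceAs (Module K (grade d d' R (-1)))

/-- The inclusion of the component of degree `0`. -/
def zeroIncl : Zero d d' R →ₗ[K] Min d d' R := (grade d d' R 0).subtype
/-- The inclusion of the component of degree `1`. -/
def posIncl : Pos d d' R →ₗ[K] Min d d' R := (grade d d' R 1).subtype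
/-- The inclusion of the component of degree `-1`. -/
def negIncl : Neg d d' R →ₗ[K] Min d d' R := (grade d d' R (-1)).subtype

variable {d d' R}

theorem zero_ext {x y : Zero d d' R} (h : zeroIncl d d' R x = zeroIncl d d' R y) : x = y :=
  Subtype.ext h
theorem pos_ext {x y : Pos d d' R} (h : posIncl d d' R x = posIncl d d' R y) : x = y :=
  Subtype.ext h
theorem neg_ext {x y : Neg d d' R} (h : negIncl d d' R x = negIncl d d' R y) : x = y :=
  Subtype.ext h

theorem zeroIncl_mem (x : Zero d d' R) : zeroIncl d d' R x ∈ grade d d' R 0 := x.2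
theorem posIncl_mem (x : Pos d d' R) : posIncl d d' R x ∈ grade d d' R 1 := x.2
theorem negIncl_mem (x : Neg d d' R) : negIncl d d' R x ∈ grade d d' R (-1) := x.2

@[simp] theorem sgn_zero_left (n : ℤ) : sgn 0 n = 1 := by simp [sgn]
@[simp] theorem sgn_zero_right (n : ℤ) : sgn n 0 = 1 := by simp [sgn]

instance : Bracket (Zero d d' R) (Zero d d' R) where
  bracket x y := ⟨bracket d d' R (zeroIncl d d' R x) (zeroIncl d d' R y),
    by simpa using bracket_mem (zeroIncl_mem x) (zeroIncl_mem y)⟩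

instance : Bracket (Zero d d' R) (Pos d d' R) where
  bracket x y := ⟨bracket d d' R (zeroIncl d d' R x) (posIncl d d' R y),
    by simpa using bracket_mem (zeroIncl_mem x) (posIncl_mem y)⟩

instance : Bracket (Zero d d' R) (Neg d d' R) where
  bracket x y := ⟨bracket d d' R (zeroIncl d d' R x) (negIncl d d' R y),
    by simpa using bracket_mem (zeroIncl_mem x) (negIncl_mem y)⟩

theorem zeroIncl_lie (x y : Zero d d' R) : zeroIncl d d' R ⁅x, y⁆ =
    bracket d d' R (zeroIncl d d' R x) (zeroIncl d d' R y) := rfl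
theorem posIncl_lie (x : Zero d d' R) (y : Pos d d' R) : posIncl d d' R ⁅x, y⁆ =
    bracket d d' R (zeroIncl d d' R x) (posIncl d d' R y) := rfl
theorem negIncl_lie (x : Zero d d' R) (y : Neg d d' R) : negIncl d d' R ⁅x, y⁆ =
    bracket d d' R (zeroIncl d d' R x) (negIncl d d' R y) := rfl

theorem jacobi_zero (x y : Zero d d' R) (z : Min d d' R) :
    bracket d d' R (zeroIncl d d' R x) (bracket d d' R (zeroIncl d d' R y) z) =
      bracket d d' R (bracket d d' R (zeroIncl d d' R x) (zeroIncl d d' R y)) z +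
        bracket d d' R (zeroIncl d d' R y) (bracket d d' R (zeroIncl d d' R x) z) := by
  have := jacobi (zeroIncl_mem x) (zeroIncl_mem y) z
  simp only [sgn_zero_left, one_smul] at this
  rw [sub_sub, sub_eq_zero] at this
  exact this

instance [CharZero K] : LieRing (Zero d d' R) where
  add_lie x y z := zero_ext (by simp [zeroIncl_lie])
  lie_add x y z := zero_ext (by simp [zeroIncl_lie])
  lie_self x := zero_ext (by
    have h := skew (zeroIncl_mem x) (zeroIncl_mem x)
    rw [sgn_zero_left, one_smul, ← two_smul K, smul_eq_zero] at h
    rw [zeroIncl_lie, map_zero]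
    exact h.resolve_left two_ne_zero)
  leibniz_lie x y z := zero_ext (by
    simp only [zeroIncl_lie, map_add]; exact jacobi_zero x y _)

instance [CharZero K] : LieAlgebra K (Zero d d' R) where
  lie_smul c x y := zero_ext (by simp [zeroIncl_lie])

instance [CharZero K] : LieRingModule (Zero d d' R) (Pos d d' R) where
  add_lie x y z := pos_ext (by simp [posIncl_lie])
  lie_add x y z := pos_ext (by simp [posIncl_lie])
  leibniz_lie x y z := pos_ext (by
    simp only [zeroIncl_lie, posIncl_lie, map_add]; exact jacobi_zero x y _)

instance [CharZero K] : LieModule K (Zero d d' R) (Pos d d' R) where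
  smul_lie c x y := pos_ext (by simp [posIncl_lie])
  lie_smul c x y := pos_ext (by simp [posIncl_lie])

instance [CharZero K] : LieRingModule (Zero d d' R) (Neg d d' R) where
  add_lie x y z := neg_ext (by simp [negIncl_lie])
  lie_add x y z := neg_ext (by simp [negIncl_lie])
  leibniz_lie x y z := neg_ext (by
    simp only [zeroIncl_lie, negIncl_lie, map_add]; exact jacobi_zero x y _)

instance [CharZero K] : LieModule K (Zero d d' R) (Neg d d' R) where
  smul_lie c x y := neg_ext (by simp [negIncl_lie])
  lie_smul c x y := neg_ext (by simp [negIncl_lie])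

variable (d d' R) in
/-- The bracket of an element of degree `1` with an element of degree `-1`. -/
def posNegBracket : Pos d d' R →ₗ[K] Neg d d' R →ₗ[K] Zero d d' R :=
  LinearMap.mk₂ K
    (fun x y => ⟨bracket d d' R (posIncl d d' R x) (negIncl d d' R y),
      by simpa using bracket_mem (posIncl_mem x) (negIncl_mem y)⟩)
    (fun x y z => Subtype.ext (by simp; rfl)) (fun c x y => Subtype.ext (by simp; rfl))
    (fun x y z => Subtype.ext (by simp; rfl)) (fun c x y => Subtype.ext (by simp; rfl))

theorem zeroIncl_posNegBracket (x : Pos d d' R) (y : Neg d d' R) :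
    zeroIncl d d' R (posNegBracket d d' R x y) =
      bracket d d' R (posIncl d d' R x) (negIncl d d' R y) := rfl

theorem lie_posNegBracket [CharZero K] (z : Zero d d' R) (x : Pos d d' R) (y : Neg d d' R) :
    ⁅z, posNegBracket d d' R x y⁆ =
      posNegBracket d d' R ⁅z, x⁆ y + posNegBracket d d' R x ⁅z, y⁆ := zero_ext (by
  have := jacobi (zeroIncl_mem z) (posIncl_mem x) (negIncl d d' R y)
  simp only [sgn_zero_left, one_smul] at this
  rw [sub_sub, sub_eq_zero] at this
  simp only [zeroIncl_lie, map_add, zeroIncl_posNegBracket, posIncl_lie, negIncl_lie]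
  exact this)

end Min

end Presented

/-! ### Local algebras -/

/-- A local algebra `L₋₁ ⊕ L₀ ⊕ L₁`: the bracket is defined whenever it takes values in degrees
`-1`, `0` and `1`. Only half of the components of the bracket are recorded; the others are given by
graded antisymmetry, where `L₀` is even and `L₋₁` and `L₁` are odd (so that in particular the
bracket of `L₁` and `L₋₁` is symmetric). -/
structure LocalAlgebra (K : Type*) (Lm L0 Lp : Type*) [Field K] [AddCommGroup Lm] [Module K Lm]
    [AddCommGroup L0] [Module K L0] [AddCommGroup Lp] [Module K Lp] where
  zz : L0 →ₗ[K] L0 →ₗ[K] L0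
  zm : L0 →ₗ[K] Lm →ₗ[K] Lm
  zp : L0 →ₗ[K] Lp →ₗ[K] Lp
  pm : Lp →ₗ[K] Lm →ₗ[K] L0

namespace LocalAlgebra

variable {K : Type u} {Lm L0 Lp : Type v} [Field K] [AddCommGroup Lm] [Module K Lm]
  [AddCommGroup L0] [Module K L0] [AddCommGroup Lp] [Module K Lp]

/-- Graded subalgebras of a local algebra. -/
structure Sub (A : LocalAlgebra K Lm L0 Lp) where
  m : Submodule K Lm
  z : Submodule K L0
  p : Submodule K Lp
  zz_mem : ∀ x ∈ z, ∀ y ∈ z, A.zz x y ∈ z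
  zm_mem : ∀ x ∈ z, ∀ y ∈ m, A.zm x y ∈ m
  zp_mem : ∀ x ∈ z, ∀ y ∈ p, A.zp x y ∈ p
  pm_mem : ∀ x ∈ p, ∀ y ∈ m, A.pm x y ∈ z

/-- The subalgebra generated by a set of elements of degree `-1` and a set of elements of
degree `1`. -/
def gen (A : LocalAlgebra K Lm L0 Lp) (Sm : Set Lm) (Sp : Set Lp) : A.Sub where
  m := sInf {T | ∃ B : A.Sub, Sm ⊆ B.m ∧ Sp ⊆ B.p ∧ T = B.m}
  z := sInf {T | ∃ B : A.Sub, Sm ⊆ B.m ∧ Sp ⊆ B.p ∧ T = B.z}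
  p := sInf {T | ∃ B : A.Sub, Sm ⊆ B.m ∧ Sp ⊆ B.p ∧ T = B.p}
  zz_mem := by
    intro x hx y hy
    simp only [Submodule.mem_sInf, Set.mem_ofPred_eq] at *
    rintro T ⟨B, h1, h2, rfl⟩
    exact B.zz_mem x (hx _ ⟨B, h1, h2, rfl⟩) y (hy _ ⟨B, h1, h2, rfl⟩)
  zm_mem := by
    intro x hx y hy
    simp only [Submodule.mem_sInf, Set.mem_ofPred_eq] at *
    rintro T ⟨B, h1, h2, rfl⟩
    exact B.zm_mem x (hx _ ⟨B, h1, h2, rfl⟩) y (hy _ ⟨B, h1, h2, rfl⟩)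
  zp_mem := by
    intro x hx y hy
    simp only [Submodule.mem_sInf, Set.mem_ofPred_eq] at *
    rintro T ⟨B, h1, h2, rfl⟩
    exact B.zp_mem x (hx _ ⟨B, h1, h2, rfl⟩) y (hy _ ⟨B, h1, h2, rfl⟩)
  pm_mem := by
    intro x hx y hy
    simp only [Submodule.mem_sInf, Set.mem_ofPred_eq] at *
    rintro T ⟨B, h1, h2, rfl⟩
    exact B.pm_mem x (hx _ ⟨B, h1, h2, rfl⟩) y (hy _ ⟨B, h1, h2, rfl⟩)

/-- A subalgebra as a local algebra. -/
def Sub.toLocalAlgebra {A : LocalAlgebra K Lm L0 Lp} (B : A.Sub) :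
    LocalAlgebra K B.m B.z B.p where
  zz := LinearMap.mk₂ K (fun x y => ⟨A.zz x y, B.zz_mem x x.2 y y.2⟩)
    (fun x y z => Subtype.ext (by simp)) (fun c x y => Subtype.ext (by simp))
    (fun x y z => Subtype.ext (by simp)) (fun c x y => Subtype.ext (by simp))
  zm := LinearMap.mk₂ K (fun x y => ⟨A.zm x y, B.zm_mem x x.2 y y.2⟩)
    (fun x y z => Subtype.ext (by simp)) (fun c x y => Subtype.ext (by simp))
    (fun x y z => Subtype.ext (by simp)) (fun c x y => Subtype.ext (by simp))
  zp := LinearMap.mk₂ K (fun x y => ⟨A.zp x y, B.zp_mem x x.2 y y.2⟩)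
    (fun x y z => Subtype.ext (by simp)) (fun c x y => Subtype.ext (by simp))
    (fun x y z => Subtype.ext (by simp)) (fun c x y => Subtype.ext (by simp))
  pm := LinearMap.mk₂ K (fun x y => ⟨A.pm x y, B.pm_mem x x.2 y y.2⟩)
    (fun x y z => Subtype.ext (by simp)) (fun c x y => Subtype.ext (by simp))
    (fun x y z => Subtype.ext (by simp)) (fun c x y => Subtype.ext (by simp))

/-- Peripheral ideals: the graded ideals `m ⊕ 0 ⊕ p` that intersect `L₀` trivially. -/
structure PeripheralIdeal (A : LocalAlgebra K Lm L0 Lp) where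
  m : Submodule K Lm
  p : Submodule K Lp
  zm_mem : ∀ x, ∀ y ∈ m, A.zm x y ∈ m
  zp_mem : ∀ x, ∀ y ∈ p, A.zp x y ∈ p
  pm_left : ∀ x ∈ p, ∀ y, A.pm x y = 0
  pm_right : ∀ x, ∀ y ∈ m, A.pm x y = 0

/-- The maximal peripheral ideal, which is the sum of all peripheral ideals. -/
def maxPeripheral (A : LocalAlgebra K Lm L0 Lp) : A.PeripheralIdeal where
  m := ⨆ I : A.PeripheralIdeal, I.m
  p := ⨆ I : A.PeripheralIdeal, I.p
  zm_mem x := by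
    have h : (⨆ I : A.PeripheralIdeal, I.m) ≤ (⨆ I : A.PeripheralIdeal, I.m).comap (A.zm x) :=
      iSup_le fun I y hy => (le_iSup (fun I : A.PeripheralIdeal => I.m) I) (I.zm_mem x y hy)
    exact fun y hy => h hy
  zp_mem x := by
    have h : (⨆ I : A.PeripheralIdeal, I.p) ≤ (⨆ I : A.PeripheralIdeal, I.p).comap (A.zp x) :=
      iSup_le fun I y hy => (le_iSup (fun I : A.PeripheralIdeal => I.p) I) (I.zp_mem x y hy)
    exact fun y hy => h hy
  pm_left x hx y := by
    have h : (⨆ I : A.PeripheralIdeal, I.p) ≤ LinearMap.ker (A.pm.flip y) :=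
      iSup_le fun I x hx => I.pm_left x hx y
    exact h hx
  pm_right x y hy := by
    have h : (⨆ I : A.PeripheralIdeal, I.m) ≤ LinearMap.ker (A.pm x) :=
      iSup_le fun I y hy => I.pm_right x y hy
    exact h hy

/-- The quotient by a peripheral ideal. -/
def quot (A : LocalAlgebra K Lm L0 Lp) (I : A.PeripheralIdeal) :
    LocalAlgebra K (Lm ⧸ I.m) L0 (Lp ⧸ I.p) where
  zz := A.zz
  zm :=
    { toFun := fun x => I.m.mapQ I.m (A.zm x) fun y hy => I.zm_mem x y hy
      map_add' := by intro x y; ext z; simp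
      map_smul' := by intro c x; ext z; simp }
  zp :=
    { toFun := fun x => I.p.mapQ I.p (A.zp x) fun y hy => I.zp_mem x y hy
      map_add' := by intro x y; ext z; simp
      map_smul' := by intro c x; ext z; simp }
  pm := I.p.liftQ
    { toFun := fun x => I.m.liftQ (A.pm x) fun y hy => I.pm_right x y hy
      map_add' := by intro x y; ext z; simp; rfl
      map_smul' := by intro c x; ext z; simp; rfl }
    (by
      intro x hx
      rw [LinearMap.mem_ker]
      ext z
      exact I.pm_left x hx z)

/-- The elements of a local algebra as generators. -/
inductive Gen (Lm L0 Lp : Type v) : Type v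
  | neg (x : Lm)
  | zero (x : L0)
  | pos (x : Lp)

/-- The degree of a generator. -/
def Gen.deg : Gen Lm L0 Lp → ℤ
  | .neg _ => -1
  | .zero _ => 0
  | .pos _ => 1

section

variable (K) in
/-- A generator as an element of the free nonassociative algebra. -/
def Gen.of (x : Gen Lm L0 Lp) : FreeNonUnitalNonAssocAlgebra K (Gen Lm L0 Lp) :=
  FreeNonUnitalNonAssocAlgebra.of K x

/-- The relations saying that the map from the local algebra to the Lie superalgebra that it
generates is linear and preserves the bracket (where this is defined). -/
inductive Rel (A : LocalAlgebra K Lm L0 Lp) :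
    FreeNonUnitalNonAssocAlgebra K (Gen Lm L0 Lp) → Prop
  | neg_add (x y : Lm) : Rel A ((Gen.neg (x + y)).of K - (Gen.neg x).of K - (Gen.neg y).of K)
  | neg_smul (c : K) (x : Lm) : Rel A ((Gen.neg (c • x)).of K - c • (Gen.neg x).of K)
  | zero_add (x y : L0) : Rel A ((Gen.zero (x + y)).of K - (Gen.zero x).of K - (Gen.zero y).of K)
  | zero_smul (c : K) (x : L0) : Rel A ((Gen.zero (c • x)).of K - c • (Gen.zero x).of K)
  | pos_add (x y : Lp) : Rel A ((Gen.pos (x + y)).of K - (Gen.pos x).of K - (Gen.pos y).of K)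
  | pos_smul (c : K) (x : Lp) : Rel A ((Gen.pos (c • x)).of K - c • (Gen.pos x).of K)
  | zz (x y : L0) :
      Rel A ((Gen.zero x).of K * (Gen.zero y).of K - (Gen.zero (A.zz x y)).of K)
  | zm (x : L0) (y : Lm) :
      Rel A ((Gen.zero x).of K * (Gen.neg y).of K - (Gen.neg (A.zm x y)).of K)
  | zp (x : L0) (y : Lp) :
      Rel A ((Gen.zero x).of K * (Gen.pos y).of K - (Gen.pos (A.zp x y)).of K)
  | pm (x : Lp) (y : Lm) :
      Rel A ((Gen.pos x).of K * (Gen.neg y).of K - (Gen.zero (A.pm x y)).of K)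

end

/-- The relators of the maximal `ℤ`-graded Lie superalgebra with a given local part. -/
def relators (A : LocalAlgebra K Lm L0 Lp) :
    Set (FreeNonUnitalNonAssocAlgebra K (Gen Lm L0 Lp)) :=
  {x | A.Rel x}

/-- The minimal `ℤ`-graded Lie superalgebra with a given local part: the maximal one (generated
by the local part) modulo the maximal graded ideal intersecting the local part trivially. -/
abbrev Minimal (A : LocalAlgebra K Lm L0 Lp) : Type (max u v) :=
  Min Gen.deg Gen.deg A.relators

end LocalAlgebra

/-! ### Contragredient local Lie superalgebras and their cartanifications -/

/-- A contragredient local Lie superalgebra `G₋₁ ⊕ G₀ ⊕ G₁` with even part `G₀` and odd part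
`G₋₁ ⊕ G₁`: a bracket, with a grading element `L` and an invariant bilinear map `G₋₁ × G₁ → K`. -/
structure ContragredientLocal (K : Type*) (Gm G0 Gp : Type*) [Field K] [LieRing G0]
    [LieAlgebra K G0] [AddCommGroup Gm] [Module K Gm] [LieRingModule G0 Gm] [LieModule K G0 Gm]
    [AddCommGroup Gp] [Module K Gp] [LieRingModule G0 Gp] [LieModule K G0 Gp] where
  /-- The bracket of elements of degree `1` and `-1`. -/
  br : Gp →ₗ[K] Gm →ₗ[K] G0
  lie_br : ∀ (z : G0) (x : Gp) (y : Gm), ⁅z, br x y⁆ = br ⁅z, x⁆ y + br x ⁅z, y⁆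
  /-- The grading element. -/
  L : G0
  L_zero : ∀ z : G0, ⁅L, z⁆ = 0
  L_pos : ∀ x : Gp, ⁅L, x⁆ = x
  L_neg : ∀ y : Gm, ⁅L, y⁆ = -y
  form : Gm →ₗ[K] Gp →ₗ[K] K
  form_invariant : ∀ (y : Gm) (z : G0) (x : Gp), form (-⁅z, y⁆) x = form y ⁅z, x⁆

section Env

attribute [local instance] LieRing.ofAssociativeRing

variable (K : Type u) (G0 : Type v) [Field K] [LieRing G0] [LieAlgebra K G0]
variable (G : Type v) [AddCommGroup G] [Module K G] [LieRingModule G0 G] [LieModule K G0 G]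

/-- The enveloping algebra of the Lie algebra in degree `0`. -/
abbrev Env := UniversalEnvelopingAlgebra K G0

/-- The left multiplication by `z ∈ G₀` on `G ⊗ U(G₀)`, where `x ⊗ u` is the product `xu`:
we have `z (x u) = [z, x] u + x (z u)`. -/
def leftMul₀ : G0 →ₗ⁅K⁆ Module.End K (G ⊗[K] Env K G0) where
  toFun z := TensorProduct.map (LieModule.toEnd K G0 G z) LinearMap.id +
    TensorProduct.map LinearMap.id (LinearMap.mulLeft K (UniversalEnvelopingAlgebra.ι K z))
  map_add' z w := by
    ext x u
    simp [-UniversalEnvelopingAlgebra.ι_apply, TensorProduct.add_tmul, TensorProduct.tmul_add, add_mul]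
    abel
  map_smul' c z := by
    ext x u
    simp [-UniversalEnvelopingAlgebra.ι_apply, TensorProduct.smul_tmul', TensorProduct.tmul_smul]
  map_lie' {z w} := by
    ext x u
    simp [-UniversalEnvelopingAlgebra.ι_apply, LieRing.of_associative_ring_bracket, TensorProduct.sub_tmul, TensorProduct.tmul_sub,
      sub_mul, mul_assoc]
    abel

/-- The left multiplication by elements of `U(G₀)` on `G U(G₀)`. -/
def leftMul : Env K G0 →ₐ[K] Module.End K (G ⊗[K] Env K G0) :=
  UniversalEnvelopingAlgebra.lift K (leftMul₀ K G0 G)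

/-- The right multiplication by elements of `U(G₀)` on `G U(G₀)`. -/
def rightMul : Env K G0 →ₗ[K] Module.End K (G ⊗[K] Env K G0) :=
  LinearMap.lTensorHom G ∘ₗ (LinearMap.mul K (Env K G0)).flip

/-- The commutator of elements of `U(G₀)` with elements of `G U(G₀)`. -/
def envBracket : Env K G0 →ₗ[K] (G ⊗[K] Env K G0) →ₗ[K] (G ⊗[K] Env K G0) :=
  (leftMul K G0 G).toLinearMap - rightMul K G0 G

/-- The right multiplication by `z ∈ G₀` on `U(G₀) ⊗ G`, where `u ⊗ x` is the product `ux`: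
we have `(u x) z = (u z) x - u [z, x]`. -/
def rightMul₀ : G0 →ₗ⁅K⁆ (Module.End K (Env K G0 ⊗[K] G))ᵐᵒᵖ where
  toFun z := MulOpposite.op
    (TensorProduct.map (LinearMap.mulRight K (UniversalEnvelopingAlgebra.ι K z)) LinearMap.id -
      TensorProduct.map LinearMap.id (LieModule.toEnd K G0 G z))
  map_add' z w := by
    rw [← MulOpposite.op_add]
    congr 1
    ext u x
    simp [-UniversalEnvelopingAlgebra.ι_apply, TensorProduct.add_tmul, TensorProduct.tmul_add, mul_add]
    abel
  map_smul' c z := by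
    rw [RingHom.id_apply, ← MulOpposite.op_smul]
    congr 1
    ext u x
    simp [-UniversalEnvelopingAlgebra.ι_apply, TensorProduct.smul_tmul', TensorProduct.tmul_smul, smul_sub]
  map_lie' {z w} := by
    rw [LieRing.of_associative_ring_bracket, ← MulOpposite.op_mul, ← MulOpposite.op_mul,
      ← MulOpposite.op_sub]
    congr 1
    ext u x
    simp [-UniversalEnvelopingAlgebra.ι_apply, LieRing.of_associative_ring_bracket, TensorProduct.sub_tmul, TensorProduct.tmul_sub,
      mul_sub, mul_assoc]
    abel

/-- Rewriting elements of `G U(G₀)` as elements of `U(G₀) G`: the product `x u` is sent to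
`(1 ⊗ x) u`. -/
def toLeft : (G ⊗[K] Env K G0) →ₗ[K] (Env K G0 ⊗[K] G) :=
  TensorProduct.lift <| LinearMap.mk₂ K
    (fun x u => (UniversalEnvelopingAlgebra.lift K (rightMul₀ K G0 G) u).unop (1 ⊗ₜ x))
    (by intro x y u; simp [TensorProduct.tmul_add])
    (by intro c x u; simp [TensorProduct.tmul_smul])
    (by intro x u v; simp)
    (by intro c x u; simp)

variable {K G0}
variable {G H : Type v} [AddCommGroup G] [Module K G] [LieRingModule G0 G] [LieModule K G0 G]
  [AddCommGroup H] [Module K H] [LieRingModule G0 H] [LieModule K G0 H]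

/-- Given a product `c : G × H → U(G₀)`, its extension to a product
`(X x)(y Y) = X (x y) Y` for `X, Y ∈ U(G₀)`, `x ∈ G` and `y ∈ H`. -/
def sandwich (c : G →ₗ[K] H →ₗ[K] Env K G0) :
    (Env K G0 ⊗[K] G) →ₗ[K] (H ⊗[K] Env K G0) →ₗ[K] Env K G0 :=
  TensorProduct.lift <| LinearMap.mk₂ K
    (fun X x => LinearMap.mulLeft K X ∘ₗ
      TensorProduct.lift (LinearMap.mul K (Env K G0) ∘ₗ c x))
    (by intro X X' x; ext y Y; simp [add_mul])
    (by intro a X x; ext y Y; simp)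
    (by intro X x x'; ext y Y; simp [mul_add])
    (by intro a X x; ext y Y; simp)

/-- The product of `G U(G₀)` and `H U(G₀)` with values in `U(G₀)`. -/
def envProduct (c : G →ₗ[K] H →ₗ[K] Env K G0) :
    (G ⊗[K] Env K G0) →ₗ[K] (H ⊗[K] Env K G0) →ₗ[K] Env K G0 :=
  sandwich c ∘ₗ toLeft K G0 G

end Env

namespace ContragredientLocal

variable {K : Type u} {Gm G0 Gp : Type u} [Field K] [LieRing G0]
  [LieAlgebra K G0] [AddCommGroup Gm] [Module K Gm] [LieRingModule G0 Gm] [LieModule K G0 Gm]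
  [AddCommGroup Gp] [Module K Gp] [LieRingModule G0 Gp] [LieModule K G0 Gp]

/-- The product `x y = -⟦y, x⟧ + ⟨x|y⟩ L` of `x` of degree `-1` and `y` of degree `1`. -/
def negPos (A : ContragredientLocal K Gm G0 Gp) : Gm →ₗ[K] Gp →ₗ[K] Env K G0 :=
  LinearMap.mk₂ K
    (fun x y => -UniversalEnvelopingAlgebra.ι K (A.br y x) +
      A.form x y • UniversalEnvelopingAlgebra.ι K A.L)
    (by intro x x' y; simp [-UniversalEnvelopingAlgebra.ι_apply, add_smul]; abel)
    (by intro c x y; simp [-UniversalEnvelopingAlgebra.ι_apply, mul_smul])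
    (by intro x x' y; simp [-UniversalEnvelopingAlgebra.ι_apply, add_smul]; abel)
    (by intro c x y; simp [-UniversalEnvelopingAlgebra.ι_apply, mul_smul])

/-- The product `x y = ⟦y, x⟧ + ⟨x|y⟩ L + ⟨x|y⟩` of `x` of degree `1` and `y` of degree `-1`, where
`⟦y, x⟧ = ⟦x, y⟧` and `⟨x|y⟩ = -⟨y|x⟩` since `x` and `y` are odd. -/
def posNeg (A : ContragredientLocal K Gm G0 Gp) : Gp →ₗ[K] Gm →ₗ[K] Env K G0 :=
  LinearMap.mk₂ K
    (fun x y => UniversalEnvelopingAlgebra.ι K (A.br x y) +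
      (-A.form y x) • UniversalEnvelopingAlgebra.ι K A.L + (-A.form y x) • (1 : Env K G0))
    (by intro x x' y; simp [-UniversalEnvelopingAlgebra.ι_apply, add_smul]; abel)
    (by intro c x y; simp [-UniversalEnvelopingAlgebra.ι_apply, mul_smul])
    (by intro x x' y; simp [-UniversalEnvelopingAlgebra.ι_apply, add_smul]; abel)
    (by intro c x y; simp [-UniversalEnvelopingAlgebra.ι_apply, mul_smul])

/-- The local part `G₋₁ U(G₀) ⊕ U(G₀) ⊕ G₁ U(G₀)` of the algebra with restricted associativity
associated to a contragredient local Lie superalgebra, with the (graded) commutator as bracket. -/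
def corner (A : ContragredientLocal K Gm G0 Gp) :
    LocalAlgebra K (Gm ⊗[K] Env K G0) (Env K G0) (Gp ⊗[K] Env K G0) where
  zz := LinearMap.mul K (Env K G0) - (LinearMap.mul K (Env K G0)).flip
  zm := envBracket K G0 Gm
  zp := envBracket K G0 Gp
  pm := envProduct A.posNeg + (envProduct A.negPos).flip

/-- The subalgebra generated by `G₋₁ G₀` and `G₁`. -/
def cornerSub (A : ContragredientLocal K Gm G0 Gp) : A.corner.Sub :=
  A.corner.gen
    {w | ∃ (x : Gm) (z : G0), x ⊗ₜ[K] UniversalEnvelopingAlgebra.ι K z = w}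
    {w | ∃ x : Gp, x ⊗ₜ[K] (1 : Env K G0) = w}

/-- The local cartanification: the quotient of this subalgebra by its maximal peripheral ideal. -/
def localCartanification (A : ContragredientLocal K Gm G0 Gp) :
    LocalAlgebra K (A.cornerSub.m ⧸ A.cornerSub.toLocalAlgebra.maxPeripheral.m) A.cornerSub.z
      (A.cornerSub.p ⧸ A.cornerSub.toLocalAlgebra.maxPeripheral.p) :=
  A.cornerSub.toLocalAlgebra.quot A.cornerSub.toLocalAlgebra.maxPeripheral

/-- The cartanification: the minimal `ℤ`-graded Lie superalgebra with the local cartanification as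
its local part. -/
abbrev Cartanified (A : ContragredientLocal K Gm G0 Gp) : Type u :=
  A.localCartanification.Minimal

end ContragredientLocal

/-! ### The data `(𝔤, λ, κ)` -/

/-- The matrix `B` with row and column `0` (here `none`) added to the Cartan matrix `A`. -/
def extMatrix {K : Type*} [Field K] {r : ℕ} (A : Matrix (Fin r) (Fin r) ℤ) (ε : Fin r → K)
    (lam : Fin r → ℕ) : Matrix (Option (Fin r)) (Option (Fin r)) K :=
  Matrix.of fun i j => match i, j with
    | none, none => 0
    | some i, none => -(lam i : K)
    | none, some j => -((lam j : K) / ε j)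
    | some i, some j => (A i j : K)

/-- The data `(𝔤, λ, κ)`, given by the Cartan matrix of `𝔤`, the numbers `ε i = κ(e_i, f_i)`, and
the Dynkin labels of the dominant integral weight `λ`, with the standing assumptions. -/
structure Triple (K : Type u) [Field K] where
  r : ℕ
  r_pos : 0 < r
  /-- The (generalised) Cartan matrix. -/
  A : Matrix (Fin r) (Fin r) ℤ
  A_diag : ∀ i, A i i = 2
  A_nonpos : ∀ i j, i ≠ j → A i j ≤ 0
  A_zero : ∀ i j, A i j = 0 → A j i = 0
  A_det : A.det ≠ 0
  ε : Fin r → K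
  ε_ne : ∀ i, ε i ≠ 0
  /-- With `D = diag(ε)`, the matrix `D⁻¹ A` is symmetric. -/
  symm : ∀ i j, (A i j : K) / ε i = (A j i : K) / ε j
  /-- The Dynkin labels of `λ`. -/
  lam : Fin r → ℕ
  B_det : (extMatrix A ε lam).det ≠ 0

namespace Triple

variable {K : Type u} [Field K] (D : Triple K)

/-- The extended matrix. -/
abbrev B : Matrix (Option (Fin D.r)) (Option (Fin D.r)) K := extMatrix D.A D.ε D.lam

/-- The Lie algebra `𝔤` with Cartan matrix `A`, by the Chevalley–Serre presentation. -/
abbrev LieAlg : Type u := Matrix.ToLieAlgebra K D.A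

/-- The Cartan elements `h_i` of `𝔤`. -/
def cartan (i : Fin D.r) : D.LieAlg :=
  LieSubmodule.Quotient.mk (N := CartanMatrix.Relations.toIdeal K D.A)
    (FreeLieAlgebra.of K (CartanMatrix.Generators.H i))

/-- Weights `μ` of `𝔤` (elements of the dual space of the Cartan subalgebra), given by their Dynkin
labels `μ i = μ(h_i)`. -/
abbrev Weight : Type u := Fin D.r → K

/-- The weight `λ`. -/
def lambda : D.Weight := fun i => (D.lam i : K)

/-- The weight with Dynkin labels `λ_i / ε_i`. -/
def lambdaUp : D.Weight := fun i => (D.lam i : K) / D.ε i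

/-- The roots of `𝔤`. -/
def IsRoot (α : D.Weight) : Prop :=
  α ≠ 0 ∧ ∃ x : D.LieAlg, x ≠ 0 ∧ ∀ i, ⁅D.cartan i, x⁆ = α i • x

/-- The matrix with entries `κ(h_i, h_j) = ε_i A_ji`. -/
def gram : Matrix (Fin D.r) (Fin D.r) K := Matrix.of fun i j => D.ε i * (D.A j i : K)

/-- The bilinear form on weights induced by `κ`. -/
def weightForm (μ ν : D.Weight) : K := μ ⬝ᵥ (D.gram⁻¹.mulVec ν)

/-- Pseudo-minuscule weights: dominant integral weights such that the weight with Dynkin labels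
`ε_i μ_i` has inner product `0` or `±1` with any root. -/
def IsPseudoMinuscule (μ : D.Weight) : Prop :=
  (∃ m : Fin D.r → ℕ, ∀ i, μ i = (m i : K)) ∧
    ∀ α, D.IsRoot α →
      D.weightForm (fun i => D.ε i * μ i) α = 0 ∨ D.weightForm (fun i => D.ε i * μ i) α = 1 ∨
        D.weightForm (fun i => D.ε i * μ i) α = -1

/-! ### The contragredient Lie superalgebra -/

/-- The generators `e_i`, `f_i`, `h_i` for `i ∈ {0} ∪ I`. -/
inductive GenB (r : ℕ) : Type
  | e (i : Option (Fin r))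
  | f (i : Option (Fin r))
  | h (i : Option (Fin r))

/-- The consistent degree, with `e_0` and `f_0` in degree `1` and `-1`, respectively, and all other
generators in degree `0`. -/
def GenB.deg {r : ℕ} : GenB r → ℤ
  | .e none => 1
  | .f none => -1
  | _ => 0

/-- The degree with all `e_i` in degree `1`, all `f_i` in degree `-1` and all `h_i` in degree `0`. -/
def GenB.degPrincipal {r : ℕ} : GenB r → ℤ
  | .e _ => 1
  | .f _ => -1
  | .h _ => 0

variable (K) in
/-- A generator as an element of the free nonassociative algebra. -/
def GenB.of {r : ℕ} (x : GenB r) : FreeNonUnitalNonAssocAlgebra K (GenB r) :=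
  FreeNonUnitalNonAssocAlgebra.of K x

/-- The defining relators. -/
inductive RelB : FreeNonUnitalNonAssocAlgebra K (GenB D.r) → Prop
  | he (i j) : RelB ((GenB.h i).of K * (GenB.e j).of K - D.B i j • (GenB.e j).of K)
  | hf (i j) : RelB ((GenB.h i).of K * (GenB.f j).of K + D.B i j • (GenB.f j).of K)
  | ef (i) : RelB ((GenB.e i).of K * (GenB.f i).of K - (GenB.h i).of K)
  | ef_ne (i j) : i ≠ j → RelB ((GenB.e i).of K * (GenB.f j).of K)

/-- The set of defining relators. -/
def relB : Set (FreeNonUnitalNonAssocAlgebra K (GenB D.r)) := {x | D.RelB x}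

/-- The contragredient Lie superalgebra `𝓑`: the quotient by the maximal ideal that is graded and
intersects the local part trivially, with respect to the principal grading. -/
abbrev Contra : Type u := Min GenB.deg GenB.degPrincipal D.relB

/-- The component of `𝓑` of degree `-1` in the consistent grading. -/
abbrev ContraNeg : Type u := Min.Neg GenB.deg GenB.degPrincipal D.relB
/-- The component of `𝓑` of degree `0` in the consistent grading. -/
abbrev ContraZero : Type u := Min.Zero GenB.deg GenB.degPrincipal D.relB
/-- The component of `𝓑` of degree `1` in the consistent grading. -/
abbrev ContraPos : Type u := Min.Pos GenB.deg GenB.degPrincipal D.relB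

/-- The generators of `𝓑`. -/
def genB (x : GenB D.r) : D.Contra := Min.gen _ _ _ x

/-- The element `e_0` of `𝓑`. -/
def e₀ : D.ContraPos := ⟨D.genB (.e none), Min.gen_mem (GenB.e none)⟩

/-- The element `f_0` of `𝓑`. -/
def f₀ : D.ContraNeg := ⟨D.genB (.f none), Min.gen_mem (GenB.f none)⟩

/-- The elements `h_i` of `𝓑`. -/
def h (i : Option (Fin D.r)) : D.ContraZero := ⟨D.genB (.h i), Min.gen_mem (GenB.h i)⟩

/-- The grading element `∑ i, (B⁻¹)_{0i} h_i` of `𝓑`. -/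
def gradingElement : D.ContraZero := ∑ i, D.B⁻¹ none i • D.h i

theorem bracket_gen (x y : GenB D.r) (z : FreeNonUnitalNonAssocAlgebra K (GenB D.r))
    (hz : D.RelB (x.of K * y.of K - z)) :
    Min.bracket GenB.deg GenB.degPrincipal D.relB (D.genB x) (D.genB y) = Min.proj _ _ _ z := by
  have h1 := Min.proj_rel (d := GenB.deg) (d' := GenB.degPrincipal) (R := D.relB) (Or.inr hz)
  rw [map_sub, sub_eq_zero] at h1
  exact h1

theorem bracket_h_e (i j : Option (Fin D.r)) :
    Min.bracket GenB.deg GenB.degPrincipal D.relB (D.genB (.h i)) (D.genB (.e j)) =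
      D.B i j • D.genB (.e j) := by
  rw [D.bracket_gen _ _ _ (RelB.he i j), map_smul]
  rfl

theorem bracket_h_f (i j : Option (Fin D.r)) :
    Min.bracket GenB.deg GenB.degPrincipal D.relB (D.genB (.h i)) (D.genB (.f j)) =
      -(D.B i j • D.genB (.f j)) := by
  have h := RelB.hf (D := D) i j
  rw [← sub_neg_eq_add] at h
  rw [D.bracket_gen _ _ _ h, map_neg, map_smul]
  rfl

theorem bracket_e_f (i : Option (Fin D.r)) :
    Min.bracket GenB.deg GenB.degPrincipal D.relB (D.genB (.e i)) (D.genB (.f i)) =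
      D.genB (.h i) :=
  D.bracket_gen _ _ _ (RelB.ef i)

theorem bracket_h_h (i j : Option (Fin D.r)) :
    Min.bracket GenB.deg GenB.degPrincipal D.relB (D.genB (.h i)) (D.genB (.h j)) = 0 := by
  have := Min.jacobi (Min.gen_mem (d := GenB.deg) (d' := GenB.degPrincipal) (R := D.relB)
    (GenB.h i)) (Min.gen_mem (d := GenB.deg) (d' := GenB.degPrincipal) (R := D.relB)
    (GenB.e j)) (D.genB (.f j))
  change Min.bracket GenB.deg GenB.degPrincipal D.relB (D.genB (.h i))
      (Min.bracket GenB.deg GenB.degPrincipal D.relB (D.genB (.e j)) (D.genB (.f j))) -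
    Min.bracket GenB.deg GenB.degPrincipal D.relB
      (Min.bracket GenB.deg GenB.degPrincipal D.relB (D.genB (.h i)) (D.genB (.e j)))
      (D.genB (.f j)) - sgn 0 _ • Min.bracket GenB.deg GenB.degPrincipal D.relB (D.genB (.e j))
      (Min.bracket GenB.deg GenB.degPrincipal D.relB (D.genB (.h i)) (D.genB (.f j))) = 0 at this
  rw [bracket_e_f, bracket_h_e, bracket_h_f, Min.sgn_zero_left, one_smul, map_neg, map_smul,
    map_smul, LinearMap.smul_apply, bracket_e_f, sub_neg_eq_add, sub_add_cancel] at this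
  exact this

theorem gradingElement_incl :
    Min.zeroIncl GenB.deg GenB.degPrincipal D.relB D.gradingElement =
      ∑ i, D.B⁻¹ none i • D.genB (.h i) := by
  rw [gradingElement, map_sum]
  rfl

theorem gradingElement_gen (x : GenB D.r) :
    Min.bracket GenB.deg GenB.degPrincipal D.relB
      (Min.zeroIncl GenB.deg GenB.degPrincipal D.relB D.gradingElement) (D.genB x) =
      ((GenB.deg x : ℤ) : K) • D.genB x := by
  have hB : D.B⁻¹ * D.B = 1 := Matrix.nonsing_inv_mul _ (isUnit_iff_ne_zero.mpr D.B_det)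
  have hB' : ∀ j, ∑ i, D.B⁻¹ none i * D.B i j = (1 : Matrix _ _ K) none j := fun j => by
    rw [← hB, Matrix.mul_apply]
  rw [gradingElement_incl, map_sum, LinearMap.sum_apply]
  simp only [map_smul, LinearMap.smul_apply]
  cases x with
  | e j =>
    simp only [bracket_h_e, smul_smul, ← Finset.sum_smul, hB']
    cases j <;> simp [GenB.deg]
  | f j =>
    simp only [bracket_h_f, smul_neg, smul_smul, Finset.sum_neg_distrib, ← Finset.sum_smul, hB']
    cases j <;> simp [GenB.deg]
  | h j =>
    simp [bracket_h_h, GenB.deg]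

theorem gradingElement_spec {k : ℤ} {x : D.Contra}
    (hx : x ∈ Min.grade GenB.deg GenB.degPrincipal D.relB k) :
    Min.bracket GenB.deg GenB.degPrincipal D.relB
      (Min.zeroIncl GenB.deg GenB.degPrincipal D.relB D.gradingElement) x = (k : K) • x := by
  induction hx using Submodule.span_induction with
  | mem x hx =>
    obtain ⟨a, rfl, rfl⟩ := hx
    induction a using FreeMagma.rec with
    | of x => exact D.gradingElement_gen x
    | mul a b ha hb =>
      rw [Min.word_mul, ← Min.bracket_proj]
      have := Min.jacobi (Min.zeroIncl_mem D.gradingElement)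
        (Submodule.subset_span ⟨a, rfl, rfl⟩) (Min.proj GenB.deg GenB.degPrincipal D.relB (word b))
      rw [ha, hb, Min.sgn_zero_left, one_smul, sub_sub, sub_eq_zero] at this
      rw [this, map_smul, map_smul, LinearMap.smul_apply, ← add_smul]
      simp [wordDeg]
  | zero => simp
  | add x y _ _ hx hy => rw [map_add, hx, hy, smul_add]
  | smul c x _ hx => rw [map_smul, hx, smul_comm]

section

variable [CharZero K]

/-- The invariant bilinear map `𝓑₋₁ × 𝓑₁ → K` normalised by `⟨f_0|e_0⟩ = -⟨e_0|f_0⟩ = -1`. Since `𝓑₁`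
and `𝓑₋₁` are generated by `e_0` and `f_0` as modules over `𝓑₀`, this is the restriction of the
invariant bilinear form on `𝓑` extending `κ`. -/
structure IsInvariantForm (Φ : D.ContraNeg →ₗ[K] D.ContraPos →ₗ[K] K) : Prop where
  invariant : ∀ (y : D.ContraNeg) (z : D.ContraZero) (x : D.ContraPos), Φ (-⁅z, y⁆) x = Φ y ⁅z, x⁆
  normalised : Φ D.f₀ D.e₀ = -1

/-- The local part of `𝓑` as a contragredient local Lie superalgebra. -/
def localPart (Φ : D.ContraNeg →ₗ[K] D.ContraPos →ₗ[K] K) (hΦ : D.IsInvariantForm Φ) :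
    ContragredientLocal K D.ContraNeg D.ContraZero D.ContraPos where
  br := Min.posNegBracket _ _ _
  lie_br := Min.lie_posNegBracket
  L := D.gradingElement
  L_zero z := Min.zero_ext <| by
    rw [Min.zeroIncl_lie, D.gradingElement_spec (Min.zeroIncl_mem z)]; simp
  L_pos x := Min.pos_ext <| by
    rw [Min.posIncl_lie, D.gradingElement_spec (Min.posIncl_mem x)]; simp
  L_neg y := Min.neg_ext <| by
    rw [Min.negIncl_lie, D.gradingElement_spec (Min.negIncl_mem y)]; simp
  form := Φ
  form_invariant := hΦ.invariant

end

/-! ### The tensor hierarchy algebra -/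

/-- The index set `{0} ∪ K`, where `K` consists of all `k ∈ I` with `λ_k = 0`. -/
abbrev IndexK : Type := {i : Option (Fin D.r) // ∀ j, i = some j → D.lam j = 0}

/-- The generators `e_i` and `h_i` for `i ∈ {0} ∪ I`, `f_i` for `i ∈ I`, and `f_{0i}` for
`i ∈ {0} ∪ K`. -/
inductive GenW : Type
  | e (i : Option (Fin D.r))
  | f (i : Fin D.r)
  | h (i : Option (Fin D.r))
  | f0 (i : D.IndexK)

/-- The consistent degree, with `e_0` in degree `1`, all `f_{0i}` in degree `-1` and all other
generators in degree `0`. -/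
def GenW.deg {D : Triple K} : D.GenW → ℤ
  | .e none => 1
  | .f0 _ => -1
  | _ => 0

/-- The elements `e_i` of the free nonassociative algebra. -/
def we (i : Option (Fin D.r)) : FreeNonUnitalNonAssocAlgebra K D.GenW :=
  FreeNonUnitalNonAssocAlgebra.of K (GenW.e i)

/-- The elements `f_i` of the free nonassociative algebra. -/
def wf (i : Fin D.r) : FreeNonUnitalNonAssocAlgebra K D.GenW :=
  FreeNonUnitalNonAssocAlgebra.of K (GenW.f i)

/-- The elements `h_i` of the free nonassociative algebra. -/
def wh (i : Option (Fin D.r)) : FreeNonUnitalNonAssocAlgebra K D.GenW :=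
  FreeNonUnitalNonAssocAlgebra.of K (GenW.h i)

/-- The elements `f_{0i}` of the free nonassociative algebra. -/
def wf0 (i : D.IndexK) : FreeNonUnitalNonAssocAlgebra K D.GenW :=
  FreeNonUnitalNonAssocAlgebra.of K (GenW.f0 i)

/-- An element `k ∈ K` as an element of `{0} ∪ K`. -/
def toK (k : Fin D.r) (hk : D.lam k = 0) : D.IndexK :=
  ⟨some k, fun _ h => Option.some.inj h ▸ hk⟩

/-- The defining relators of `W`, before the maximal ideal is factored out. An exponent `1 - B_ij` in
a Serre relation is a natural number `n` that is equal to `1 - B_ij` in `K`; there is no such `n` for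
`i = j ≠ 0`. -/
inductive RelW : FreeNonUnitalNonAssocAlgebra K D.GenW → Prop
  | ef (i : Fin D.r) : RelW (D.we (some i) * D.wf i - D.wh (some i))
  | ef_ne (i : Option (Fin D.r)) (j : Fin D.r) : i ≠ some j → RelW (D.we i * D.wf j)
  | hf (i : Option (Fin D.r)) (j : Fin D.r) : RelW (D.wh i * D.wf j + D.B i (some j) • D.wf j)
  | he (i j : Option (Fin D.r)) : RelW (D.wh i * D.we j - D.B i j • D.we j)
  | ef0 (i : D.IndexK) : RelW (D.we none * D.wf0 i - D.wh i)
  | hf0 (i : Option (Fin D.r)) (j : D.IndexK) : RelW (D.wh i * D.wf0 j + D.B i none • D.wf0 j)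
  | serre_e (i j : Option (Fin D.r)) (n : ℕ) : (n : K) = 1 - D.B i j →
      RelW ((ad (D.we i) ^ n) (D.we j))
  | serre_f (i j : Fin D.r) (n : ℕ) : (n : K) = 1 - D.B (some i) (some j) →
      RelW ((ad (D.wf i) ^ n) (D.wf j))
  | eff0 (k : Fin D.r) (hk : D.lam k = 0) (i : D.IndexK) :
      RelW (D.we (some k) * (D.wf k * D.wf0 i) - D.B i (some k) • D.wf0 (D.toK k hk))
  | eff0_ne (k l : Fin D.r) (i : D.IndexK) : D.lam k = 0 → D.lam l = 0 → k ≠ l →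
      RelW (D.we (some k) * (D.wf l * D.wf0 i))
  | serre_f0 (j : Fin D.r) (i : D.IndexK) (n : ℕ) : D.lam j ≠ 0 →
      (n : K) = 1 - D.B (some j) none → RelW ((ad (D.wf j) ^ n) (D.wf0 i))
  | ef0_J (j : Fin D.r) (i : D.IndexK) : D.lam j ≠ 0 → RelW (D.we (some j) * D.wf0 i)
  | eef0 (k : Fin D.r) (i : D.IndexK) : D.lam k = 0 →
      RelW (D.we (some k) * (D.we (some k) * D.wf0 i))
  | fff0 (k : Fin D.r) (i : D.IndexK) : D.lam k = 0 → RelW (D.wf k * (D.wf k * D.wf0 i))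
  | eef0_J (j k : Fin D.r) (i : D.IndexK) : D.lam j ≠ 0 → D.lam k = 0 →
      RelW (D.we (some j) * (D.we (some k) * D.wf0 i))

/-- The set of defining relators. -/
def relW : Set (FreeNonUnitalNonAssocAlgebra K D.GenW) := {x | D.RelW x}

/-- The tensor hierarchy algebra `W`. -/
abbrev W : Type u := Min (GenW.deg (D := D)) GenW.deg D.relW

end Triple

end Cartanification
end

/-!
Since `ε_j = 1` whenever `λ_j ≠ 0`, the element `c` of the Cartan subalgebra of `𝔤` with
`[c, e_j] = λ_j e_j` has eigenvalue `(∑ ε_i λ_i Λ_i, α)` on the root space of `α`. The assumption that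
`λ` is pseudo-minuscule thus says that `c` defines a grading `𝔤 = 𝔤₋₁ ⊕ 𝔤₀ ⊕ 𝔤₁`
(`Triple.grading`), in which `e_j` has degree `λ_j`. As `𝔤` is simple, exactly one `λ_j` is not zero
(`Chev.Grading.eq_of_lam_ne_zero`), and it equals `1`.

On `𝔤` the element `h_0` of `𝓑` acts as `-c`. Therefore `𝓑₀ = 𝔤 + K h_0`, and `𝓑₁` and `𝓑₋₁` are the
`𝔤`-modules generated by `e_0` and `f_0` (`Triple.local_eqB`). An invariant form is determined by its
value on `(f_0, e_0)`. One is obtained from the bracket `𝓑₁ × 𝓑₋₁ → 𝓑₀` and the linear functional that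
vanishes on `𝔤` and takes the value `1` at `h_0`, which gives
`Triple.existsUnique_isInvariantForm`.

The local part of the cartanification is spanned by `𝓑₀` in degree `0`, by `𝓑₁` in degree `1` and by
the products `y z` with `y ∈ 𝓑₋₁`, `z ∈ 𝓑₀` in degree `-1`. The bracket of `x ∈ 𝓑₁` with `y z` is the
explicit element `cornerBr` of `𝓑₀`, and products on which all these brackets vanish are zero
(`ContragredientLocal.exists_isModel`, `Triple.zeroSub_eq_top`). It follows that `f_0 z = 0` for
`z ∈ 𝔤₁` and for `z = h_0 + L`. With these two identities the elements `f_0 h_i` satisfy the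
relations of the generators `f_{0i}` of `W` (`Triple.eval_cartGen`), and together with `𝓑₀` and `e_0`
they generate the cartanification (`Triple.eq_top_of_cartGen_mem`). This yields a surjective
homomorphism from `W` to the cartanification.

A homomorphism between minimal graded Lie superalgebras is injective if it is injective on the local
part (`Min.exists_equiv`). In degree `0` this holds because `𝔤` and `h_0` also span that component of
`W`. In degrees `1` and `-1` the components of `W` are finite-dimensional `𝔤`-modules generated by
their vectors of extremal degree with respect to `c`. By complete reducibility the kernel vanishes
if it contains no such vector (`Chev.Grading.IsLowest.eq_bot`). In degree `1` the extremal vectors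
are the multiples of `e_0`. In degree `-1` they form the module `negBase` generated by the elements
`f_{0i}` under the `e_k` and `f_k` with `λ_k = 0`; the essential point is that the generator `e_j` with
`λ_j = 1` annihilates it (`Triple.e_lie_eq_zero_of_mem_negBase`), which is inferred from the
corresponding products `f_0 x` in the cartanification. The kernel meets `negBase` trivially because
it does not meet the span of the `f_{0i}`. These vectors have the same weight, and a word in the `e_k`
applied to them that lies in the kernel is lowered by the `f_k` to shorter ones, so that it is a
lowest weight vector of an excluded weight if these vanish (`Chev.Grading.IsCore.eq_zero_of_mem`).

Complete reducibility of finite-dimensional modules of a simple Lie algebra is proved from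
Cartan's criterion by means of Casimir elements (`exists_equivariant_projection`). That the
generators `e_i` of `𝓑` and related elements do not vanish is seen from representations by operators
(`Triple.eq_zero_of_mkQ_e_eq_zero`, `LocalAlgebra.ann_eq_zero`).
-/

namespace Cartanification

/-! ### Complete reducibility -/

section Weyl

open LieModule

universe w

variable {K G : Type*} [Field K] [LieRing G] [LieAlgebra K G]

variable (K G) in
/-- The map `x ↦ ⁅x, v⁆`. -/
def lieFlip {V : Type w} [AddCommGroup V] [Module K V] [LieRingModule G V] [LieModule K G V]
    (v : V) : G →ₗ[K] V where
  toFun x := ⁅x, v⁆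
  map_add' := by simp
  map_smul' := by simp

theorem derivedSeries_one_of_isSimple [LieAlgebra.IsSimple K G] :
    LieAlgebra.derivedSeries K G 1 = ⊤ := by
  rcases LieAlgebra.IsSimple.eq_bot_or_eq_top (R := K) (LieAlgebra.derivedSeries K G 1) with h | h
  · exfalso
    apply LieAlgebra.IsSimple.non_abelian K (L := G)
    refine ⟨fun x y => ?_⟩
    have : ⁅x, y⁆ ∈ LieAlgebra.derivedSeries K G 1 := by
      rw [LieAlgebra.derivedSeries_def, LieAlgebra.derivedSeriesOfIdeal_succ]
      exact LieSubmodule.lie_mem_lie (LieSubmodule.mem_top x) (LieSubmodule.mem_top y)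
    rw [h] at this
    simpa using this
  · exact h

variable [CharZero K] [FiniteDimensional K G]

omit [FiniteDimensional K G] in
/-- A module with zero trace form has a nonzero invariant vector, by Cartan's criterion. -/
theorem exists_invariant_of_traceForm_eq_zero [LieAlgebra.IsSimple K G] {V : Type w}
    [AddCommGroup V] [Module K V] [LieRingModule G V] [LieModule K G V] [FiniteDimensional K V]
    [Nontrivial V] (h : traceForm K G V = 0) : maxTrivSubmodule K G V ≠ ⊥ := by
  have h1 : IsNilpotent (LieAlgebra.derivedSeries K G 1) V :=
    isNilpotent_derivedSeries_of_traceForm_eq_zero h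
  have h2 := nontrivial_max_triv_of_isNilpotent K (LieAlgebra.derivedSeries K G 1) V
  obtain ⟨⟨v, hv⟩, hv0⟩ := exists_ne (0 : maxTrivSubmodule K (LieAlgebra.derivedSeries K G 1) V)
  intro h3
  apply hv0
  have hv' : v ∈ maxTrivSubmodule K G V := by
    intro x
    have hx : x ∈ LieAlgebra.derivedSeries K G 1 := by
      rw [derivedSeries_one_of_isSimple]; exact LieSubmodule.mem_top x
    exact hv ⟨x, hx⟩
  rw [h3] at hv'
  exact Subtype.ext (by simpa using hv')

/-- Whitehead's first lemma for an irreducible module: the Casimir element of the trace form acts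
bijectively, and it turns a cocycle into a coboundary. -/
theorem exists_lie_eq_of_irreducible [LieAlgebra.IsSimple K G] {V : Type w}
    [AddCommGroup V] [Module K V] [LieRingModule G V] [LieModule K G V] [FiniteDimensional K V]
    (hirr : ∀ N : LieSubmodule K G V, N = ⊥ ∨ N = ⊤) (δ : G →ₗ[K] V)
    (hδ : ∀ x y, δ ⁅x, y⁆ = ⁅x, δ y⁆ - ⁅y, δ x⁆) : ∃ v, ∀ x, δ x = ⁅x, v⁆ := by
  rcases subsingleton_or_nontrivial V with hV | hV
  · exact ⟨0, fun x => Subsingleton.elim _ _⟩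
  by_cases htriv : maxTrivSubmodule K G V = ⊤
  · -- On a trivial module a cocycle vanishes on commutators, hence everywhere.
    have ht : ∀ (x : G) (v : V), ⁅x, v⁆ = 0 := fun x v => by
      have : v ∈ maxTrivSubmodule K G V := by rw [htriv]; exact LieSubmodule.mem_top v
      exact this x
    refine ⟨0, fun x => ?_⟩
    have hx : x ∈ LieAlgebra.derivedSeries K G 1 := by
      rw [derivedSeries_one_of_isSimple]; exact LieSubmodule.mem_top x
    rw [LieAlgebra.derivedSeries_def, LieAlgebra.derivedSeriesOfIdeal_succ,
      ← LieSubmodule.mem_toSubmodule, LieSubmodule.lieIdeal_oper_eq_linear_span'] at hx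
    rw [lie_zero]
    induction hx using Submodule.span_induction with
    | mem x hx =>
      obtain ⟨y, -, z, -, rfl⟩ := hx
      rw [hδ, ht, ht, sub_zero]
    | zero => simp
    | add x y _ _ hx hy => rw [map_add, hx, hy, add_zero]
    | smul c x _ hx => rw [map_smul, hx, smul_zero]
  have htriv' := (hirr (maxTrivSubmodule K G V)).resolve_right htriv
  have hB0 : traceForm K G V ≠ 0 := fun h => exists_invariant_of_traceForm_eq_zero h htriv'
  let B : LinearMap.BilinForm K G := traceForm K G V
  have hinv : ∀ x y z : G, B ⁅x, y⁆ z = - B y ⁅x, z⁆ := fun x y z => by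
    rw [← lie_skew, map_neg, LinearMap.neg_apply]
    exact congrArg _ (traceForm_apply_lie_apply K G V y x z)
  have hker : LinearMap.ker B = ⊥ := by
    let I : LieIdeal K G := { LinearMap.ker B with
      lie_mem := by
        intro x y hy
        have hy' : B y = 0 := hy
        change B ⁅x, y⁆ = 0
        ext z
        rw [hinv, hy']; simp }
    rcases LieAlgebra.IsSimple.eq_bot_or_eq_top (R := K) I with h | h
    · have : I.toSubmodule = ⊥ := by rw [h]; rfl
      exact this
    · exfalso
      apply hB0
      have : I.toSubmodule = ⊤ := by rw [h]; rfl
      exact LinearMap.ker_eq_top.mp this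
  have hnd : B.Nondegenerate := by
    refine ⟨LinearMap.separatingLeft_iff_ker_eq_bot.mpr hker, ?_⟩
    intro y hy
    apply LinearMap.separatingLeft_iff_ker_eq_bot.mpr hker
    intro x
    rw [show B y x = B x y from traceForm_comm K G V y x]
    exact hy x
  let b := Module.finBasis K G
  let b' := B.dualBasis hnd b
  have hbb : ∀ i j, B (b' i) (b j) = if j = i then 1 else 0 :=
    fun i j => LinearMap.BilinForm.apply_dualBasis_left hnd b i j
  have hexp : ∀ x : G, x = ∑ i, B (b' i) x • b i := fun x => by
    conv_lhs => rw [← b.sum_repr x]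
    refine Finset.sum_congr rfl fun i _ => ?_
    have h := congrArg (B (b' i)) (b.sum_repr x)
    simp only [map_sum, map_smul, hbb, smul_eq_mul, mul_ite, mul_one, mul_zero,
      Finset.sum_ite_eq', Finset.mem_univ, if_true] at h
    rw [h]
  have hexp' : ∀ x : G, x = ∑ i, B x (b i) • b' i := fun x => by
    conv_lhs => rw [← b'.sum_repr x]
    refine Finset.sum_congr rfl fun i _ => ?_
    congr 1
    exact LinearMap.BilinForm.dualBasis_repr_apply hnd b x i
  -- The canonical tensor `∑ b' i ⊗ b i` is invariant.
  have hcan : ∀ (F : G →ₗ[K] G →ₗ[K] V) (x : G),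
      ∑ i, F ⁅x, b' i⁆ (b i) + ∑ i, F (b' i) ⁅x, b i⁆ = 0 := fun F x => by
    have h1 : ∀ i, F (b' i) ⁅x, b i⁆ = ∑ j, B (b' j) ⁅x, b i⁆ • F (b' i) (b j) := fun i => by
      conv_lhs => rw [hexp ⁅x, b i⁆]
      simp
    have h2 : ∀ j, F ⁅x, b' j⁆ (b j) = ∑ i, B ⁅x, b' j⁆ (b i) • F (b' i) (b j) := fun j => by
      conv_lhs => rw [hexp' ⁅x, b' j⁆]
      simp
    simp only [h1, h2]
    rw [Finset.sum_comm, ← Finset.sum_add_distrib]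
    refine Finset.sum_eq_zero fun i _ => ?_
    rw [← Finset.sum_add_distrib]
    refine Finset.sum_eq_zero fun j _ => ?_
    rw [hinv, neg_smul, neg_add_cancel]
  -- The Casimir operator. Its trace is `dim G`, so it is invertible on the irreducible module.
  let Ω : V →ₗ[K] V := ∑ i, toEnd K G V (b' i) ∘ₗ toEnd K G V (b i)
  have hΩ : ∀ v, Ω v = ∑ i, ⁅b' i, ⁅b i, v⁆⁆ := fun v => by simp [Ω]
  have hΩlie : ∀ (x : G) (v : V), ⁅x, Ω v⁆ = Ω ⁅x, v⁆ := fun x v => by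
    have := hcan (LinearMap.mk₂ K (fun y z => ⁅y, ⁅z, v⁆⁆) (by simp) (by simp) (by simp)
      (by simp)) x
    simp only [LinearMap.mk₂_apply] at this
    rw [hΩ, hΩ, lie_sum, ← sub_eq_zero, ← Finset.sum_sub_distrib, ← this,
      ← Finset.sum_add_distrib]
    refine Finset.sum_congr rfl fun i _ => ?_
    rw [lie_lie x (b' i), lie_lie x (b i), lie_sub]
    abel
  have htr : LinearMap.trace K V Ω ≠ 0 := by
    have h1 : LinearMap.trace K V Ω = ∑ i, B (b' i) (b i) := by
      simp only [Ω, map_sum]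
      rfl
    rw [h1]
    simp only [hbb, if_true, Finset.sum_const, Finset.card_univ, Fintype.card_fin]
    rw [nsmul_eq_mul, mul_one, Nat.cast_ne_zero]
    have : Nontrivial G := by
      by_contra h
      rw [not_nontrivial_iff_subsingleton] at h
      exact LieAlgebra.IsSimple.non_abelian K (L := G) ⟨fun _ _ => Subsingleton.elim _ _⟩
    exact Module.finrank_pos.ne'
  have hinj : LinearMap.ker Ω = ⊥ := by
    let N : LieSubmodule K G V := { LinearMap.ker Ω with
      lie_mem := by
        intro x v hv
        have hv' : Ω v = 0 := hv
        change Ω ⁅x, v⁆ = 0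
        rw [← hΩlie, hv', lie_zero] }
    rcases hirr N with h | h
    · have : N.toSubmodule = ⊥ := by rw [h]; rfl
      exact this
    · exfalso
      have : N.toSubmodule = ⊤ := by rw [h]; rfl
      apply htr
      rw [show Ω = 0 from LinearMap.ker_eq_top.mp this, map_zero]
  have hsurj : Function.Surjective Ω :=
    LinearMap.injective_iff_surjective.mp (LinearMap.ker_eq_bot.mp hinj)
  -- By invariance of the canonical tensor, `Ω (δ x) = [x, ∑ b' i (δ (b i))]`.
  obtain ⟨v, hv⟩ := hsurj (∑ i, ⁅b' i, δ (b i)⁆)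
  refine ⟨v, fun x => LinearMap.ker_eq_bot.mp hinj ?_⟩
  rw [← hΩlie, hv, hΩ]
  have := hcan (LinearMap.mk₂ K (fun y z => ⁅y, δ z⁆) (by simp) (by simp) (by simp)
    (by simp)) x
  simp only [LinearMap.mk₂_apply] at this
  rw [← sub_eq_zero, ← neg_eq_zero, ← this, lie_sum, ← Finset.sum_sub_distrib,
    ← Finset.sum_add_distrib, ← Finset.sum_neg_distrib]
  refine Finset.sum_congr rfl fun i _ => ?_
  rw [hδ x (b i), lie_lie x (b' i), lie_sub]
  abel

/-- **Whitehead's first lemma**: every cocycle of a simple Lie algebra with values in a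
finite-dimensional module is a coboundary. -/
theorem exists_lie_eq_of_cocycle [LieAlgebra.IsSimple K G] (n : ℕ) : ∀ {V : Type w}
    [AddCommGroup V] [Module K V] [LieRingModule G V] [LieModule K G V] [FiniteDimensional K V]
    (_ : Module.finrank K V = n) (δ : G →ₗ[K] V)
    (_ : ∀ x y, δ ⁅x, y⁆ = ⁅x, δ y⁆ - ⁅y, δ x⁆), ∃ v, ∀ x, δ x = ⁅x, v⁆ := by
  induction n using Nat.strong_induction_on with
  | _ n ih =>
  intro V _ _ _ _ _ hn δ hδ
  by_cases hirr : ∀ N : LieSubmodule K G V, N = ⊥ ∨ N = ⊤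
  · exact exists_lie_eq_of_irreducible hirr δ hδ
  push Not at hirr
  obtain ⟨N, hN0, hN1⟩ := hirr
  have hlt : Module.finrank K N < n := by
    rw [← hn]
    exact Submodule.finrank_lt (s := N.toSubmodule) fun h => hN1 (by simpa using h)
  have hpos : 0 < Module.finrank K N := by
    have : Nontrivial N := (LieSubmodule.nontrivial_iff_ne_bot K G V).mpr hN0
    exact Module.finrank_pos
  have hq : Module.finrank K (V ⧸ N) < n := by
    have := Submodule.finrank_quotient_add_finrank N.toSubmodule
    rw [hn] at this
    change Module.finrank K (V ⧸ N) + Module.finrank K N = n at this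
    omega
  obtain ⟨q, hq'⟩ := ih _ hq (V := V ⧸ N) rfl (N.toSubmodule.mkQ ∘ₗ δ) (fun x y => by
    change LieSubmodule.Quotient.mk (N := N) (δ ⁅x, y⁆) = _
    rw [hδ]
    rfl)
  obtain ⟨v, rfl⟩ := LieSubmodule.Quotient.surjective_mk' N q
  have hmem : ∀ x, δ x - ⁅x, v⁆ ∈ N := fun x => by
    rw [← LieSubmodule.Quotient.mk_eq_zero (N := N)]
    have := hq' x
    change LieSubmodule.Quotient.mk (N := N) (δ x) =
      LieSubmodule.Quotient.mk (N := N) ⁅x, v⁆ at this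
    change LieSubmodule.Quotient.mk (N := N) (δ x) - LieSubmodule.Quotient.mk (N := N) ⁅x, v⁆ = 0
    rw [this, sub_self]
  let δ' : G →ₗ[K] N := (δ - lieFlip K G v).codRestrict N.toSubmodule
    (fun x => hmem x)
  have hδ' : ∀ x, (δ' x : V) = δ x - ⁅x, v⁆ := fun x => rfl
  obtain ⟨u, hu⟩ := ih _ hlt (V := N) rfl δ' (fun x y => by
    apply Subtype.ext
    simp only [LieSubmodule.coe_sub, LieSubmodule.coe_bracket, hδ', hδ, lie_sub, lie_lie]
    abel)
  refine ⟨v + u, fun x => ?_⟩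
  have := congrArg (Subtype.val) (hu x)
  rw [hδ', LieSubmodule.coe_bracket, sub_eq_iff_eq_add] at this
  rw [this, lie_add, add_comm]

/-- **Weyl's theorem**: a submodule of a finite-dimensional module over a simple Lie algebra is the
image of an equivariant projection. -/
theorem exists_equivariant_projection [LieAlgebra.IsSimple K G] {V : Type w}
    [AddCommGroup V] [Module K V] [LieRingModule G V] [LieModule K G V] [FiniteDimensional K V]
    (N : LieSubmodule K G V) :
    ∃ p : V →ₗ⁅K, G⁆ V, (∀ v, p v ∈ N) ∧ ∀ v ∈ N, p v = v := by
  obtain ⟨g, hg⟩ := N.toSubmodule.subtype.exists_leftInverse_of_injective (by simp)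
  let π : V →ₗ[K] V := N.toSubmodule.subtype ∘ₗ g
  have hπ : (∀ v, π v ∈ N) ∧ ∀ v ∈ N, π v = v := ⟨fun v => (g v).2, fun v hv =>
    congrArg Subtype.val (LinearMap.congr_fun hg ⟨v, hv⟩)⟩
  let E : LieSubmodule K G (V →ₗ[K] V) :=
    { carrier := {φ | (∀ v, φ v ∈ N) ∧ ∀ v ∈ N, φ v = 0}
      add_mem' := fun {φ ψ} hφ hψ => ⟨fun v => add_mem (hφ.1 v) (hψ.1 v), fun v hv => by
        rw [LinearMap.add_apply, hφ.2 v hv, hψ.2 v hv, add_zero]⟩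
      zero_mem' := ⟨fun v => zero_mem _, fun v _ => rfl⟩
      smul_mem' := fun c φ hφ => ⟨fun v => N.smul_mem c (hφ.1 v), fun v hv => by
        rw [LinearMap.smul_apply, hφ.2 v hv, smul_zero]⟩
      lie_mem := fun {x φ} hφ => ⟨fun v => by
        rw [LieHom.lie_apply]
        exact sub_mem (N.lie_mem (hφ.1 v)) (hφ.1 _), fun v hv => by
        rw [LieHom.lie_apply, hφ.2 v hv, hφ.2 _ (N.lie_mem hv), lie_zero, sub_zero]⟩ }
  have hmem : ∀ x : G, ⁅x, π⁆ ∈ E := fun x => ⟨fun v => by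
    rw [LieHom.lie_apply]
    exact sub_mem (N.lie_mem (hπ.1 v)) (hπ.1 _), fun v hv => by
    rw [LieHom.lie_apply, hπ.2 v hv, hπ.2 _ (N.lie_mem hv), sub_self]⟩
  let δ : G →ₗ[K] E := (lieFlip K G π).codRestrict
    E.toSubmodule (fun x => hmem x)
  have hδ : ∀ x, (δ x : V →ₗ[K] V) = ⁅x, π⁆ := fun x => rfl
  obtain ⟨u, hu⟩ := exists_lie_eq_of_cocycle _ (V := E) rfl δ (fun x y => by
    apply Subtype.ext
    simp only [LieSubmodule.coe_sub, LieSubmodule.coe_bracket, hδ, lie_lie])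
  have hu' : ∀ x : G, ⁅x, π⁆ = ⁅x, (u : V →ₗ[K] V)⁆ := fun x => congrArg Subtype.val (hu x)
  refine ⟨{ (π - (u : V →ₗ[K] V)) with map_lie' := ?_ }, fun v => ?_, fun v hv => ?_⟩
  · intro x v
    have h1 := LinearMap.congr_fun (hu' x) v
    rw [LieHom.lie_apply, LieHom.lie_apply] at h1
    change π ⁅x, v⁆ - u.1 ⁅x, v⁆ = ⁅x, π v - u.1 v⁆
    rw [lie_sub, sub_eq_sub_iff_sub_eq_sub, ← neg_inj, neg_sub, neg_sub]
    exact h1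
  · exact sub_mem (hπ.1 v) (u.2.1 v)
  · change π v - u.1 v = v
    rw [hπ.2 v hv, u.2.2 v hv, sub_zero]

end Weyl

/-! ### Weight vectors -/

section Weights

variable {K V : Type*} [Field K] [AddCommGroup V] [Module K V]

/-- A subspace that is stable under a family of operators contains the components, with respect to
distinct weights, of each of its elements. -/
theorem mem_of_sum_mem {ι β : Type*} {T : ι → Module.End K V} {N : Submodule K V}
    (hN : ∀ i, ∀ v ∈ N, T i v ∈ N) (s : Finset β) {χ : β → ι → K}
    (hχ : ∀ a ∈ s, ∀ b ∈ s, a ≠ b → χ a ≠ χ b) : ∀ {v : β → V}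
    (_ : ∀ a ∈ s, ∀ i, T i (v a) = χ a i • v a) (_ : ∑ a ∈ s, v a ∈ N), ∀ a ∈ s, v a ∈ N := by
  classical
  induction s using Finset.induction_on with
  | empty => intro v _ _ a ha; simp at ha
  | insert a₀ s ha₀ ih =>
    intro v hv hsum
    have ih' : ∀ {v : β → V}, (∀ a ∈ s, ∀ i, T i (v a) = χ a i • v a) → ∑ a ∈ s, v a ∈ N →
        ∀ a ∈ s, v a ∈ N :=
      ih fun a ha b hb => hχ a (Finset.mem_insert_of_mem ha) b (Finset.mem_insert_of_mem hb)
    have hs : ∀ b ∈ s, v b ∈ N := by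
      intro b hb
      have hne : χ b ≠ χ a₀ := hχ b (Finset.mem_insert_of_mem hb) a₀ (Finset.mem_insert_self _ _)
        fun h => ha₀ (h ▸ hb)
      obtain ⟨i, hi⟩ := Function.ne_iff.mp hne
      have h1 : ∑ a ∈ s, (χ a i - χ a₀ i) • v a ∈ N := by
        have h2 := sub_mem (hN i _ hsum) (N.smul_mem (χ a₀ i) hsum)
        rw [Finset.sum_insert ha₀, map_add, map_sum, smul_add, hv a₀ (Finset.mem_insert_self _ _),
          add_sub_add_left_eq_sub, Finset.smul_sum, ← Finset.sum_sub_distrib] at h2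
        convert h2 using 2 with a ha
        rw [hv a (Finset.mem_insert_of_mem ha), sub_smul]
      have h3 := ih' (v := fun a => (χ a i - χ a₀ i) • v a) (fun a ha j => by
        rw [map_smul, hv a (Finset.mem_insert_of_mem ha), smul_comm]) h1 b hb
      exact (N.smul_mem_iff (sub_ne_zero.mpr hi)).mp h3
    intro a ha
    rcases Finset.mem_insert.mp ha with rfl | ha
    · rw [Finset.sum_insert ha₀] at hsum
      exact (Submodule.add_mem_iff_left N (sum_mem hs)).mp hsum
    · exact hs a ha

/-- Eigenvectors with an eigenvalue outside a given family do not lie in the span of the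
corresponding eigenspaces. -/
theorem eq_zero_of_mem_iSup_eigenspace {β : Type*} (T : Module.End K V) (μ : β → K) {ν : K}
    (hν : ∀ b, μ b ≠ ν) {v : V} (hv : T v = ν • v) (hv' : v ∈ ⨆ b, T.eigenspace (μ b)) : v = 0 := by
  have h := T.eigenspaces_iSupIndep ν
  refine (Submodule.disjoint_def.mp h) v (Module.End.mem_eigenspace_iff.mpr hv) ?_
  refine (iSup_le fun b => ?_ : (⨆ b, T.eigenspace (μ b)) ≤ _) hv'
  exact le_iSup₂_of_le (μ b) (hν b) le_rfl

/-- An eigenvector in the span of subspaces of different eigenspaces lies in the one with its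
eigenvalue. -/
theorem mem_of_mem_iSup_of_eigenvector {β : Type*} (T : Module.End K V) {μ : β → K}
    (hμ : Function.Injective μ) {F : β → Submodule K V} (hF : ∀ b, F b ≤ T.eigenspace (μ b))
    {v : V} {b : β} (hv : T v = μ b • v) (hv' : v ∈ ⨆ b, F b) : v ∈ F b := by
  have h1 : (⨆ b, F b) ≤ F b ⊔ ⨆ c : {c // c ≠ b}, F c := by
    refine iSup_le fun c => ?_
    by_cases h : c = b
    · subst h; exact le_sup_left
    · exact le_sup_of_le_right (le_iSup (fun c : {c // c ≠ b} => F c) ⟨c, h⟩)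
  obtain ⟨x, hx, y, hy, rfl⟩ := Submodule.mem_sup.mp (h1 hv')
  have hx' : T x = μ b • x := Module.End.mem_eigenspace_iff.mp (hF b hx)
  have hy' : y = 0 := by
    refine eq_zero_of_mem_iSup_eigenspace T (fun c : {c // c ≠ b} => μ c) (ν := μ b)
      (fun c => hμ.ne c.2) ?_
      ((iSup_mono (fun c : {c // c ≠ b} => hF c.1) : (⨆ c : {c // c ≠ b}, F c.1) ≤ _) hy)
    rw [map_add, smul_add, hx'] at hv
    exact add_left_cancel hv
  rw [hy', add_zero]
  exact hx

/-- The smallest subspace that contains `M` and is stable under the operators in `S`. -/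
def opClosure (S : Set (Module.End K V)) (M : Submodule K V) : Submodule K V :=
  sInf {X | M ≤ X ∧ ∀ t ∈ S, X ≤ X.comap t}

theorem le_opClosure (S : Set (Module.End K V)) (M : Submodule K V) : M ≤ opClosure S M :=
  le_sInf fun _ hX => hX.1

theorem opClosure_stable {S : Set (Module.End K V)} {M : Submodule K V} {t : Module.End K V}
    (ht : t ∈ S) {v : V} (hv : v ∈ opClosure S M) : t v ∈ opClosure S M := by
  rw [opClosure, Submodule.mem_sInf] at hv ⊢
  exact fun X hX => hX.2 t ht (hv X hX)

theorem opClosure_le {S : Set (Module.End K V)} {M X : Submodule K V} (h : M ≤ X)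
    (h' : ∀ t ∈ S, ∀ v ∈ X, t v ∈ X) : opClosure S M ≤ X :=
  sInf_le ⟨h, fun t ht v hv => h' t ht v hv⟩

/-- A finite-dimensional subspace generates a finite-dimensional subspace under finitely many
commuting nilpotent operators. -/
theorem exists_finiteDimensional_stable (s : Finset (Module.End K V))
    (hs : ∀ a ∈ s, ∀ b ∈ s, Commute a b) (hs' : ∀ a ∈ s, IsNilpotent a) (M : Submodule K V)
    [FiniteDimensional K M] :
    ∃ X : Submodule K V, M ≤ X ∧ FiniteDimensional K X ∧ ∀ a ∈ s, ∀ v ∈ X, a v ∈ X := by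
  classical
  induction s using Finset.induction_on with
  | empty => exact ⟨M, le_rfl, inferInstance, by simp⟩
  | insert t s _ ih =>
    obtain ⟨X, hMX, hX, hst⟩ := ih
      (fun a ha b hb => hs a (Finset.mem_insert_of_mem ha) b (Finset.mem_insert_of_mem hb))
      (fun a ha => hs' a (Finset.mem_insert_of_mem ha))
    obtain ⟨n, hn⟩ := hs' t (Finset.mem_insert_self _ _)
    refine ⟨⨆ i : Fin (n + 1), X.map (t ^ (i : ℕ)), ?_, inferInstance, ?_⟩
    · refine le_iSup_of_le 0 ?_
      rw [Fin.val_zero, pow_zero, Module.End.one_eq_id, Submodule.map_id]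
      exact hMX
    · intro a ha
      suffices h : (⨆ i : Fin (n + 1), X.map (t ^ (i : ℕ))) ≤
          (⨆ i : Fin (n + 1), X.map (t ^ (i : ℕ))).comap a from h
      refine iSup_le fun i => ?_
      rintro _ ⟨x, hx, rfl⟩
      rw [Submodule.mem_comap]
      rcases Finset.mem_insert.mp ha with rfl | ha
      · rw [← Module.End.mul_apply, ← pow_succ']
        by_cases hi : (i : ℕ) + 1 < n + 1
        · exact (le_iSup (fun i : Fin (n + 1) => X.map (a ^ (i : ℕ))) ⟨i + 1, hi⟩) ⟨x, hx, rfl⟩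
        · have : (a ^ ((i : ℕ) + 1)) = 0 := pow_eq_zero_of_le (by omega) hn
          rw [this]; exact zero_mem _
      · have hc : Commute a (t ^ (i : ℕ)) :=
          (hs a (Finset.mem_insert_of_mem ha) t (Finset.mem_insert_self _ _)).pow_right _
        rw [← Module.End.mul_apply, hc.eq, Module.End.mul_apply]
        exact (le_iSup (fun i : Fin (n + 1) => X.map (t ^ (i : ℕ))) i) ⟨_, hst a ha x hx, rfl⟩

end Weights

/-- If the inner derivation `D` of `y` maps a nilpotent element `x` to `x₁` and `x₁` to `x₂`, where
`x`, `x₁` and `x₂` commute, then `x₁` is nilpotent: applying `D` to `x ^ (m + 1) * x₁ ^ (2 * k) = 0`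
and multiplying by `x₁` gives `x ^ m * x₁ ^ (2 * (k + 1)) = 0`. -/
theorem isNilpotent_of_derivation {K R : Type*} [Field K] [CharZero K] [Ring R] [Algebra K R]
    {x y x₁ x₂ : R} (h₁ : y * x - x * y = x₁) (h₂ : y * x₁ - x₁ * y = x₂) (c₁ : Commute x x₁)
    (c₂ : Commute x₁ x₂) (hx : IsNilpotent x) : IsNilpotent x₁ := by
  have hpow : ∀ {a b : R}, y * a - a * y = b → Commute a b →
      ∀ m : ℕ, y * a ^ (m + 1) = a ^ (m + 1) * y + ((m + 1 : ℕ) : K) • (a ^ m * b) := by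
    intro a b hab hc m
    have hya : y * a = a * y + b := by rw [← hab]; abel
    induction m with
    | zero => simp [hya]
    | succ m ih =>
      have h1 : a ^ (m + 1) * (a * y) = a ^ (m + 2) * y := by rw [← mul_assoc, ← pow_succ]
      have h2 : a ^ m * b * a = a ^ (m + 1) * b := by
        rw [mul_assoc, ← hc.eq, ← mul_assoc, ← pow_succ]
      rw [pow_succ, ← mul_assoc, ih, add_mul, mul_assoc, hya, mul_add, h1, smul_mul_assoc, h2,
        add_assoc]
      rw [show ((m + 1 + 1 : ℕ) : K) = ((m + 1 : ℕ) : K) + 1 by push_cast; ring, add_smul, one_smul,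
        ← pow_succ]
      abel
  obtain ⟨n, hn⟩ := hx
  have key : ∀ k ≤ n, x ^ (n - k) * x₁ ^ (2 * k) = 0 := by
    intro k
    induction k with
    | zero => intro _; simp [hn]
    | succ k ih =>
      intro hk
      have ih' := ih (by omega)
      obtain ⟨m, hm⟩ : ∃ m, n - k = m + 1 := ⟨n - k - 1, by omega⟩
      have hm' : n - (k + 1) = m := by omega
      rw [hm] at ih'
      rw [hm']
      have h3 : y * (x ^ (m + 1) * x₁ ^ (2 * k)) * x₁ = 0 := by rw [ih']; simp
      rw [← mul_assoc, hpow h₁ c₁, add_mul] at h3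
      have h4 : x ^ (m + 1) * y * x₁ ^ (2 * k) * x₁ = 0 := by
        rcases Nat.eq_zero_or_pos (2 * k) with h0 | h0
        · have h0' : k = 0 := by omega
          subst h0'
          have ih'' : x ^ (m + 1) = 0 := by simpa using ih'
          rw [ih'']; simp
        · obtain ⟨l, hl⟩ : ∃ l, 2 * k = l + 1 := ⟨2 * k - 1, by omega⟩
          rw [hl] at ih' ⊢
          rw [mul_assoc (x ^ (m + 1)) y, hpow h₂ c₂, mul_add, ← mul_assoc (x ^ (m + 1)) _ y, ih',
            zero_mul, zero_add, mul_smul_comm, smul_mul_assoc, mul_assoc _ (x₁ ^ l * x₂) x₁,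
            mul_assoc (x₁ ^ l) x₂ x₁, ← c₂.eq, ← mul_assoc (x₁ ^ l) x₁ x₂, ← pow_succ,
            ← mul_assoc, ih', zero_mul, smul_zero]
      rw [add_mul, h4, zero_add, smul_mul_assoc, smul_mul_assoc, smul_eq_zero] at h3
      have h5 := h3.resolve_left (by exact_mod_cast Nat.succ_ne_zero m)
      rw [mul_assoc (x ^ m) x₁, ← pow_succ', mul_assoc, ← pow_succ] at h5
      exact h5
  exact ⟨2 * n, by simpa using key n le_rfl⟩

section Sl2

variable {K G V : Type*} [Field K] [CharZero K] [LieRing G] [LieAlgebra K G] [AddCommGroup V]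
  [Module K V] [LieRingModule G V] [LieModule K G V]

/-- A lowest weight vector of an `𝔰𝔩₂`-module on which `e` is locally nilpotent has a weight
in `-ℕ`. -/
theorem exists_weight_eq_neg {e f h : G} (hef : ⁅e, f⁆ = h) (he : ⁅h, e⁆ = (2 : K) • e) {v : V}
    {μ : K} (hv0 : v ≠ 0) (hf : ⁅f, v⁆ = 0) (hh : ⁅h, v⁆ = μ • v) {n : ℕ}
    (hn : ((LieModule.toEnd K G V e) ^ n) v = 0) : ∃ m < n, μ = -(m : K) := by
  let E := LieModule.toEnd K G V e
  have hE : ∀ w, E w = ⁅e, w⁆ := fun w => rfl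
  have hweight : ∀ k : ℕ, ⁅h, (E ^ k) v⁆ = (μ + 2 * k) • (E ^ k) v := by
    intro k
    induction k with
    | zero => simpa using hh
    | succ k ih =>
      rw [pow_succ', Module.End.mul_apply, hE, leibniz_lie, he, ih, smul_lie, lie_smul, ← add_smul]
      congr 1; push_cast; ring
  have hlow : ∀ k : ℕ, ⁅f, (E ^ (k + 1)) v⁆ = (-((k + 1) * (μ + k) : K)) • (E ^ k) v := by
    intro k
    induction k with
    | zero =>
      rw [zero_add, pow_one, hE, leibniz_lie, hf, lie_zero, add_zero, ← lie_skew, hef, neg_lie, hh]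
      simp
    | succ k ih =>
      rw [pow_succ', Module.End.mul_apply, hE, leibniz_lie, ih, ← lie_skew f e, hef, neg_lie,
        hweight, lie_smul, ← hE, ← Module.End.mul_apply, ← pow_succ', ← neg_smul, ← add_smul]
      congr 1; push_cast; ring
  by_contra hcon
  push Not at hcon
  have key : ∀ k ≤ n, (E ^ (n - k)) v = 0 := by
    intro k
    induction k with
    | zero => intro _; simpa using hn
    | succ k ih =>
      intro hk
      obtain ⟨m, hm⟩ : ∃ m, n - k = m + 1 := ⟨n - k - 1, by omega⟩
      have h1 := ih (by omega)
      rw [hm] at h1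
      have h2 := hlow m
      rw [h1, lie_zero, eq_comm, smul_eq_zero, neg_eq_zero, mul_eq_zero] at h2
      rw [show n - (k + 1) = m by omega]
      refine h2.resolve_left (not_or.mpr ⟨by exact_mod_cast Nat.succ_ne_zero m, fun h => ?_⟩)
      exact hcon m (by omega) (eq_neg_of_add_eq_zero_left h)
  exact hv0 (by simpa using key n le_rfl)

end Sl2

/-! ### Chevalley generators -/

/-- Elements `e i`, `f i` and `h i` of a Lie algebra which satisfy the Chevalley relations with
respect to an integral matrix, and which generate the Lie algebra. -/
structure Chev (K ι G : Type*) [Field K] [LieRing G] [LieAlgebra K G] where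
  A : Matrix ι ι ℤ
  e : ι → G
  f : ι → G
  h : ι → G
  ef : ∀ i, ⁅e i, f i⁆ = h i
  ef_ne : ∀ i j, i ≠ j → ⁅e i, f j⁆ = 0
  hh : ∀ i j, ⁅h i, h j⁆ = 0
  he : ∀ i j, ⁅h i, e j⁆ = (A i j : K) • e j
  hf : ∀ i j, ⁅h i, f j⁆ = -((A i j : K) • f j)
  gen : ∀ X : LieSubalgebra K G, (∀ i, e i ∈ X) → (∀ i, f i ∈ X) → X = ⊤

namespace Chev

section Triangular

variable {K ι G : Type*} [Field K] [LieRing G] [LieAlgebra K G] (S : Chev K ι G)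

/-- The Chevalley involution, as an operation on Chevalley generators. -/
def swap : Chev K ι G where
  A := S.A
  e := S.f
  f := S.e
  h := fun i => -S.h i
  ef i := by rw [← lie_skew, S.ef]
  ef_ne i j h := by rw [← lie_skew, S.ef_ne j i h.symm, neg_zero]
  hh i j := by rw [lie_neg, neg_lie, S.hh, neg_zero, neg_zero]
  he i j := by rw [neg_lie, S.hf, neg_neg]
  hf i j := by rw [neg_lie, S.he]
  gen X h1 h2 := S.gen X h2 h1

theorem fe (i : ι) : ⁅S.f i, S.e i⁆ = -S.h i := by rw [← lie_skew, S.ef]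

theorem fe_ne (i j : ι) (h : i ≠ j) : ⁅S.f i, S.e j⁆ = 0 := by
  rw [← lie_skew, S.ef_ne j i h.symm, neg_zero]

theorem eh (i j : ι) : ⁅S.e j, S.h i⁆ = -((S.A i j : K) • S.e j) := by rw [← lie_skew, S.he]

theorem fh (i j : ι) : ⁅S.f j, S.h i⁆ = (S.A i j : K) • S.f j := by
  rw [← lie_skew, S.hf, neg_neg]

variable [DecidableEq ι]

/-- Iterated brackets `⁅e i, ⁅e j, …⁆⁆`, together with the multiplicities of the generators. -/
inductive IsWord : (ι → ℕ) → G → Prop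
  | of (i : ι) : IsWord (Pi.single i 1) (S.e i)
  | lie (i : ι) {a : ι → ℕ} {x : G} : IsWord a x → IsWord (Pi.single i 1 + a) ⁅S.e i, x⁆

variable {S} in
theorem IsWord.lie_h [Fintype ι] {a : ι → ℕ} {x : G} (hx : S.IsWord a x) (i : ι) :
    ⁅S.h i, x⁆ = (∑ l, (S.A i l : K) * (a l : K)) • x := by
  induction hx with
  | of j => simp [S.he, Pi.single_apply]
  | @lie j a x _ ih =>
    rw [leibniz_lie, S.he, ih, smul_lie, lie_smul, ← add_smul]
    simp [mul_add, Finset.sum_add_distrib, Pi.single_apply]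

variable {S} in
/-- An element that acts diagonally on the generators acts diagonally on the words. -/
theorem IsWord.lie_eq_smul [Fintype ι] {a : ι → ℕ} {x c : G} {μ : ι → K} (hx : S.IsWord a x)
    (hc : ∀ i, ⁅c, S.e i⁆ = μ i • S.e i) : ⁅c, x⁆ = (∑ l, μ l * (a l : K)) • x := by
  induction hx with
  | of j => simp [hc, Pi.single_apply]
  | @lie j a x _ ih =>
    rw [leibniz_lie, hc, ih, smul_lie, lie_smul, ← add_smul]
    simp [mul_add, Finset.sum_add_distrib, Pi.single_apply]

/-- The span of the elements `h i` and the words in the elements `e i`. -/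
def borel : Submodule K G := Submodule.span K (Set.range S.h ∪ {x | ∃ a, S.IsWord a x})

theorem h_mem_borel (i : ι) : S.h i ∈ S.borel := Submodule.subset_span (Or.inl ⟨i, rfl⟩)

variable {S} in
theorem IsWord.mem_borel {a : ι → ℕ} {x : G} (hx : S.IsWord a x) : x ∈ S.borel :=
  Submodule.subset_span (Or.inr ⟨a, hx⟩)

theorem e_lie_mem_borel (i : ι) {x : G} (hx : x ∈ S.borel) : ⁅S.e i, x⁆ ∈ S.borel := by
  induction hx using Submodule.span_induction with
  | mem x hx =>
    rcases hx with ⟨j, rfl⟩ | ⟨a, ha⟩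
    · rw [eh]
      exact neg_mem (Submodule.smul_mem _ _ (IsWord.of i).mem_borel)
    · exact (ha.lie i).mem_borel
  | zero => simp
  | add x y _ _ hx hy => rw [lie_add]; exact add_mem hx hy
  | smul t x _ hx => rw [lie_smul]; exact Submodule.smul_mem _ _ hx

theorem f_lie_mem_borel [Fintype ι] (i : ι) {a : ι → ℕ} {x : G} (hx : S.IsWord a x) :
    ⁅S.f i, x⁆ ∈ S.borel := by
  induction hx with
  | of j =>
    by_cases h : i = j
    · subst h; rw [fe]; exact neg_mem (S.h_mem_borel i)
    · rw [S.fe_ne i j h]; exact zero_mem _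
  | @lie j a x hx ih =>
    rw [leibniz_lie]
    refine add_mem ?_ (S.e_lie_mem_borel j ih)
    by_cases h : i = j
    · subst h
      rw [fe, neg_lie, hx.lie_h]
      exact neg_mem (Submodule.smul_mem _ _ hx.mem_borel)
    · rw [S.fe_ne i j h, zero_lie]; exact zero_mem _

/-- The triangular decomposition. -/
theorem borel_sup_borel [Fintype ι] : S.borel ⊔ S.swap.borel = ⊤ := by
  have key : ∀ (S : Chev K ι G) (i : ι), ∀ x ∈ S.borel ⊔ S.swap.borel,
      ⁅S.e i, x⁆ ∈ S.borel ⊔ S.swap.borel := by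
    intro S i x hx
    obtain ⟨y, hy, z, hz, rfl⟩ := Submodule.mem_sup.mp hx
    rw [lie_add]
    refine add_mem (Submodule.mem_sup_left (S.e_lie_mem_borel i hy)) ?_
    clear hx
    induction hz using Submodule.span_induction with
    | mem z hz =>
      rcases hz with ⟨j, rfl⟩ | ⟨a, ha⟩
      · refine Submodule.mem_sup_left ?_
        rw [show S.swap.h j = -S.h j from rfl, lie_neg]
        exact neg_mem (S.e_lie_mem_borel i (S.h_mem_borel j))
      · exact Submodule.mem_sup_right (S.swap.f_lie_mem_borel i ha)
    | zero => simp
    | add x y _ _ hx hy => rw [lie_add]; exact add_mem hx hy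
    | smul t x _ hx => rw [lie_smul]; exact Submodule.smul_mem _ _ hx
  have hss : S.swap.swap = S := by
    cases S; simp [swap]
  have keyf : ∀ (i : ι), ∀ x ∈ S.borel ⊔ S.swap.borel, ⁅S.f i, x⁆ ∈ S.borel ⊔ S.swap.borel := by
    intro i x hx
    have := key S.swap i x
    rw [hss, sup_comm] at this
    exact this hx
  have hnorm : ∀ y : G, ∀ x ∈ S.borel ⊔ S.swap.borel, ⁅y, x⁆ ∈ S.borel ⊔ S.swap.borel := by
    let N : LieSubalgebra K G :=
      { carrier := {y : G | ∀ x ∈ S.borel ⊔ S.swap.borel, ⁅y, x⁆ ∈ S.borel ⊔ S.swap.borel}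
        add_mem' := fun {a b} ha hb x hx => by rw [add_lie]; exact add_mem (ha x hx) (hb x hx)
        zero_mem' := fun x _ => by rw [zero_lie]; exact zero_mem _
        smul_mem' := fun t a ha x hx => by rw [smul_lie]; exact Submodule.smul_mem _ _ (ha x hx)
        lie_mem' := fun {a b} ha hb x hx => by
          rw [lie_lie]; exact sub_mem (ha _ (hb x hx)) (hb _ (ha x hx)) }
    have hN : N = ⊤ := S.gen N (fun i => key S i) keyf
    intro y
    have hy : y ∈ N := hN ▸ LieSubalgebra.mem_top y
    exact hy
  let T : LieSubalgebra K G :=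
    { (S.borel ⊔ S.swap.borel) with lie_mem' := fun {a b} _ hb => hnorm a b hb }
  have hT : T = ⊤ := S.gen T (fun i => Submodule.mem_sup_left (IsWord.of i).mem_borel)
    (fun i => Submodule.mem_sup_right (IsWord.of (S := S.swap) i).mem_borel)
  rw [eq_top_iff]
  intro x _
  have hx : x ∈ T := hT ▸ LieSubalgebra.mem_top x
  exact hx

/-- The triangular decomposition, as an induction principle. -/
theorem eq_top_of_words [Fintype ι] (X : Submodule K G) (hX : ∀ i, S.h i ∈ X)
    (hp : ∀ a x, S.IsWord a x → x ∈ X) (hm : ∀ a x, S.swap.IsWord a x → x ∈ X) : X = ⊤ := by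
  rw [eq_top_iff, ← S.borel_sup_borel]
  refine sup_le (Submodule.span_le.mpr ?_) (Submodule.span_le.mpr ?_)
  · rintro x (⟨i, rfl⟩ | ⟨a, ha⟩)
    exacts [hX i, hp a x ha]
  · rintro x (⟨i, rfl⟩ | ⟨a, ha⟩)
    exacts [neg_mem (hX i), hm a x ha]

end Triangular

/-! ### Positivity of the Cartan matrix -/

section Positivity

/-- If an operator is diagonalisable with rational eigenvalues, then the trace of its square is a
nonnegative rational number, which vanishes only if the operator does. -/
theorem _root_.Cartanification.exists_trace_sq {K V : Type*} [Field K] [CharZero K]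
    [AddCommGroup V] [Module K V] [FiniteDimensional K V] (T : Module.End K V)
    (hT : ⊤ ≤ Submodule.span K {v | ∃ q : ℚ, T v = (q : K) • v}) :
    ∃ q : ℚ, 0 ≤ q ∧ LinearMap.trace K V (T * T) = q ∧ (q = 0 → T = 0) := by
  classical
  let b := Module.Basis.ofSpan hT
  have hb : ∀ i, ∃ q : ℚ, T (b i) = (q : K) • b i := fun i =>
    Module.Basis.ofSpan_subset hT ⟨i, rfl⟩
  choose q hq using hb
  have : Fintype _ := FiniteDimensional.fintypeBasisIndex b
  refine ⟨∑ i, q i * q i, Finset.sum_nonneg fun i _ => mul_self_nonneg _, ?_, fun h => ?_⟩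
  · rw [LinearMap.trace_eq_matrix_trace K b, Matrix.trace]
    push_cast
    refine Finset.sum_congr rfl fun i _ => ?_
    rw [Matrix.diag_apply, LinearMap.toMatrix_apply, Module.End.mul_apply, hq, map_smul, hq]
    simp
  · refine b.ext fun i => ?_
    rw [Finset.sum_eq_zero_iff_of_nonneg fun i _ => mul_self_nonneg _] at h
    rw [hq, mul_self_eq_zero.mp (h i (Finset.mem_univ i))]
    simp

variable {K ι G : Type*} [Field K] [CharZero K] [LieRing G] [LieAlgebra K G] (S : Chev K ι G)
  [Fintype ι] [DecidableEq ι]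

theorem span_eigenvectors_eq_top (s : ι → ℚ) : ⊤ ≤ Submodule.span K
    {v | ∃ q : ℚ, LieAlgebra.ad K G (∑ l, (s l : K) • S.h l) v = (q : K) • v} := by
  have key : ∀ (S : Chev K ι G) (a : ι → ℕ) (x : G), S.IsWord a x →
      ∃ q : ℚ, ⁅∑ l, (s l : K) • S.h l, x⁆ = (q : K) • x := fun S a x hx => by
    refine ⟨∑ i, s i * ∑ l, (S.A i l : ℚ) * (a l : ℚ), ?_⟩
    rw [sum_lie]
    push_cast
    rw [Finset.sum_smul]
    exact Finset.sum_congr rfl fun i _ => by rw [smul_lie, hx.lie_h, smul_smul]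
  rw [← S.eq_top_of_words _ (fun i => ?_) (fun a x hx => ?_) (fun a x hx => ?_)]
  · refine Submodule.subset_span ⟨0, ?_⟩
    rw [LieAlgebra.ad_apply, sum_lie]
    simp [S.hh]
  · exact Submodule.subset_span (key S a x hx)
  · obtain ⟨q, hq⟩ := key S.swap a x hx
    refine Submodule.subset_span ⟨-q, ?_⟩
    have : ∑ l, (s l : K) • S.swap.h l = -∑ l, (s l : K) • S.h l := by simp [swap]
    rw [this, neg_lie] at hq
    rw [LieAlgebra.ad_apply, ← neg_neg ⁅_, x⁆, hq]
    simp

/-- A nonzero vector `a` with natural coefficients cannot satisfy `(A a) k ≤ 0` on its support. -/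
theorem eq_zero_of_mulVec_nonpos [FiniteDimensional K G] (hA : S.A.det ≠ 0)
    (hdiag : ∀ i, S.A i i = 2) (he : ∀ i, S.e i ≠ 0) (a : ι → ℕ)
    (ha : ∀ k, a k ≠ 0 → ∑ l, S.A k l * (a l : ℤ) ≤ 0) : a = 0 := by
  -- elements of the Cartan subalgebra with vanishing adjoint action are zero
  have hinj : ∀ s : ι → ℚ, LieAlgebra.ad K G (∑ l, (s l : K) • S.h l) = 0 → s = 0 := by
    intro s hs
    have h1 : Matrix.vecMul s (S.A.map (Int.cast : ℤ → ℚ)) = 0 := by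
      ext i
      have h2 : ⁅∑ l, (s l : K) • S.h l, S.e i⁆ = 0 := LinearMap.congr_fun hs (S.e i)
      rw [sum_lie] at h2
      simp only [smul_lie, S.he, smul_smul, ← Finset.sum_smul] at h2
      have h3 := (smul_eq_zero.mp h2).resolve_right (he i)
      simp only [Matrix.vecMul, dotProduct, Matrix.map_apply, Pi.zero_apply]
      exact_mod_cast h3
    have hdet : (S.A.map (Int.cast : ℤ → ℚ)).det ≠ 0 := by
      have := (Int.castRingHom ℚ).map_det S.A
      rw [RingHom.mapMatrix_apply] at this
      change (S.A.map (Int.castRingHom ℚ)).det ≠ 0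
      rw [← this]
      simpa using hA
    exact Matrix.eq_zero_of_vecMul_eq_zero hdet h1
  have hκ : ∀ k l, killingForm K G (S.h k) (S.h l) =
      (S.A l k : K) * killingForm K G (S.e k) (S.f k) := by
    intro k l
    rw [← S.ef, LieModule.traceForm_apply_lie_apply, S.fh, map_smul, smul_eq_mul]
  have hd : ∀ k, ∃ q : ℚ, 0 < q ∧ killingForm K G (S.e k) (S.f k) = q := by
    intro k
    obtain ⟨q, hq0, hq, hq'⟩ := exists_trace_sq _ (S.span_eigenvectors_eq_top (Pi.single k 1))
    have hk : ∑ l, ((Pi.single k 1 : ι → ℚ) l : K) • S.h l = S.h k := by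
      rw [Finset.sum_eq_single k]
      · simp
      · intro l _ hl; simp [Pi.single_eq_of_ne hl]
      · simp
    have hq1 : killingForm K G (S.h k) (S.h k) = q := by
      rw [← hq, hk, LieModule.traceForm_apply_apply]; rfl
    rw [hκ, hdiag] at hq1
    refine ⟨q / 2, div_pos (lt_of_le_of_ne hq0 fun h => ?_) two_pos, ?_⟩
    · have := congrFun (hinj _ (hq' h.symm)) k
      simp at this
    · push_cast at hq1 ⊢
      rw [← hq1]; ring
  choose d hd0 hd using hd
  let s : ι → ℚ := fun l => a l / d l
  obtain ⟨q, hq0, hq, hq'⟩ := exists_trace_sq _ (S.span_eigenvectors_eq_top s)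
  have hsum : q = ∑ k, s k * ∑ l, (S.A k l : ℚ) * (a l : ℚ) := by
    have h1 : killingForm K G (∑ l, (s l : K) • S.h l) (∑ l, (s l : K) • S.h l) = q := by
      rw [← hq, LieModule.traceForm_apply_apply]; rfl
    have h2 : ((∑ k, s k * ∑ l, (S.A k l : ℚ) * (a l : ℚ) : ℚ) : K) = q := by
      have h3 : ∀ k l, killingForm K G (S.h k) (S.h l) = S.A k l * d l := fun k l => by
        rw [LieModule.traceForm_comm, hκ, hd]
      rw [← h1]
      simp only [map_sum, LinearMap.sum_apply, map_smul, LinearMap.smul_apply, smul_eq_mul, h3]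
      push_cast
      simp only [Finset.mul_sum]
      rw [Finset.sum_comm]
      refine Finset.sum_congr rfl fun l _ => Finset.sum_congr rfl fun k _ => ?_
      have : (d l : K) ≠ 0 := by exact_mod_cast (hd0 l).ne'
      simp only [s]
      push_cast
      field_simp
    exact_mod_cast h2.symm
  have hq2 : q = 0 := by
    refine le_antisymm ?_ hq0
    rw [hsum]
    refine Finset.sum_nonpos fun k _ => ?_
    by_cases hk : a k = 0
    · simp [s, hk]
    · refine mul_nonpos_of_nonneg_of_nonpos (div_nonneg (Nat.cast_nonneg _) (hd0 k).le) ?_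
      exact_mod_cast ha k hk
  have hs := hinj s (hq' hq2)
  funext l
  have h1 := congrFun hs l
  simp only [s, Pi.zero_apply, div_eq_zero_iff, (hd0 l).ne', or_false] at h1
  exact_mod_cast h1

end Positivity

end Chev

/-! ### Gradings of depth one and their modules -/

section

variable {K ι G : Type*} [Field K] [LieRing G] [LieAlgebra K G] (S : Chev K ι G)
  {V : Type*} [AddCommGroup V] [Module K V] [LieRingModule G V] [LieModule K G V]

/-- A subspace that is stable under the Chevalley generators is a submodule. -/
theorem Chev.lie_mem {X : Submodule K V} (he : ∀ i, ∀ v ∈ X, ⁅S.e i, v⁆ ∈ X)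
    (hf : ∀ i, ∀ v ∈ X, ⁅S.f i, v⁆ ∈ X) (g : G) : ∀ v ∈ X, ⁅g, v⁆ ∈ X := by
  let Y : LieSubalgebra K G :=
    { carrier := {g | ∀ v ∈ X, ⁅g, v⁆ ∈ X}
      add_mem' := fun ha hb v hv => by rw [add_lie]; exact add_mem (ha v hv) (hb v hv)
      zero_mem' := fun v _ => by rw [zero_lie]; exact zero_mem _
      smul_mem' := fun t a ha v hv => by rw [smul_lie]; exact Submodule.smul_mem _ _ (ha v hv)
      lie_mem' := fun {a b} ha hb v hv => by
        rw [lie_lie]; exact sub_mem (ha _ (hb v hv)) (hb _ (ha v hv)) }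
  have h1 : g ∈ Y := by rw [S.gen Y he hf]; trivial
  exact h1

/-- A subspace that is stable under the elements `h i` and `f i` generates a submodule already
under the elements `e i`. -/
theorem Chev.stable_opClosure_e {M : Submodule K V} (hh : ∀ i, ∀ v ∈ M, ⁅S.h i, v⁆ ∈ M)
    (hf : ∀ i, ∀ v ∈ M, ⁅S.f i, v⁆ ∈ M) (i : ι) {v : V}
    (hv : v ∈ opClosure (Set.range fun i => LieModule.toEnd K G V (S.e i)) M) :
    ⁅S.f i, v⁆ ∈ opClosure (Set.range fun i => LieModule.toEnd K G V (S.e i)) M := by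
  let ops : Set (Module.End K V) := Set.range fun i => LieModule.toEnd K G V (S.e i)
  let Y := opClosure ops M
  have heY : ∀ i, ∀ v ∈ Y, ⁅S.e i, v⁆ ∈ Y := fun i v hv => opClosure_stable (S := ops) ⟨i, rfl⟩ hv
  have hMY : M ≤ Y := le_opClosure _ _
  let Z : Submodule K V :=
    { carrier := {v : V | v ∈ Y ∧ ∀ i, ⁅S.h i, v⁆ ∈ Y ∧ ⁅S.f i, v⁆ ∈ Y}
      add_mem' := fun {a b} ha hb => ⟨add_mem ha.1 hb.1, fun i => by
        rw [lie_add, lie_add]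
        exact ⟨add_mem (ha.2 i).1 (hb.2 i).1, add_mem (ha.2 i).2 (hb.2 i).2⟩⟩
      zero_mem' := ⟨zero_mem _, fun i => by rw [lie_zero, lie_zero]; exact ⟨zero_mem _, zero_mem _⟩⟩
      smul_mem' := fun t a ha => ⟨Submodule.smul_mem _ _ ha.1, fun i => by
        rw [lie_smul, lie_smul]
        exact ⟨Submodule.smul_mem _ _ (ha.2 i).1, Submodule.smul_mem _ _ (ha.2 i).2⟩⟩ }
  have hYZ : Y ≤ Z := by
    refine opClosure_le (fun v hv => ?_) ?_
    · exact ⟨hMY hv, fun i => ⟨hMY (hh i v hv), hMY (hf i v hv)⟩⟩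
    · rintro _ ⟨l, rfl⟩ v hv
      refine ⟨heY l v hv.1, fun i => ⟨?_, ?_⟩⟩
      · rw [LieModule.toEnd_apply_apply, leibniz_lie, S.he, smul_lie]
        exact add_mem (Submodule.smul_mem _ _ (heY l v hv.1)) (heY l _ (hv.2 i).1)
      · rw [LieModule.toEnd_apply_apply, leibniz_lie]
        refine add_mem ?_ (heY l _ (hv.2 i).2)
        by_cases h : i = l
        · subst h; rw [S.fe, neg_lie]; exact neg_mem (hv.2 i).1
        · rw [S.fe_ne i l h, zero_lie]; exact zero_mem _
  exact ((hYZ hv).2 i).2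

end

/-- A grading `G = G₋₁ ⊕ G₀ ⊕ G₁` which is given by an inner derivation, where each of the elements
`e i` has degree `lam i`. -/
structure Chev.Grading {K ι G : Type*} [Field K] [LieRing G] [LieAlgebra K G]
    (S : Chev K ι G) where
  lam : ι → ℕ
  c : G
  ce : ∀ i, ⁅c, S.e i⁆ = (lam i : K) • S.e i
  cf : ∀ i, ⁅c, S.f i⁆ = -((lam i : K) • S.f i)
  lam_le : ∀ i, lam i ≤ 1
  exists_add : ∀ x : G, ∃ a b d, x = a + b + d ∧ ⁅c, a⁆ = a ∧ ⁅c, b⁆ = 0 ∧ ⁅c, d⁆ = -d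

namespace Chev.Grading

variable {K ι G : Type*} [Field K] [LieRing G] [LieAlgebra K G] {S : Chev K ι G}

/-- The opposite grading. -/
def swap (T : S.Grading) : S.swap.Grading where
  lam := T.lam
  c := -T.c
  ce i := by rw [neg_lie, show S.swap.e i = S.f i from rfl, T.cf, neg_neg]
  cf i := by rw [neg_lie, show S.swap.f i = S.e i from rfl, T.ce]
  lam_le := T.lam_le
  exists_add x := by
    obtain ⟨a, b, d, hx, ha, hb, hd⟩ := T.exists_add x
    exact ⟨d, b, a, by rw [hx]; abel, by rw [neg_lie, hd, neg_neg], by rw [neg_lie, hb, neg_zero],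
      by rw [neg_lie, ha]⟩

theorem eq_zero_of_c [CharZero K] (T : S.Grading) {μ : K} (h1 : μ ≠ 1) (h0 : μ ≠ 0) (h2 : μ ≠ -1)
    {x : G} (hx : ⁅T.c, x⁆ = μ • x) : x = 0 := by
  let χ : Fin 3 → K := ![1, 0, -1]
  refine eq_zero_of_mem_iSup_eigenspace (LieAlgebra.ad K G T.c) χ (ν := μ) ?_ hx ?_
  · intro b; fin_cases b
    exacts [h1.symm, h0.symm, h2.symm]
  · obtain ⟨a, b, d, rfl, ha, hb, hd⟩ := T.exists_add x
    refine add_mem (add_mem ?_ ?_) ?_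
    · refine Submodule.mem_iSup_of_mem (0 : Fin 3) (Module.End.mem_eigenspace_iff.mpr ?_)
      simpa [χ] using ha
    · refine Submodule.mem_iSup_of_mem (1 : Fin 3) (Module.End.mem_eigenspace_iff.mpr ?_)
      simpa [χ] using hb
    · refine Submodule.mem_iSup_of_mem (2 : Fin 3) (Module.End.mem_eigenspace_iff.mpr ?_)
      simpa [χ] using hd

/-- Elements of degree `1` commute. -/
theorem lie_eq_zero [CharZero K] (T : S.Grading) {x y : G} (hx : ⁅T.c, x⁆ = x) (hy : ⁅T.c, y⁆ = y) :
    ⁅x, y⁆ = 0 := by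
  refine T.eq_zero_of_c (μ := 2) (by norm_num) (by norm_num) ?_ ?_
  · intro h
    have : (3 : K) = 0 := by linear_combination h
    norm_num at this
  · rw [leibniz_lie, hx, hy, two_smul]

/-- A module `V` which is generated by a subspace `M` of "lowest degree" `s` with respect to the
grading. -/
structure IsLowest {V : Type*} [AddCommGroup V] [Module K V] [LieRingModule G V]
    (T : S.Grading) (M : Submodule K V) (s : K) : Prop where
  e_mem : ∀ k, T.lam k = 0 → ∀ v ∈ M, ⁅S.e k, v⁆ ∈ M
  f_mem : ∀ k, T.lam k = 0 → ∀ v ∈ M, ⁅S.f k, v⁆ ∈ M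
  h_mem : ∀ i, ∀ v ∈ M, ⁅S.h i, v⁆ ∈ M
  f_eq_zero : ∀ j, T.lam j ≠ 0 → ∀ v ∈ M, ⁅S.f j, v⁆ = 0
  c_lie : ∀ v ∈ M, ⁅T.c, v⁆ = s • v
  gen : ∀ X : Submodule K V, M ≤ X → (∀ i, ∀ v ∈ X, ⁅S.e i, v⁆ ∈ X) →
    (∀ i, ∀ v ∈ X, ⁅S.f i, v⁆ ∈ X) → X = ⊤

namespace IsLowest

variable {V : Type*} [AddCommGroup V] [Module K V] [LieRingModule G V] [LieModule K G V]
  {T : S.Grading} {M : Submodule K V} {s : K}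

/-- The module is already generated by `M` and the elements `e i`. -/
theorem eq_top_of_e (hM : T.IsLowest M s) (X : Submodule K V) (hX : M ≤ X)
    (he : ∀ i, ∀ v ∈ X, ⁅S.e i, v⁆ ∈ X) : X = ⊤ := by
  let ops : Set (Module.End K V) := Set.range fun i => LieModule.toEnd K G V (S.e i)
  have hYX : opClosure ops M ≤ X := opClosure_le hX (by rintro _ ⟨i, rfl⟩ v hv; exact he i v hv)
  have := hM.gen (opClosure ops M) (le_opClosure _ _)
    (fun i v hv => opClosure_stable (S := ops) ⟨i, rfl⟩ hv)
    fun i v hv => S.stable_opClosure_e hM.h_mem (fun i v hv => ?_) i hv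
  · exact top_le_iff.mp (this ▸ hYX)
  · by_cases hi : T.lam i = 0
    · exact hM.f_mem i hi v hv
    · rw [hM.f_eq_zero i hi v hv]; exact zero_mem _

variable (T M s) in
/-- The part of degree `s + n`. -/
def part (n : ℕ) : Submodule K V :=
  if n = 0 then M else (LieModule.toEnd K G V T.c).eigenspace (s + n)

theorem mem_part_of_pos {n : ℕ} (hn : n ≠ 0) {v : V} :
    v ∈ part T M s n ↔ ⁅T.c, v⁆ = (s + n) • v := by
  rw [part, if_neg hn, Module.End.mem_eigenspace_iff, LieModule.toEnd_apply_apply]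

theorem lie_of_mem_part (hM : T.IsLowest M s) {n : ℕ} {v : V} (hv : v ∈ part T M s n) :
    ⁅T.c, v⁆ = (s + n) • v := by
  by_cases hn : n = 0
  · subst hn
    rw [part, if_pos rfl] at hv
    simpa using hM.c_lie v hv
  · exact (mem_part_of_pos hn).mp hv

theorem iSup_part (hM : T.IsLowest M s) : ⨆ n, part T M s n = ⊤ := by
  refine hM.eq_top_of_e _ (le_iSup_of_le 0 (by rw [part, if_pos rfl])) fun i v hv => ?_
  have key : (⨆ n, part T M s n) ≤ (⨆ n, part T M s n).comap (LieModule.toEnd K G V (S.e i)) := by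
    refine iSup_le fun n v hv => ?_
    rw [Submodule.mem_comap, LieModule.toEnd_apply_apply]
    refine Submodule.mem_iSup_of_mem (n + T.lam i) ?_
    by_cases h0 : n + T.lam i = 0
    · obtain ⟨rfl, h2⟩ := Nat.add_eq_zero_iff.mp h0
      rw [h2, part, if_pos (by rfl)]
      rw [part, if_pos rfl] at hv
      exact hM.e_mem i h2 v hv
    · rw [mem_part_of_pos h0, leibniz_lie, T.ce, hM.lie_of_mem_part hv, smul_lie, lie_smul,
        ← add_smul]
      congr 1; push_cast; ring
  exact key hv

variable [CharZero K]

theorem mem_of_c_lie (hM : T.IsLowest M s) {v : V} (hv : ⁅T.c, v⁆ = s • v) : v ∈ M := by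
  have := mem_of_mem_iSup_of_eigenvector (LieModule.toEnd K G V T.c) (μ := fun n : ℕ => s + n)
    (fun a b h => by simpa using h) (F := part T M s)
    (fun n v hv => Module.End.mem_eigenspace_iff.mpr (hM.lie_of_mem_part hv)) (v := v) (b := 0)
    (by simpa using hv) (by rw [hM.iSup_part]; trivial)
  rwa [part, if_pos rfl] at this

theorem eq_zero_of_c_lie (hM : T.IsLowest M s) {v : V} (hv : ⁅T.c, v⁆ = (s - 1) • v) : v = 0 := by
  refine eq_zero_of_mem_iSup_eigenspace (LieModule.toEnd K G V T.c) (fun n : ℕ => s + n)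
    (ν := s - 1) (fun n h => ?_) hv ?_
  · have h1 : ((n + 1 : ℕ) : K) = 0 := by push_cast; linear_combination h
    exact Nat.succ_ne_zero n (by exact_mod_cast h1)
  · have : (⨆ n, part T M s n) ≤ ⨆ n : ℕ, (LieModule.toEnd K G V T.c).eigenspace (s + n) :=
      iSup_mono fun n v hv => Module.End.mem_eigenspace_iff.mpr (hM.lie_of_mem_part hv)
    exact this (by rw [hM.iSup_part]; trivial)

/-- `M` is stable under `G₀`. -/
theorem lie_mem (hM : T.IsLowest M s) {x : G} (hx : ⁅T.c, x⁆ = 0) {v : V} (hv : v ∈ M) :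
    ⁅x, v⁆ ∈ M :=
  hM.mem_of_c_lie (by rw [leibniz_lie, hx, zero_lie, zero_add, hM.c_lie v hv, lie_smul])

/-- `M` is annihilated by `G₋₁`. -/
theorem lie_eq_zero (hM : T.IsLowest M s) {x : G} (hx : ⁅T.c, x⁆ = -x) {v : V} (hv : v ∈ M) :
    ⁅x, v⁆ = 0 :=
  hM.eq_zero_of_c_lie (by
    rw [leibniz_lie, hx, hM.c_lie v hv, lie_smul, neg_lie, sub_smul, one_smul]; abel)

omit [CharZero K] in
theorem e_of_lam_ne_zero (T : S.Grading) {j : ι} (hj : T.lam j ≠ 0) : ⁅T.c, S.e j⁆ = S.e j := by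
  have : T.lam j = 1 := le_antisymm (T.lam_le j) (Nat.one_le_iff_ne_zero.mpr hj)
  rw [T.ce, this]; simp

/-- The module is already generated by `M` and `G₁`. -/
theorem eq_top_of_one (hM : T.IsLowest M s) (X : Submodule K V) (hX : M ≤ X)
    (h1 : ∀ x : G, ⁅T.c, x⁆ = x → ∀ v ∈ X, ⁅x, v⁆ ∈ X) : X = ⊤ := by
  let ops : Set (Module.End K V) := {t | ∃ x : G, ⁅T.c, x⁆ = x ∧ t = LieModule.toEnd K G V x}
  let Y := opClosure ops M
  have hYX : Y ≤ X := opClosure_le hX (by rintro _ ⟨x, hx, rfl⟩ v hv; exact h1 x hx v hv)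
  have hY : ∀ x : G, ⁅T.c, x⁆ = x → ∀ v ∈ Y, ⁅x, v⁆ ∈ Y := fun x hx v hv =>
    opClosure_stable (S := ops) ⟨x, hx, rfl⟩ hv
  refine top_le_iff.mp (le_of_eq_of_le (hM.eq_top_of_e Y (le_opClosure _ _) fun i => ?_).symm hYX)
  by_cases hi : T.lam i = 0
  · have : Y ≤ Y ⊓ Y.comap (LieModule.toEnd K G V (S.e i)) := by
      refine opClosure_le (fun v hv => ⟨le_opClosure _ _ hv, le_opClosure _ _ (hM.e_mem i hi v hv)⟩)
        ?_
      rintro _ ⟨x, hx, rfl⟩ v ⟨hv1, hv2⟩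
      refine ⟨hY x hx v hv1, ?_⟩
      change ⁅S.e i, ⁅x, v⁆⁆ ∈ Y
      rw [leibniz_lie]
      refine add_mem (hY _ ?_ v hv1) (hY x hx _ hv2)
      rw [leibniz_lie, T.ce, hi, hx]; simp
    exact fun v hv => (this hv).2
  · exact hY _ (e_of_lam_ne_zero T hi)

theorem commute (T : S.Grading) {x y : G} (hx : ⁅T.c, x⁆ = x) (hy : ⁅T.c, y⁆ = y) :
    Commute (LieModule.toEnd K G V x) (LieModule.toEnd K G V y) := by
  refine LinearMap.ext fun v => ?_
  simp only [Module.End.mul_apply, LieModule.toEnd_apply_apply]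
  rw [leibniz_lie, T.lie_eq_zero hx hy, zero_lie, zero_add]

/-- If the elements `e j` of degree `1` act nilpotently on `M`, then `G₁` acts nilpotently on
`V`. -/
theorem isNilpotent (hM : T.IsLowest M s)
    (hnil : ∀ j, T.lam j ≠ 0 → ∃ n : ℕ, ∀ v ∈ M, (LieModule.toEnd K G V (S.e j) ^ n) v = 0)
    {x : G} (hx : ⁅T.c, x⁆ = x) : IsNilpotent (LieModule.toEnd K G V x) := by
  have hadd : ∀ {a b : G}, (⁅T.c, a⁆ = a ∧ IsNilpotent (LieModule.toEnd K G V a)) →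
      (⁅T.c, b⁆ = b ∧ IsNilpotent (LieModule.toEnd K G V b)) →
      (⁅T.c, a + b⁆ = a + b ∧ IsNilpotent (LieModule.toEnd K G V (a + b))) := fun ha hb =>
    ⟨by rw [lie_add, ha.1, hb.1], by
      rw [map_add]; exact (commute T ha.1 hb.1).isNilpotent_add ha.2 hb.2⟩
  have hsmul : ∀ (t : K) {a : G}, (⁅T.c, a⁆ = a ∧ IsNilpotent (LieModule.toEnd K G V a)) →
      (⁅T.c, t • a⁆ = t • a ∧ IsNilpotent (LieModule.toEnd K G V (t • a))) := fun t a ha =>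
    ⟨by rw [lie_smul, ha.1], by rw [map_smul]; exact ha.2.smul t⟩
  have hlie : ∀ {y a : G}, ⁅T.c, y⁆ = 0 →
      (⁅T.c, a⁆ = a ∧ IsNilpotent (LieModule.toEnd K G V a)) →
      (⁅T.c, ⁅y, a⁆⁆ = ⁅y, a⁆ ∧ IsNilpotent (LieModule.toEnd K G V ⁅y, a⁆)) := by
    intro y a hy ha
    have h1 : ∀ {a : G}, ⁅T.c, a⁆ = a → ⁅T.c, ⁅y, a⁆⁆ = ⁅y, a⁆ := fun ha => by
      rw [leibniz_lie, hy, zero_lie, zero_add, ha]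
    refine ⟨h1 ha.1, isNilpotent_of_derivation (K := K) (y := LieModule.toEnd K G V y)
      (x₂ := LieModule.toEnd K G V ⁅y, ⁅y, a⁆⁆) ?_ ?_ (commute T ha.1 (h1 ha.1))
      (commute T (h1 ha.1) (h1 (h1 ha.1))) ha.2⟩
    · ext v; simp
    · ext v; simp
  -- The sums of a nilpotently acting element of degree `1` and elements of degrees `0` and `-1` form
  -- a subalgebra, which contains the generators.
  let E : LieSubalgebra K G :=
    { carrier := {x | ∃ a b d, x = a + b + d ∧
        (⁅T.c, a⁆ = a ∧ IsNilpotent (LieModule.toEnd K G V a)) ∧ ⁅T.c, b⁆ = 0 ∧ ⁅T.c, d⁆ = -d}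
      add_mem' := by
        rintro _ _ ⟨a, b, d, rfl, ha, hb, hd⟩ ⟨a', b', d', rfl, ha', hb', hd'⟩
        exact ⟨a + a', b + b', d + d', by abel, hadd ha ha', by rw [lie_add, hb, hb', add_zero],
          by rw [lie_add, hd, hd', neg_add]⟩
      zero_mem' := ⟨0, 0, 0, by simp, ⟨by simp, by rw [map_zero]; exact IsNilpotent.zero⟩, by simp,
        by simp⟩
      smul_mem' := by
        rintro t _ ⟨a, b, d, rfl, ha, hb, hd⟩
        exact ⟨t • a, t • b, t • d, by rw [smul_add, smul_add], hsmul t ha,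
          by rw [lie_smul, hb, smul_zero], by rw [lie_smul, hd, smul_neg]⟩
      lie_mem' := by
        rintro _ _ ⟨a, b, d, rfl, ha, hb, hd⟩ ⟨a', b', d', rfl, ha', hb', hd'⟩
        refine ⟨⁅b, a'⁆ - ⁅b', a⁆, ⁅a, d'⁆ + ⁅b, b'⁆ + ⁅d, a'⁆, ⁅b, d'⁆ + ⁅d, b'⁆, ?_, ?_, ?_, ?_⟩
        · have h1 : ⁅a, a'⁆ = 0 := T.lie_eq_zero ha.1 ha'.1
          have h2 : ⁅d, d'⁆ = 0 := T.swap.lie_eq_zero (x := d) (y := d')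
            (by rw [show T.swap.c = -T.c from rfl, neg_lie, hd, neg_neg])
            (by rw [show T.swap.c = -T.c from rfl, neg_lie, hd', neg_neg])
          simp only [add_lie, lie_add, h1, h2, ← lie_skew a b']
          abel
        · have := hadd (hlie hb ha') (hsmul (-1) (hlie hb' ha))
          rwa [neg_one_smul, ← sub_eq_add_neg] at this
        · simp only [lie_add, leibniz_lie T.c, ha.1, ha'.1, hb, hb', hd, hd', zero_lie, lie_zero,
            lie_neg, neg_lie]
          abel
        · simp only [lie_add, leibniz_lie T.c, hb, hb', hd, hd', zero_lie, lie_zero, lie_neg,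
            neg_lie]
          abel }
  have hE : E = ⊤ := by
    refine S.gen E (fun i => ?_) fun i => ?_
    · by_cases hi : T.lam i = 0
      · refine ⟨0, S.e i, 0, by simp, ⟨by simp, by rw [map_zero]; exact IsNilpotent.zero⟩, ?_,
          by simp⟩
        rw [T.ce, hi]; simp
      · refine ⟨S.e i, 0, 0, by simp, ⟨e_of_lam_ne_zero T hi, ?_⟩, by simp, by simp⟩
        obtain ⟨n, hn⟩ := hnil i hi
        refine ⟨n, ?_⟩
        -- The power of `e i` that annihilates `M` commutes with the action of `G₁` on `V = U(G₁) M`.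
        have := hM.eq_top_of_one (LinearMap.ker (LieModule.toEnd K G V (S.e i) ^ n)) hn
          fun x hx v hv => ?_
        · exact LinearMap.ker_eq_top.mp this
        · have hc := (commute (V := V) T (e_of_lam_ne_zero T hi) hx).pow_left n
          rw [LinearMap.mem_ker] at hv ⊢
          rw [← LieModule.toEnd_apply_apply K, ← Module.End.mul_apply, hc.eq, Module.End.mul_apply,
            hv, map_zero]
    · by_cases hi : T.lam i = 0
      · refine ⟨0, S.f i, 0, by simp, ⟨by simp, by rw [map_zero]; exact IsNilpotent.zero⟩, ?_,
          by simp⟩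
        rw [T.cf, hi]; simp
      · refine ⟨0, 0, S.f i, by simp, ⟨by simp, by rw [map_zero]; exact IsNilpotent.zero⟩, by simp,
          ?_⟩
        have : T.lam i = 1 := le_antisymm (T.lam_le i) (Nat.one_le_iff_ne_zero.mpr hi)
        rw [T.cf, this]; simp
  have hxE : x ∈ E := hE ▸ LieSubalgebra.mem_top x
  obtain ⟨a, b, d, h, ha, hb, hd⟩ := hxE
  -- applying `ad c` twice to `x = a + b + d` gives `x = a + d` and `x = a - d`
  have h1 : x = a - d := by
    rw [← hx, h, lie_add, lie_add, ha.1, hb, hd]; abel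
  have h2 : x = a + d := by
    rw [← hx, h1, lie_sub, ha.1, hd]; abel
  have h3 : x = a := by
    have : (2 : K) • x = (2 : K) • a := by
      rw [two_smul, two_smul]; nth_rewrite 1 [h1]; rw [h2]; abel
    exact smul_right_injective _ (two_ne_zero' K) this
  rw [h3]
  exact ha.2

theorem finiteDimensional [FiniteDimensional K G] (hM : T.IsLowest M s) [FiniteDimensional K M]
    (hnil : ∀ j, T.lam j ≠ 0 → ∃ n : ℕ, ∀ v ∈ M, (LieModule.toEnd K G V (S.e j) ^ n) v = 0) :
    FiniteDimensional K V := by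
  classical
  let G₁ : Submodule K G := (LieAlgebra.ad K G T.c).eigenspace 1
  have hG : ∀ {x}, x ∈ G₁ ↔ ⁅T.c, x⁆ = x := fun {x} => by
    rw [Module.End.mem_eigenspace_iff, one_smul, LieAlgebra.ad_apply]
  obtain ⟨t, ht⟩ : G₁.FG := IsNoetherian.noetherian _
  have ht' : ∀ x ∈ t, ⁅T.c, x⁆ = x := fun x hx => hG.mp (ht ▸ Submodule.subset_span hx)
  obtain ⟨X, hX, hfin, hst⟩ := exists_finiteDimensional_stable (t.image (LieModule.toEnd K G V))
    (by
      intro a ha b hb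
      obtain ⟨x, hx, rfl⟩ := Finset.mem_image.mp ha
      obtain ⟨y, hy, rfl⟩ := Finset.mem_image.mp hb
      exact commute T (ht' x hx) (ht' y hy))
    (by
      intro a ha
      obtain ⟨x, hx, rfl⟩ := Finset.mem_image.mp ha
      exact hM.isNilpotent hnil (ht' x hx)) M
  have hX' : X = ⊤ := by
    refine hM.eq_top_of_one X hX fun x hx v hv => ?_
    have h1 := hG.mpr hx
    clear hx
    rw [← ht] at h1
    induction h1 using Submodule.span_induction with
    | mem x hx => exact hst _ (Finset.mem_image_of_mem _ hx) v hv
    | zero => rw [zero_lie]; exact zero_mem _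
    | add x y _ _ hx hy => rw [add_lie]; exact add_mem hx hy
    | smul a x _ hx => rw [smul_lie]; exact Submodule.smul_mem _ _ hx
  rw [hX'] at hfin
  exact Module.finite_def.mpr ((Submodule.fg_top _).mp (Module.finite_def.mp hfin))

/-- A submodule that intersects `M` trivially is zero. -/
theorem eq_bot [FiniteDimensional K G] [LieAlgebra.IsSimple K G] (hM : T.IsLowest M s)
    [FiniteDimensional K M]
    (hnil : ∀ j, T.lam j ≠ 0 → ∃ n : ℕ, ∀ v ∈ M, (LieModule.toEnd K G V (S.e j) ^ n) v = 0)
    (N : LieSubmodule K G V) (hN : ∀ v ∈ N, v ∈ M → v = 0) : N = ⊥ := by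
  have := hM.finiteDimensional hnil
  obtain ⟨p, hp, hp'⟩ := exists_equivariant_projection N
  have hker : LinearMap.ker p.toLinearMap = ⊤ := by
    refine hM.gen _ (fun v hv => ?_) (fun i v hv => ?_) fun i v hv => ?_
    · refine hN _ (hp v) (hM.mem_of_c_lie ?_)
      change ⁅T.c, p v⁆ = s • p v
      rw [← LieModuleHom.map_lie, hM.c_lie v hv, map_smul]
    · rw [LinearMap.mem_ker] at hv ⊢
      change p ⁅S.e i, v⁆ = 0
      rw [LieModuleHom.map_lie, show p v = 0 from hv, lie_zero]
    · rw [LinearMap.mem_ker] at hv ⊢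
      change p ⁅S.f i, v⁆ = 0
      rw [LieModuleHom.map_lie, show p v = 0 from hv, lie_zero]
  rw [LieSubmodule.eq_bot_iff]
  intro v hv
  have : v ∈ LinearMap.ker p.toLinearMap := hker ▸ Submodule.mem_top
  rw [← hp' v hv]
  exact this

end IsLowest

end Chev.Grading

namespace Chev

section

variable {K ι G : Type*} [Field K] [CharZero K] [LieRing G] [LieAlgebra K G] (S : Chev K ι G)
  [Fintype ι] [DecidableEq ι]

omit [CharZero K] [DecidableEq ι] in
theorem sum_smul_h_lie_e (r : ι → K) (j : ι) :
    ⁅∑ i, r i • S.h i, S.e j⁆ = (∑ i, r i * (S.A i j : K)) • S.e j := by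
  simp only [sum_lie, smul_lie, S.he, smul_smul, Finset.sum_smul]

omit [CharZero K] [DecidableEq ι] in
theorem sum_smul_h_lie_f (r : ι → K) (j : ι) :
    ⁅∑ i, r i • S.h i, S.f j⁆ = -((∑ i, r i * (S.A i j : K)) • S.f j) := by
  simp only [sum_lie, smul_lie, S.hf, smul_neg, smul_smul, Finset.sum_smul, Finset.sum_neg_distrib]

theorem det_map_ne_zero (hA : S.A.det ≠ 0) : (S.A.map (Int.cast : ℤ → K)).det ≠ 0 := by
  have h1 := (Int.castRingHom K).map_det S.A
  rw [RingHom.mapMatrix_apply] at h1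
  change (S.A.map (Int.castRingHom K)).det ≠ 0
  rw [← h1]
  simpa using hA

/-- Each assignment of degrees to the generators is given by an element of the Cartan subalgebra. -/
theorem exists_vecMul_eq (hA : S.A.det ≠ 0) (b : ι → K) :
    ∃ r : ι → K, ∀ j, ∑ i, r i * (S.A i j : K) = b j := by
  refine ⟨Matrix.vecMul b (S.A.map (Int.cast : ℤ → K))⁻¹, fun j => ?_⟩
  have : Matrix.vecMul (Matrix.vecMul b (S.A.map (Int.cast : ℤ → K))⁻¹)
      (S.A.map (Int.cast : ℤ → K)) = b := by
    rw [Matrix.vecMul_vecMul, Matrix.nonsing_inv_mul _ (isUnit_iff_ne_zero.mpr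
      (S.det_map_ne_zero hA)), Matrix.vecMul_one]
  exact congrFun this j

/-- The generators are nilpotent in each finite-dimensional representation. -/
theorem _root_.Cartanification.isNilpotent_of_bracket_eq_self {K V : Type*} [Field K] [CharZero K]
    [AddCommGroup V] [Module K V] [FiniteDimensional K V] {D x : Module.End K V}
    (h : D * x - x * D = x) : IsNilpotent x := by
  let δ : Module.End K (Module.End K V) := LinearMap.mulLeft K D - LinearMap.mulRight K D
  have hδ : ∀ n : ℕ, δ (x ^ n) = (n : K) • x ^ n := by
    intro n
    induction n with
    | zero => simp [δ]
    | succ n ih =>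
      have h1 : δ (x ^ n * x) = δ (x ^ n) * x + x ^ n * δ x := by
        simp only [δ, LinearMap.sub_apply, LinearMap.mulLeft_apply, LinearMap.mulRight_apply,
          sub_mul, mul_sub, mul_assoc]
        abel
      have h2 : δ x = x := h
      rw [pow_succ, h1, h2, ih, smul_mul_assoc]
      push_cast
      rw [add_smul, one_smul]
  by_contra hx
  have h1 : ∀ n : ℕ, δ.HasEigenvalue (n : K) := fun n =>
    Module.End.hasEigenvalue_of_hasEigenvector
      ⟨Module.End.mem_eigenspace_iff.mpr (hδ n), fun h0 => hx ⟨n, h0⟩⟩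
  exact Set.infinite_of_injective_forall_mem (Nat.cast_injective (R := K)) h1
    (Module.End.finite_hasEigenvalue δ)

theorem isNilpotent_ad [FiniteDimensional K G] (hA : S.A.det ≠ 0) (k : ι) :
    IsNilpotent (LieAlgebra.ad K G (S.e k)) := by
  obtain ⟨r, hr⟩ := S.exists_vecMul_eq hA fun _ => (1 : K)
  refine isNilpotent_of_bracket_eq_self (D := LieAlgebra.ad K G (∑ i, r i • S.h i)) ?_
  have h1 := S.sum_smul_h_lie_e r k
  rw [hr, one_smul] at h1
  ext v
  simp only [LinearMap.sub_apply, Module.End.mul_apply, LieAlgebra.ad_apply]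
  rw [leibniz_lie, h1]; abel

/-- Vectors on which `e k` acts nilpotently form a submodule, since `ad (e k)` is nilpotent. -/
theorem lie_mem_maxGenEigenspace [FiniteDimensional K G] (hA : S.A.det ≠ 0) (k : ι) {V : Type*}
    [AddCommGroup V] [Module K V] [LieRingModule G V] [LieModule K G V] (y : G) {v : V}
    (hv : v ∈ (LieModule.toEnd K G V (S.e k)).maxGenEigenspace 0) :
    ⁅y, v⁆ ∈ (LieModule.toEnd K G V (S.e k)).maxGenEigenspace 0 := by
  have hy : y ∈ (LieModule.toEnd K G G (S.e k)).maxGenEigenspace 0 := by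
    rw [Module.End.mem_maxGenEigenspace, zero_smul, sub_zero]
    obtain ⟨n, hn⟩ := S.isNilpotent_ad hA k
    refine ⟨n, ?_⟩
    have h2 : LieModule.toEnd K G G (S.e k) = LieAlgebra.ad K G (S.e k) := rfl
    rw [h2, hn, LinearMap.zero_apply]
  have := LieModule.lie_mem_maxGenEigenspace_toEnd hy hv
  rwa [add_zero] at this

end

/-! ### Modules of the degree zero part generated by vectors of weight zero -/

namespace Grading

variable {K ι G : Type*} [Field K] [LieRing G] [LieAlgebra K G] {S : Chev K ι G}
  {V : Type*} [AddCommGroup V] [Module K V] [LieRingModule G V]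

/-- A space of vectors with the same weight `χ`, where `χ` vanishes on the semisimple part of `G₀`,
which is stable under the products `e k * f l` and `f k * e l` of generators of degree zero. -/
structure IsCore (T : S.Grading) (U : Submodule K V) (χ : ι → K) : Prop where
  h_lie : ∀ i, ∀ v ∈ U, ⁅S.h i, v⁆ = χ i • v
  χ_eq_zero : ∀ k, T.lam k = 0 → χ k = 0
  ef_mem : ∀ k l, T.lam k = 0 → T.lam l = 0 → ∀ v ∈ U, ⁅S.e k, ⁅S.f l, v⁆⁆ ∈ U
  fe_mem : ∀ k l, T.lam k = 0 → T.lam l = 0 → ∀ v ∈ U, ⁅S.f k, ⁅S.e l, v⁆⁆ ∈ U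

namespace IsCore

theorem swap {T : S.Grading} {U : Submodule K V} {χ : ι → K} (hU : T.IsCore U χ) :
    T.swap.IsCore U (-χ) where
  h_lie i v hv := by
    rw [show S.swap.h i = -S.h i from rfl, neg_lie, hU.h_lie i v hv, Pi.neg_apply, neg_smul]
  χ_eq_zero k hk := by rw [Pi.neg_apply, hU.χ_eq_zero k hk, neg_zero]
  ef_mem := hU.fe_mem
  fe_mem := hU.ef_mem

variable [LieModule K G V]

/-- The span of the vectors `e k₁ ⋯ e kₙ u` with `u ∈ U`, for generators of degree zero. -/
def words (T : S.Grading) (U : Submodule K V) : ℕ → Submodule K V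
  | 0 => U
  | n + 1 => ⨆ k : {k // T.lam k = 0}, (words T U n).map (LieModule.toEnd K G V (S.e k))

variable {T : S.Grading} {U : Submodule K V} {χ : ι → K}

theorem e_mem_words {n : ℕ} {k : ι} (hk : T.lam k = 0) {v : V} (hv : v ∈ words T U n) :
    ⁅S.e k, v⁆ ∈ words T U (n + 1) :=
  Submodule.mem_iSup_of_mem (⟨k, hk⟩ : {k // T.lam k = 0}) ⟨v, hv, rfl⟩

theorem words_succ_le {n : ℕ} {X : Submodule K V}
    (h : ∀ k, T.lam k = 0 → ∀ v ∈ words T U n, ⁅S.e k, v⁆ ∈ X) : words T U (n + 1) ≤ X := by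
  refine iSup_le fun k => ?_
  rintro _ ⟨v, hv, rfl⟩
  exact h k k.2 v hv

theorem h_mem_words (hU : T.IsCore U χ) (i : ι) (n : ℕ) : ∀ v ∈ words T U n,
    ⁅S.h i, v⁆ ∈ words T U n := by
  induction n with
  | zero => intro v hv; rw [hU.h_lie i v hv]; exact Submodule.smul_mem _ _ hv
  | succ n ih =>
    have : words T U (n + 1) ≤ (words T U (n + 1)).comap (LieModule.toEnd K G V (S.h i)) := by
      refine words_succ_le fun k hk v hv => ?_
      rw [Submodule.mem_comap, LieModule.toEnd_apply_apply, leibniz_lie, S.he, smul_lie]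
      exact add_mem (Submodule.smul_mem _ _ (e_mem_words hk hv)) (e_mem_words hk (ih v hv))
    exact fun v hv => this hv

theorem f_mem_words (hU : T.IsCore U χ) {k : ι} (hk : T.lam k = 0) (n : ℕ) :
    ∀ v ∈ words T U (n + 1), ⁅S.f k, v⁆ ∈ words T U n := by
  induction n with
  | zero =>
    have : words T U 1 ≤ U.comap (LieModule.toEnd K G V (S.f k)) :=
      words_succ_le fun l hl v hv => hU.fe_mem k l hk hl v hv
    exact fun v hv => this hv
  | succ n ih =>
    have : words T U (n + 2) ≤ (words T U (n + 1)).comap (LieModule.toEnd K G V (S.f k)) := by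
      refine words_succ_le fun l hl v hv => ?_
      rw [Submodule.mem_comap, LieModule.toEnd_apply_apply, leibniz_lie]
      refine add_mem ?_ (e_mem_words hl (ih v hv))
      by_cases h : k = l
      · subst h; rw [S.fe, neg_lie]; exact neg_mem (hU.h_mem_words k _ v hv)
      · rw [S.fe_ne k l h, zero_lie]; exact zero_mem _
    exact fun v hv => this hv

/-- Words of the generators `e k` and `f k` of degree zero applied to `U` are spanned by those which
involve only generators `e k` and those which involve only generators `f k`. -/
theorem eq_sup_words (hU : T.IsCore U χ) (X : Submodule K V) (hp : ∀ n, words T U n ≤ X)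
    (hm : ∀ n, words T.swap U n ≤ X) :
    opClosure {t | ∃ k, T.lam k = 0 ∧ (t = LieModule.toEnd K G V (S.e k) ∨
      t = LieModule.toEnd K G V (S.f k))} U ≤ X := by
  suffices h : opClosure {t | ∃ k, T.lam k = 0 ∧ (t = LieModule.toEnd K G V (S.e k) ∨
      t = LieModule.toEnd K G V (S.f k))} U ≤ (⨆ n, words T U n) ⊔ ⨆ n, words T.swap U n from
    h.trans (sup_le (iSup_le hp) (iSup_le hm))
  refine opClosure_le (le_sup_of_le_left (le_iSup_of_le 0 le_rfl)) ?_
  have key : ∀ {S : Chev K ι G} {T : S.Grading} {χ : ι → K}, T.IsCore U χ → ∀ k, T.lam k = 0 →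
      (⨆ n, words T U n) ⊔ (⨆ n, words T.swap U n) ≤
      ((⨆ n, words T U n) ⊔ ⨆ n, words T.swap U n).comap (LieModule.toEnd K G V (S.e k)) := by
    intro S T χ hU k hk
    refine sup_le (iSup_le fun n v hv => ?_) (iSup_le fun n v hv => ?_)
    · exact Submodule.mem_sup_left (Submodule.mem_iSup_of_mem (n + 1) (e_mem_words hk hv))
    · cases n with
      | zero => exact Submodule.mem_sup_left (Submodule.mem_iSup_of_mem 1 (e_mem_words hk hv))
      | succ n =>
        exact Submodule.mem_sup_right (Submodule.mem_iSup_of_mem n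
          (hU.swap.f_mem_words (S := S.swap) (T := T.swap) hk n v hv))
  rintro _ ⟨k, hk, rfl | rfl⟩ v hv
  · exact key hU k hk hv
  · have h1 := key hU.swap k hk
    have h2 : ∀ n, words T.swap.swap U n = words T U n := by
      intro n
      induction n with
      | zero => rfl
      | succ n ih => simp only [words, ih]; rfl
    simp only [h2] at h1
    rw [sup_comm] at h1
    exact h1 hv

variable [CharZero K] [Fintype ι] [DecidableEq ι] [FiniteDimensional K G]

/-- A word of positive length that is annihilated by all generators `f k` of degree zero is zero,
since its weight components are lowest weight vectors. -/
theorem eq_zero_of_f_lie (hU : T.IsCore U χ) (hA : S.A.det ≠ 0)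
    (hdiag : ∀ i, S.A i i = 2) (hpos : ∀ a : ι → ℕ,
      (∀ k, a k ≠ 0 → ∑ l, S.A k l * (a l : ℤ) ≤ 0) → a = 0)
    (hnil : ∀ k, T.lam k = 0 → U ≤ (LieModule.toEnd K G V (S.e k)).maxGenEigenspace 0)
    {n : ℕ} {v : V}
    (hv : v ∈ words T U (n + 1)) (hf : ∀ k, T.lam k = 0 → ⁅S.f k, v⁆ = 0) : v = 0 := by
  -- The weights of words are `χ` plus sums of simple roots. They are distinct, so that every weight
  -- component of `v` is also annihilated by all `f k`.
  let wt : (ι → ℕ) → ι → K := fun a i => χ i + ∑ l, (S.A i l : K) * (a l : K)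
  let F : {a : ι → ℕ // ∑ i, a i = n + 1 ∧ ∀ i, a i ≠ 0 → T.lam i = 0} → Submodule K V := fun a =>
    ⨅ i, (LieModule.toEnd K G V (S.h i)).eigenspace (wt a i)
  have hwords : ∀ m, words T U m ≤
      ⨆ a : {a : ι → ℕ // ∑ i, a i = m ∧ ∀ i, a i ≠ 0 → T.lam i = 0},
        ⨅ i, (LieModule.toEnd K G V (S.h i)).eigenspace (wt a i) := by
    intro m
    induction m with
    | zero =>
      refine le_iSup_of_le ⟨0, by simp⟩ (le_iInf fun i v hv => ?_)
      rw [Module.End.mem_eigenspace_iff]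
      simpa [wt] using hU.h_lie i v hv
    | succ m ih =>
      refine words_succ_le fun k hk v hv => ?_
      have h1 := ih hv
      clear hv
      induction h1 using Submodule.iSup_induction' with
      | mem a v hv =>
        refine Submodule.mem_iSup_of_mem ⟨Pi.single k 1 + a.1, ?_, ?_⟩ ?_
        · simp [Finset.sum_add_distrib, a.2.1, add_comm]
        · intro i hi
          by_cases h : i = k
          · rw [h]; exact hk
          · exact a.2.2 i (by simpa [Pi.single_apply, h] using hi)
        · rw [Submodule.mem_iInf] at hv ⊢
          intro i
          have h2 := Module.End.mem_eigenspace_iff.mp (hv i)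
          rw [LieModule.toEnd_apply_apply] at h2
          rw [Module.End.mem_eigenspace_iff, LieModule.toEnd_apply_apply, leibniz_lie, S.he, h2,
            smul_lie, lie_smul, ← add_smul]
          congr 1
          simp [wt, mul_add, Finset.sum_add_distrib, Pi.single_apply]
          ring
      | zero => rw [lie_zero]; exact zero_mem _
      | add x y _ _ hx hy => rw [lie_add]; exact add_mem hx hy
  have h1 : v ∈ ⨆ a, F a := hwords (n + 1) hv
  obtain ⟨w, hw, hsum⟩ := (Submodule.mem_iSup_iff_exists_finsupp F v).mp h1
  let N : Submodule K V := ⨅ k : {k // T.lam k = 0}, LinearMap.ker (LieModule.toEnd K G V (S.f k)) ⊓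
    (LieModule.toEnd K G V (S.e k)).maxGenEigenspace 0
  have hN : ∀ {v}, v ∈ N ↔ ∀ k, T.lam k = 0 → ⁅S.f k, v⁆ = 0 ∧
      v ∈ (LieModule.toEnd K G V (S.e k)).maxGenEigenspace 0 := by
    intro v
    simp [N, Submodule.mem_iInf, -Module.End.mem_maxGenEigenspace]
  have hNst : ∀ i, ∀ v ∈ N, LieModule.toEnd K G V (S.h i) v ∈ N := by
    intro i v hv
    rw [hN] at hv ⊢
    intro k hk
    rw [LieModule.toEnd_apply_apply]
    refine ⟨?_, S.lie_mem_maxGenEigenspace hA k _ (hv k hk).2⟩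
    rw [leibniz_lie, (hv k hk).1, lie_zero, add_zero, S.fh, smul_lie, (hv k hk).1, smul_zero]
  have hw' : ∀ a i, ⁅S.h i, w a⁆ = wt a i • w a := fun a i => by
    have := hw a
    rw [Submodule.mem_iInf] at this
    exact Module.End.mem_eigenspace_iff.mp (this i)
  have hcomp : ∀ a ∈ w.support, w a ∈ N := by
    refine mem_of_sum_mem (T := fun i => LieModule.toEnd K G V (S.h i)) hNst w.support
      (χ := fun a => wt a) ?_ (fun a _ i => hw' a i) ?_
    · intro a _ b _ hab heq
      refine hab (Subtype.ext (funext fun l => ?_))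
      have h2 : (S.A.map (Int.cast : ℤ → K)).mulVec (fun l => (a.1 l : K) - b.1 l) = 0 := by
        funext i
        have := congrFun heq i
        simp only [wt, add_right_inj] at this
        simp only [Matrix.mulVec, dotProduct, Matrix.map_apply, mul_sub, Finset.sum_sub_distrib,
          Pi.zero_apply, this, sub_self]
      have h3 := congrFun (Matrix.eq_zero_of_mulVec_eq_zero (S.det_map_ne_zero hA) h2) l
      exact_mod_cast sub_eq_zero.mp h3
    · have : ∑ a ∈ w.support, w a = v := hsum
      rw [this, hN]
      refine fun k hk => ⟨hf k hk, ?_⟩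
      have hle : ∀ m, words T U m ≤ (LieModule.toEnd K G V (S.e k)).maxGenEigenspace 0 := by
        intro m
        induction m with
        | zero => exact hnil k hk
        | succ m ih =>
          exact words_succ_le fun l _ v hv => S.lie_mem_maxGenEigenspace hA k _ (ih hv)
      exact hle _ hv
  have hzero : ∀ a ∈ w.support, w a = 0 := by
    intro a ha
    by_contra hne
    have h4 := hN.mp (hcomp a ha)
    have h5 : a.1 = 0 := by
      -- A lowest weight vector on which `e k` acts nilpotently has nonpositive weight for `h k`, which
      -- excludes a nonzero sum of simple roots.
      refine hpos a.1 fun k hk => ?_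
      have hk' := a.2.2 k hk
      obtain ⟨h4k, h4e⟩ := h4 k hk'
      rw [Module.End.mem_maxGenEigenspace, zero_smul, sub_zero] at h4e
      obtain ⟨m, hm⟩ := h4e
      obtain ⟨p, -, hp⟩ := exists_weight_eq_neg (S.ef k) (by rw [S.he, hdiag]; norm_num) hne
        h4k (hw' a k) hm
      simp only [wt, hU.χ_eq_zero k hk', zero_add] at hp
      have h6 : ∑ l, S.A k l * (a.1 l : ℤ) = -(p : ℤ) := by exact_mod_cast hp
      rw [h6]; omega
    have h7 := a.2.1
    rw [h5] at h7
    simp at h7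
  rw [← hsum]
  exact Finset.sum_eq_zero hzero

/-- A submodule that intersects `U` trivially intersects the module generated by `U` under the
generators of degree zero trivially. -/
theorem eq_zero_of_mem (hU : T.IsCore U χ) (hA : S.A.det ≠ 0)
    (hdiag : ∀ i, S.A i i = 2) (hpos : ∀ a : ι → ℕ,
      (∀ k, a k ≠ 0 → ∑ l, S.A k l * (a l : ℤ) ≤ 0) → a = 0)
    (hnil : ∀ k, T.lam k = 0 → U ≤ (LieModule.toEnd K G V (S.e k)).maxGenEigenspace 0)
    (hnil' : ∀ k, T.lam k = 0 → U ≤ (LieModule.toEnd K G V (S.f k)).maxGenEigenspace 0)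
    (N : LieSubmodule K G V) (hN : ∀ v ∈ N, v ∈ U → v = 0) {v : V} (hv : v ∈ N)
    (hv' : v ∈ opClosure {t | ∃ k, T.lam k = 0 ∧ (t = LieModule.toEnd K G V (S.e k) ∨
      t = LieModule.toEnd K G V (S.f k))} U) : v = 0 := by
  -- The generators `f k` map a word in the `e k` to a shorter one, which is zero by induction.
  have hp : ∀ n, ∀ v ∈ N, v ∈ words T U n → v = 0 := by
    intro n
    induction n with
    | zero => exact hN
    | succ n ih =>
      exact fun v hv h => hU.eq_zero_of_f_lie hA hdiag hpos hnil h fun k hk =>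
        ih _ (LieSubmodule.lie_mem _ hv) (hU.f_mem_words hk n v h)
  have hm : ∀ n, ∀ v ∈ N, v ∈ words T.swap U n → v = 0 := by
    intro n
    induction n with
    | zero => exact hN
    | succ n ih =>
      exact fun v hv h => hU.swap.eq_zero_of_f_lie (S := S.swap) (T := T.swap) hA hdiag hpos hnil' h
        fun k hk => ih _ (LieSubmodule.lie_mem _ hv)
          (hU.swap.f_mem_words (S := S.swap) (T := T.swap) hk n v h)
  obtain ⟨r, hr⟩ := S.exists_vecMul_eq hA fun _ => (1 : K)
  -- The element `ρ` distinguishes the lengths of words, hence `N` contains the homogeneous components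
  -- of `v`.
  let ρ : G := ∑ i, r i • S.h i
  have hρU : ∀ v ∈ U, ⁅ρ, v⁆ = (∑ i, r i * χ i) • v := fun v hv => by
    rw [sum_lie, Finset.sum_smul]
    exact Finset.sum_congr rfl fun i _ => by rw [smul_lie, hU.h_lie i v hv, smul_smul]
  have hρe : ∀ j, ⁅ρ, S.e j⁆ = S.e j := fun j => by
    rw [sum_smul_h_lie_e, hr, one_smul]
  have hρf : ∀ j, ⁅ρ, S.f j⁆ = -S.f j := fun j => by
    rw [sum_smul_h_lie_f, hr, one_smul]
  have h1 : ∀ n : ℕ, ∀ v ∈ words T U n, ⁅ρ, v⁆ = ((∑ i, r i * χ i) + n) • v := by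
    intro n
    induction n with
    | zero => intro v hv; simpa using hρU v hv
    | succ n ih =>
      have : words T U (n + 1) ≤ (LieModule.toEnd K G V ρ).eigenspace
          ((∑ i, r i * χ i) + (n + 1 : ℕ)) := by
        refine words_succ_le fun k hk v hv => ?_
        rw [Module.End.mem_eigenspace_iff, LieModule.toEnd_apply_apply, leibniz_lie, hρe, ih v hv,
          lie_smul]
        push_cast
        module
      exact fun v hv => Module.End.mem_eigenspace_iff.mp (this hv)
  have h2 : ∀ n : ℕ, ∀ v ∈ words T.swap U n, ⁅ρ, v⁆ = ((∑ i, r i * χ i) - n) • v := by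
    intro n
    induction n with
    | zero => intro v hv; simpa using hρU v hv
    | succ n ih =>
      have : words T.swap U (n + 1) ≤ (LieModule.toEnd K G V ρ).eigenspace
          ((∑ i, r i * χ i) - (n + 1 : ℕ)) := by
        refine words_succ_le (S := S.swap) (T := T.swap) fun k hk v hv => ?_
        rw [show S.swap.e k = S.f k from rfl]
        rw [Module.End.mem_eigenspace_iff, LieModule.toEnd_apply_apply, leibniz_lie, hρf, ih v hv,
          lie_smul, neg_lie, ← neg_one_smul K, ← add_smul]
        congr 1; push_cast; ring
      exact fun v hv => Module.End.mem_eigenspace_iff.mp (this hv)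
  let F : ℤ → Submodule K V := fun n =>
    if 0 ≤ n then words T U n.toNat else words T.swap U (-n).toNat
  have hF : ∀ n : ℤ, ∀ v ∈ F n, ⁅ρ, v⁆ = ((∑ i, r i * χ i) + n) • v := by
    intro n v hv
    by_cases hn : 0 ≤ n
    · simp only [F, if_pos hn] at hv
      rw [h1 _ v hv]
      congr 2
      exact_mod_cast congrArg (Int.cast : ℤ → K) (Int.toNat_of_nonneg hn)
    · simp only [F, if_neg hn] at hv
      rw [h2 _ v hv, sub_eq_add_neg]
      congr 2
      have := congrArg (Int.cast : ℤ → K) (Int.toNat_of_nonneg (a := -n) (by omega))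
      push_cast at this
      rw [this, neg_neg]
  have hFN : ∀ n : ℤ, ∀ v ∈ N, v ∈ F n → v = 0 := by
    intro n v hv h
    by_cases hn : 0 ≤ n
    · simp only [F, if_pos hn] at h; exact hp _ v hv h
    · simp only [F, if_neg hn] at h; exact hm _ v hv h
  have h3 : v ∈ ⨆ n, F n := by
    refine hU.eq_sup_words _ (fun n => ?_) (fun n => ?_) hv'
    · refine le_iSup_of_le (n : ℤ) ?_
      simp [F]
    · refine le_iSup_of_le (-(n : ℤ)) ?_
      rcases Nat.eq_zero_or_pos n with rfl | h
      · simp [F, words]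
      · simp [F, h.ne']
  obtain ⟨w, hw, hsum⟩ := (Submodule.mem_iSup_iff_exists_finsupp F v).mp h3
  have hsum' : ∑ a ∈ w.support, w a = v := hsum
  have hcomp := mem_of_sum_mem (ι := Unit) (T := fun _ => LieModule.toEnd K G V ρ)
    (N := N.toSubmodule) (fun _ v hv => LieSubmodule.lie_mem _ hv) w.support
    (χ := fun n _ => (∑ i, r i * χ i) + (n : K))
    (fun a _ b _ hab h => hab (by simpa using congrFun h ()))
    (fun a _ _ => hF a _ (hw a)) (by rw [hsum']; exact hv)
  rw [← hsum']
  exact Finset.sum_eq_zero fun a ha => hFN a _ (hcomp a ha) (hw a)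

end IsCore

end Grading

end Chev

end Cartanification

namespace Cartanification

/-! ### Quotients of the free Lie superalgebra -/

universe u v

section Quot

variable {K : Type u} [Field K] {X : Type v} {E : Type*} [AddCommGroup E] [Module K E]

/-- The span of the images of the words of degree `k` with respect to `g`. -/
def wordSpan (π : FreeNonUnitalNonAssocAlgebra K X →ₗ[K] E) (g : X → ℤ) (k : ℤ) : Submodule K E :=
  Submodule.span K {x | ∃ a : FreeMagma X, wordDeg g a = k ∧ π (word a) = x}

/-- `E` is a quotient of the free Lie superalgebra on `X`, by means of the linear map `π`. -/
structure IsLieQuot (d : X → ℤ) (br : E →ₗ[K] E →ₗ[K] E)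
    (π : FreeNonUnitalNonAssocAlgebra K X →ₗ[K] E) : Prop where
  surjective : Function.Surjective π
  map_mul : ∀ x y, π (x * y) = br (π x) (π y)
  rel : ∀ x, SuperRel d x → π x = 0

variable {d : X → ℤ} {br : E →ₗ[K] E →ₗ[K] E} {π : FreeNonUnitalNonAssocAlgebra K X →ₗ[K] E}

theorem word_induction {p : FreeNonUnitalNonAssocAlgebra K X → Prop} (h0 : p 0)
    (hadd : ∀ x y, p x → p y → p (x + y)) (hsmul : ∀ (c : K) a, p (word a) → p (c • word a))
    (hw : ∀ a, p (word a)) (x) : p x := by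
  induction x using MonoidAlgebra.induction_linear with
  | zero => exact h0
  | add x y hx hy => exact hadd x y hx hy
  | single a c =>
    have : (MonoidAlgebra.single a c : FreeNonUnitalNonAssocAlgebra K X) = c • word a := by
      simp [word]
    rw [this]
    exact hsmul c a (hw a)

theorem word_mem_wordSpan (π : FreeNonUnitalNonAssocAlgebra K X →ₗ[K] E) (g : X → ℤ)
    (a : FreeMagma X) : π (word a) ∈ wordSpan π g (wordDeg g a) :=
  Submodule.subset_span ⟨a, rfl, rfl⟩

theorem of_mem_wordSpan (π : FreeNonUnitalNonAssocAlgebra K X →ₗ[K] E) (g : X → ℤ) (x : X) :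
    π (FreeNonUnitalNonAssocAlgebra.of K x) ∈ wordSpan π g (g x) :=
  word_mem_wordSpan π g (FreeMagma.of x)

namespace IsLieQuot

variable (h : IsLieQuot d br π)

include h

theorem bracket_mem (g : X → ℤ) {m n : ℤ} {x y : E} (hx : x ∈ wordSpan π g m)
    (hy : y ∈ wordSpan π g n) : br x y ∈ wordSpan π g (m + n) := by
  induction hx, hy using Submodule.span_induction₂ with
  | mem_mem x y hx hy =>
    obtain ⟨a, ha, rfl⟩ := hx
    obtain ⟨b, hb, rfl⟩ := hy
    refine Submodule.subset_span ⟨a.mul b, ?_, ?_⟩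
    · simp [wordDeg, ha, hb]
    · rw [Min.word_mul, h.map_mul]
  | zero_left y hy => simp
  | zero_right x hx => simp
  | add_left x y z _ _ _ h1 h2 => simpa using add_mem h1 h2
  | add_right x y z _ _ _ h1 h2 => simpa using add_mem h1 h2
  | smul_left c x y _ _ h => simpa using Submodule.smul_mem _ c h
  | smul_right c x y _ _ h => simpa using Submodule.smul_mem _ c h

theorem skew {m n : ℤ} {x y : E} (hx : x ∈ wordSpan π d m) (hy : y ∈ wordSpan π d n) :
    br x y = -(sgn m n • br y x) := by
  rw [eq_neg_iff_add_eq_zero]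
  induction hx, hy using Submodule.span_induction₂ with
  | mem_mem x y hx hy =>
    obtain ⟨a, ha, rfl⟩ := hx
    obtain ⟨b, hb, rfl⟩ := hy
    have := h.rel _ (SuperRel.skew (K := K) (d := d) a b)
    rw [map_add, map_zsmul, ha, hb] at this
    simpa only [h.map_mul] using this
  | zero_left y hy => simp
  | zero_right x hx => simp
  | add_left x y z _ _ _ h1 h2 =>
    rw [map_add, map_add, LinearMap.add_apply, smul_add, add_add_add_comm, h1, h2, add_zero]
  | add_right x y z _ _ _ h1 h2 =>
    rw [map_add, map_add, LinearMap.add_apply, smul_add, add_add_add_comm, h1, h2, add_zero]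
  | smul_left c x y _ _ h =>
    rw [map_smul, map_smul, LinearMap.smul_apply, smul_comm, ← smul_add, h, smul_zero]
  | smul_right c x y _ _ h =>
    rw [map_smul, map_smul, LinearMap.smul_apply, smul_comm, ← smul_add, h, smul_zero]

theorem jacobi {m n : ℤ} {x y : E} (hx : x ∈ wordSpan π d m)
    (hy : y ∈ wordSpan π d n) (z : E) :
    br x (br y z) = br (br x y) z + sgn m n • br y (br x z) := by
  rw [← sub_eq_zero, ← sub_sub]
  induction hx, hy using Submodule.span_induction₂ with
  | mem_mem x y hx hy =>
    obtain ⟨a, ha, rfl⟩ := hx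
    obtain ⟨b, hb, rfl⟩ := hy
    obtain ⟨w, rfl⟩ := h.surjective z
    induction w using word_induction with
    | h0 => simp
    | hadd p q hp hq =>
      simp only [map_add, smul_add]
      rw [add_sub_add_comm, add_sub_add_comm, hp, hq, add_zero]
    | hsmul c a ha =>
      simp only [map_smul]
      rw [smul_comm _ c, ← smul_sub, ← smul_sub, ha, smul_zero]
    | hw c =>
      have := h.rel _ (SuperRel.jacobi (K := K) (d := d) a b c)
      rw [map_sub, map_sub, map_zsmul, ha, hb] at this
      simpa only [h.map_mul] using this
  | zero_left y hy => simp
  | zero_right x hx => simp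
  | add_left x y w _ _ _ h1 h2 =>
    simp only [map_add, LinearMap.add_apply, smul_add]
    rw [add_sub_add_comm, add_sub_add_comm, h1, h2, add_zero]
  | add_right x y w _ _ _ h1 h2 =>
    simp only [map_add, LinearMap.add_apply, smul_add]
    rw [add_sub_add_comm, add_sub_add_comm, h1, h2, add_zero]
  | smul_left c x y _ _ h1 =>
    simp only [map_smul, LinearMap.smul_apply]
    rw [smul_comm _ c, ← smul_sub, ← smul_sub, h1, smul_zero]
  | smul_right c x y _ _ h1 =>
    simp only [map_smul, LinearMap.smul_apply]
    rw [smul_comm _ c, ← smul_sub, ← smul_sub, h1, smul_zero]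

theorem iSup_wordSpan (g : X → ℤ) : ⨆ k, wordSpan π g k = ⊤ := by
  rw [eq_top_iff]
  intro x _
  obtain ⟨w, rfl⟩ := h.surjective x
  induction w using word_induction with
  | h0 => rw [map_zero]; exact zero_mem _
  | hadd x y hx hy => rw [map_add]; exact add_mem (hx trivial) (hy trivial)
  | hsmul c a ha => rw [map_smul]; exact Submodule.smul_mem _ _ (ha trivial)
  | hw a => exact Submodule.mem_iSup_of_mem _ (word_mem_wordSpan π g a)

/-- A subspace that is stable under the generators is stable under all elements. -/
theorem stable_of_gen {Q : Submodule K E}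
    (hQ : ∀ x, ∀ y ∈ Q, br (π (FreeNonUnitalNonAssocAlgebra.of K x)) y ∈ Q) (z : E) :
    ∀ y ∈ Q, br z y ∈ Q := by
  obtain ⟨w, rfl⟩ := h.surjective z
  induction w using word_induction with
  | h0 => simp
  | hadd x y hx hy =>
    intro z hz
    rw [map_add, map_add, LinearMap.add_apply]; exact add_mem (hx z hz) (hy z hz)
  | hsmul c a ha =>
    intro z hz
    rw [map_smul, map_smul, LinearMap.smul_apply]; exact Submodule.smul_mem _ _ (ha z hz)
  | hw a =>
    induction a using FreeMagma.rec with
    | of x => exact hQ x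
    | mul a b ha hb =>
      intro z hz
      have := h.jacobi (word_mem_wordSpan π d a) (word_mem_wordSpan π d b) z
      rw [Min.word_mul, h.map_mul, ← sub_eq_iff_eq_add.mpr this]
      exact sub_mem (ha _ (hb z hz)) (zsmul_mem (hb _ (ha z hz)) _)

/-- A subspace that contains the generators and is stable under them is everything. -/
theorem eq_top_of_gen {Q : Submodule K E}
    (hgen : ∀ x, π (FreeNonUnitalNonAssocAlgebra.of K x) ∈ Q)
    (hQ : ∀ x, ∀ y ∈ Q, br (π (FreeNonUnitalNonAssocAlgebra.of K x)) y ∈ Q) : Q = ⊤ := by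
  rw [eq_top_iff]
  intro x _
  obtain ⟨w, rfl⟩ := h.surjective x
  induction w using word_induction with
  | h0 => rw [map_zero]; exact zero_mem _
  | hadd x y hx hy => rw [map_add]; exact add_mem (hx trivial) (hy trivial)
  | hsmul c a ha => rw [map_smul]; exact Submodule.smul_mem _ _ (ha trivial)
  | hw a =>
    induction a using FreeMagma.rec with
    | of x => exact hgen x
    | mul a b ha hb =>
      rw [Min.word_mul, h.map_mul]
      exact h.stable_of_gen hQ _ _ (hb trivial)

/-- An even element that acts by multiplication with the degree on the generators does so on all
homogeneous elements. -/
theorem grading_lie (g : X → ℤ) {ℓ : E} (hℓ : ℓ ∈ wordSpan π d 0)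
    (hgen : ∀ x, br ℓ (π (FreeNonUnitalNonAssocAlgebra.of K x)) =
      (g x : K) • π (FreeNonUnitalNonAssocAlgebra.of K x)) {k : ℤ} {x : E}
    (hx : x ∈ wordSpan π g k) : br ℓ x = (k : K) • x := by
  induction hx using Submodule.span_induction with
  | mem x hx =>
    obtain ⟨a, rfl, rfl⟩ := hx
    induction a using FreeMagma.rec with
    | of x => exact hgen x
    | mul a b ha hb =>
      rw [Min.word_mul, h.map_mul, h.jacobi hℓ (word_mem_wordSpan π d a), ha, hb,
        Min.sgn_zero_left, one_smul, map_smul, map_smul, LinearMap.smul_apply, ← add_smul]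
      simp [wordDeg]
  | zero => simp
  | add x y _ _ hx hy => rw [map_add, hx, hy, smul_add]
  | smul c x _ hx => rw [map_smul, hx, smul_comm]

end IsLieQuot

/-- `ℓ` is an even element whose adjoint action is the grading given by `g`. -/
structure IsGradingElement (d g : X → ℤ) (br : E →ₗ[K] E →ₗ[K] E)
    (π : FreeNonUnitalNonAssocAlgebra K X →ₗ[K] E) (ℓ : E) : Prop where
  even : ℓ ∈ wordSpan π d 0
  lie_gen : ∀ x, br ℓ (π (FreeNonUnitalNonAssocAlgebra.of K x)) =
    (g x : K) • π (FreeNonUnitalNonAssocAlgebra.of K x)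

namespace IsLieQuot

variable [CharZero K] (h : IsLieQuot d br π) {g : X → ℤ} {ℓ : E}
  (hℓ : IsGradingElement d g br π ℓ)

include h hℓ

omit [CharZero K] in
theorem lie_of_mem {k : ℤ} {x : E} (hx : x ∈ wordSpan π g k) : br ℓ x = (k : K) • x :=
  h.grading_lie g hℓ.even hℓ.lie_gen hx

theorem mem_of_mem_iSup {F : ℤ → Submodule K E} (hF : ∀ k, F k ≤ wordSpan π g k) {k : ℤ} {x : E}
    (hx : x ∈ wordSpan π g k) (hx' : x ∈ ⨆ k, F k) : x ∈ F k :=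
  mem_of_mem_iSup_of_eigenvector (br ℓ) (μ := fun k : ℤ => (k : K)) Int.cast_injective
    (fun k _ hy => Module.End.mem_eigenspace_iff.mpr (h.lie_of_mem hℓ (hF k hy)))
    (h.lie_of_mem hℓ hx) hx'

/-- A subspace that is stable under the grading element is graded. -/
theorem isGraded {J : Submodule K E} (hJ : ∀ y ∈ J, br ℓ y ∈ J) :
    IsGradedSubspace (wordSpan π g) J := by
  intro x hx
  have h1 : x ∈ ⨆ k, wordSpan π g k := by rw [h.iSup_wordSpan]; trivial
  obtain ⟨w, hw, hsum⟩ := (Submodule.mem_iSup_iff_exists_finsupp _ x).mp h1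
  have hsum' : ∑ a ∈ w.support, w a = x := hsum
  have hcomp := mem_of_sum_mem (ι := Unit) (T := fun _ => br ℓ) (N := J) (fun _ v hv => hJ v hv)
    w.support (χ := fun (n : ℤ) _ => (n : K))
    (fun a _ b _ hab h => hab (by simpa using congrFun h ()))
    (fun a _ _ => h.lie_of_mem hℓ (hw a)) (by rw [hsum']; exact hx)
  rw [← hsum']
  exact sum_mem fun a ha => Submodule.mem_iSup_of_mem a ⟨hcomp a ha, hw a⟩

omit [CharZero K] h hℓ in
/-- A graded subspace without components in the local part is concentrated in the other degrees. -/
theorem le_of_inf_eq_bot {J : Submodule K E} (hJ : IsGradedSubspace (wordSpan π g) J)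
    (hm : J ⊓ wordSpan π g (-1) = ⊥) (h0 : J ⊓ wordSpan π g 0 = ⊥)
    (hp : J ⊓ wordSpan π g 1 = ⊥) : J ≤ ⨆ k : ℤ, ⨆ _ : 2 ≤ |k|, wordSpan π g k := by
  refine hJ.trans (iSup_le fun k => ?_)
  by_cases hk : 2 ≤ |k|
  · exact inf_le_right.trans (le_iSup₂_of_le k hk le_rfl)
  · have hk' : k = -1 ∨ k = 0 ∨ k = 1 := by
      rw [not_le, abs_lt] at hk; omega
    rcases hk' with rfl | rfl | rfl
    exacts [hm.trans_le bot_le, h0.trans_le bot_le, hp.trans_le bot_le]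

omit [CharZero K] h hℓ in
theorem le_of_disjoint {J : Submodule K E} (hJ : IsGradedSubspace (wordSpan π g) J)
    (hdisj : Disjoint J (wordSpan π g (-1) ⊔ wordSpan π g 0 ⊔ wordSpan π g 1)) :
    J ≤ ⨆ k : ℤ, ⨆ _ : 2 ≤ |k|, wordSpan π g k :=
  le_of_inf_eq_bot hJ (hdisj.mono_right (le_sup_of_le_left le_sup_left)).eq_bot
    (hdisj.mono_right (le_sup_of_le_left le_sup_right)).eq_bot
    (hdisj.mono_right le_sup_right).eq_bot

theorem disjoint_of_le {J : Submodule K E} (hJ : J ≤ ⨆ k : ℤ, ⨆ _ : 2 ≤ |k|, wordSpan π g k) :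
    Disjoint J (wordSpan π g (-1) ⊔ wordSpan π g 0 ⊔ wordSpan π g 1) := by
  have hind : iSupIndep (wordSpan π g) :=
    ((Module.End.eigenspaces_iSupIndep (br ℓ)).comp Int.cast_injective).mono fun k x hx =>
      Module.End.mem_eigenspace_iff.mpr (h.lie_of_mem hℓ hx)
  have := hind.disjoint_biSup_biSup (s := {k : ℤ | 2 ≤ |k|}) (t := {-1, 0, 1}) (by
    rw [Set.disjoint_left]
    rintro k hk (rfl | rfl | rfl) <;> simp at hk)
  refine this.mono hJ (sup_le (sup_le ?_ ?_) ?_)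
  · exact le_iSup₂_of_le (-1) (by simp) le_rfl
  · exact le_iSup₂_of_le 0 (by simp) le_rfl
  · exact le_iSup₂_of_le 1 (by simp) le_rfl

end IsLieQuot

/-- A left ideal is an ideal, if the consistent grading is inner. -/
theorem IsLieQuot.isIdeal [CharZero K] (h : IsLieQuot d br π) {ℓ : E}
    (hℓ : IsGradingElement d d br π ℓ) {J : Submodule K E}
    (hJ : ∀ x, ∀ y ∈ J, br (π (FreeNonUnitalNonAssocAlgebra.of K x)) y ∈ J) : IsIdeal br J := by
  have hJ' := h.stable_of_gen hJ
  refine fun z y hy => ⟨hJ' z y hy, ?_⟩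
  have h1 := h.isGraded hℓ (hJ' ℓ) hy
  clear hy
  induction h1 using Submodule.iSup_induction' with
  | mem k y hy =>
    have h2 : z ∈ ⨆ k, wordSpan π d k := by rw [h.iSup_wordSpan]; trivial
    induction h2 using Submodule.iSup_induction' with
    | mem l z hz =>
      rw [h.skew hy.2 hz]
      exact neg_mem (zsmul_mem (hJ' z y hy.1) _)
    | zero => simp
    | add z w _ _ h1 h2 => rw [map_add]; exact add_mem h1 h2
  | zero => simp
  | add x y _ _ h1 h2 => rw [map_add, LinearMap.add_apply]; exact add_mem h1 h2

end Quot

end Cartanification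

namespace Cartanification

universe u v w

/-! ### Local parts -/

section Local

variable {K : Type u} [Field K] {X : Type v} {E : Type*} [AddCommGroup E] [Module K E]
  {d : X → ℤ} {br : E →ₗ[K] E →ₗ[K] E} {π : FreeNonUnitalNonAssocAlgebra K X →ₗ[K] E}

/-- The span of the iterated brackets of `n + 1` elements of `V`. -/
def iterBracket (br : E →ₗ[K] E →ₗ[K] E) (V : Submodule K E) : ℕ → Submodule K E
  | 0 => V
  | n + 1 => Submodule.map₂ br V (iterBracket br V n)

namespace IsLieQuot

variable (h : IsLieQuot d br π)

include h

theorem iterBracket_le {V : Submodule K E} {σ : ℤ} (hV : V ≤ wordSpan π d σ) (n : ℕ) :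
    iterBracket br V n ≤ wordSpan π d (σ * (n + 1)) := by
  induction n with
  | zero => simpa [iterBracket] using hV
  | succ n ih =>
    refine Submodule.map₂_le.mpr fun x hx y hy => ?_
    have := h.bracket_mem d (hV hx) (ih hy)
    convert this using 1
    push_cast; ring_nf

theorem lie_mem_iterBracket {V₀ V : Submodule K E} {σ : ℤ} (h₀ : V₀ ≤ wordSpan π d 0)
    (hV : V ≤ wordSpan π d σ) (h₀V : ∀ x ∈ V₀, ∀ y ∈ V, br x y ∈ V) (n : ℕ) :
    ∀ x ∈ V₀, ∀ y ∈ iterBracket br V n, br x y ∈ iterBracket br V n := by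
  induction n with
  | zero => exact h₀V
  | succ n ih =>
    intro z hz
    have : iterBracket br V (n + 1) ≤ (iterBracket br V (n + 1)).comap (br z) := by
      refine Submodule.map₂_le.mpr fun x hx y hy => ?_
      rw [Submodule.mem_comap, h.jacobi (h₀ hz) (hV hx)]
      exact add_mem (Submodule.apply_mem_map₂ _ (h₀V z hz x hx) hy)
        (zsmul_mem (Submodule.apply_mem_map₂ _ hx (ih z hz y hy)) _)
    exact fun y hy => this hy

theorem opp_lie_mem_iterBracket {V₀ V V' : Submodule K E} {σ τ : ℤ} (h₀ : V₀ ≤ wordSpan π d 0)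
    (hV : V ≤ wordSpan π d σ) (hV' : V' ≤ wordSpan π d τ) (h₀V : ∀ x ∈ V₀, ∀ y ∈ V, br x y ∈ V)
    (hVV' : ∀ x ∈ V', ∀ y ∈ V, br x y ∈ V₀) (n : ℕ) :
    ∀ x ∈ V', ∀ y ∈ iterBracket br V (n + 1), br x y ∈ iterBracket br V n := by
  induction n with
  | zero =>
    intro z hz
    have : iterBracket br V 1 ≤ V.comap (br z) := by
      refine Submodule.map₂_le.mpr fun x hx y hy => ?_
      rw [Submodule.mem_comap, h.jacobi (hV' hz) (hV hx)]
      refine add_mem (h₀V _ (hVV' z hz x hx) y hy) (zsmul_mem ?_ _)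
      rw [h.skew (hV hx) (h₀ (hVV' z hz y hy))]
      exact neg_mem (zsmul_mem (h₀V _ (hVV' z hz y hy) x hx) _)
    exact fun y hy => this hy
  | succ n ih =>
    intro z hz
    have : iterBracket br V (n + 2) ≤ (iterBracket br V (n + 1)).comap (br z) := by
      refine Submodule.map₂_le.mpr fun x hx y hy => ?_
      rw [Submodule.mem_comap, h.jacobi (hV' hz) (hV hx)]
      exact add_mem (h.lie_mem_iterBracket h₀ hV h₀V _ _ (hVV' z hz x hx) y hy)
        (zsmul_mem (Submodule.apply_mem_map₂ _ hx (ih z hz y hy)) _)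
    exact fun y hy => this hy

/-- A subspace that is closed under the brackets of a local Lie superalgebra and that contains the
generators is the whole local part. -/
theorem local_eq [CharZero K] {ℓ : E} (hℓ : IsGradingElement d d br π ℓ)
    {V₀ Vp Vm : Submodule K E} (h₀ : V₀ ≤ wordSpan π d 0) (hp : Vp ≤ wordSpan π d 1)
    (hm : Vm ≤ wordSpan π d (-1))
    (h00 : ∀ x ∈ V₀, ∀ y ∈ V₀, br x y ∈ V₀) (h0p : ∀ x ∈ V₀, ∀ y ∈ Vp, br x y ∈ Vp)
    (h0m : ∀ x ∈ V₀, ∀ y ∈ Vm, br x y ∈ Vm) (hpm : ∀ x ∈ Vp, ∀ y ∈ Vm, br x y ∈ V₀)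
    (hgen : ∀ x, π (FreeNonUnitalNonAssocAlgebra.of K x) ∈ V₀ ∨
      π (FreeNonUnitalNonAssocAlgebra.of K x) ∈ Vp ∨ π (FreeNonUnitalNonAssocAlgebra.of K x) ∈ Vm) :
    V₀ = wordSpan π d 0 ∧ Vp = wordSpan π d 1 ∧ Vm = wordSpan π d (-1) := by
  have hmp : ∀ x ∈ Vm, ∀ y ∈ Vp, br x y ∈ V₀ := fun x hx y hy => by
    rw [h.skew (hm hx) (hp hy)]
    exact neg_mem (zsmul_mem (hpm y hy x hx) _)
  -- The components of the subalgebra generated by `V₀`, `Vp` and `Vm`.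
  let F : ℤ → Submodule K E := fun n =>
    if n = 0 then V₀ else if 0 < n then iterBracket br Vp (n - 1).toNat
      else iterBracket br Vm (-n - 1).toNat
  have hF0 : F 0 = V₀ := by simp [F]
  have hFp : ∀ n : ℕ, F (n + 1) = iterBracket br Vp n := fun n => by
    have h1 : (n : ℤ) + 1 ≠ 0 := by omega
    have h2 : (0 : ℤ) < n + 1 := by omega
    simp [F, h1, h2]
  have hFm : ∀ n : ℕ, F (-(n + 1)) = iterBracket br Vm n := fun n => by
    have h1 : -((n : ℤ) + 1) ≠ 0 := by omega
    have h2 : ¬ (0 : ℤ) < -(n + 1) := by omega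
    simp only [F, if_neg h1, if_neg h2]
    congr 1; omega
  have hcases : ∀ {p : ℤ → Prop}, p 0 → (∀ n : ℕ, p (n + 1)) → (∀ n : ℕ, p (-(n + 1))) →
      ∀ n, p n := by
    intro p h0 h1 h2 n
    rcases lt_trichotomy n 0 with hn | rfl | hn
    · obtain ⟨m, hm⟩ : ∃ m : ℕ, n = -(m + 1) := ⟨(-n - 1).toNat, by omega⟩
      rw [hm]; exact h2 m
    · exact h0
    · obtain ⟨m, hm⟩ : ∃ m : ℕ, n = m + 1 := ⟨(n - 1).toNat, by omega⟩
      rw [hm]; exact h1 m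
  have hF : ∀ n, F n ≤ wordSpan π d n := by
    refine hcases ?_ ?_ ?_
    · rwa [hF0]
    · intro n; rw [hFp]
      simpa using h.iterBracket_le hp n
    · intro n; rw [hFm]
      have := h.iterBracket_le hm n
      rwa [neg_one_mul] at this
  have hst : ∀ z ∈ (V₀ ⊔ Vp ⊔ Vm), ∀ n, F n ≤ (⨆ n, F n).comap (br z) := by
    intro z hz
    obtain ⟨z', hz', c, hc, rfl⟩ := Submodule.mem_sup.mp hz
    obtain ⟨a, ha, b, hb, rfl⟩ := Submodule.mem_sup.mp hz'
    refine hcases ?_ ?_ ?_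
    · intro y hy
      rw [hF0] at hy
      rw [Submodule.mem_comap, map_add, map_add, LinearMap.add_apply, LinearMap.add_apply]
      refine add_mem (add_mem ?_ ?_) ?_
      · exact Submodule.mem_iSup_of_mem 0 (hF0 ▸ h00 a ha y hy)
      · refine Submodule.mem_iSup_of_mem ((0 : ℕ) + 1 : ℤ) ?_
        rw [hFp 0, h.skew (hp hb) (h₀ hy)]
        exact neg_mem (zsmul_mem (h0p y hy b hb) _)
      · refine Submodule.mem_iSup_of_mem (-((0 : ℕ) + 1) : ℤ) ?_
        rw [hFm 0, h.skew (hm hc) (h₀ hy)]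
        exact neg_mem (zsmul_mem (h0m y hy c hc) _)
    · intro n y hy
      rw [hFp] at hy
      rw [Submodule.mem_comap, map_add, map_add, LinearMap.add_apply, LinearMap.add_apply]
      refine add_mem (add_mem ?_ ?_) ?_
      · exact Submodule.mem_iSup_of_mem _
          ((hFp n).symm ▸ h.lie_mem_iterBracket h₀ hp h0p n a ha y hy)
      · exact Submodule.mem_iSup_of_mem ((n + 1 : ℕ) + 1 : ℤ)
          ((hFp (n + 1)).symm ▸ Submodule.apply_mem_map₂ _ hb hy)
      · cases n with
        | zero => exact Submodule.mem_iSup_of_mem 0 (hF0 ▸ hmp c hc y hy)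
        | succ n => exact Submodule.mem_iSup_of_mem _ ((hFp n).symm ▸
            h.opp_lie_mem_iterBracket h₀ hp hm h0p hmp n c hc y hy)
    · intro n y hy
      rw [hFm] at hy
      rw [Submodule.mem_comap, map_add, map_add, LinearMap.add_apply, LinearMap.add_apply]
      refine add_mem (add_mem ?_ ?_) ?_
      · exact Submodule.mem_iSup_of_mem _
          ((hFm n).symm ▸ h.lie_mem_iterBracket h₀ hm h0m n a ha y hy)
      · cases n with
        | zero => exact Submodule.mem_iSup_of_mem 0 (hF0 ▸ hpm b hb y hy)
        | succ n => exact Submodule.mem_iSup_of_mem _ ((hFm n).symm ▸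
            h.opp_lie_mem_iterBracket h₀ hm hp h0m hpm n b hb y hy)
      · exact Submodule.mem_iSup_of_mem (-((n + 1 : ℕ) + 1) : ℤ)
          ((hFm (n + 1)).symm ▸ Submodule.apply_mem_map₂ _ hc hy)
  have hgen' : ∀ x, π (FreeNonUnitalNonAssocAlgebra.of K x) ∈ V₀ ⊔ Vp ⊔ Vm := by
    intro x
    rcases hgen x with h1 | h1 | h1
    exacts [Submodule.mem_sup_left (Submodule.mem_sup_left h1),
      Submodule.mem_sup_left (Submodule.mem_sup_right h1), Submodule.mem_sup_right h1]
  have htop : ⨆ n, F n = ⊤ := by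
    refine h.eq_top_of_gen (fun x => ?_) fun x y hy => (iSup_le (hst _ (hgen' x))) hy
    rcases hgen x with h1 | h1 | h1
    · exact Submodule.mem_iSup_of_mem 0 (hF0 ▸ h1)
    · exact Submodule.mem_iSup_of_mem ((0 : ℕ) + 1 : ℤ) ((hFp 0).symm ▸ h1)
    · exact Submodule.mem_iSup_of_mem (-((0 : ℕ) + 1) : ℤ) ((hFm 0).symm ▸ h1)
  have hle : ∀ n, wordSpan π d n ≤ F n := fun n x hx =>
    h.mem_of_mem_iSup hℓ hF hx (htop ▸ Submodule.mem_top)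
  refine ⟨le_antisymm h₀ (hF0 ▸ hle 0), le_antisymm hp ?_, le_antisymm hm ?_⟩
  · have h1 := hle ((0 : ℕ) + 1 : ℤ)
    rw [hFp 0] at h1
    exact h1
  · have h1 := hle (-((0 : ℕ) + 1) : ℤ)
    rw [hFm 0] at h1
    exact h1

/-- An element of degree at least `2` that is annihilated by the elements of degree `-1` generates
an ideal which has no components in degrees less than `2`. -/
theorem exists_stable (g : X → ℤ) {Np N₀ Nm : Set E}
    (hom : ∀ x ∈ Np ∪ N₀ ∪ Nm, ∃ k, x ∈ wordSpan π d k)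
    (hNp : ∀ x ∈ Np, x ∈ wordSpan π g 1) (hN₀ : ∀ x ∈ N₀, x ∈ wordSpan π g 0)
    (h0p : ∀ x ∈ N₀, ∀ y ∈ Np, br x y ∈ Submodule.span K Np)
    (hm0 : ∀ x ∈ Nm, ∀ y ∈ N₀, br x y ∈ Submodule.span K Nm)
    (hmp : ∀ x ∈ Nm, ∀ y ∈ Np, br x y ∈ Submodule.span K N₀)
    (hgen : ∀ x, π (FreeNonUnitalNonAssocAlgebra.of K x) ∈ Np ∪ N₀ ∪ Nm)
    {s : E} {n : ℤ} (hn : 2 ≤ n) (hs : s ∈ wordSpan π g n) (hs' : ∀ x ∈ Nm, br x s = 0) :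
    ∃ J : Submodule K E, s ∈ J ∧ J ≤ (⨆ k : ℤ, ⨆ _ : 2 ≤ |k|, wordSpan π g k) ∧
      ∀ x, ∀ y ∈ J, br (π (FreeNonUnitalNonAssocAlgebra.of K x)) y ∈ J := by
  have span_mem : ∀ {N : Set E} {J : Submodule K E}, (∀ x ∈ N, ∀ y ∈ J, br x y ∈ J) →
      ∀ x ∈ Submodule.span K N, ∀ y ∈ J, br x y ∈ J := by
    intro N J hN x hx y hy
    induction hx using Submodule.span_induction with
    | mem x hx => exact hN x hx y hy
    | zero => simp
    | add x z _ _ h1 h2 => rw [map_add, LinearMap.add_apply]; exact add_mem h1 h2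
    | smul c x _ h1 => rw [map_smul, LinearMap.smul_apply]; exact Submodule.smul_mem _ _ h1
  have jac : ∀ x ∈ Np ∪ N₀ ∪ Nm, ∀ y ∈ Np ∪ N₀ ∪ Nm, ∃ t : ℤ, ∀ z,
      br x (br y z) = br (br x y) z + t • br y (br x z) := by
    intro x hx y hy
    obtain ⟨k, hk⟩ := hom x hx
    obtain ⟨l, hl⟩ := hom y hy
    exact ⟨_, h.jacobi hk hl⟩
  -- The elements of `J₀` still have degree `n` and are annihilated by `Nm`.
  let J₀ := opClosure (br '' N₀) (Submodule.span K {s})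
  have hJ₀ : ∀ x ∈ N₀, ∀ y ∈ J₀, br x y ∈ J₀ := fun x hx y hy =>
    opClosure_stable (S := br '' N₀) ⟨x, hx, rfl⟩ hy
  have hJ₀g : J₀ ≤ wordSpan π g n := by
    refine opClosure_le (by simpa using hs) ?_
    rintro _ ⟨x, hx, rfl⟩ y hy
    simpa using h.bracket_mem g (hN₀ x hx) hy
  have hJ₀m : ∀ x ∈ Nm, ∀ y ∈ J₀, br x y = 0 := by
    suffices h1 : J₀ ≤ ⨅ x : Nm, LinearMap.ker (br x) from fun x hx y hy => by
      have := h1 hy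
      rw [Submodule.mem_iInf] at this
      exact this ⟨x, hx⟩
    refine opClosure_le ?_ ?_
    · rw [Submodule.span_le, Set.singleton_subset_iff, SetLike.mem_coe, Submodule.mem_iInf]
      exact fun x => hs' x x.2
    · rintro _ ⟨y, hy, rfl⟩ v hv
      rw [Submodule.mem_iInf] at hv ⊢
      intro x
      obtain ⟨t, ht⟩ := jac x (Or.inr x.2) y (Or.inl (Or.inr hy))
      rw [LinearMap.mem_ker, ht, show br x v = 0 from hv x, map_zero, smul_zero, add_zero]
      have h2 : Submodule.span K Nm ≤ LinearMap.ker (br.flip v) :=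
        Submodule.span_le.mpr fun x hx => hv ⟨x, hx⟩
      exact h2 (hm0 x x.2 y hy)
  -- Only the operators of degree `1` enlarge `J₀`, so the degrees in `J` are at least `n`.
  let J := opClosure (br '' Np) J₀
  have hJp : ∀ x ∈ Np, ∀ y ∈ J, br x y ∈ J := fun x hx y hy =>
    opClosure_stable (S := br '' Np) ⟨x, hx, rfl⟩ hy
  have hJJ : J₀ ≤ J := le_opClosure _ _
  have hJ0 : ∀ x ∈ N₀, ∀ y ∈ J, br x y ∈ J := by
    suffices h1 : J ≤ J ⊓ ⨅ x : N₀, J.comap (br x) from fun x hx y hy => by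
      have := (h1 hy).2
      rw [SetLike.mem_coe, Submodule.mem_iInf] at this
      exact this ⟨x, hx⟩
    refine opClosure_le (le_inf hJJ (le_iInf fun x y hy => hJJ (hJ₀ x x.2 y hy))) ?_
    rintro _ ⟨y, hy, rfl⟩ v ⟨hv, hv'⟩
    rw [SetLike.mem_coe, Submodule.mem_iInf] at hv'
    refine ⟨hJp y hy v hv, ?_⟩
    rw [SetLike.mem_coe, Submodule.mem_iInf]
    intro x
    obtain ⟨t, ht⟩ := jac x (Or.inl (Or.inr x.2)) y (Or.inl (Or.inl hy))
    rw [Submodule.mem_comap, ht]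
    exact add_mem (span_mem hJp _ (h0p x x.2 y hy) v hv) (zsmul_mem (hJp y hy _ (hv' x)) _)
  have hJm : ∀ x ∈ Nm, ∀ y ∈ J, br x y ∈ J := by
    suffices h1 : J ≤ J ⊓ ⨅ x : Nm, J.comap (br x) from fun x hx y hy => by
      have := (h1 hy).2
      rw [SetLike.mem_coe, Submodule.mem_iInf] at this
      exact this ⟨x, hx⟩
    refine opClosure_le (le_inf hJJ (le_iInf fun x y hy => ?_)) ?_
    · rw [Submodule.mem_comap, hJ₀m x x.2 y hy]; exact zero_mem _
    rintro _ ⟨y, hy, rfl⟩ v ⟨hv, hv'⟩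
    rw [SetLike.mem_coe, Submodule.mem_iInf] at hv'
    refine ⟨hJp y hy v hv, ?_⟩
    rw [SetLike.mem_coe, Submodule.mem_iInf]
    intro x
    obtain ⟨t, ht⟩ := jac x (Or.inr x.2) y (Or.inl (Or.inl hy))
    rw [Submodule.mem_comap, ht]
    exact add_mem (span_mem hJ0 _ (hmp x x.2 y hy) v hv) (zsmul_mem (hJp y hy _ (hv' x)) _)
  refine ⟨J, hJJ (le_opClosure _ _ (Submodule.mem_span_singleton_self s)), ?_, fun x y hy => ?_⟩
  · have h1 : J ≤ ⨆ k : ℕ, wordSpan π g (2 + k) := by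
      refine opClosure_le ?_ ?_
      · obtain ⟨m, hm⟩ : ∃ m : ℕ, n = 2 + m := ⟨(n - 2).toNat, by omega⟩
        exact le_iSup_of_le m (hm ▸ hJ₀g)
      · rintro _ ⟨x, hx, rfl⟩ v hv
        induction hv using Submodule.iSup_induction' with
        | mem k v hv =>
          refine Submodule.mem_iSup_of_mem (k + 1) ?_
          have := h.bracket_mem g (hNp x hx) hv
          convert this using 1
          push_cast; ring_nf
        | zero => simp
        | add a b _ _ h1 h2 => rw [map_add]; exact add_mem h1 h2
    refine h1.trans (iSup_le fun k => le_iSup₂_of_le (2 + (k : ℤ)) ?_ le_rfl)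
    rw [abs_of_nonneg (by omega)]; omega
  · rcases hgen x with (h1 | h1) | h1
    exacts [hJp _ h1 y hy, hJ0 _ h1 y hy, hJm _ h1 y hy]

end IsLieQuot

end Local

/-! ### Minimal quotients -/

section Min

variable {K : Type u} [Field K] {X : Type v} {d d' : X → ℤ}
  {R : Set (FreeNonUnitalNonAssocAlgebra K X)}

theorem presBracket_isLieQuot (d : X → ℤ) (R : Set (FreeNonUnitalNonAssocAlgebra K X)) :
    IsLieQuot d (presBracket d R) (relIdeal d R).mkQ where
  surjective := Submodule.mkQ_surjective _
  map_mul _ _ := rfl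
  rel _ hx := (Submodule.Quotient.mk_eq_zero _).mpr (subset_idealGen _ _ (Or.inl hx))

namespace Min

theorem isLieQuot (d d' : X → ℤ) (R : Set (FreeNonUnitalNonAssocAlgebra K X)) :
    IsLieQuot d (bracket d d' R) (proj d d' R) where
  surjective := (Submodule.mkQ_surjective _).comp (Submodule.mkQ_surjective _)
  map_mul _ _ := rfl
  rel _ hx := proj_rel (Or.inl hx)

variable (d d' R) in
/-- The quotient map from the maximal Lie superalgebra. -/
noncomputable def ofPres : Pres d R →ₗ[K] Min d d' R :=
  (maxIdeal (presBracket d R) (presGrade d R d')).mkQ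

theorem ofPres_surjective : Function.Surjective (ofPres d d' R) := Submodule.mkQ_surjective _

theorem ofPres_bracket (x y : Pres d R) :
    ofPres d d' R (presBracket d R x y) = bracket d d' R (ofPres d d' R x) (ofPres d d' R y) := rfl

theorem ofPres_mkQ (x : FreeNonUnitalNonAssocAlgebra K X) :
    ofPres d d' R ((relIdeal d R).mkQ x) = proj d d' R x := rfl

theorem map_wordSpan (g : X → ℤ) (k : ℤ) :
    (wordSpan (relIdeal d R).mkQ g k).map (ofPres d d' R) = wordSpan (proj d d' R) g k := by
  rw [wordSpan, wordSpan, Submodule.map_span]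
  congr 1
  ext x
  constructor
  · rintro ⟨_, ⟨a, ha, rfl⟩, rfl⟩; exact ⟨a, ha, rfl⟩
  · rintro ⟨a, ha, rfl⟩; exact ⟨_, ⟨a, ha, rfl⟩, rfl⟩

theorem isGradingElement {g : X → ℤ} {ℓ : Pres d R}
    (hℓ : IsGradingElement d g (presBracket d R) (relIdeal d R).mkQ ℓ) :
    IsGradingElement d g (bracket d d' R) (proj d d' R) (ofPres d d' R ℓ) where
  even := by rw [← map_wordSpan]; exact ⟨ℓ, hℓ.even, rfl⟩
  lie_gen x := by
    rw [← ofPres_mkQ, ← ofPres_bracket, hℓ.lie_gen, map_smul]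

variable [CharZero K] {ℓ : Pres d R}
  (hℓ : IsGradingElement d d' (presBracket d R) (relIdeal d R).mkQ ℓ)

include hℓ

omit [CharZero K] hℓ in
theorem maxIdeal_le : maxIdeal (presBracket d R) (presGrade d R d') ≤
    ⨆ k : ℤ, ⨆ _ : 2 ≤ |k|, wordSpan (relIdeal d R).mkQ d' k :=
  sSup_le fun _ hI => IsLieQuot.le_of_disjoint hI.2.1 hI.2.2

/-- The local part of the maximal Lie superalgebra is not affected by passing to the minimal one. -/
theorem eq_zero_of_ofPres_eq_zero {x : Pres d R}
    (hx : x ∈ wordSpan (relIdeal d R).mkQ d' (-1) ⊔ wordSpan (relIdeal d R).mkQ d' 0 ⊔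
      wordSpan (relIdeal d R).mkQ d' 1) (h0 : ofPres d d' R x = 0) : x = 0 :=
  Submodule.disjoint_def.mp ((presBracket_isLieQuot d R).disjoint_of_le hℓ maxIdeal_le) x
    ((Submodule.Quotient.mk_eq_zero _).mp h0) hx

/-- An ideal of the minimal Lie superalgebra which intersects the local part trivially is zero. -/
theorem eq_bot_of_disjoint {J : Submodule K (Min d d' R)} (hJ : IsIdeal (bracket d d' R) J)
    (hdisj : Disjoint J (wordSpan (proj d d' R) d' (-1) ⊔ wordSpan (proj d d' R) d' 0 ⊔
      wordSpan (proj d d' R) d' 1)) : J = ⊥ := by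
  have h1 : J.comap (ofPres d d' R) ≤ maxIdeal (presBracket d R) (presGrade d R d') := by
    refine le_sSup ⟨fun x y hy => ?_, ?_, ?_⟩
    · rw [Submodule.mem_comap] at hy
      exact ⟨(hJ (ofPres d d' R x) _ hy).1, (hJ (ofPres d d' R x) _ hy).2⟩
    · refine (presBracket_isLieQuot d R).isGraded hℓ fun y hy => ?_
      exact (hJ (ofPres d d' R ℓ) _ hy).1
    · rw [Submodule.disjoint_def]
      intro x hx hx'
      refine eq_zero_of_ofPres_eq_zero hℓ hx' (Submodule.disjoint_def.mp hdisj _ hx ?_)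
      rw [← map_wordSpan, ← map_wordSpan, ← map_wordSpan, ← Submodule.map_sup, ← Submodule.map_sup]
      exact ⟨x, hx', rfl⟩
  rw [eq_bot_iff]
  intro y hy
  obtain ⟨x, rfl⟩ := ofPres_surjective y
  exact (Submodule.Quotient.mk_eq_zero _).mpr (h1 hy)

theorem eq_bot_of_le {J : Submodule K (Min d d' R)} (hJ : IsIdeal (bracket d d' R) J)
    (hle : J ≤ ⨆ k : ℤ, ⨆ _ : 2 ≤ |k|, wordSpan (proj d d' R) d' k) : J = ⊥ :=
  eq_bot_of_disjoint hℓ hJ ((isLieQuot d d' R).disjoint_of_le (isGradingElement hℓ) hle)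

end Min

end Min

/-! ### Homomorphisms given by the images of the generators -/

section Eval

variable {K : Type u} [Field K] {X : Type v} {E : Type*} [AddCommGroup E] [Module K E]

/-- The value of a nonassociative word. -/
def evalWord (br : E →ₗ[K] E →ₗ[K] E) (ρ : X → E) : FreeMagma X → E
  | FreeMagma.of x => ρ x
  | FreeMagma.mul a b => br (evalWord br ρ a) (evalWord br ρ b)

/-- The value of an element of the free nonassociative algebra. -/
noncomputable def eval (br : E →ₗ[K] E →ₗ[K] E) (ρ : X → E) :
    FreeNonUnitalNonAssocAlgebra K X →ₗ[K] E :=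
  Finsupp.linearCombination K (evalWord br ρ) ∘ₗ (MonoidAlgebra.coeffLinearEquiv K).toLinearMap

variable (br : E →ₗ[K] E →ₗ[K] E) (ρ : X → E)

theorem eval_word (a : FreeMagma X) : eval br ρ (word a) = evalWord br ρ a := by
  simp [eval, word]

@[simp] theorem eval_of (x : X) : eval br ρ (FreeNonUnitalNonAssocAlgebra.of K x) = ρ x :=
  eval_word br ρ (FreeMagma.of x)

@[simp] theorem eval_mul (x y : FreeNonUnitalNonAssocAlgebra K X) :
    eval br ρ (x * y) = br (eval br ρ x) (eval br ρ y) := by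
  induction x using word_induction with
  | h0 => simp
  | hadd x z hx hz => rw [add_mul, map_add, hx, hz, map_add, map_add, LinearMap.add_apply]
  | hsmul c a ha => rw [smul_mul_assoc, map_smul, ha, map_smul, map_smul, LinearMap.smul_apply]
  | hw a =>
    induction y using word_induction with
    | h0 => simp
    | hadd x z hx hz => rw [mul_add, map_add, hx, hz, map_add, map_add]
    | hsmul c a ha => rw [mul_smul_comm, map_smul, ha, map_smul, map_smul]
    | hw b => rw [← Min.word_mul, eval_word, eval_word, eval_word]; rfl

theorem eval_ad_pow (x y : FreeNonUnitalNonAssocAlgebra K X) (n : ℕ) :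
    eval br ρ ((ad x ^ n) y) = (br (eval br ρ x) ^ n) (eval br ρ y) := by
  induction n with
  | zero => simp
  | succ n ih =>
    rw [pow_succ', Module.End.mul_apply, pow_succ', Module.End.mul_apply, ← ih]
    exact eval_mul br ρ x _

/-- Graded antisymmetry and the graded Jacobi identity for homogeneous elements. -/
structure IsGradedLie (br : E →ₗ[K] E →ₗ[K] E) (G : ℤ → Submodule K E) : Prop where
  mem : ∀ {m n x y}, x ∈ G m → y ∈ G n → br x y ∈ G (m + n)
  skew : ∀ {m n x y}, x ∈ G m → y ∈ G n → br x y = -(sgn m n • br y x)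
  jacobi : ∀ {m n k x y z}, x ∈ G m → y ∈ G n → z ∈ G k →
    br x (br y z) = br (br x y) z + sgn m n • br y (br x z)

theorem IsLieQuot.isGradedLie {d : X → ℤ} {br : E →ₗ[K] E →ₗ[K] E}
    {π : FreeNonUnitalNonAssocAlgebra K X →ₗ[K] E} (h : IsLieQuot d br π) :
    IsGradedLie br (wordSpan π d) where
  mem := h.bracket_mem d
  skew := h.skew
  jacobi hx hy _ := h.jacobi hx hy _

variable {br ρ} {d : X → ℤ} {G : ℤ → Submodule K E} (hG : IsGradedLie br G)
  (hρ : ∀ x, ρ x ∈ G (d x))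

include hG hρ

theorem evalWord_mem (a : FreeMagma X) : evalWord br ρ a ∈ G (wordDeg d a) := by
  induction a using FreeMagma.rec with
  | of x => exact hρ x
  | mul a b ha hb => exact hG.mem ha hb

/-- The evaluation map factors through the Lie superalgebra given by generators and relations if the
relators are mapped to zero. -/
theorem relIdeal_le_ker_eval {R : Set (FreeNonUnitalNonAssocAlgebra K X)}
    (hR : ∀ x ∈ R, eval br ρ x = 0) : relIdeal d R ≤ LinearMap.ker (eval br ρ) := by
  refine sInf_le ⟨fun x y hy => ?_, ?_⟩
  · rw [LinearMap.mem_ker] at hy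
    constructor
    · change eval br ρ (x * y) = 0
      rw [eval_mul, hy, map_zero]
    · change eval br ρ (y * x) = 0
      rw [eval_mul, hy, map_zero, LinearMap.zero_apply]
  · rintro x (hx | hx)
    · have hw := evalWord_mem hG hρ
      cases hx with
      | skew a b =>
        rw [SetLike.mem_coe, LinearMap.mem_ker, map_add, map_zsmul, eval_mul, eval_mul, eval_word,
          eval_word, hG.skew (hw a) (hw b), neg_add_cancel]
      | jacobi a b c =>
        rw [SetLike.mem_coe, LinearMap.mem_ker, map_sub, map_sub, map_zsmul]
        simp only [eval_mul, eval_word]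
        rw [hG.jacobi (hw a) (hw b) (hw c)]; abel
    · exact hR x hx

end Eval

/-- A surjective homomorphism between minimal Lie superalgebras is given by images of the generators
that satisfy the relations. -/
theorem Min.exists_hom {K : Type u} [Field K] [CharZero K] {X : Type v} {Y : Type w} {d : X → ℤ}
    {R : Set (FreeNonUnitalNonAssocAlgebra K X)} {d₂ : Y → ℤ}
    {R₂ : Set (FreeNonUnitalNonAssocAlgebra K Y)} {ℓ₂ : Pres d₂ R₂}
    (hℓ₂ : IsGradingElement d₂ d₂ (presBracket d₂ R₂) (relIdeal d₂ R₂).mkQ ℓ₂)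
    (ρ : X → Min d₂ d₂ R₂) (hρ : ∀ x, ρ x ∈ grade d₂ d₂ R₂ (d x))
    (hR : ∀ x ∈ R, eval (bracket d₂ d₂ R₂) ρ x = 0)
    (hsurj : ∀ Q : Submodule K (Min d₂ d₂ R₂), (∀ x, ρ x ∈ Q) →
      (∀ x ∈ Q, ∀ y ∈ Q, bracket d₂ d₂ R₂ x y ∈ Q) → Q = ⊤) :
    ∃ φ : Min d d R →ₗ[K] Min d₂ d₂ R₂, (∀ x, φ (gen d d R x) = ρ x) ∧
      (∀ x y, φ (bracket d d R x y) = bracket d₂ d₂ R₂ (φ x) (φ y)) ∧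
      (∀ k, ∀ x ∈ grade d d R k, φ x ∈ grade d₂ d₂ R₂ k) ∧ Function.Surjective φ := by
  have hG : IsGradedLie (bracket d₂ d₂ R₂) (grade d₂ d₂ R₂) := (isLieQuot d₂ d₂ R₂).isGradedLie
  let ev := eval (bracket d₂ d₂ R₂) ρ
  let φ₁ : Pres d R →ₗ[K] Min d₂ d₂ R₂ := (relIdeal d R).liftQ ev (relIdeal_le_ker_eval hG hρ hR)
  have hφ₁ : ∀ x, φ₁ ((relIdeal d R).mkQ x) = ev x := fun x => rfl
  have hbr : ∀ x y, φ₁ (presBracket d R x y) = bracket d₂ d₂ R₂ (φ₁ x) (φ₁ y) := by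
    intro x y
    obtain ⟨x, rfl⟩ := Submodule.mkQ_surjective _ x
    obtain ⟨y, rfl⟩ := Submodule.mkQ_surjective _ y
    exact eval_mul _ _ x y
  have hsur : Function.Surjective φ₁ := by
    rw [← LinearMap.range_eq_top]
    refine hsurj _ (fun x => ⟨(relIdeal d R).mkQ (FreeNonUnitalNonAssocAlgebra.of K x), ?_⟩) ?_
    · rw [hφ₁]; exact eval_of _ _ x
    · rintro _ ⟨x, rfl⟩ _ ⟨y, rfl⟩
      exact ⟨_, hbr x y⟩
  have hgr : ∀ k, ∀ x ∈ wordSpan (relIdeal d R).mkQ d k, φ₁ x ∈ wordSpan (proj d₂ d₂ R₂) d₂ k := by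
    intro k x hx
    induction hx using Submodule.span_induction with
    | mem x hx =>
      obtain ⟨a, rfl, rfl⟩ := hx
      rw [hφ₁]
      have := evalWord_mem hG hρ a
      rw [← eval_word] at this
      exact this
    | zero => rw [map_zero]; exact zero_mem _
    | add x y _ _ hx hy => rw [map_add]; exact add_mem hx hy
    | smul c x _ hx => rw [map_smul]; exact Submodule.smul_mem _ _ hx
  -- Surjectivity makes the image of the maximal ideal an ideal without components in the local part.
  have hker : maxIdeal (presBracket d R) (presGrade d R d) ≤ LinearMap.ker φ₁ := by
    have h1 : (maxIdeal (presBracket d R) (presGrade d R d)).map φ₁ = ⊥ := by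
      refine eq_bot_of_le hℓ₂ ?_ ?_
      · rintro z _ ⟨y, hy, rfl⟩
        obtain ⟨x, rfl⟩ := hsur z
        have := maxIdeal_isIdeal (presBracket d R) (presGrade d R d) x y hy
        rw [← hbr, ← hbr]
        exact ⟨⟨_, this.1, rfl⟩, ⟨_, this.2, rfl⟩⟩
      · refine (Submodule.map_mono maxIdeal_le).trans ?_
        simp only [Submodule.map_iSup]
        refine iSup₂_mono fun k hk => ?_
        rintro _ ⟨x, hx, rfl⟩
        exact hgr k x hx
    rwa [LinearMap.le_ker_iff_map]
  refine ⟨(maxIdeal (presBracket d R) (presGrade d R d)).liftQ φ₁ hker, fun x => ?_, fun x y => ?_,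
    fun k x hx => ?_, fun y => ?_⟩
  · exact eval_of _ _ x
  · obtain ⟨x, rfl⟩ := ofPres_surjective x
    obtain ⟨y, rfl⟩ := ofPres_surjective y
    exact hbr x y
  · have hx' : x ∈ wordSpan (proj d d R) d k := hx
    rw [← map_wordSpan] at hx'
    obtain ⟨y, hy, rfl⟩ := hx'
    exact hgr k y hy
  · obtain ⟨x, hx⟩ := hsur y
    exact ⟨ofPres d d R x, hx⟩

/-- A surjective graded homomorphism between minimal Lie superalgebras that is injective on the
local part is an isomorphism. -/
theorem Min.exists_equiv {K : Type u} [Field K] [CharZero K] {X : Type v} {Y : Type w} {d : X → ℤ}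
    {R : Set (FreeNonUnitalNonAssocAlgebra K X)} {d₂ : Y → ℤ}
    {R₂ : Set (FreeNonUnitalNonAssocAlgebra K Y)} {ℓ : Pres d R} {ℓ₂ : Pres d₂ R₂}
    (hℓ : IsGradingElement d d (presBracket d R) (relIdeal d R).mkQ ℓ)
    (hℓ₂ : IsGradingElement d₂ d₂ (presBracket d₂ R₂) (relIdeal d₂ R₂).mkQ ℓ₂)
    (φ : Min d d R →ₗ[K] Min d₂ d₂ R₂)
    (hbr : ∀ x y, φ (bracket d d R x y) = bracket d₂ d₂ R₂ (φ x) (φ y))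
    (hgr : ∀ k, ∀ x ∈ grade d d R k, φ x ∈ grade d₂ d₂ R₂ k) (hsur : Function.Surjective φ)
    (hm : ∀ x ∈ grade d d R (-1), φ x = 0 → x = 0) (h0 : ∀ x ∈ grade d d R 0, φ x = 0 → x = 0)
    (hp : ∀ x ∈ grade d d R 1, φ x = 0 → x = 0) :
    ∃ ψ : Min d d R ≃ₗ[K] Min d₂ d₂ R₂,
      (∀ x y, ψ (bracket d d R x y) = bracket d₂ d₂ R₂ (ψ x) (ψ y)) ∧
      ∀ k, (grade d d R k).map ψ.toLinearMap = grade d₂ d₂ R₂ k := by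
  have hq := isLieQuot d d R
  have hq₂ := isLieQuot d₂ d₂ R₂
  have hℓ' := isGradingElement (d' := d) hℓ
  have hℓ₂' := isGradingElement (d' := d₂) hℓ₂
  have hideal : IsIdeal (bracket d d R) (LinearMap.ker φ) := by
    intro x y hy
    rw [LinearMap.mem_ker] at hy
    rw [LinearMap.mem_ker, LinearMap.mem_ker, hbr, hbr, hy]
    simp
  have hker : LinearMap.ker φ = ⊥ := by
    refine eq_bot_of_le hℓ hideal (IsLieQuot.le_of_inf_eq_bot
      (hq.isGraded hℓ' fun y hy => (hideal _ y hy).1) ?_ ?_ ?_)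
    exacts [(Submodule.eq_bot_iff _).mpr fun x hx => hm x hx.2 hx.1,
      (Submodule.eq_bot_iff _).mpr fun x hx => h0 x hx.2 hx.1,
      (Submodule.eq_bot_iff _).mpr fun x hx => hp x hx.2 hx.1]
  let ψ := LinearEquiv.ofBijective φ ⟨LinearMap.ker_eq_bot.mp hker, hsur⟩
  refine ⟨ψ, hbr, fun k => le_antisymm ?_ fun y hy => ?_⟩
  · rintro _ ⟨x, hx, rfl⟩
    exact hgr k x hx
  · have h1 : y ∈ ⨆ k, (grade d d R k).map φ := by
      rw [← Submodule.map_iSup]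
      have : (⨆ k, grade d d R k) = ⊤ := hq.iSup_wordSpan d
      rw [this]
      obtain ⟨x, rfl⟩ := hsur y
      exact ⟨x, trivial, rfl⟩
    exact hq₂.mem_of_mem_iSup hℓ₂' (F := fun k => (grade d d R k).map φ)
      (by rintro k _ ⟨x, hx, rfl⟩; exact hgr k x hx) hy h1

/-! ### Representations -/

section Operators

variable {K : Type*} [Field K] {A : Type*} [Ring A] [Algebra K A]

variable (A) in
/-- Laurent polynomials with coefficients in `A`; the powers of the variable keep track of the
degree. -/
def Laurent : Type _ := ℤ →₀ A

noncomputable instance : AddCommGroup (Laurent A) := inferInstanceAs (AddCommGroup (ℤ →₀ A))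

noncomputable instance : Module K (Laurent A) := inferInstanceAs (Module K (ℤ →₀ A))

variable (K A) in
/-- The monomial with a given coefficient. -/
noncomputable def Laurent.single (n : ℤ) : A →ₗ[K] Laurent A := Finsupp.lsingle n

theorem Laurent.single_eq_zero {n : ℤ} {a : A} : Laurent.single K A n a = 0 ↔ a = 0 :=
  Finsupp.single_eq_zero

theorem superComm_aux (m n : ℤ) (a b : A) :
    (Finsupp.lsum K fun m => (Finsupp.lsum K : (ℤ → A →ₗ[K] (ℤ →₀ A)) ≃ₗ[K] _).toLinearMap ∘ₗ
      LinearMap.pi fun n => (LinearMap.mul K A - sgn m n • (LinearMap.mul K A).flip).compr₂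
        (Finsupp.lsingle (m + n))) (Finsupp.single m a) (Finsupp.single n b) =
      Finsupp.single (m + n) (a * b - sgn m n • (b * a)) := by
  simp

variable (K A) in
/-- The supercommutator of operators, where an operator has the degree of the monomial that it
is the coefficient of. -/
noncomputable def superComm : Laurent A →ₗ[K] Laurent A →ₗ[K] Laurent A :=
  Finsupp.lsum K fun m => (Finsupp.lsum K : (ℤ → A →ₗ[K] (ℤ →₀ A)) ≃ₗ[K] _).toLinearMap ∘ₗ
    LinearMap.pi fun n => (LinearMap.mul K A - sgn m n • (LinearMap.mul K A).flip).compr₂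
      (Finsupp.lsingle (m + n))

theorem superComm_single (m n : ℤ) (a b : A) :
    superComm K A (Laurent.single K A m a) (Laurent.single K A n b) =
      Laurent.single K A (m + n) (a * b - sgn m n • (b * a)) := by
  exact superComm_aux m n a b

theorem sgn_comm (m n : ℤ) : sgn m n = sgn n m := by rw [sgn, sgn, mul_comm]

theorem sgn_mul_self (m n : ℤ) : sgn m n * sgn m n = 1 := by
  rw [sgn, ← Units.val_mul, Int.units_mul_self]; rfl

theorem sgn_add_left (m n k : ℤ) : sgn (m + n) k = sgn m k * sgn n k := by
  rw [sgn, sgn, sgn, add_mul, Int.negOnePow_add, Units.val_mul]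

theorem sgn_add_right (m n k : ℤ) : sgn m (n + k) = sgn m n * sgn m k := by
  rw [sgn, sgn, sgn, mul_add, Int.negOnePow_add, Units.val_mul]

theorem superComm_isGradedLie :
    IsGradedLie (superComm K A) fun k => LinearMap.range (Laurent.single K A k) where
  mem := by
    rintro m n _ _ ⟨a, rfl⟩ ⟨b, rfl⟩
    rw [superComm_single]
    exact ⟨_, rfl⟩
  skew := by
    rintro m n _ _ ⟨a, rfl⟩ ⟨b, rfl⟩
    rw [superComm_single, superComm_single,
      add_comm n m, sgn_comm n m, ← map_zsmul, ← map_neg, smul_sub, smul_smul,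
      sgn_mul_self, one_smul, neg_sub]
  jacobi := by
    rintro m n k _ _ _ ⟨a, rfl⟩ ⟨b, rfl⟩ ⟨c, rfl⟩
    simp only [superComm_single, ← map_zsmul, add_assoc, add_left_comm n m]
    rw [← map_add]
    congr 1
    simp only [sgn_add_left, sgn_add_right, mul_sub, sub_mul, smul_sub, mul_smul_comm,
      smul_mul_assoc, mul_assoc, smul_smul, sgn_comm n m]
    have h := sgn_mul_self m n
    rcases mul_self_eq_one_iff.mp (sgn_mul_self m n) with h1 | h1 <;>
    rcases mul_self_eq_one_iff.mp (sgn_mul_self m k) with h2 | h2 <;>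
    rcases mul_self_eq_one_iff.mp (sgn_mul_self n k) with h3 | h3 <;>
    rw [h1, h2, h3] <;> simp only [mul_one, mul_neg, neg_neg, one_smul, neg_smul] <;> abel

end Operators

namespace Triple

variable {K : Type u} [Field K] (D : Triple K)

/-- Operators that satisfy the relations of `𝓑` define a representation of the maximal Lie
superalgebra with these relations. -/
theorem eq_zero_of_mkQ_e_eq_zero {A : Type*} [Ring A] [Algebra K A] (E F H : Option (Fin D.r) → A)
    (he : ∀ i j, H i * E j = E j * H i + D.B i j • E j)
    (hf : ∀ i j, H i * F j = F j * H i - D.B i j • F j)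
    (hef : ∀ i j, E i * F j = sgn (GenB.deg (GenB.e i)) (GenB.deg (GenB.f j)) • (F j * E i) +
      if i = j then H i else 0) {i : Option (Fin D.r)}
    (h : (relIdeal GenB.deg D.relB).mkQ ((GenB.e i).of K) = 0) : E i = 0 := by
  let ρ : GenB D.r → Laurent A := fun x => Laurent.single K A (GenB.deg x) (match x with
    | .e i => E i
    | .f i => F i
    | .h i => H i)
  have hle : relIdeal GenB.deg D.relB ≤ LinearMap.ker (eval (superComm K A) ρ) := by
    refine relIdeal_le_ker_eval superComm_isGradedLie (fun x => ⟨_, rfl⟩) ?_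
    rintro x (⟨i, j⟩ | ⟨i, j⟩ | ⟨i⟩ | ⟨i, j, hij⟩) <;>
      simp only [GenB.of, map_sub, map_add, map_smul, eval_mul, eval_of, superComm_single, he,
        hf, hef]
    · simp [GenB.deg]
    · simp [GenB.deg]
    · have : GenB.deg (GenB.e i) + GenB.deg (GenB.f i) = GenB.deg (GenB.h i) := by
        cases i <;> rfl
      simp [this]
    · simp [hij]
  have h1 := hle ((Submodule.Quotient.mk_eq_zero _).mp h)
  rw [LinearMap.mem_ker, GenB.of, eval_of] at h1
  exact Laurent.single_eq_zero.mp h1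

/-! ### A highest weight module of the contragredient Lie superalgebra -/

/-- The creation operators. -/
noncomputable def vermaF (j : Option (Fin D.r)) : Module.End K (List (Option (Fin D.r)) →₀ K) :=
  Finsupp.lmapDomain K K (List.cons j)

/-- The Cartan elements, acting with weight `1` on the highest weight vector. -/
noncomputable def vermaH (i : Option (Fin D.r)) : Module.End K (List (Option (Fin D.r)) →₀ K) :=
  Finsupp.linearCombination K fun w => (1 - (w.map (D.B i)).sum) • Finsupp.single w (1 : K)

/-- The value of an annihilation operator at a word. -/
noncomputable def vermaEWord (D : Triple K) (i : Option (Fin D.r)) :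
    List (Option (Fin D.r)) → (List (Option (Fin D.r)) →₀ K)
  | [] => 0
  | j :: w => sgn (GenB.deg (GenB.e i)) (GenB.deg (GenB.f j)) • D.vermaF j (vermaEWord D i w) +
      if i = j then D.vermaH i (Finsupp.single w 1) else 0

/-- The annihilation operators. -/
noncomputable def vermaE (i : Option (Fin D.r)) : Module.End K (List (Option (Fin D.r)) →₀ K) :=
  Finsupp.linearCombination K (D.vermaEWord i)

theorem vermaF_single (j w) : D.vermaF j (Finsupp.single w 1) = Finsupp.single (j :: w) 1 := by
  simp [vermaF]

theorem vermaH_single (i w) : D.vermaH i (Finsupp.single w 1) =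
    (1 - (w.map (D.B i)).sum) • Finsupp.single w (1 : K) := by
  simp [vermaH]

theorem vermaE_single (i w) : D.vermaE i (Finsupp.single w 1) = D.vermaEWord i w := by
  simp [vermaE]

theorem vermaH_vermaF (i j) : D.vermaH i * D.vermaF j =
    D.vermaF j * D.vermaH i - D.B i j • D.vermaF j := by
  refine Finsupp.lhom_ext' fun w => LinearMap.ext_ring ?_
  simp only [LinearMap.comp_apply, Finsupp.lsingle_apply, Module.End.mul_apply,
    LinearMap.sub_apply, LinearMap.smul_apply, vermaF_single, vermaH_single, map_smul,
    List.map_cons, List.sum_cons, ← sub_smul]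
  congr 1; ring

theorem vermaE_vermaF (i j) : D.vermaE i * D.vermaF j =
    sgn (GenB.deg (GenB.e i)) (GenB.deg (GenB.f j)) • (D.vermaF j * D.vermaE i) +
      if i = j then D.vermaH i else 0 := by
  refine Finsupp.lhom_ext' fun w => LinearMap.ext_ring ?_
  simp only [LinearMap.comp_apply, Finsupp.lsingle_apply, Module.End.mul_apply,
    LinearMap.add_apply, LinearMap.smul_apply, vermaF_single, vermaE_single, vermaEWord]
  split_ifs <;> rfl

theorem vermaH_vermaE (i j) : D.vermaH i * D.vermaE j =
    D.vermaE j * D.vermaH i + D.B i j • D.vermaE j := by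
  refine Finsupp.lhom_ext' fun w => LinearMap.ext_ring ?_
  simp only [LinearMap.comp_apply, Finsupp.lsingle_apply, Module.End.mul_apply,
    LinearMap.add_apply, LinearMap.smul_apply, vermaH_single, map_smul, vermaE_single, ← add_smul]
  induction w with
  | nil => simp [vermaEWord]
  | cons k w ih =>
    have h1 := LinearMap.congr_fun (D.vermaH_vermaF i k) (D.vermaEWord j w)
    simp only [Module.End.mul_apply, LinearMap.sub_apply, LinearMap.smul_apply, ih, map_smul] at h1
    rw [vermaEWord, map_add, map_zsmul, h1, smul_add]
    congr 1
    · rw [← sub_smul, smul_comm]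
      congr 1
      simp only [List.map_cons, List.sum_cons]; ring
    · split_ifs with h
      · subst h
        rw [vermaH_single, map_smul, vermaH_single, smul_comm, smul_comm _ (1 - _)]
        simp only [smul_smul]
        congr 1
        simp only [List.map_cons, List.sum_cons]; ring
      · simp

theorem mkQ_e_ne_zero (i) : (relIdeal GenB.deg D.relB).mkQ ((GenB.e i).of K) ≠ 0 := by
  intro h
  have h1 := D.eq_zero_of_mkQ_e_eq_zero D.vermaE D.vermaF D.vermaH D.vermaH_vermaE D.vermaH_vermaF
    D.vermaE_vermaF h
  have h2 := LinearMap.congr_fun h1 (Finsupp.single [i] 1)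
  rw [vermaE_single, vermaEWord, vermaEWord, map_zero, smul_zero, zero_add, if_pos rfl,
    vermaH_single] at h2
  simp at h2

/-! ### Inner gradings -/

section Grading

variable [CharZero K] {E : Type*} [AddCommGroup E] [Module K E] {br : E →ₗ[K] E →ₗ[K] E}
  {π : FreeNonUnitalNonAssocAlgebra K (GenB D.r) →ₗ[K] E}

omit [CharZero K] in
open FreeNonUnitalNonAssocAlgebra in
theorem exists_isGradingElement (h : IsLieQuot GenB.deg br π) (hR : ∀ x ∈ D.relB, π x = 0)
    (g : GenB D.r → ℤ) (hf : ∀ i, g (.f i) = - g (.e i)) (hh : ∀ i, g (.h i) = 0) :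
    ∃ ℓ, IsGradingElement GenB.deg g br π ℓ := by
  have he' : ∀ i j, br (π (of K (GenB.h i))) (π (of K (GenB.e j))) =
      D.B i j • π (of K (GenB.e j)) := fun i j => by
    have := hR _ (RelB.he i j)
    rwa [map_sub, map_smul, h.map_mul, sub_eq_zero] at this
  have hf' : ∀ i j, br (π (of K (GenB.h i))) (π (of K (GenB.f j))) =
      -(D.B i j • π (of K (GenB.f j))) := fun i j => by
    have := hR _ (RelB.hf i j)
    rwa [map_add, map_smul, h.map_mul, ← eq_neg_iff_add_eq_zero] at this
  have hef' : ∀ i, br (π (of K (GenB.e i))) (π (of K (GenB.f i))) =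
      π (of K (GenB.h i)) := fun i => by
    have := hR _ (RelB.ef i)
    rwa [map_sub, h.map_mul, sub_eq_zero] at this
  have hhh : ∀ i j, br (π (of K (GenB.h i))) (π (of K (GenB.h j))) = 0 := by
    intro i j
    rw [← hef' j, h.jacobi (m := 0) (n := GenB.deg (GenB.e j))
      (of_mem_wordSpan π GenB.deg (GenB.h i)) (of_mem_wordSpan π GenB.deg (GenB.e j)),
      he', hf', Min.sgn_zero_left, one_smul, map_neg,
      map_smul, map_smul, LinearMap.smul_apply, add_neg_cancel]
  let r := Matrix.vecMul (fun i => (g (.e i) : K)) D.B⁻¹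
  have hr : ∀ j, ∑ i, r i * D.B i j = g (.e j) := by
    have : Matrix.vecMul r D.B = fun i => (g (.e i) : K) := by
      rw [Matrix.vecMul_vecMul, Matrix.nonsing_inv_mul _ (isUnit_iff_ne_zero.mpr D.B_det),
        Matrix.vecMul_one]
    exact fun j => congrFun this j
  refine ⟨∑ i, r i • π (of K (GenB.h i)), sum_mem fun i _ => Submodule.smul_mem _ _
    (of_mem_wordSpan π GenB.deg (GenB.h i)), fun x => ?_⟩
  rw [map_sum, LinearMap.sum_apply]
  simp only [map_smul, LinearMap.smul_apply]
  rcases x with j | j | j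
  · rw [← hr j, Finset.sum_smul]
    exact Finset.sum_congr rfl fun i _ => by rw [mul_smul, ← he']
  · rw [hf j, Int.cast_neg, ← hr j, neg_smul, Finset.sum_smul, ← Finset.sum_neg_distrib]
    exact Finset.sum_congr rfl fun i _ => by rw [mul_smul, ← smul_neg, ← hf']
  · rw [hh j, Int.cast_zero, zero_smul]
    exact Finset.sum_eq_zero fun i _ => by
      rw [show br (π (of K (GenB.h i))) (π (of K (GenB.h j))) = 0 from
        hhh i j, smul_zero]

theorem genB_e_ne_zero (i) : D.genB (.e i) ≠ 0 := by
  obtain ⟨ℓ, hℓ⟩ := D.exists_isGradingElement (presBracket_isLieQuot GenB.deg D.relB)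
    (fun x hx => (Submodule.Quotient.mk_eq_zero _).mpr (subset_idealGen _ _ (Or.inr hx)))
    GenB.degPrincipal (fun _ => rfl) (fun _ => rfl)
  intro h0
  refine D.mkQ_e_ne_zero i (Min.eq_zero_of_ofPres_eq_zero hℓ (Submodule.mem_sup_right ?_) h0)
  exact of_mem_wordSpan (relIdeal GenB.deg D.relB).mkQ GenB.degPrincipal (GenB.e i)

end Grading

end Triple

namespace Triple

variable {K : Type u} [Field K] (D : Triple K)

/-! ### Chevalley generators of the Lie algebra with a given Cartan matrix -/

/-- The quotient map from the free Lie algebra. -/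
noncomputable def toLieAlg :
    FreeLieAlgebra K (CartanMatrix.Generators (Fin D.r)) →ₗ⁅K⁆ D.LieAlg :=
  { (CartanMatrix.Relations.toIdeal K D.A).toSubmodule.mkQ with
    map_lie' := fun {x y} => LieSubmodule.Quotient.mk_bracket _ x y }

theorem toLieAlg_surjective : Function.Surjective D.toLieAlg := Submodule.mkQ_surjective _

theorem toLieAlg_eq_zero {x} (hx : x ∈ CartanMatrix.Relations.toSet K D.A) : D.toLieAlg x = 0 :=
  LieSubmodule.Quotient.mk_eq_zero'.mpr (LieSubmodule.subset_lieSpan hx)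

/-- The Chevalley generators. -/
noncomputable def chev : Chev K (Fin D.r) D.LieAlg where
  A := D.A
  e i := D.toLieAlg (FreeLieAlgebra.of K (CartanMatrix.Generators.E i))
  f i := D.toLieAlg (FreeLieAlgebra.of K (CartanMatrix.Generators.F i))
  h i := D.toLieAlg (FreeLieAlgebra.of K (CartanMatrix.Generators.H i))
  ef i := by
    have := D.toLieAlg_eq_zero (Or.inl (Or.inl (Or.inl (Or.inl (Or.inr ⟨(i, i), rfl⟩)))))
    simpa [CartanMatrix.Relations.EF, sub_eq_zero] using this
  ef_ne i j hij := by
    have := D.toLieAlg_eq_zero (Or.inl (Or.inl (Or.inl (Or.inl (Or.inr ⟨(i, j), rfl⟩)))))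
    simpa [CartanMatrix.Relations.EF, hij] using this
  hh i j := by
    have := D.toLieAlg_eq_zero (Or.inl (Or.inl (Or.inl (Or.inl (Or.inl ⟨(i, j), rfl⟩)))))
    simpa [CartanMatrix.Relations.HH] using this
  he i j := by
    have := D.toLieAlg_eq_zero (Or.inl (Or.inl (Or.inl (Or.inr ⟨(i, j), rfl⟩))))
    simpa [CartanMatrix.Relations.HE, sub_eq_zero, Int.cast_smul_eq_zsmul] using this
  hf i j := by
    have := D.toLieAlg_eq_zero (Or.inl (Or.inl (Or.inr ⟨(i, j), rfl⟩)))
    simpa [CartanMatrix.Relations.HF, ← eq_neg_iff_add_eq_zero, Int.cast_smul_eq_zsmul] using this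
  gen X he hf := by
    rw [eq_top_iff]
    intro x _
    obtain ⟨y, rfl⟩ := D.toLieAlg_surjective x
    have hE (i) : D.toLieAlg (FreeLieAlgebra.of K (CartanMatrix.Generators.E i)) ∈ X := he i
    have hF (i) : D.toLieAlg (FreeLieAlgebra.of K (CartanMatrix.Generators.F i)) ∈ X := hf i
    have hH (i) : D.toLieAlg (FreeLieAlgebra.of K (CartanMatrix.Generators.H i)) ∈ X := by
      have := D.toLieAlg_eq_zero (Or.inl (Or.inl (Or.inl (Or.inl (Or.inr ⟨(i, i), rfl⟩)))))
      have h2 : ⁅D.toLieAlg (FreeLieAlgebra.of K (CartanMatrix.Generators.E i)),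
          D.toLieAlg (FreeLieAlgebra.of K (CartanMatrix.Generators.F i))⁆ =
          D.toLieAlg (FreeLieAlgebra.of K (CartanMatrix.Generators.H i)) := by
        simpa [CartanMatrix.Relations.EF, sub_eq_zero] using this
      rw [← h2]
      exact X.lie_mem (hE i) (hF i)
    let F : FreeLieAlgebra K (CartanMatrix.Generators (Fin D.r)) →ₗ⁅K⁆ X :=
      FreeLieAlgebra.lift K fun x => ⟨D.toLieAlg (FreeLieAlgebra.of K x), by
        rcases x with i | i | i
        exacts [hH i, hE i, hF i]⟩
    have hXF : X.incl.comp F = D.toLieAlg :=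
      FreeLieAlgebra.hom_ext fun x => by
        rw [LieHom.comp_apply, FreeLieAlgebra.lift_of_apply]; rfl
    rw [← hXF]
    exact (F y).2

theorem chev_h (i : Fin D.r) : D.chev.h i = D.cartan i := rfl

theorem exists_lieHom {L : Type*} [LieRing L] [LieAlgebra K L] (e f h : Fin D.r → L)
    (hh : ∀ i j, ⁅h i, h j⁆ = 0) (ef : ∀ i, ⁅e i, f i⁆ = h i)
    (ef_ne : ∀ i j, i ≠ j → ⁅e i, f j⁆ = 0) (he : ∀ i j, ⁅h i, e j⁆ = (D.A i j : K) • e j)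
    (hf : ∀ i j, ⁅h i, f j⁆ = -((D.A i j : K) • f j))
    (se : ∀ i j, i ≠ j → (LieAlgebra.ad K L (e i) ^ ((-D.A i j).toNat + 1)) (e j) = 0)
    (sf : ∀ i j, i ≠ j → (LieAlgebra.ad K L (f i) ^ ((-D.A i j).toNat + 1)) (f j) = 0) :
    ∃ θ : D.LieAlg →ₗ⁅K⁆ L, (∀ i, θ (D.chev.e i) = e i) ∧ (∀ i, θ (D.chev.f i) = f i) ∧
      ∀ i, θ (D.chev.h i) = h i := by
  let F : FreeLieAlgebra K (CartanMatrix.Generators (Fin D.r)) →ₗ⁅K⁆ L :=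
    FreeLieAlgebra.lift K fun x => match x with
      | .E i => e i
      | .F i => f i
      | .H i => h i
  have hE : ∀ i, F (FreeLieAlgebra.of K (.E i)) = e i := fun i => FreeLieAlgebra.lift_of_apply _ _
  have hF : ∀ i, F (FreeLieAlgebra.of K (.F i)) = f i := fun i => FreeLieAlgebra.lift_of_apply _ _
  have hH : ∀ i, F (FreeLieAlgebra.of K (.H i)) = h i := fun i => FreeLieAlgebra.lift_of_apply _ _
  have hpow : ∀ x y n, F ((LieAlgebra.ad K _ x ^ n) y) = (LieAlgebra.ad K L (F x) ^ n) (F y) := by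
    intro x y n
    induction n with
    | zero => rfl
    | succ n ih =>
      simp only [pow_succ', Module.End.mul_apply, LieAlgebra.ad_apply, LieHom.map_lie, ih]
  have hle : CartanMatrix.Relations.toIdeal K D.A ≤ F.ker := by
    refine LieSubmodule.lieSpan_le.mpr ?_
    rintro _ (((((⟨⟨i, j⟩, rfl⟩ | ⟨⟨i, j⟩, rfl⟩) | ⟨⟨i, j⟩, rfl⟩) | ⟨⟨i, j⟩, rfl⟩) |
      ⟨⟨i, j⟩, rfl⟩) | ⟨⟨i, j⟩, rfl⟩) <;> rw [SetLike.mem_coe, LieHom.mem_ker]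
    · simp [CartanMatrix.Relations.HH, hH, hh]
    · by_cases hij : i = j
      · subst hij; simp [CartanMatrix.Relations.EF, hE, hF, hH, ef]
      · simp [CartanMatrix.Relations.EF, hE, hF, hij, ef_ne]
    · simp [CartanMatrix.Relations.HE, hE, hH, he, Int.cast_smul_eq_zsmul]
    · simp [CartanMatrix.Relations.HF, hF, hH, hf, Int.cast_smul_eq_zsmul]
    · by_cases hij : i = j
      · subst hij; simp [CartanMatrix.Relations.adE]
      · have := se i j hij
        rw [pow_succ, Module.End.mul_apply, LieAlgebra.ad_apply] at this
        simpa [CartanMatrix.Relations.adE, hpow, hE] using this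
    · by_cases hij : i = j
      · subst hij; simp [CartanMatrix.Relations.adF]
      · have := sf i j hij
        rw [pow_succ, Module.End.mul_apply, LieAlgebra.ad_apply] at this
        simpa [CartanMatrix.Relations.adF, hpow, hF] using this
  let θ : D.LieAlg →ₗ⁅K⁆ L :=
    { (CartanMatrix.Relations.toIdeal K D.A).toSubmodule.liftQ F.toLinearMap
      (fun x hx => LieHom.mem_ker.mp (hle hx)) with
      map_lie' := fun {x y} => by
        obtain ⟨x, rfl⟩ := D.toLieAlg_surjective x
        obtain ⟨y, rfl⟩ := D.toLieAlg_surjective y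
        rw [← LieHom.map_lie]
        exact LieHom.map_lie F x y }
  exact ⟨θ, hE, hF, hH⟩

end Triple

/-- The action of the third element of an `𝔰𝔩₂`-triple on the vectors generated by a highest weight
vector. -/
theorem sl2_lie_pow {K E : Type*} [Field K] [AddCommGroup E] [Module K E] {e f h : Module.End K E}
    (hfe : ∀ v, f (e v) = e (f v) - h v) (he : ∀ v, h (e v) = e (h v) + (2 : K) • e v) {x : E}
    {μ : K} (hf : f x = 0) (hx : h x = μ • x) (m : ℕ) :
    h ((e ^ m) x) = (μ + 2 * m) • (e ^ m) x ∧
      f ((e ^ (m + 1)) x) = -(((m + 1) * (μ + m)) • (e ^ m) x) := by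
  induction m with
  | zero => simp [hfe, hf, hx]
  | succ m ih =>
    have h1 : h ((e ^ (m + 1)) x) = (μ + 2 * (m + 1 : ℕ)) • (e ^ (m + 1)) x := by
      rw [pow_succ', Module.End.mul_apply, he, ih.1, map_smul, ← add_smul]
      congr 1; push_cast; ring
    refine ⟨h1, ?_⟩
    rw [pow_succ', Module.End.mul_apply, hfe, ih.2, h1, map_neg, map_smul, pow_succ' e m,
      Module.End.mul_apply, ← neg_smul, ← neg_smul, ← sub_smul]
    congr 1; push_cast; ring

namespace Triple

variable {K : Type u} [Field K] (D : Triple K)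

theorem B_eq_zero {i : Fin D.r} {j : Option (Fin D.r)} (h : D.B (some i) j = 0)
    [CharZero K] : D.B j (some i) = 0 := by
  cases j with
  | none =>
    have h1 : (D.lam i : K) = 0 := neg_eq_zero.mp h
    change -((D.lam i : K) / D.ε i) = 0
    rw [h1, zero_div, neg_zero]
  | some j =>
    have h1 : (D.A i j : K) = 0 := h
    change (D.A j i : K) = 0
    exact_mod_cast D.A_zero i j (by exact_mod_cast h1)

theorem exists_B_eq {i : Fin D.r} {j : Option (Fin D.r)} (h : some i ≠ j) :
    ∃ n : ℕ, D.B (some i) j = -(n : K) := by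
  cases j with
  | none => exact ⟨D.lam i, rfl⟩
  | some j =>
    refine ⟨(-D.A i j).toNat, ?_⟩
    change (D.A i j : K) = _
    have h1 := D.A_nonpos i j fun h' => h (congrArg some h')
    have h2 : (((-D.A i j).toNat : ℤ) : K) = ((-D.A i j : ℤ) : K) := by
      rw [Int.toNat_of_nonneg (by omega)]
    rw [Int.cast_natCast] at h2
    rw [h2]; push_cast; ring

variable [CharZero K]

/-! ### Relations in the contragredient Lie superalgebra -/

/-- The Serre element `(ad pᵢ)^(1 - B i j) (p j)` is annihilated by all elements `m k`, where `p`
and `m` are the two families of generators of a contragredient Lie superalgebra. -/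
theorem serre_aux {X E : Type*} [AddCommGroup E] [Module K E]
    {d : X → ℤ} {br : E →ₗ[K] E →ₗ[K] E} {π : FreeNonUnitalNonAssocAlgebra K X →ₗ[K] E}
    (hE : IsLieQuot d br π) {p m h : Option (Fin D.r) → E} {σ : K} {τ : Option (Fin D.r) → K}
    (hσ : σ * σ = 1) (hτ : ∀ i, τ (some i) = -σ) (hp : ∀ i j, br (h i) (p j) = (σ * D.B i j) • p j)
    (hmp : ∀ i, br (m i) (p i) = τ i • h i) (hmp_ne : ∀ i j, i ≠ j → br (m i) (p j) = 0)
    (hp0 : ∀ i, p (some i) ∈ wordSpan π d 0) (hh0 : ∀ i, h i ∈ wordSpan π d 0)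
    (hm : ∀ i, ∃ k, m i ∈ wordSpan π d k)
    {i : Fin D.r} {j : Option (Fin D.r)} (hij : some i ≠ j) {n : ℕ}
    (hn : (n : K) = 1 - D.B (some i) j) (k : Option (Fin D.r)) :
    br (m k) ((br (p (some i)) ^ n) (p j)) = 0 := by
  obtain ⟨b, hb⟩ := D.exists_B_eq hij
  obtain rfl : n = b + 1 := by
    rw [hb] at hn
    have : (n : K) = ((b + 1 : ℕ) : K) := by rw [hn]; push_cast; ring
    exact_mod_cast this
  clear hn
  have jac : ∀ z, br (m k) (br (p (some i)) z) =
      br (br (m k) (p (some i))) z + br (p (some i)) (br (m k) z) := fun z => by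
    obtain ⟨l, hl⟩ := hm k
    rw [hE.jacobi hl (hp0 i), Min.sgn_zero_right, one_smul]
  by_cases hki : k = some i
  · subst hki
    have h1 := (sl2_lie_pow (e := br (p (some i))) (f := br (m (some i)))
      (h := σ • br (h (some i))) (x := p j) (μ := D.B (some i) j) (fun v => ?_) (fun v => ?_)
      (hmp_ne _ _ hij) ?_ b).2
    · rw [h1, hb]; simp
    · rw [jac, hmp, hτ, neg_smul, map_neg, map_smul, LinearMap.neg_apply, LinearMap.smul_apply]
      abel
    · rw [LinearMap.smul_apply, hE.jacobi (hh0 _) (hp0 i), hp, Min.sgn_zero_right, one_smul,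
        map_smul, LinearMap.smul_apply, smul_add, smul_smul, LinearMap.smul_apply, map_smul,
        add_comm,
        ← mul_assoc, hσ, one_mul]
      congr 2
      change (D.A i i : K) = 2
      rw [D.A_diag]; norm_num
    · rw [LinearMap.smul_apply, hp, smul_smul, ← mul_assoc, hσ, one_mul]
  · have jac' : ∀ z, br (m k) (br (p (some i)) z) = br (p (some i)) (br (m k) z) := fun z => by
      rw [jac, hmp_ne _ _ hki, map_zero, LinearMap.zero_apply, zero_add]
    have hpow : ∀ n z, br (m k) ((br (p (some i)) ^ n) z) = (br (p (some i)) ^ n) (br (m k) z) := by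
      intro n z
      induction n with
      | zero => rfl
      | succ n ih => rw [pow_succ', Module.End.mul_apply, jac', ih, Module.End.mul_apply]
    rw [hpow]
    by_cases hkj : k = j
    · subst hkj
      have h1 : br (p (some i)) (h k) = -((σ * D.B k (some i)) • p (some i)) := by
        rw [hE.skew (hp0 i) (hh0 k), Min.sgn_zero_right, one_smul, hp]
      rw [hmp, map_smul, pow_succ, Module.End.mul_apply, h1]
      cases b with
      | zero => rw [D.B_eq_zero (by rw [hb]; simp)]; simp
      | succ b =>
        have h2 : br (p (some i)) (p (some i)) = 0 := by
          have := hE.skew (hp0 i) (hp0 i)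
          rw [Min.sgn_zero_right, one_smul] at this
          rw [eq_neg_iff_add_eq_zero, ← two_smul K] at this
          exact (smul_eq_zero.mp this).resolve_left two_ne_zero
        rw [map_neg, map_smul, pow_succ, Module.End.mul_apply, h2, map_zero, smul_zero, neg_zero,
          smul_zero]
    · rw [hmp_ne _ _ hkj, map_zero]

/-- The bracket of `𝓑`. -/
noncomputable abbrev brB : D.Contra →ₗ[K] D.Contra →ₗ[K] D.Contra :=
  Min.bracket GenB.deg GenB.degPrincipal D.relB

omit [CharZero K] in
theorem isLieQuotB : IsLieQuot GenB.deg D.brB (Min.proj GenB.deg GenB.degPrincipal D.relB) :=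
  Min.isLieQuot _ _ _

omit [CharZero K] in
theorem genB_mem (g : GenB D.r → ℤ) (x : GenB D.r) :
    D.genB x ∈ wordSpan (Min.proj GenB.deg GenB.degPrincipal D.relB) g (g x) :=
  of_mem_wordSpan _ g x

omit [CharZero K] in
theorem brB_e_f_ne {i j} (h : i ≠ j) : D.brB (D.genB (.e i)) (D.genB (.f j)) = 0 := by
  have := D.bracket_gen (.e i) (.f j) 0 (by rw [sub_zero]; exact RelB.ef_ne i j h)
  rwa [map_zero] at this

omit [CharZero K] in
theorem exists_isGradingElementB (g : GenB D.r → ℤ) (hf : ∀ i, g (.f i) = - g (.e i))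
    (hh : ∀ i, g (.h i) = 0) :
    ∃ ℓ, IsGradingElement GenB.deg g (presBracket GenB.deg D.relB)
      (relIdeal GenB.deg D.relB).mkQ ℓ :=
  D.exists_isGradingElement (presBracket_isLieQuot GenB.deg D.relB)
    (fun _ hx => (Submodule.Quotient.mk_eq_zero _).mpr (subset_idealGen _ _ (Or.inr hx))) g hf hh

omit [CharZero K] in
theorem wordSpan_neg {X E : Type*} [AddCommGroup E] [Module K E]
    (π : FreeNonUnitalNonAssocAlgebra K X →ₗ[K] E) (g : X → ℤ) (k : ℤ) :
    wordSpan π (fun x => -g x) k = wordSpan π g (-k) := by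
  have : ∀ a, wordDeg (fun x => -g x) a = -wordDeg g a := by
    intro a
    induction a using FreeMagma.rec with
    | of x => rfl
    | mul a b ha hb => simp only [wordDeg, ha, hb]; ring
  simp only [wordSpan, this, neg_eq_iff_eq_neg]

/-- An element of principal degree at least `2` is zero if it is annihilated by all generators of
principal degree `-1`. -/
theorem eq_zero_of_principal {p m : Option (Fin D.r) → GenB D.r} {σ : ℤ}
    (hσ : σ = 1 ∨ σ = -1) (hp : ∀ i, GenB.degPrincipal (p i) = σ)
    (hm : ∀ i, GenB.degPrincipal (m i) = -σ)
    (hgen : ∀ x, (∃ i, x = p i) ∨ (∃ i, x = .h i) ∨ ∃ i, x = m i)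
    (hhp : ∀ i j, ∃ c : K, D.brB (D.genB (.h i)) (D.genB (p j)) = c • D.genB (p j))
    (hhm : ∀ i j, ∃ c : K, D.brB (D.genB (.h i)) (D.genB (m j)) = c • D.genB (m j))
    (hmp : ∀ i j, ∃ c : K, D.brB (D.genB (m i)) (D.genB (p j)) = c • D.genB (.h i))
    {s : D.Contra} {n : ℤ} (hn : 2 ≤ n)
    (hs : s ∈ wordSpan (Min.proj GenB.deg GenB.degPrincipal D.relB) GenB.degPrincipal (σ * n))
    (hs' : ∀ i, D.brB (D.genB (m i)) s = 0) : s = 0 := by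
  obtain ⟨ℓ, hℓ⟩ := D.exists_isGradingElementB GenB.deg (by rintro (_ | _) <;> rfl) (fun _ => rfl)
  obtain ⟨ℓ', hℓ'⟩ := D.exists_isGradingElementB GenB.degPrincipal (fun _ => rfl) (fun _ => rfl)
  -- The sign `σ` treats the generators `e_i` and `f_i` at the same time.
  let g : GenB D.r → ℤ := fun x => σ * GenB.degPrincipal x
  have hg : ∀ k, wordSpan (Min.proj GenB.deg GenB.degPrincipal D.relB) g k =
      wordSpan (Min.proj GenB.deg GenB.degPrincipal D.relB) GenB.degPrincipal (σ * k) := by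
    intro k
    rcases hσ with rfl | rfl
    · simp only [g, one_mul]
    · simp only [g, neg_mul, one_mul]; exact wordSpan_neg _ _ _
  have hσσ : σ * σ = 1 := by rcases hσ with rfl | rfl <;> rfl
  obtain ⟨J, hsJ, hJ, hJ'⟩ := D.isLieQuotB.exists_stable g
    (Np := Set.range fun i => D.genB (p i)) (N₀ := Set.range fun i => D.genB (.h i))
    (Nm := Set.range fun i => D.genB (m i)) (s := s) (n := n)
    (by rintro _ ((⟨i, rfl⟩ | ⟨i, rfl⟩) | ⟨i, rfl⟩) <;> exact ⟨_, D.genB_mem _ _⟩)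
    (by rintro _ ⟨i, rfl⟩; have := D.genB_mem g (p i); simpa only [g, hp, hσσ] using this)
    (by
      rintro _ ⟨i, rfl⟩
      have := D.genB_mem g (.h i)
      simpa only [g, GenB.degPrincipal, mul_zero] using this)
    (by
      rintro _ ⟨i, rfl⟩ _ ⟨j, rfl⟩
      obtain ⟨c, hc⟩ := hhp i j
      rw [hc]; exact Submodule.smul_mem _ _ (Submodule.subset_span ⟨j, rfl⟩))
    (by
      rintro _ ⟨j, rfl⟩ _ ⟨i, rfl⟩
      obtain ⟨c, hc⟩ := hhm i j
      rw [D.isLieQuotB.skew (D.genB_mem _ _) (D.genB_mem GenB.deg (.h i))]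
      change -(sgn _ 0 • _) ∈ _
      rw [Min.sgn_zero_right, one_smul, hc]
      exact neg_mem (Submodule.smul_mem _ _ (Submodule.subset_span ⟨j, rfl⟩)))
    (by
      rintro _ ⟨i, rfl⟩ _ ⟨j, rfl⟩
      obtain ⟨c, hc⟩ := hmp i j
      rw [hc]; exact Submodule.smul_mem _ _ (Submodule.subset_span ⟨i, rfl⟩))
    (by
      intro x
      rcases hgen x with ⟨i, rfl⟩ | ⟨i, rfl⟩ | ⟨i, rfl⟩
      exacts [Or.inl (Or.inl ⟨i, rfl⟩), Or.inl (Or.inr ⟨i, rfl⟩), Or.inr ⟨i, rfl⟩])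
    hn (by rwa [hg]) (by rintro _ ⟨i, rfl⟩; exact hs' i)
  have h1 := Min.eq_bot_of_le hℓ' (D.isLieQuotB.isIdeal (Min.isGradingElement hℓ) hJ') (hJ.trans ?_)
  · rw [h1] at hsJ; exact hsJ
  · refine iSup₂_le fun k hk => ?_
    rw [hg]
    refine le_iSup₂_of_le (σ * k) ?_ le_rfl
    rcases hσ with rfl | rfl <;> simpa using hk

omit [CharZero K] in
theorem brB_f_e (i j : Option (Fin D.r)) : ∃ c : K,
    D.brB (D.genB (.f i)) (D.genB (.e j)) = c • D.genB (.h i) := by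
  rw [D.isLieQuotB.skew (D.genB_mem _ _) (D.genB_mem _ _)]
  by_cases h : j = i
  · subst h
    rw [show D.brB (D.genB (.e j)) (D.genB (.f j)) = D.genB (.h j) from D.bracket_e_f j,
      ← Int.cast_smul_eq_zsmul K, ← neg_smul]
    exact ⟨_, rfl⟩
  · rw [D.brB_e_f_ne h, smul_zero, neg_zero]
    exact ⟨0, (zero_smul _ _).symm⟩

theorem eq_zero_of_brB_f {s : D.Contra} {n : ℤ} (hn : 2 ≤ n)
    (hs : s ∈ wordSpan (Min.proj GenB.deg GenB.degPrincipal D.relB) GenB.degPrincipal n)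
    (hs' : ∀ i, D.brB (D.genB (.f i)) s = 0) : s = 0 :=
  D.eq_zero_of_principal (p := .e) (m := .f) (Or.inl rfl) (fun _ => rfl) (fun _ => rfl)
    (by rintro (i | i | i) <;> simp) (fun i j => ⟨_, D.bracket_h_e i j⟩)
    (fun i j => ⟨-D.B i j, by rw [neg_smul]; exact D.bracket_h_f i j⟩) D.brB_f_e hn
    (by rwa [one_mul]) hs'

theorem eq_zero_of_brB_e {s : D.Contra} {n : ℤ} (hn : 2 ≤ n)
    (hs : s ∈ wordSpan (Min.proj GenB.deg GenB.degPrincipal D.relB) GenB.degPrincipal (-n))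
    (hs' : ∀ i, D.brB (D.genB (.e i)) s = 0) : s = 0 :=
  D.eq_zero_of_principal (p := .f) (m := .e) (Or.inr rfl) (fun _ => rfl) (fun _ => rfl)
    (by rintro (i | i | i) <;> simp)
    (fun i j => ⟨-D.B i j, by rw [neg_smul]; exact D.bracket_h_f i j⟩)
    (fun i j => ⟨_, D.bracket_h_e i j⟩)
    (fun i j => by
      by_cases h : i = j
      · subst h; exact ⟨1, by rw [one_smul]; exact D.bracket_e_f i⟩
      · exact ⟨0, by rw [zero_smul]; exact D.brB_e_f_ne h⟩) hn
    (by rwa [neg_one_mul]) hs'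

omit [CharZero K] in
theorem pow_mem_wordSpan (g : GenB D.r → ℤ) (x y : GenB D.r) (n : ℕ) :
    (D.brB (D.genB x) ^ n) (D.genB y) ∈
      wordSpan (Min.proj GenB.deg GenB.degPrincipal D.relB) g (n * g x + g y) := by
  induction n with
  | zero => simpa using D.genB_mem g y
  | succ n ih =>
    rw [pow_succ', Module.End.mul_apply]
    have := D.isLieQuotB.bracket_mem g (D.genB_mem g x) ih
    convert this using 1
    push_cast; ring_nf

omit [CharZero K] in
theorem one_le_of_eq {i : Fin D.r} {j : Option (Fin D.r)} [CharZero K] (hij : some i ≠ j) {n : ℕ}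
    (hn : (n : K) = 1 - D.B (some i) j) : 1 ≤ n := by
  obtain ⟨b, hb⟩ := D.exists_B_eq hij
  rw [hb] at hn
  have : (n : K) = ((b + 1 : ℕ) : K) := by rw [hn]; push_cast; ring
  have : n = b + 1 := by exact_mod_cast this
  omega

/-- The Serre relations for the generators `e`. -/
theorem serreB_e {i : Fin D.r} {j : Option (Fin D.r)} (hij : some i ≠ j) {n : ℕ}
    (hn : (n : K) = 1 - D.B (some i) j) :
    (D.brB (D.genB (.e (some i))) ^ n) (D.genB (.e j)) = 0 := by
  have h1 := D.one_le_of_eq hij hn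
  refine D.eq_zero_of_brB_f (n := n + 1) (by omega)
    (by simpa [GenB.degPrincipal] using D.pow_mem_wordSpan GenB.degPrincipal (.e (some i)) (.e j) n)
    (D.serre_aux D.isLieQuotB (p := fun i => D.genB (.e i)) (m := fun i => D.genB (.f i))
      (h := fun i => D.genB (.h i)) (σ := 1) (τ := fun i => if i = none then 1 else -1)
      (by norm_num) (by simp) (fun i j => by rw [one_mul]; exact D.bracket_h_e i j) (fun i => ?_)
      (fun i j hij => ?_) (fun i => D.genB_mem GenB.deg (.e (some i)))
      (fun i => D.genB_mem GenB.deg (.h i)) (fun i => ⟨_, D.genB_mem GenB.deg (.f i)⟩) hij hn)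
  · rw [D.isLieQuotB.skew (D.genB_mem _ _) (D.genB_mem _ _)]
    rw [show D.brB (D.genB (.e i)) (D.genB (.f i)) = D.genB (.h i) from D.bracket_e_f i]
    cases i with
    | none => simp [GenB.deg, sgn]
    | some i => simp [GenB.deg]
  · rw [D.isLieQuotB.skew (D.genB_mem _ _) (D.genB_mem _ _), D.brB_e_f_ne hij.symm, smul_zero,
      neg_zero]

/-- The Serre relations for the generators `f`. -/
theorem serreB_f {i : Fin D.r} {j : Option (Fin D.r)} (hij : some i ≠ j) {n : ℕ}
    (hn : (n : K) = 1 - D.B (some i) j) :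
    (D.brB (D.genB (.f (some i))) ^ n) (D.genB (.f j)) = 0 := by
  have h1 := D.one_le_of_eq hij hn
  refine D.eq_zero_of_brB_e (n := n + 1) (by omega)
    (by
      have := D.pow_mem_wordSpan GenB.degPrincipal (.f (some i)) (.f j) n
      simp only [GenB.degPrincipal] at this
      rwa [show (n : ℤ) * -1 + -1 = -(n + 1) by ring] at this)
    (D.serre_aux D.isLieQuotB (p := fun i => D.genB (.f i)) (m := fun i => D.genB (.e i))
      (h := fun i => D.genB (.h i)) (σ := -1) (τ := fun i => 1)
      (by norm_num) (by simp) (fun i j => by rw [neg_one_mul, neg_smul]; exact D.bracket_h_f i j)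
      (fun i => by rw [one_smul]; exact D.bracket_e_f i)
      (fun i j hij => D.brB_e_f_ne hij) (fun i => D.genB_mem GenB.deg (.f (some i)))
      (fun i => D.genB_mem GenB.deg (.h i)) (fun i => ⟨_, D.genB_mem GenB.deg (.e i)⟩) hij hn)

end Triple

namespace Triple

variable {K : Type u} [Field K] [CharZero K] (D : Triple K)

/-! ### The grading of `𝔤` given by `λ` -/

/-- The coefficients of the element `c` of the Cartan subalgebra with `[c, e_j] = λ_j e_j`. -/
noncomputable def cCoeff : Fin D.r → K :=
  Classical.choose (D.chev.exists_vecMul_eq D.A_det fun j => (D.lam j : K))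

theorem cCoeff_spec (j : Fin D.r) : ∑ i, D.cCoeff i * (D.A i j : K) = D.lam j :=
  Classical.choose_spec (D.chev.exists_vecMul_eq D.A_det fun j => (D.lam j : K)) j

/-- The element `c` of the Cartan subalgebra with `[c, e_j] = λ_j e_j`. -/
noncomputable def c : D.LieAlg := ∑ i, D.cCoeff i • D.chev.h i

theorem c_lie_e (j : Fin D.r) : ⁅D.c, D.chev.e j⁆ = (D.lam j : K) • D.chev.e j := by
  rw [c, Chev.sum_smul_h_lie_e]
  congr 1
  exact D.cCoeff_spec j

theorem c_lie_f (j : Fin D.r) : ⁅D.c, D.chev.f j⁆ = -((D.lam j : K) • D.chev.f j) := by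
  rw [c, Chev.sum_smul_h_lie_f]
  congr 2
  exact D.cCoeff_spec j

/-- The number `λ(c)`. -/
noncomputable def cWeight : K := ∑ i, D.cCoeff i * (D.lam i : K)

theorem cWeight_ne_zero (hε : ∀ j, D.lam j ≠ 0 → D.ε j = 1) : D.cWeight ≠ 0 := by
  intro h
  let v : Option (Fin D.r) → K := fun i => i.elim 1 D.cCoeff
  have hv : Matrix.vecMul v D.B = 0 := by
    funext j
    rw [Matrix.vecMul, dotProduct, Fintype.sum_option]
    cases j with
    | none =>
      change 1 * 0 + ∑ i, D.cCoeff i * -(D.lam i : K) = 0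
      rw [mul_zero, zero_add, ← neg_eq_zero, ← Finset.sum_neg_distrib, ← h]
      simp [cWeight]
    | some j =>
      change 1 * -((D.lam j : K) / D.ε j) + ∑ i, D.cCoeff i * (D.A i j : K) = 0
      rw [D.cCoeff_spec]
      by_cases hj : D.lam j = 0
      · simp [hj]
      · simp [hε j hj]
  have := congrFun (Matrix.eq_zero_of_vecMul_eq_zero D.B_det hv) none
  exact one_ne_zero this

/-! ### Lie superalgebras whose even part is spanned by `𝔤` and one further element -/

/-- Elements of degrees `0` and `1` of a Lie superalgebra that satisfy the relations of the
generators `e_i`, `f_i` (`i ≠ 0`), `h_i` and `e_0` of `𝓑`. -/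
structure Frame {X : Type v} (d d' : X → ℤ) (R : Set (FreeNonUnitalNonAssocAlgebra K X)) where
  e : Fin D.r → Min.Zero d d' R
  f : Fin D.r → Min.Zero d d' R
  h : Fin D.r → Min.Zero d d' R
  h₀ : Min.Zero d d' R
  e₀ : Min.Pos d d' R
  hh : ∀ i j, ⁅h i, h j⁆ = 0
  ef : ∀ i, ⁅e i, f i⁆ = h i
  ef_ne : ∀ i j, i ≠ j → ⁅e i, f j⁆ = 0
  he : ∀ i j, ⁅h i, e j⁆ = (D.A i j : K) • e j
  hf : ∀ i j, ⁅h i, f j⁆ = -((D.A i j : K) • f j)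
  se : ∀ i j, i ≠ j → (LieAlgebra.ad K _ (e i) ^ ((-D.A i j).toNat + 1)) (e j) = 0
  sf : ∀ i j, i ≠ j → (LieAlgebra.ad K _ (f i) ^ ((-D.A i j).toNat + 1)) (f j) = 0
  h₀e : ∀ j, ⁅h₀, e j⁆ = -(((D.lam j : K) / D.ε j) • e j)
  h₀f : ∀ j, ⁅h₀, f j⁆ = ((D.lam j : K) / D.ε j) • f j
  he₀ : ∀ i, ⁅h i, e₀⁆ = -((D.lam i : K) • e₀)
  h₀e₀ : ⁅h₀, e₀⁆ = 0
  fe₀ : ∀ i, ⁅f i, e₀⁆ = 0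
  se₀ : ∀ i, (LieModule.toEnd K (Min.Zero d d' R) (Min.Pos d d' R) (e i) ^ (D.lam i + 1)) e₀ = 0

namespace Frame

variable {D} {X : Type v} {d d' : X → ℤ} {R : Set (FreeNonUnitalNonAssocAlgebra K X)}
  (F : D.Frame d d' R)

/-- The homomorphism from `𝔤` to the even part. -/
noncomputable def θ : D.LieAlg →ₗ⁅K⁆ Min.Zero d d' R :=
  Classical.choose (D.exists_lieHom F.e F.f F.h F.hh F.ef F.ef_ne F.he F.hf F.se F.sf)

theorem θ_e (i : Fin D.r) : F.θ (D.chev.e i) = F.e i :=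
  (Classical.choose_spec (D.exists_lieHom F.e F.f F.h F.hh F.ef F.ef_ne F.he F.hf F.se F.sf)).1 i

theorem θ_f (i : Fin D.r) : F.θ (D.chev.f i) = F.f i :=
  (Classical.choose_spec (D.exists_lieHom F.e F.f F.h F.hh F.ef F.ef_ne F.he F.hf F.se F.sf)).2.1 i

theorem θ_h (i : Fin D.r) : F.θ (D.chev.h i) = F.h i :=
  (Classical.choose_spec (D.exists_lieHom F.e F.f F.h F.hh F.ef F.ef_ne F.he F.hf F.se F.sf)).2.2 i

/-- The component of degree `1` as a module over `𝔤`. -/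
@[nolint unusedArguments]
def PosMod (_ : D.Frame d d' R) : Type _ := Min.Pos d d' R

/-- The component of degree `-1` as a module over `𝔤`. -/
@[nolint unusedArguments]
def NegMod (_ : D.Frame d d' R) : Type _ := Min.Neg d d' R

noncomputable instance : AddCommGroup F.PosMod := inferInstanceAs (AddCommGroup (Min.Pos d d' R))
noncomputable instance : Module K F.PosMod := inferInstanceAs (Module K (Min.Pos d d' R))
noncomputable instance : LieRingModule (Min.Zero d d' R) F.PosMod :=
  inferInstanceAs (LieRingModule (Min.Zero d d' R) (Min.Pos d d' R))
noncomputable instance : LieModule K (Min.Zero d d' R) F.PosMod :=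
  inferInstanceAs (LieModule K (Min.Zero d d' R) (Min.Pos d d' R))
noncomputable instance : LieRingModule D.LieAlg F.PosMod :=
  LieRingModule.compLieHom F.PosMod F.θ
noncomputable instance : LieModule K D.LieAlg F.PosMod :=
  LieModule.compLieHom F.PosMod F.θ
noncomputable instance : AddCommGroup F.NegMod := inferInstanceAs (AddCommGroup (Min.Neg d d' R))
noncomputable instance : Module K F.NegMod := inferInstanceAs (Module K (Min.Neg d d' R))
noncomputable instance : LieRingModule (Min.Zero d d' R) F.NegMod :=
  inferInstanceAs (LieRingModule (Min.Zero d d' R) (Min.Neg d d' R))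
noncomputable instance : LieModule K (Min.Zero d d' R) F.NegMod :=
  inferInstanceAs (LieModule K (Min.Zero d d' R) (Min.Neg d d' R))
noncomputable instance : LieRingModule D.LieAlg F.NegMod :=
  LieRingModule.compLieHom F.NegMod F.θ
noncomputable instance : LieModule K D.LieAlg F.NegMod :=
  LieModule.compLieHom F.NegMod F.θ

theorem pos_lie_def (x : D.LieAlg) (v : F.PosMod) :
    ⁅x, v⁆ = ⁅F.θ x, v⁆ := rfl

theorem neg_lie_def (x : D.LieAlg) (v : F.NegMod) :
    ⁅x, v⁆ = ⁅F.θ x, v⁆ := rfl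

/-- The element `e_0`. -/
def ePos : F.PosMod := F.e₀

theorem h_ePos (i : Fin D.r) : ⁅D.chev.h i, F.ePos⁆ = -((D.lam i : K) • F.ePos) := by
  rw [pos_lie_def, θ_h]; exact F.he₀ i

theorem f_ePos (i : Fin D.r) : ⁅D.chev.f i, F.ePos⁆ = 0 := by
  rw [pos_lie_def, θ_f]; exact F.fe₀ i

theorem h₀_ePos : ⁅F.h₀, F.ePos⁆ = 0 := F.h₀e₀

/-- The inclusion of the component of degree `1`. -/
noncomputable def posIncl : F.PosMod →ₗ[K] Min d d' R := Min.posIncl d d' R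

/-- The inclusion of the component of degree `-1`. -/
noncomputable def negIncl : F.NegMod →ₗ[K] Min d d' R := Min.negIncl d d' R

/-- The bracket of elements of degrees `1` and `-1`. -/
noncomputable def pairing : F.PosMod →ₗ[K] F.NegMod →ₗ[K] Min.Zero d d' R :=
  Min.posNegBracket d d' R

theorem lie_pairing (z : Min.Zero d d' R) (x : F.PosMod) (y : F.NegMod) :
    ⁅z, F.pairing x y⁆ = F.pairing ⁅z, x⁆ y + F.pairing x ⁅z, y⁆ :=
  Min.lie_posNegBracket z x y

theorem pow_e_ePos (i : Fin D.r) :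
    (LieModule.toEnd K D.LieAlg F.PosMod (D.chev.e i) ^ (D.lam i + 1)) F.ePos = 0 := by
  have h1 : LieModule.toEnd K D.LieAlg F.PosMod (D.chev.e i) =
      LieModule.toEnd K (Min.Zero d d' R) (Min.Pos d d' R) (F.e i) := by
    ext v; change ⁅F.θ (D.chev.e i), v⁆ = _; rw [θ_e]; rfl
  rw [h1]
  exact F.se₀ i

theorem c_ePos : ⁅D.c, F.ePos⁆ = -(D.cWeight • F.ePos) := by
  rw [c, sum_lie, cWeight, Finset.sum_smul, ← Finset.sum_neg_distrib]
  exact Finset.sum_congr rfl fun i _ => by rw [smul_lie, h_ePos, smul_neg, smul_smul]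

/-- The element `h_0 + c`, which commutes with `𝔤`. -/
noncomputable def z : Min.Zero d d' R := F.h₀ + F.θ D.c

theorem z_lie (hε : ∀ j, D.lam j ≠ 0 → D.ε j = 1) (x : D.LieAlg) : ⁅F.z, F.θ x⁆ = 0 := by
  have hdiv : ∀ j, (D.lam j : K) / D.ε j = D.lam j := fun j => by
    by_cases hj : D.lam j = 0
    · simp [hj]
    · simp [hε j hj]
  let Y : LieSubalgebra K D.LieAlg :=
    { carrier := {x | ⁅F.z, F.θ x⁆ = 0}
      add_mem' := fun {a b} ha hb => by
        rw [Set.mem_ofPred_eq] at *; rw [map_add, lie_add, ha, hb, add_zero]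
      zero_mem' := by rw [Set.mem_ofPred_eq, map_zero, lie_zero]
      smul_mem' := fun t a ha => by
        rw [Set.mem_ofPred_eq] at *; rw [map_smul, lie_smul, ha, smul_zero]
      lie_mem' := fun {a b} ha hb => by
        rw [Set.mem_ofPred_eq] at *
        rw [LieHom.map_lie, leibniz_lie, ha, hb, zero_lie, lie_zero, add_zero] }
  have h1 : x ∈ Y := by
    rw [D.chev.gen Y (fun j => ?_) fun j => ?_]
    · trivial
    · change ⁅F.z, F.θ (D.chev.e j)⁆ = 0
      rw [z, add_lie, ← LieHom.map_lie, D.c_lie_e, map_smul, θ_e, F.h₀e, hdiv, neg_add_cancel]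
    · change ⁅F.z, F.θ (D.chev.f j)⁆ = 0
      rw [z, add_lie, ← LieHom.map_lie, D.c_lie_f, map_neg, map_smul, θ_f, F.h₀f, hdiv,
        add_neg_cancel]
  exact h1

theorem z_lie_e₀ : ⁅F.z, F.e₀⁆ = -(D.cWeight • F.e₀) := by
  rw [z, add_lie, F.h₀e₀, zero_add]
  exact F.c_ePos

theorem h₀_lie (hε : ∀ j, D.lam j ≠ 0 → D.ε j = 1) (x : D.LieAlg) :
    ⁅F.h₀, F.θ x⁆ = -F.θ ⁅D.c, x⁆ := by
  have := F.z_lie hε x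
  rwa [z, add_lie, ← LieHom.map_lie, add_eq_zero_iff_eq_neg] at this

/-! #### The local part -/

/-- The span of the image of `𝔤` and `h_0`. -/
noncomputable def even : Submodule K (Min.Zero d d' R) :=
  LinearMap.range F.θ.toLinearMap ⊔ Submodule.span K {F.h₀}

theorem mem_even {x : Min.Zero d d' R} :
    x ∈ F.even ↔ ∃ (y : D.LieAlg) (a : K), x = F.θ y + a • F.h₀ := by
  rw [even, Submodule.mem_sup]
  constructor
  · rintro ⟨_, ⟨y, rfl⟩, w, hw, rfl⟩
    obtain ⟨a, rfl⟩ := Submodule.mem_span_singleton.mp hw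
    exact ⟨y, a, rfl⟩
  · rintro ⟨y, a, rfl⟩
    exact ⟨_, ⟨y, rfl⟩, _, Submodule.mem_span_singleton.mpr ⟨a, rfl⟩, rfl⟩

/-- A subspace `M` of the component of degree `-1` which is stable under `h_i`, `e_i` and `h_0`, whose
brackets with `e_0` lie in the span of `𝔤` and `h_0`, and which together with `𝔤`, `h_0` and `e_0`
contains all generators. -/
structure IsNegBase (M : Submodule K F.NegMod) : Prop where
  h_mem : ∀ i, ∀ v ∈ M, ⁅D.chev.h i, v⁆ ∈ M
  e_mem : ∀ i, ∀ v ∈ M, ⁅D.chev.e i, v⁆ ∈ M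
  h₀_mem : ∀ v ∈ M, ⁅F.h₀, v⁆ ∈ M
  e₀_mem : ∀ v ∈ M, F.pairing F.ePos v ∈ F.even
  gen : ∀ x, (∃ y, Min.zeroIncl d d' R (F.θ y) = Min.gen d d' R x) ∨
    Min.zeroIncl d d' R F.h₀ = Min.gen d d' R x ∨ F.posIncl F.ePos = Min.gen d d' R x ∨
      ∃ v ∈ M, F.negIncl v = Min.gen d d' R x

theorem lie_mem_even (hε : ∀ j, D.lam j ≠ 0 → D.ε j = 1) {x y : Min.Zero d d' R}
    (hx : x ∈ F.even) (hy : y ∈ F.even) : ⁅x, y⁆ ∈ F.even := by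
  obtain ⟨x, a, rfl⟩ := F.mem_even.mp hx
  obtain ⟨y, b, rfl⟩ := F.mem_even.mp hy
  refine F.mem_even.mpr ⟨⁅x, y⁆ - a • ⁅D.c, y⁆ + b • ⁅D.c, x⁆, 0, ?_⟩
  rw [add_lie, lie_add, lie_add, smul_lie, lie_smul, smul_lie, lie_smul, lie_self, F.h₀_lie hε,
    show ⁅F.θ x, F.h₀⁆ = F.θ ⁅D.c, x⁆ by rw [← lie_skew, F.h₀_lie hε, neg_neg],
    map_add, map_sub, map_smul, map_smul, LieHom.map_lie]
  simp only [smul_neg, smul_zero, add_zero, zero_smul, LieHom.map_lie]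
  abel

variable {F} in
/-- Induction over the submodules generated by `e_0` and by a base of the component of degree
`-1`. -/
theorem IsNegBase.local_eq (hε : ∀ j, D.lam j ≠ 0 → D.ε j = 1) {M : Submodule K F.NegMod}
    (hM : F.IsNegBase M) {ℓ : Min d d' R}
    (hℓ : IsGradingElement d d (Min.bracket d d' R) (Min.proj d d' R) ℓ) :
    F.even = ⊤ ∧
    opClosure (Set.range fun i => LieModule.toEnd K D.LieAlg F.PosMod (D.chev.e i))
      (Submodule.span K {F.ePos}) = ⊤ ∧
    opClosure (Set.range fun i => LieModule.toEnd K D.LieAlg F.NegMod (D.chev.f i)) M = ⊤ := by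
  let P := opClosure (Set.range fun i => LieModule.toEnd K D.LieAlg F.PosMod (D.chev.e i))
      (Submodule.span K {F.ePos})
  let N := opClosure (Set.range fun i => LieModule.toEnd K D.LieAlg F.NegMod (D.chev.f i)) M
  have hPe : ∀ i, ∀ v ∈ P, ⁅D.chev.e i, v⁆ ∈ P := fun i v hv => opClosure_stable
    (S := Set.range fun i => LieModule.toEnd K D.LieAlg F.PosMod (D.chev.e i)) ⟨i, rfl⟩ hv
  have hPf : ∀ i, ∀ v ∈ P, ⁅D.chev.f i, v⁆ ∈ P := fun i v hv =>
    D.chev.stable_opClosure_e (fun i v hv => by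
      obtain ⟨a, rfl⟩ := Submodule.mem_span_singleton.mp hv
      rw [lie_smul, h_ePos]
      exact Submodule.smul_mem _ _ (neg_mem (Submodule.smul_mem _ _
        (Submodule.mem_span_singleton_self _)))) (fun i v hv => by
      obtain ⟨a, rfl⟩ := Submodule.mem_span_singleton.mp hv
      rw [lie_smul, f_ePos, smul_zero]; exact zero_mem _) i hv
  have hNf : ∀ i, ∀ v ∈ N, ⁅D.chev.f i, v⁆ ∈ N := fun i v hv => opClosure_stable
    (S := Set.range fun i => LieModule.toEnd K D.LieAlg F.NegMod (D.chev.f i)) ⟨i, rfl⟩ hv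
  have hNe : ∀ i, ∀ v ∈ N, ⁅D.chev.e i, v⁆ ∈ N := fun i v hv =>
    D.chev.swap.stable_opClosure_e (fun i v hv => by
      change ⁅-D.chev.h i, v⁆ ∈ M
      rw [neg_lie]; exact neg_mem (hM.h_mem i v hv)) hM.e_mem i hv
  have hP := D.chev.lie_mem hPe hPf
  have hN := D.chev.lie_mem hNe hNf
  have hPz : ∀ v ∈ P, ⁅F.h₀, v⁆ ∈ P := by
    have : P ≤ P ⊓ P.comap (LieModule.toEnd K (Min.Zero d d' R) F.PosMod F.h₀) := by
      refine opClosure_le (le_inf (le_opClosure _ _) ?_) ?_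
      · rw [Submodule.span_singleton_le_iff_mem]
        change ⁅F.h₀, F.ePos⁆ ∈ P
        rw [F.h₀_ePos]; exact zero_mem P
      · rintro _ ⟨i, rfl⟩ v ⟨hv, hv'⟩
        refine ⟨hPe i v hv, ?_⟩
        change ⁅F.h₀, ⁅F.θ (D.chev.e i), v⁆⁆ ∈ P
        rw [leibniz_lie, F.h₀_lie hε, ← map_neg]
        exact add_mem (hP _ v hv) (hPe i _ hv')
    exact fun v hv => (this hv).2
  have hNz : ∀ v ∈ N, ⁅F.h₀, v⁆ ∈ N := by
    have : N ≤ N ⊓ N.comap (LieModule.toEnd K (Min.Zero d d' R) F.NegMod F.h₀) := by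
      refine opClosure_le (le_inf (le_opClosure _ _) ?_) ?_
      · exact fun v hv => le_opClosure _ _ (hM.h₀_mem v hv)
      · rintro _ ⟨i, rfl⟩ v ⟨hv, hv'⟩
        refine ⟨hNf i v hv, ?_⟩
        change ⁅F.h₀, ⁅F.θ (D.chev.f i), v⁆⁆ ∈ N
        rw [leibniz_lie, F.h₀_lie hε, ← map_neg]
        exact add_mem (hN _ v hv) (hNf i _ hv')
    exact fun v hv => (this hv).2
  have h₀P : ∀ x ∈ F.even, ∀ v ∈ P,
      ⁅x, v⁆ ∈ P := by
    intro x hx v hv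
    obtain ⟨x, a, rfl⟩ := F.mem_even.mp hx
    rw [add_lie, smul_lie]
    exact add_mem (hP x v hv) (P.smul_mem a (hPz v hv))
  have h₀N : ∀ x ∈ F.even, ∀ v ∈ N,
      ⁅x, v⁆ ∈ N := by
    intro x hx v hv
    obtain ⟨x, a, rfl⟩ := F.mem_even.mp hx
    rw [add_lie, smul_lie]
    exact add_mem (hN x v hv) (N.smul_mem a (hNz v hv))
  have hθ : ∀ x, F.θ x ∈ F.even := fun x => F.mem_even.mpr ⟨x, 0, by rw [zero_smul, add_zero]⟩
  -- the bracket of `e_0` with the elements of degree `-1`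
  have h1 : N ≤ F.even.comap (F.pairing F.ePos) := by
    refine opClosure_le hM.e₀_mem ?_
    rintro _ ⟨i, rfl⟩ v hv
    have := F.lie_pairing (F.θ (D.chev.f i)) F.ePos v
    rw [show ⁅F.θ (D.chev.f i), F.ePos⁆ = 0 from F.f_ePos i, map_zero, LinearMap.zero_apply,
      zero_add] at this
    rw [Submodule.mem_comap]
    exact this ▸ F.lie_mem_even hε (hθ _) hv
  have h2 : ∀ v ∈ P, ∀ w ∈ N, F.pairing v w ∈ F.even := by
    have : P ≤ ⨅ w : N, F.even.comap (F.pairing.flip w.1) := by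
      refine opClosure_le ?_ ?_
      · rw [Submodule.span_singleton_le_iff_mem, Submodule.mem_iInf]
        exact fun w => h1 w.2
      · rintro _ ⟨i, rfl⟩ v hv
        rw [Submodule.mem_iInf] at hv ⊢
        intro w
        have h3 := F.lie_pairing (F.θ (D.chev.e i)) v w.1
        rw [← sub_eq_iff_eq_add] at h3
        change F.pairing _ _ ∈ F.even
        refine h3 ▸ sub_mem (F.lie_mem_even hε (hθ _) (hv w)) (hv ⟨_, hNe i _ w.2⟩)
    exact fun v hv w hw => Submodule.mem_iInf _ |>.mp (this hv) ⟨w, hw⟩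
  obtain ⟨r0, rp, rm⟩ := (Min.isLieQuot d d' R).local_eq hℓ
    (V₀ := F.even.map (Min.zeroIncl d d' R)) (Vp := Submodule.map (F.posIncl) P)
    (Vm := Submodule.map (F.negIncl) N)
    (by rintro _ ⟨x, _, rfl⟩; exact Min.zeroIncl_mem x)
    (by rintro _ ⟨x, _, rfl⟩; exact Min.posIncl_mem x)
    (by rintro _ ⟨x, _, rfl⟩; exact Min.negIncl_mem x)
    (by
      rintro _ ⟨x, hx, rfl⟩ _ ⟨y, hy, rfl⟩
      exact ⟨_, F.lie_mem_even hε hx hy, Min.zeroIncl_lie x y⟩)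
    (by
      rintro _ ⟨x, hx, rfl⟩ _ ⟨y, hy, rfl⟩
      exact ⟨_, h₀P x hx y hy, Min.posIncl_lie x y⟩)
    (by
      rintro _ ⟨x, hx, rfl⟩ _ ⟨y, hy, rfl⟩
      exact ⟨_, h₀N x hx y hy, Min.negIncl_lie x y⟩)
    (by
      rintro _ ⟨x, hx, rfl⟩ _ ⟨y, hy, rfl⟩
      exact ⟨_, h2 x hx y hy, Min.zeroIncl_posNegBracket x y⟩)
    (by
      intro x
      change Min.gen d d' R x ∈ _ ∨ Min.gen d d' R x ∈ _ ∨ Min.gen d d' R x ∈ _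
      rcases hM.gen x with ⟨y, hy⟩ | hy | hy | ⟨v, hv, hy⟩
      · exact Or.inl ⟨_, hθ y, hy⟩
      · exact Or.inl ⟨_, F.mem_even.mpr ⟨0, 1, by rw [map_zero, one_smul, zero_add]⟩, hy⟩
      · exact Or.inr (Or.inl ⟨_, le_opClosure _ _ (Submodule.mem_span_singleton_self F.ePos), hy⟩)
      · exact Or.inr (Or.inr ⟨_, le_opClosure _ _ hv, hy⟩))
  refine ⟨?_, ?_, ?_⟩
  · rw [eq_top_iff]; intro x _
    have h3 : Min.zeroIncl d d' R x ∈ F.even.map (Min.zeroIncl d d' R) := by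
      rw [r0]; exact Min.zeroIncl_mem x
    obtain ⟨y, hy, hyx⟩ := h3
    rwa [Min.zero_ext hyx] at hy
  · rw [eq_top_iff]; intro x _
    have h3 : F.posIncl x ∈ Submodule.map (F.posIncl) P := by
      rw [rp]; exact Min.posIncl_mem x
    obtain ⟨y, hy, hyx⟩ := h3
    rwa [Min.pos_ext hyx] at hy
  · rw [eq_top_iff]; intro x _
    have h3 : F.negIncl x ∈ Submodule.map (F.negIncl) N := by
      rw [rm]; exact Min.negIncl_mem x
    obtain ⟨y, hy, hyx⟩ := h3
    rwa [Min.neg_ext hyx] at hy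

end Frame

end Triple

/-! ### The grading of depth one of `𝔤` -/

namespace Chev

variable {K ι G : Type*} [Field K] [LieRing G] [LieAlgebra K G] {S : Chev K ι G} [DecidableEq ι]

theorem IsWord.f_lie_eq_zero {a : ι → ℕ} {x : G} (hx : S.IsWord a x) {j : ι} (hj : a j = 0) :
    ⁅S.f j, x⁆ = 0 := by
  induction hx with
  | of i =>
    refine S.fe_ne j i fun h => ?_
    subst h; simp at hj
  | @lie i a x _ ih =>
    simp only [Pi.add_apply, Nat.add_eq_zero_iff] at hj
    have h1 : ⁅S.f j, S.e i⁆ = 0 := by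
      refine S.fe_ne j i fun h => ?_
      subst h; simp at hj
    rw [leibniz_lie, h1, ih hj.2, zero_lie, lie_zero, add_zero]

/-- A simple Lie algebra has at most one generator of degree `1` with respect to a grading of depth
one. Otherwise the elements of nonzero degree with respect to the first one of two such generators
commute with the second one and generate a proper ideal. -/
theorem Grading.eq_of_lam_ne_zero [CharZero K] [Fintype ι] [LieAlgebra.IsSimple K G]
    (T : S.Grading) (hA : S.A.det ≠ 0) (hdiag : ∀ i, S.A i i = 2) (he : ∀ i, S.e i ≠ 0) {i j : ι}
    (hi : T.lam i ≠ 0) (hj : T.lam j ≠ 0) : i = j := by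
  by_contra hij
  obtain ⟨r, hr⟩ := S.exists_vecMul_eq hA (Pi.single i (1 : K))
  let c := ∑ l, r l • S.h l
  have hce : ∀ l, ⁅c, S.e l⁆ = (Pi.single i (1 : K) : ι → K) l • S.e l := fun l => by
    rw [S.sum_smul_h_lie_e, hr]
  have hcf : ∀ l, ⁅-c, S.f l⁆ = (Pi.single i (1 : K) : ι → K) l • S.f l := fun l => by
    rw [neg_lie, S.sum_smul_h_lie_f, hr, neg_neg]
  have hword : ∀ a x, S.IsWord a x → ⁅c, x⁆ = (a i : K) • x := fun a x hx => by
    rw [hx.lie_eq_smul hce]; simp [Pi.single_apply]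
  have hword' : ∀ a x, S.swap.IsWord a x → ⁅c, x⁆ = -((a i : K) • x) := fun a x hx => by
    have := hx.lie_eq_smul (c := -c) hcf
    rw [neg_lie, neg_eq_iff_eq_neg] at this
    rw [this]; simp [Pi.single_apply]
  have hch : ∀ l, ⁅c, S.h l⁆ = 0 := fun l => by
    rw [sum_lie]; exact Finset.sum_eq_zero fun m _ => by rw [smul_lie, S.hh, smul_zero]
  -- words that involve both generators are zero
  have hsum : ∀ a : ι → ℕ, a i ≠ 0 → a j ≠ 0 →
      ∃ n : ℕ, ∑ l, (T.lam l : K) * (a l : K) = n ∧ 2 ≤ n := by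
    intro a h1 h2
    refine ⟨∑ l, T.lam l * a l, by push_cast; rfl, ?_⟩
    have h3 := Finset.add_le_sum (f := fun l => T.lam l * a l) (s := Finset.univ)
      (fun _ _ => Nat.zero_le _) (Finset.mem_univ i) (Finset.mem_univ j) hij
    have h4 : 1 ≤ T.lam i * a i := Nat.mul_pos (Nat.pos_of_ne_zero hi) (Nat.pos_of_ne_zero h1)
    have h5 : 1 ≤ T.lam j * a j := Nat.mul_pos (Nat.pos_of_ne_zero hj) (Nat.pos_of_ne_zero h2)
    omega
  have hnat : ∀ n : ℕ, 2 ≤ n → (n : K) ≠ 1 ∧ (n : K) ≠ 0 ∧ (n : K) ≠ -1 := by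
    intro n hn
    refine ⟨by exact_mod_cast (by omega : n ≠ 1), by exact_mod_cast (by omega : n ≠ 0), fun h => ?_⟩
    have : ((n + 1 : ℕ) : K) = 0 := by push_cast; rw [h]; ring
    exact Nat.succ_ne_zero n (by exact_mod_cast this)
  have hz : ∀ a x, S.IsWord a x → a i ≠ 0 → a j ≠ 0 → x = 0 := by
    intro a x hx h1 h2
    obtain ⟨n, hn, h2n⟩ := hsum a h1 h2
    have h3 := hx.lie_eq_smul T.ce
    rw [hn] at h3
    exact T.eq_zero_of_c (hnat n h2n).1 (hnat n h2n).2.1 (hnat n h2n).2.2 h3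
  have hz' : ∀ a x, S.swap.IsWord a x → a i ≠ 0 → a j ≠ 0 → x = 0 := by
    intro a x hx h1 h2
    obtain ⟨n, hn, h2n⟩ := hsum a h1 h2
    have h3 := hx.lie_eq_smul T.swap.ce
    have h4 : T.swap.lam = T.lam := rfl
    rw [h4, hn] at h3
    exact T.swap.eq_zero_of_c (hnat n h2n).1 (hnat n h2n).2.1 (hnat n h2n).2.2 h3
  let D : G →ₗ[K] G := LieAlgebra.ad K G c
  have hD : ∀ x, D x = ⁅c, x⁆ := fun _ => rfl
  -- The sum of the eigenspaces of `c` with nonzero eigenvalues; it commutes with `e_j`.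
  let P := LinearMap.range D
  have hcomm : ∀ x ∈ P, ⁅x, S.e j⁆ = 0 := by
    have : LinearMap.ker ((LieAlgebra.ad K G (S.e j) : G →ₗ[K] G) ∘ₗ D) = ⊤ := by
      refine S.eq_top_of_words _ (fun l => ?_) (fun a x hx => ?_) fun a x hx => ?_ <;>
        rw [LinearMap.mem_ker, LinearMap.comp_apply, hD, LieAlgebra.ad_apply]
      · rw [hch, lie_zero]
      · rw [hword a x hx, lie_smul]
        by_cases h : a i = 0
        · rw [h, Nat.cast_zero, zero_smul]
        · rw [hz _ _ (IsWord.lie j hx) (by simp [h]) (by simp), smul_zero]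
      · rw [hword' a x hx, lie_neg, lie_smul]
        by_cases h : a i = 0
        · rw [h, Nat.cast_zero, zero_smul, neg_zero]
        · by_cases h' : a j = 0
          · rw [show ⁅S.e j, x⁆ = 0 from hx.f_lie_eq_zero h', smul_zero, neg_zero]
          · rw [hz' _ _ hx h h', lie_zero, smul_zero, neg_zero]
    rintro _ ⟨x, rfl⟩
    have h1 : x ∈ LinearMap.ker ((LieAlgebra.ad K G (S.e j) : G →ₗ[K] G) ∘ₗ D) := this ▸ trivial
    rw [← lie_skew, show ⁅S.e j, D x⁆ = 0 from h1, neg_zero]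
  have hdec : LinearMap.ker D ⊔ P = ⊤ := by
    refine S.eq_top_of_words _ (fun l => ?_) (fun a x hx => ?_) fun a x hx => ?_
    · exact Submodule.mem_sup_left (hch l)
    · by_cases h : a i = 0
      · exact Submodule.mem_sup_left (by rw [LinearMap.mem_ker, hD, hword a x hx, h]; simp)
      · refine Submodule.mem_sup_right ⟨(a i : K)⁻¹ • x, ?_⟩
        rw [map_smul, hD, hword a x hx, smul_smul, inv_mul_cancel₀ (by exact_mod_cast h), one_smul]
    · by_cases h : a i = 0
      · exact Submodule.mem_sup_left (by rw [LinearMap.mem_ker, hD, hword' a x hx, h]; simp)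
      · refine Submodule.mem_sup_right ⟨-(a i : K)⁻¹ • x, ?_⟩
        rw [map_smul, hD, hword' a x hx, smul_neg, neg_smul, neg_neg, smul_smul,
          inv_mul_cancel₀ (by exact_mod_cast h), one_smul]
  have h0P : ∀ g ∈ LinearMap.ker D, ∀ x ∈ P, ⁅g, x⁆ ∈ P := by
    rintro g hg _ ⟨x, rfl⟩
    refine ⟨⁅g, x⁆, ?_⟩
    rw [LinearMap.mem_ker, hD] at hg
    rw [hD, hD, leibniz_lie, hg, zero_lie, zero_add]
  -- The ideal generated by `P`, which is all of `G` as `G` is simple. It still commutes with `e_j`.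
  let Q : Submodule K G := P ⊔ Submodule.span K {w | ∃ x ∈ P, ∃ y ∈ P, ⁅x, y⁆ = w}
  have hPQ : ∀ x ∈ P, ∀ y, ⁅x, y⁆ ∈ Q := by
    intro x hx y
    obtain ⟨y₀, h0, y₁, h1, rfl⟩ := Submodule.mem_sup.mp (hdec ▸ Submodule.mem_top : y ∈ _)
    rw [lie_add]
    refine add_mem (Submodule.mem_sup_left ?_)
      (Submodule.mem_sup_right (Submodule.subset_span ⟨x, hx, y₁, h1, rfl⟩))
    rw [← lie_skew]
    exact neg_mem (h0P _ h0 x hx)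
  let I : LieIdeal K G :=
    { Q with
      lie_mem := by
        intro g x hx
        change x ∈ Q at hx
        change ⁅g, x⁆ ∈ Q
        obtain ⟨g₀, h0, g₁, h1, rfl⟩ := Submodule.mem_sup.mp (hdec ▸ Submodule.mem_top : g ∈ _)
        rw [add_lie]
        refine add_mem ?_ (hPQ g₁ h1 x)
        have : Q ≤ Q.comap (LieAlgebra.ad K G g₀) := by
          refine sup_le (fun x hx => Submodule.mem_sup_left (h0P g₀ h0 x hx))
            (Submodule.span_le.mpr ?_)
          rintro _ ⟨x, hx, y, hy, rfl⟩
          rw [SetLike.mem_coe, Submodule.mem_comap, LieAlgebra.ad_apply, leibniz_lie]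
          exact add_mem (hPQ _ (h0P g₀ h0 x hx) y) (hPQ x hx _)
        exact this hx }
  have heP : S.e i ∈ P := ⟨S.e i, by rw [hD, hce]; simp⟩
  have hI : I = ⊤ := by
    refine (LieAlgebra.IsSimple.eq_bot_or_eq_top (R := K) I).resolve_left fun h => he i ?_
    have : S.e i ∈ I := Submodule.mem_sup_left heP
    rwa [h] at this
  have hQ : Q ≤ LinearMap.ker (LieAlgebra.ad K G (S.e j) : G →ₗ[K] G) := by
    refine sup_le (fun x hx => ?_) (Submodule.span_le.mpr ?_)
    · rw [LinearMap.mem_ker, LieAlgebra.ad_apply, ← lie_skew, hcomm x hx, neg_zero]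
    · rintro _ ⟨x, hx, y, hy, rfl⟩
      rw [SetLike.mem_coe, LinearMap.mem_ker, LieAlgebra.ad_apply, ← lie_skew, lie_lie,
        hcomm x hx, hcomm y hy, lie_zero, lie_zero, sub_zero, neg_zero]
  have hall : ∀ x : G, ⁅S.e j, x⁆ = 0 := fun x => by
    have h1 : x ∈ I := hI ▸ LieSubmodule.mem_top x
    exact hQ h1
  have h1 := S.he j j
  rw [← S.ef, hall, zero_lie, hdiag] at h1
  exact he j ((smul_eq_zero.mp h1.symm).resolve_left (by norm_num))

end Chev

namespace Triple

variable {K : Type u} [Field K] [CharZero K] (D : Triple K)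

theorem weightForm_mulVec (a : Fin D.r → K) :
    D.weightForm (fun i => D.ε i * D.lambda i) (fun i => ∑ l, (D.A i l : K) * a l) =
      ∑ l, (D.lam l : K) * a l := by
  have hgram : ∀ b : Fin D.r → K, D.gram.mulVec (fun i => (D.ε i)⁻¹ * b i) =
      fun i => ∑ l, (D.A i l : K) * b l := by
    intro b
    funext i
    change ∑ l, D.gram i l * ((D.ε l)⁻¹ * b l) = _
    refine Finset.sum_congr rfl fun l _ => ?_
    have h1 := D.symm i l
    have h2 := D.ε_ne i
    have h3 := D.ε_ne l
    rw [div_eq_div_iff h2 h3] at h1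
    change D.ε i * (D.A l i : K) * ((D.ε l)⁻¹ * b l) = _
    field_simp
    linear_combination (-b l) * h1
  have hdet : IsUnit D.gram.det := by
    rw [isUnit_iff_ne_zero]
    intro h
    obtain ⟨v, hv, hv'⟩ := Matrix.exists_mulVec_eq_zero_iff.mpr h
    have h1 := hgram fun i => D.ε i * v i
    have h2 : (fun i => (D.ε i)⁻¹ * (D.ε i * v i)) = v := by
      funext i; rw [← mul_assoc, inv_mul_cancel₀ (D.ε_ne i), one_mul]
    rw [h2, hv'] at h1
    have h3 := Matrix.eq_zero_of_mulVec_eq_zero (D.chev.det_map_ne_zero D.A_det) h1.symm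
    apply hv
    funext i
    exact (mul_eq_zero.mp (congrFun h3 i)).resolve_left (D.ε_ne i)
  rw [weightForm, ← hgram, Matrix.mulVec_mulVec, Matrix.nonsing_inv_mul _ hdet, Matrix.one_mulVec]
  change ∑ l, D.ε l * D.lambda l * ((D.ε l)⁻¹ * a l) = _
  refine Finset.sum_congr rfl fun l _ => ?_
  have h3 := D.ε_ne l
  change D.ε l * (D.lam l : K) * ((D.ε l)⁻¹ * a l) = _
  field_simp

theorem cast_weight (hmin : D.IsPseudoMinuscule D.lambda) {a : Fin D.r → ℕ} {x : D.LieAlg}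
    (hx : x ≠ 0) {σ : K} (hσ : σ = 1 ∨ σ = -1)
    (hax : ∀ i, ⁅D.chev.h i, x⁆ = (σ * ∑ l, (D.A i l : K) * (a l : K)) • x) :
    ∑ l, D.lam l * a l ≤ 1 := by
  by_cases ha : ∀ i, ∑ l, (D.A i l : K) * (a l : K) = 0
  · have := Matrix.eq_zero_of_mulVec_eq_zero (D.chev.det_map_ne_zero D.A_det)
      (v := fun i => (a i : K)) (funext ha)
    have h0 : ∀ i, a i = 0 := fun i => by simpa using congrFun this i
    simp [h0]
  · have hroot : D.IsRoot fun i => ∑ l, (D.A i l : K) * (σ * (a l : K)) := by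
      refine ⟨fun h => ha fun i => ?_, x, hx, fun i => ?_⟩
      · have h1 := congrFun h i
        simp only [mul_left_comm _ σ, ← Finset.mul_sum] at h1
        refine (mul_eq_zero.mp h1).resolve_left ?_
        rcases hσ with rfl | rfl <;> norm_num
      · rw [← chev_h, hax, Finset.mul_sum]
        simp only [mul_left_comm _ σ]
    have h1 := hmin.2 _ hroot
    rw [D.weightForm_mulVec (fun l => σ * (a l : K))] at h1
    have h2 : ∑ l, (D.lam l : K) * (σ * (a l : K)) = σ * ((∑ l, D.lam l * a l : ℕ) : K) := by
      push_cast
      rw [Finset.mul_sum]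
      exact Finset.sum_congr rfl fun l _ => by ring
    rw [h2] at h1
    generalize ∑ l, D.lam l * a l = n at h1
    have h3 : (n : K) = 0 ∨ (n : K) = 1 ∨ (n : K) = -1 := by
      rcases hσ with rfl | rfl
      · simpa using h1
      · rcases h1 with h1 | h1 | h1
        · left; linear_combination -h1
        · right; right; linear_combination -h1
        · right; left; linear_combination -h1
    rcases h3 with h3 | h3 | h3
    · have : n = 0 := by exact_mod_cast h3
      omega
    · have : n = 1 := by exact_mod_cast h3
      omega
    · have : ((n + 1 : ℕ) : K) = 0 := by push_cast; rw [h3]; ring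
      exact absurd (by exact_mod_cast this) (Nat.succ_ne_zero n)

/-- The grading of depth one given by a pseudo-minuscule weight. -/
noncomputable def grading (hmin : D.IsPseudoMinuscule D.lambda) (he : ∀ i, D.chev.e i ≠ 0) :
    D.chev.Grading where
  lam := D.lam
  c := D.c
  ce := D.c_lie_e
  cf := D.c_lie_f
  lam_le j := by
    have := D.cast_weight hmin (he j) (σ := 1) (a := Pi.single j 1) (Or.inl rfl) fun i => by
      rw [(Chev.IsWord.of (S := D.chev) j).lie_h, one_mul]; rfl
    simpa [Pi.single_apply] using this
  exists_add x := by
    let E : K → Submodule K D.LieAlg := fun μ =>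
      Module.End.eigenspace (LieAlgebra.ad K D.LieAlg D.c) μ
    have hE : ∀ {μ x}, x ∈ E μ ↔ ⁅D.c, x⁆ = μ • x := Module.End.mem_eigenspace_iff
    have htop : E 1 ⊔ E 0 ⊔ E (-1) = ⊤ := by
      refine D.chev.eq_top_of_words _ (fun i => ?_) (fun a x hx => ?_) fun a x hx => ?_
      · refine Submodule.mem_sup_left (Submodule.mem_sup_right (hE.mpr ?_))
        rw [c, sum_lie, zero_smul]
        exact Finset.sum_eq_zero fun l _ => by rw [smul_lie, D.chev.hh, smul_zero]
      · by_cases h0 : x = 0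
        · rw [h0]; exact zero_mem _
        have h1 := D.cast_weight hmin h0 (σ := 1) (a := a) (Or.inl rfl) fun i => by
          rw [hx.lie_h, one_mul]; rfl
        have h2 : ⁅D.c, x⁆ = ((∑ l, D.lam l * a l : ℕ) : K) • x := by
          rw [hx.lie_eq_smul D.c_lie_e]; push_cast; rfl
        generalize ∑ l, D.lam l * a l = n at h1 h2
        interval_cases n
        · exact Submodule.mem_sup_left (Submodule.mem_sup_right (hE.mpr (by simpa using h2)))
        · exact Submodule.mem_sup_left (Submodule.mem_sup_left (hE.mpr (by simpa using h2)))
      · by_cases h0 : x = 0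
        · rw [h0]; exact zero_mem _
        have h1 := D.cast_weight hmin h0 (σ := -1) (a := a) (Or.inr rfl) fun i => by
          have := hx.lie_h i
          change ⁅-D.chev.h i, x⁆ = _ at this
          rw [neg_lie, neg_eq_iff_eq_neg] at this
          rw [this, neg_one_mul, neg_smul]; rfl
        have h2 : ⁅D.c, x⁆ = -(((∑ l, D.lam l * a l : ℕ) : K) • x) := by
          have := hx.lie_eq_smul (c := -D.c) (μ := fun l => (D.lam l : K)) fun l => by
            rw [neg_lie, show D.chev.swap.e l = D.chev.f l from rfl, D.c_lie_f, neg_neg]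
          rw [neg_lie, neg_eq_iff_eq_neg] at this
          rw [this]; push_cast; rfl
        generalize ∑ l, D.lam l * a l = n at h1 h2
        interval_cases n
        · exact Submodule.mem_sup_left (Submodule.mem_sup_right (hE.mpr (by simpa using h2)))
        · exact Submodule.mem_sup_right (hE.mpr (by simpa using h2))
    have hx : x ∈ E 1 ⊔ E 0 ⊔ E (-1) := htop ▸ trivial
    obtain ⟨y, hy, d, hd, rfl⟩ := Submodule.mem_sup.mp hx
    obtain ⟨a, ha, b, hb, rfl⟩ := Submodule.mem_sup.mp hy
    exact ⟨a, b, d, rfl, by simpa using hE.mp ha, by simpa using hE.mp hb, by simpa using hE.mp hd⟩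

end Triple

namespace Min

variable {K : Type u} [Field K] [CharZero K] {X : Type v} {d d' : X → ℤ}
  {R : Set (FreeNonUnitalNonAssocAlgebra K X)}

theorem zeroIncl_ad_pow (x y : Zero d d' R) (n : ℕ) :
    zeroIncl d d' R ((LieAlgebra.ad K _ x ^ n) y) =
      (bracket d d' R (zeroIncl d d' R x) ^ n) (zeroIncl d d' R y) := by
  induction n with
  | zero => rfl
  | succ n ih =>
    rw [pow_succ', Module.End.mul_apply, LieAlgebra.ad_apply, zeroIncl_lie, ih, pow_succ',
      Module.End.mul_apply]

theorem posIncl_toEnd_pow (x : Zero d d' R) (y : Pos d d' R) (n : ℕ) :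
    posIncl d d' R ((LieModule.toEnd K _ _ x ^ n) y) =
      (bracket d d' R (zeroIncl d d' R x) ^ n) (posIncl d d' R y) := by
  induction n with
  | zero => rfl
  | succ n ih =>
    rw [pow_succ', Module.End.mul_apply, LieModule.toEnd_apply_apply, posIncl_lie, ih, pow_succ',
      Module.End.mul_apply]

end Min

namespace Triple

variable {K : Type u} [Field K] [CharZero K] (D : Triple K)

omit [CharZero K] in
theorem exists_lam_ne_zero : ∃ j, D.lam j ≠ 0 := by
  by_contra! h
  refine D.B_det (Matrix.det_eq_zero_of_column_eq_zero none fun i => ?_)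
  cases i with
  | none => rfl
  | some i =>
    change -(D.lam i : K) = 0
    rw [h, Nat.cast_zero, neg_zero]

omit [CharZero K] in
theorem natCast_eq {i j : Fin D.r} (hij : i ≠ j) :
    (((-D.A i j).toNat + 1 : ℕ) : K) = 1 - D.B (some i) (some j) := by
  have h1 := D.A_nonpos i j hij
  have h2 : (((-D.A i j).toNat : ℤ) : K) = ((-D.A i j : ℤ) : K) := by
    rw [Int.toNat_of_nonneg (by omega)]
  rw [Int.cast_natCast] at h2
  push_cast
  rw [h2]
  change _ = 1 - (D.A i j : K)
  push_cast; ring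

namespace Frame

variable {D} {X : Type v} {d d' : X → ℤ} {R : Set (FreeNonUnitalNonAssocAlgebra K X)}
  (F : D.Frame d d' R)

section

variable (he₀ : F.e₀ ≠ 0)

include he₀

theorem eq_zero_of_θ_lie_eq_zero [LieAlgebra.IsSimple K D.LieAlg] {x : D.LieAlg}
    (h : ∀ v : Min.Pos d d' R, ⁅F.θ x, v⁆ = 0) : x = 0 := by
  have h0 : x ∈ LieModule.ker K D.LieAlg F.PosMod := (LieModule.mem_ker ..).mpr h
  rcases LieAlgebra.IsSimple.eq_bot_or_eq_top (R := K) (LieModule.ker K D.LieAlg F.PosMod)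
    with h1 | h1
  · rw [h1] at h0; exact h0
  obtain ⟨j, hj⟩ := D.exists_lam_ne_zero
  have h1 : D.chev.h j ∈ LieModule.ker K D.LieAlg F.PosMod := h1 ▸ LieSubmodule.mem_top _
  have h2 := F.h_ePos j
  rw [(LieModule.mem_ker ..).mp h1, zero_eq_neg, smul_eq_zero] at h2
  exact (h2.elim (fun h => hj (by exact_mod_cast h)) he₀).elim

variable (hε : ∀ j, D.lam j ≠ 0 → D.ε j = 1)

include hε

theorem eq_zero_of_lie_eq_zero [LieAlgebra.IsSimple K D.LieAlg] {x : D.LieAlg} {a : K}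
    (h : ∀ v : Min.Pos d d' R, ⁅F.θ x + a • F.h₀, v⁆ = 0) : x = 0 ∧ a = 0 := by
  have hsplit : F.θ x + a • F.h₀ = F.θ (x - a • D.c) + a • F.z := by
    rw [show F.h₀ = F.z - F.θ D.c by rw [z, add_sub_cancel_right], map_sub, map_smul, smul_sub]
    abel
  rw [hsplit] at h
  have h3 : x - a • D.c = 0 := by
    have : x - a • D.c ∈ LieAlgebra.center K D.LieAlg := fun y => by
      rw [← lie_skew, neg_eq_zero]
      refine F.eq_zero_of_θ_lie_eq_zero he₀ fun v => ?_
      have h1 : ⁅F.θ ⁅x - a • D.c, y⁆, v⁆ =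
          ⁅⁅F.θ (x - a • D.c) + a • F.z, F.θ y⁆, v⁆ := by
        rw [add_lie, smul_lie, F.z_lie hε, smul_zero, add_zero, LieHom.map_lie]
      rw [h1, lie_lie, h, h, lie_zero, sub_zero]
    rw [LieAlgebra.center_eq_bot] at this
    exact this
  have h4 : a = 0 := by
    by_contra ha
    have h5 := h F.e₀
    rw [h3, map_zero, zero_add, smul_lie, F.z_lie_e₀] at h5
    have h6 := (smul_eq_zero.mp h5).resolve_left ha
    rw [neg_eq_zero, smul_eq_zero] at h6
    exact h6.elim (D.cWeight_ne_zero hε) he₀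
  subst h4
  rw [zero_smul, sub_zero] at h3
  exact ⟨h3, rfl⟩

theorem eq_zero_of_add_eq_zero [LieAlgebra.IsSimple K D.LieAlg] {x : D.LieAlg} {a : K}
    (h : F.θ x + a • F.h₀ = 0) : x = 0 ∧ a = 0 :=
  F.eq_zero_of_lie_eq_zero he₀ hε fun v => by rw [h, zero_lie]

/-- The linear form on the even part that vanishes on `𝔤` and has the value `1` at `h_0`. -/
theorem exists_dual [LieAlgebra.IsSimple K D.LieAlg] :
    ∃ ℓ : Min.Zero d d' R →ₗ[K] K, (∀ x, ℓ (F.θ x) = 0) ∧ ℓ F.h₀ = 1 := by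
  have h1 : F.h₀ ∉ LinearMap.range F.θ.toLinearMap := by
    rintro ⟨x, hx⟩
    have hx' : F.θ (-x) + (1 : K) • F.h₀ = 0 := by
      rw [map_neg, one_smul, ← hx]; exact neg_add_cancel _
    exact one_ne_zero (F.eq_zero_of_add_eq_zero he₀ hε hx').2
  obtain ⟨f, hf, hf'⟩ := Submodule.exists_le_ker_of_notMem h1
  refine ⟨(f F.h₀)⁻¹ • f, fun x => ?_, ?_⟩
  · rw [LinearMap.smul_apply, show f (F.θ x) = 0 from hf' ⟨x, rfl⟩, smul_zero]
  · rw [LinearMap.smul_apply, smul_eq_mul, inv_mul_cancel₀ hf]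

end

theorem isLowest_pos (T : D.chev.Grading) (hT : T.lam = D.lam) (hc : T.c = D.c)
    (htop : opClosure (Set.range fun i => LieModule.toEnd K D.LieAlg F.PosMod (D.chev.e i))
      (Submodule.span K {F.ePos}) = ⊤) :
    T.IsLowest (Submodule.span K {F.ePos}) (-D.cWeight) := by
  have key : ∀ {x : D.LieAlg} {a : K}, ⁅x, F.ePos⁆ = a • F.ePos →
      ∀ v ∈ Submodule.span K {F.ePos}, ⁅x, v⁆ = a • v := by
    intro x a h v hv
    obtain ⟨b, rfl⟩ := Submodule.mem_span_singleton.mp hv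
    rw [lie_smul, h, smul_comm]
  have key' : ∀ {x : D.LieAlg} {a : K}, ⁅x, F.ePos⁆ = a • F.ePos →
      ∀ v ∈ Submodule.span K {F.ePos}, ⁅x, v⁆ ∈ Submodule.span K {F.ePos} := fun h v hv => by
    rw [key h v hv]; exact Submodule.smul_mem _ _ hv
  refine ⟨fun k hk => key' (a := 0) ?_, fun k _ => key' (a := 0) ?_,
    fun i => key' (a := -(D.lam i : K)) ?_, fun j _ v hv => ?_, key ?_, fun X hX he hf => ?_⟩
  · rw [zero_smul]
    rw [hT] at hk
    have := F.pow_e_ePos k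
    rwa [hk, zero_add, pow_one] at this
  · rw [zero_smul, f_ePos]
  · rw [neg_smul, h_ePos]
  · rw [key (a := 0) (by rw [zero_smul, f_ePos]) v hv, zero_smul]
  · rw [hc, neg_smul, c_ePos]
  · rw [eq_top_iff, ← htop]
    exact opClosure_le hX (by rintro _ ⟨i, rfl⟩ v hv; exact he i v hv)

theorem isLowest_neg (T : D.chev.Grading) {M : Submodule K F.NegMod} (s : K)
    (htop : opClosure (Set.range fun i => LieModule.toEnd K D.LieAlg F.NegMod (D.chev.f i)) M = ⊤)
    (hf : ∀ k, T.lam k = 0 → ∀ v ∈ M, ⁅D.chev.f k, v⁆ ∈ M)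
    (he : ∀ k, T.lam k = 0 → ∀ v ∈ M, ⁅D.chev.e k, v⁆ ∈ M)
    (hh : ∀ i, ∀ v ∈ M, ⁅D.chev.h i, v⁆ ∈ M)
    (he' : ∀ j, T.lam j ≠ 0 → ∀ v ∈ M, ⁅D.chev.e j, v⁆ = 0)
    (hc : ∀ v ∈ M, ⁅T.c, v⁆ = s • v) : T.swap.IsLowest M (-s) where
  e_mem := hf
  f_mem := he
  h_mem i v hv := by
    change ⁅-D.chev.h i, v⁆ ∈ M
    rw [neg_lie]; exact neg_mem (hh i v hv)
  f_eq_zero := he'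
  c_lie v hv := by
    change ⁅-T.c, v⁆ = _
    rw [neg_lie, hc v hv, neg_smul]
  gen X hX h1 _ := by
    rw [eq_top_iff, ← htop]
    exact opClosure_le hX (by rintro _ ⟨i, rfl⟩ v hv; exact h1 i v hv)

end Frame

/-! ### The local part of the contragredient Lie superalgebra -/

/-- The element `e_i` of `𝓑`. -/
noncomputable def eB (i : Fin D.r) : D.ContraZero :=
  ⟨D.genB (.e (some i)), Min.gen_mem (GenB.e (some i))⟩

/-- The element `f_i` of `𝓑`. -/
noncomputable def fB (i : Fin D.r) : D.ContraZero :=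
  ⟨D.genB (.f (some i)), Min.gen_mem (GenB.f (some i))⟩

/-- The generators of `𝓑`. -/
noncomputable def frameB : D.Frame GenB.deg GenB.degPrincipal D.relB where
  e := D.eB
  f := D.fB
  h i := D.h (some i)
  h₀ := D.h none
  e₀ := D.e₀
  hh i j := Min.zero_ext (D.bracket_h_h _ _)
  ef i := Min.zero_ext (D.bracket_e_f _)
  ef_ne i j hij := Min.zero_ext (D.brB_e_f_ne fun h => hij (Option.some.inj h))
  he i j := Min.zero_ext (D.bracket_h_e _ _)
  hf i j := Min.zero_ext (D.bracket_h_f _ _)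
  se i j hij := Min.zero_ext (by
    refine (Min.zeroIncl_ad_pow (D.eB i) (D.eB j) _).trans ?_
    rw [map_zero]
    exact D.serreB_e (fun h => hij (Option.some.inj h)) (D.natCast_eq hij))
  sf i j hij := Min.zero_ext (by
    refine (Min.zeroIncl_ad_pow (D.fB i) (D.fB j) _).trans ?_
    rw [map_zero]
    exact D.serreB_f (fun h => hij (Option.some.inj h)) (D.natCast_eq hij))
  h₀e j := Min.zero_ext (by
    refine (D.bracket_h_e none (some j)).trans ?_
    change -((D.lam j : K) / D.ε j) • _ = _
    rw [neg_smul]; rfl)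
  h₀f j := Min.zero_ext (by
    refine (D.bracket_h_f none (some j)).trans ?_
    change -(-((D.lam j : K) / D.ε j) • _) = _
    rw [neg_smul, neg_neg]; rfl)
  he₀ i := Min.pos_ext (by
    refine (D.bracket_h_e (some i) none).trans ?_
    change -(D.lam i : K) • _ = _
    rw [neg_smul]; rfl)
  h₀e₀ := Min.pos_ext (by
    refine (D.bracket_h_e none none).trans ?_
    change (0 : K) • _ = _
    rw [zero_smul, map_zero])
  fe₀ i := Min.pos_ext (by
    refine (D.isLieQuotB.skew (D.genB_mem _ (.f (some i))) (D.genB_mem _ (.e none))).trans ?_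
    rw [D.brB_e_f_ne (by simp), smul_zero, neg_zero, map_zero])
  se₀ i := Min.pos_ext (by
    refine (Min.posIncl_toEnd_pow (D.eB i) D.e₀ _).trans ?_
    rw [map_zero]
    refine D.serreB_e (by simp) ?_
    change _ = 1 - -(D.lam i : K)
    push_cast; ring)

theorem chev_e_ne_zero (i : Fin D.r) : D.chev.e i ≠ 0 := fun h => by
  have h1 := D.frameB.θ_e i
  rw [h, map_zero] at h1
  exact D.genB_e_ne_zero (some i) (congrArg (Min.zeroIncl _ _ _) h1).symm

theorem e₀_ne_zero : D.e₀ ≠ 0 := fun h =>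
  D.genB_e_ne_zero none (congrArg (Min.posIncl _ _ _) h)

/-- The element `f_0`. -/
noncomputable def fNeg : D.frameB.NegMod := D.f₀

theorem h_fNeg (i : Fin D.r) : ⁅D.chev.h i, D.fNeg⁆ = (D.lam i : K) • D.fNeg := by
  rw [Frame.neg_lie_def, Frame.θ_h]
  refine Min.neg_ext ((D.bracket_h_f (some i) none).trans ?_)
  change -(-(D.lam i : K) • _) = _
  rw [neg_smul, neg_neg]; rfl

theorem e_fNeg (i : Fin D.r) : ⁅D.chev.e i, D.fNeg⁆ = 0 := by
  rw [Frame.neg_lie_def, Frame.θ_e]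
  refine Min.neg_ext ((D.brB_e_f_ne (i := some i) (j := none) (by simp)).trans ?_)
  exact (map_zero D.frameB.negIncl).symm

theorem h₀_fNeg : ⁅D.frameB.h₀, D.fNeg⁆ = 0 := by
  refine Min.neg_ext ((D.bracket_h_f none none).trans ?_)
  change -((0 : K) • _) = _
  rw [zero_smul, neg_zero]
  exact (map_zero D.frameB.negIncl).symm

theorem c_fNeg : ⁅D.c, D.fNeg⁆ = D.cWeight • D.fNeg := by
  rw [c, sum_lie, cWeight, Finset.sum_smul]
  exact Finset.sum_congr rfl fun i _ => by rw [smul_lie, h_fNeg, smul_smul]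

theorem pow_f_fNeg (i : Fin D.r) :
    (LieModule.toEnd K D.LieAlg D.frameB.NegMod (D.chev.f i) ^ (D.lam i + 1)) D.fNeg = 0 := by
  have h1 : ∀ n, D.frameB.negIncl ((LieModule.toEnd K D.LieAlg D.frameB.NegMod
      (D.chev.f i) ^ n) D.fNeg) = (D.brB (D.genB (.f (some i))) ^ n) (D.genB (.f none)) := by
    intro n
    induction n with
    | zero => rfl
    | succ n ih =>
      rw [pow_succ', Module.End.mul_apply, LieModule.toEnd_apply_apply, pow_succ',
        Module.End.mul_apply, ← ih, Frame.neg_lie_def, Frame.θ_f]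
      rfl
  refine Min.neg_ext ((h1 _).trans (Eq.trans ?_ (map_zero D.frameB.negIncl).symm))
  refine D.serreB_f (by simp) ?_
  change _ = 1 - -(D.lam i : K)
  push_cast; ring

theorem pairing_ePos_fNeg : D.frameB.pairing D.frameB.ePos D.fNeg = D.frameB.h₀ :=
  Min.zero_ext (D.bracket_e_f none)

/-- The component of degree `-1` of `𝓑` is generated by `f_0`. -/
theorem isNegBase : D.frameB.IsNegBase (Submodule.span K {D.fNeg}) where
  h_mem i v hv := by
    obtain ⟨a, rfl⟩ := Submodule.mem_span_singleton.mp hv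
    rw [lie_smul, h_fNeg]
    exact Submodule.smul_mem _ _ (Submodule.smul_mem _ _ (Submodule.mem_span_singleton_self _))
  e_mem i v hv := by
    obtain ⟨a, rfl⟩ := Submodule.mem_span_singleton.mp hv
    rw [lie_smul, e_fNeg, smul_zero]; exact zero_mem _
  h₀_mem v hv := by
    obtain ⟨a, rfl⟩ := Submodule.mem_span_singleton.mp hv
    rw [lie_smul, h₀_fNeg, smul_zero]; exact zero_mem _
  e₀_mem v hv := by
    obtain ⟨a, rfl⟩ := Submodule.mem_span_singleton.mp hv
    rw [map_smul, pairing_ePos_fNeg]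
    exact D.frameB.mem_even.mpr ⟨0, a, by rw [map_zero, zero_add]⟩
  gen x := by
    rcases x with (_ | i) | (_ | i) | (_ | i)
    · exact Or.inr (Or.inr (Or.inl rfl))
    · exact Or.inl ⟨D.chev.e i, by rw [Frame.θ_e]; rfl⟩
    · exact Or.inr (Or.inr (Or.inr ⟨D.fNeg, Submodule.mem_span_singleton_self _, rfl⟩))
    · exact Or.inl ⟨D.chev.f i, by rw [Frame.θ_f]; rfl⟩
    · exact Or.inr (Or.inl rfl)
    · exact Or.inl ⟨D.chev.h i, by rw [Frame.θ_h]; rfl⟩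

/-- The components of degree `0` and `±1` of `𝓑`. -/
theorem local_eqB (hε : ∀ j, D.lam j ≠ 0 → D.ε j = 1) :
    D.frameB.even = ⊤ ∧
    opClosure (Set.range fun i => LieModule.toEnd K D.LieAlg D.frameB.PosMod (D.chev.e i))
      (Submodule.span K {D.frameB.ePos}) = ⊤ ∧
    opClosure (Set.range fun i => LieModule.toEnd K D.LieAlg D.frameB.NegMod (D.chev.f i))
      (Submodule.span K {D.fNeg}) = ⊤ := by
  obtain ⟨ℓ, hℓ⟩ := D.exists_isGradingElementB GenB.deg (by rintro (_ | _) <;> rfl) (fun _ => rfl)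
  exact D.isNegBase.local_eq hε (Min.isGradingElement hℓ)

theorem exists_zero_eq (hε : ∀ j, D.lam j ≠ 0 → D.ε j = 1) (z : D.ContraZero) :
    ∃ (x : D.LieAlg) (a : K), z = D.frameB.θ x + a • D.frameB.h₀ :=
  D.frameB.mem_even.mp ((D.local_eqB hε).1 ▸ Submodule.mem_top)

/-- There is exactly one invariant bilinear map with the given normalisation. -/
theorem existsUnique_isInvariantForm [LieAlgebra.IsSimple K D.LieAlg]
    (hε : ∀ j, D.lam j ≠ 0 → D.ε j = 1) :
    ∃! Φ : D.ContraNeg →ₗ[K] D.ContraPos →ₗ[K] K, D.IsInvariantForm Φ := by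
  obtain ⟨ℓ, hℓ, hℓ₀⟩ := D.frameB.exists_dual D.e₀_ne_zero hε
  have hlie : ∀ z w : D.ContraZero, ℓ ⁅z, w⁆ = 0 := by
    intro z w
    obtain ⟨x, a, rfl⟩ := D.exists_zero_eq hε z
    obtain ⟨y, b, rfl⟩ := D.exists_zero_eq hε w
    have h1 : ∀ x, ℓ ⁅D.frameB.h₀, D.frameB.θ x⁆ = 0 := fun x => by
      rw [D.frameB.h₀_lie hε, map_neg, hℓ, neg_zero]
    have h2 : ∀ x, ℓ ⁅D.frameB.θ x, D.frameB.h₀⁆ = 0 := fun x => by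
      rw [← lie_skew, map_neg, h1, neg_zero]
    simp [h1, h2, ← LieHom.map_lie, hℓ]
  -- The invariance of `Φ₀` holds because `ℓ` vanishes on commutators.
  set Φ₀ : D.ContraNeg →ₗ[K] D.ContraPos →ₗ[K] K := -(D.frameB.pairing.flip.compr₂ ℓ) with hΦ₀
  have hinv : D.IsInvariantForm Φ₀ := by
    refine ⟨fun y z x => ?_, ?_⟩
    · have h1 := congrArg ℓ (D.frameB.lie_pairing z x y)
      rw [hlie, map_add] at h1
      have h2 : ℓ (D.frameB.pairing x (-⁅z, y⁆)) = -ℓ (D.frameB.pairing x ⁅z, y⁆) :=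
        (congrArg ℓ (LinearMap.map_neg (D.frameB.pairing x) _)).trans (map_neg ℓ _)
      refine (congrArg Neg.neg h2).trans ((neg_neg _).trans ?_)
      exact eq_neg_of_add_eq_zero_right h1.symm
    · change -ℓ (D.frameB.pairing D.frameB.ePos D.fNeg) = -1
      rw [pairing_ePos_fNeg, hℓ₀]
  refine ⟨Φ₀, hinv, fun Φ hΦ => ?_⟩
  obtain ⟨-, htop, htop'⟩ := D.local_eqB hε
  -- The difference of two forms vanishes on `(f_0, e_0)`, hence on the modules that they generate.
  set Ψ : D.frameB.NegMod →ₗ[K] D.frameB.PosMod →ₗ[K] K := Φ - Φ₀ with hΨ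
  have h1 : ∀ (y : D.frameB.NegMod) (z : D.LieAlg) (x : D.frameB.PosMod),
      Ψ y ⁅z, x⁆ = -Ψ ⁅z, y⁆ x := fun y z x => by
    have h2 : ∀ (w : D.ContraNeg) (x : D.ContraPos),
        Φ (-w) x - Φ₀ (-w) x = -(Φ w x - Φ₀ w x) := fun w x => by
      rw [map_neg, map_neg, LinearMap.neg_apply, LinearMap.neg_apply]; ring
    exact (congrArg₂ (· - ·) (hΦ.invariant y (D.frameB.θ z) x)
      (hinv.invariant y (D.frameB.θ z) x)).symm.trans (h2 _ _)
  have h2 : ∀ x, Ψ D.fNeg x = 0 := fun x => by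
    have h3 : x ∈ opClosure _ (Submodule.span K {D.frameB.ePos}) := htop ▸ Submodule.mem_top
    refine opClosure_le (X := LinearMap.ker (Ψ D.fNeg)) ?_ ?_ h3
    · rw [Submodule.span_singleton_le_iff_mem]
      exact (congrArg₂ (· - ·) hΦ.normalised hinv.normalised).trans (sub_self _)
    · rintro _ ⟨i, rfl⟩ v -
      rw [LinearMap.mem_ker, LieModule.toEnd_apply_apply, h1, e_fNeg, map_zero,
        LinearMap.zero_apply, neg_zero]
  have h3 : Ψ = 0 := by
    ext1 y
    have h4 : y ∈ opClosure _ (Submodule.span K {D.fNeg}) := htop' ▸ Submodule.mem_top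
    refine opClosure_le (X := LinearMap.ker Ψ) ?_ ?_ h4
    · rw [Submodule.span_singleton_le_iff_mem]
      exact LinearMap.ext h2
    · rintro _ ⟨i, rfl⟩ v hv
      refine LinearMap.ext fun x => ?_
      have h5 := h1 v (D.chev.f i) x
      rw [LinearMap.mem_ker.mp hv, LinearMap.zero_apply, zero_eq_neg] at h5
      exact h5
  exact sub_eq_zero.mp h3

end Triple

/-! ### The local cartanification -/

namespace ContragredientLocal

variable {K : Type u} {Gm G0 Gp : Type u} [Field K] [LieRing G0]
  [LieAlgebra K G0] [AddCommGroup Gm] [Module K Gm] [LieRingModule G0 Gm] [LieModule K G0 Gm]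
  [AddCommGroup Gp] [Module K Gp] [LieRingModule G0 Gp] [LieModule K G0 Gp]
  (A : ContragredientLocal K Gm G0 Gp)

open UniversalEnvelopingAlgebra (ι)

section

attribute [local instance] LieRing.ofAssociativeRing

theorem ι_lie (a b : G0) : ι K ⁅a, b⁆ = ι K a * ι K b - ι K b * ι K a := by
  rw [LieHom.map_lie, LieRing.of_associative_ring_bracket]

theorem leftMul_ι {G : Type u} [AddCommGroup G] [Module K G] [LieRingModule G0 G]
    [LieModule K G0 G] (a : G0) (x : G) (u : Env K G0) :
    leftMul K G0 G (ι K a) (x ⊗ₜ u) = ⁅a, x⁆ ⊗ₜ u + x ⊗ₜ (ι K a * u) := by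
  rw [leftMul, UniversalEnvelopingAlgebra.lift_ι_apply]
  rfl

theorem toLeft_ι {G : Type u} [AddCommGroup G] [Module K G] [LieRingModule G0 G]
    [LieModule K G0 G] (a : G0) (x : G) :
    toLeft K G0 G (x ⊗ₜ ι K a) = ι K a ⊗ₜ x - 1 ⊗ₜ ⁅a, x⁆ := by
  change (UniversalEnvelopingAlgebra.lift K (rightMul₀ K G0 G) (ι K a)).unop (1 ⊗ₜ x) = _
  rw [UniversalEnvelopingAlgebra.lift_ι_apply]
  change (1 * ι K a) ⊗ₜ x - _ = _
  rw [one_mul]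
  rfl

theorem toLeft_one {G : Type u} [AddCommGroup G] [Module K G] [LieRingModule G0 G]
    [LieModule K G0 G] (x : G) : toLeft K G0 G (x ⊗ₜ 1) = 1 ⊗ₜ x := by
  change (UniversalEnvelopingAlgebra.lift K (rightMul₀ K G0 G) 1).unop (1 ⊗ₜ x) = _
  rw [map_one]
  rfl

theorem ι_injective (h : ∀ a : G0, (∀ x : Gp, ⁅a, x⁆ = 0) → a = 0) :
    Function.Injective (ι K : G0 →ₗ⁅K⁆ Env K G0) := by
  rw [injective_iff_map_eq_zero]
  intro a ha
  refine h a fun x => ?_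
  have h1 := leftMul_ι a x (1 : Env K G0)
  rw [ha, map_zero, zero_mul, TensorProduct.tmul_zero, add_zero, LinearMap.zero_apply] at h1
  let aug : Env K G0 →ₐ[K] K := UniversalEnvelopingAlgebra.lift K (0 : G0 →ₗ⁅K⁆ K)
  have h2 := congrArg ((TensorProduct.rid K Gp).toLinearMap ∘ₗ aug.toLinearMap.lTensor Gp) h1
  simpa using h2.symm

/-- The bracket `[x, y z]` of `x` in degree `1` with the product of `y` in degree `-1` and `z` in
degree `0`. -/
def cornerBr (y : Gm) (z : G0) (x : Gp) : G0 :=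
  A.form y ⁅z, x⁆ • A.L - A.form y x • z - A.br ⁅z, x⁆ y

omit [LieRing G0] [LieAlgebra K G0] in
theorem cornerBr_aux {U : Type*} [Ring U] [Algebra K U] (l b p q : U) (s t : K)
    (h : l * b = b * l) :
    (p + (-s) • l + (-s) • (1 : U)) * b + (b * (-p + s • l) - (-q + (-t) • l)) =
      t • l - s • b - (b * p - p * b - q) := by
  simp only [add_mul, mul_add, smul_mul_assoc, mul_smul_comm, one_mul, mul_neg, neg_mul, neg_smul,
    h]
  abel

theorem corner_zz (a b : G0) : A.corner.zz (ι K a) (ι K b) = ι K ⁅a, b⁆ := (ι_lie a b).symm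

theorem corner_zm (a : G0) (y : Gm) (b : G0) :
    A.corner.zm (ι K a) (y ⊗ₜ ι K b) = ⁅a, y⁆ ⊗ₜ ι K b + y ⊗ₜ ι K ⁅a, b⁆ := by
  change leftMul K G0 Gm (ι K a) (y ⊗ₜ ι K b) - y ⊗ₜ (ι K b * ι K a) = _
  rw [leftMul_ι, ι_lie, TensorProduct.tmul_sub]; abel

theorem corner_zp (a : G0) (x : Gp) : A.corner.zp (ι K a) (x ⊗ₜ 1) = ⁅a, x⁆ ⊗ₜ 1 := by
  change leftMul K G0 Gp (ι K a) (x ⊗ₜ 1) - x ⊗ₜ (1 * ι K a) = _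
  rw [leftMul_ι, one_mul, mul_one]; abel

theorem corner_pm (x : Gp) (y : Gm) (b : G0) :
    A.corner.pm (x ⊗ₜ 1) (y ⊗ₜ ι K b) = ι K (A.cornerBr y b x) := by
  change sandwich A.posNeg (toLeft K G0 Gp (x ⊗ₜ 1)) (y ⊗ₜ ι K b) +
    sandwich A.negPos (toLeft K G0 Gm (y ⊗ₜ ι K b)) (x ⊗ₜ 1) = _
  rw [toLeft_one, toLeft_ι, map_sub, LinearMap.sub_apply]
  change 1 * (A.posNeg x y * ι K b) + (ι K b * (A.negPos y x * 1) -
    1 * (A.negPos ⁅b, y⁆ x * 1)) = _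
  rw [one_mul, one_mul, mul_one, mul_one]
  change (ι K (A.br x y) + (-A.form y x) • ι K A.L + (-A.form y x) • (1 : Env K G0)) * ι K b +
    (ι K b * (-ι K (A.br x y) + A.form y x • ι K A.L) -
      (-ι K (A.br x ⁅b, y⁆) + A.form ⁅b, y⁆ x • ι K A.L)) = _
  have h1 : ι K A.L * ι K b = ι K b * ι K A.L := by
    have := ι_lie (K := K) A.L b
    rw [A.L_zero, map_zero] at this
    exact (sub_eq_zero.mp this.symm)
  have h2 : A.form ⁅b, y⁆ x = -A.form y ⁅b, x⁆ := by
    rw [← A.form_invariant, map_neg, LinearMap.neg_apply, neg_neg]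
  have h3 : A.br ⁅b, x⁆ y = ⁅b, A.br x y⁆ - A.br x ⁅b, y⁆ := by rw [A.lie_br]; abel
  have h4 := ι_lie (K := K) b (A.br x y)
  rw [cornerBr, map_sub, map_sub, map_smul, map_smul, h2, h3, map_sub, h4]
  exact cornerBr_aux _ _ _ _ _ _ h1

theorem cornerBr_lie (a : G0) (y : Gm) (z : G0) (x : Gp) :
    A.cornerBr ⁅a, y⁆ z x + A.cornerBr y ⁅a, z⁆ x = ⁅a, A.cornerBr y z x⁆ -
      A.cornerBr y z ⁅a, x⁆ := by
  have h1 : ∀ x, A.form ⁅a, y⁆ x = -A.form y ⁅a, x⁆ := fun x => by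
    rw [← A.form_invariant, map_neg, LinearMap.neg_apply, neg_neg]
  have h2 : ⁅a, A.L⁆ = 0 := by rw [← lie_skew, A.L_zero, neg_zero]
  simp only [cornerBr, lie_sub, lie_smul, A.lie_br, h1, h2, lie_lie, map_sub, LinearMap.sub_apply]
  module

/-- The local algebra `Q` is the local part of the cartanification, described by spanning families:
`ζ z`, `π x` and `ν y z` are the images of `z`, `x` and the product `y z`. By `eq_zero_of_pm` an
element of degree `-1` is determined by its brackets with the elements of degree `1`. -/
structure IsModel {Lm L0 Lp : Type u} [AddCommGroup Lm] [Module K Lm]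
    [AddCommGroup L0] [Module K L0] [AddCommGroup Lp] [Module K Lp]
    (Q : LocalAlgebra K Lm L0 Lp) (ζ : G0 →ₗ[K] L0) (π : Gp →ₗ[K] Lp)
    (ν : Gm →ₗ[K] G0 →ₗ[K] Lm) : Prop where
  zero_surj : Function.Surjective ζ
  pos_surj : Function.Surjective π
  neg_span : ∀ w, w ∈ Submodule.span K {w | ∃ y z, ν y z = w}
  zz : ∀ a b, Q.zz (ζ a) (ζ b) = ζ ⁅a, b⁆
  zm : ∀ a y b, Q.zm (ζ a) (ν y b) = ν ⁅a, y⁆ b + ν y ⁅a, b⁆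
  zp : ∀ a x, Q.zp (ζ a) (π x) = π ⁅a, x⁆
  pm : ∀ x y b, Q.pm (π x) (ν y b) = ζ (A.cornerBr y b x)
  eq_zero_of_pm : ∀ w, (∀ x, Q.pm (π x) w = 0) → w = 0
  zero_inj : (∀ a : G0, (∀ x : Gp, ⁅a, x⁆ = 0) → a = 0) → Function.Injective ζ

/-- The subalgebra of the corner spanned by the products `y z`, `z` and `x`. -/
def spanSub : A.corner.Sub where
  m := Submodule.span K {w | ∃ y z, y ⊗ₜ ι K z = w}
  z := LinearMap.range (ι K : G0 →ₗ⁅K⁆ Env K G0).toLinearMap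
  p := LinearMap.range ((TensorProduct.mk K Gp (Env K G0)).flip 1)
  zz_mem := by
    rintro _ ⟨a, rfl⟩ _ ⟨b, rfl⟩
    exact ⟨⁅a, b⁆, (A.corner_zz a b).symm⟩
  zm_mem := by
    rintro _ ⟨a, rfl⟩ w hw
    change w ∈ Submodule.comap (A.corner.zm (ι K a))
      (Submodule.span K {w | ∃ (y : Gm) (z : G0), y ⊗ₜ ι K z = w})
    refine Submodule.span_le.mpr ?_ hw
    rintro _ ⟨y, z, rfl⟩
    exact (congrArg (· ∈ Submodule.span K {w | ∃ (y : Gm) (z : G0), y ⊗ₜ[K] ι K z = w})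
      (A.corner_zm a y z)).mpr
      (add_mem (Submodule.subset_span ⟨_, _, rfl⟩) (Submodule.subset_span ⟨_, _, rfl⟩))
  zp_mem := by
    rintro _ ⟨a, rfl⟩ _ ⟨x, rfl⟩
    exact ⟨⁅a, x⁆, (A.corner_zp a x).symm⟩
  pm_mem := by
    rintro _ ⟨x, rfl⟩ w hw
    change w ∈ Submodule.comap (A.corner.pm (x ⊗ₜ 1))
      (LinearMap.range (ι K : G0 →ₗ⁅K⁆ Env K G0).toLinearMap)
    refine Submodule.span_le.mpr ?_ hw
    rintro _ ⟨y, z, rfl⟩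
    exact ⟨_, (A.corner_pm x y z).symm⟩

theorem cornerSub_m_le : A.cornerSub.m ≤ A.spanSub.m :=
  sInf_le ⟨A.spanSub, by rintro _ ⟨y, z, rfl⟩; exact Submodule.subset_span ⟨y, z, rfl⟩,
    by rintro _ ⟨x, rfl⟩; exact ⟨x, rfl⟩, rfl⟩

theorem cornerSub_z_le : A.cornerSub.z ≤ A.spanSub.z :=
  sInf_le ⟨A.spanSub, by rintro _ ⟨y, z, rfl⟩; exact Submodule.subset_span ⟨y, z, rfl⟩,
    by rintro _ ⟨x, rfl⟩; exact ⟨x, rfl⟩, rfl⟩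

theorem cornerSub_p_le : A.cornerSub.p ≤ A.spanSub.p :=
  sInf_le ⟨A.spanSub, by rintro _ ⟨y, z, rfl⟩; exact Submodule.subset_span ⟨y, z, rfl⟩,
    by rintro _ ⟨x, rfl⟩; exact ⟨x, rfl⟩, rfl⟩

theorem tmul_ι_mem (y : Gm) (z : G0) : y ⊗ₜ ι K z ∈ A.cornerSub.m := by
  refine Submodule.mem_sInf.mpr ?_
  rintro _ ⟨B, h1, -, rfl⟩
  exact h1 ⟨y, z, rfl⟩

theorem tmul_one_mem (x : Gp) : x ⊗ₜ 1 ∈ A.cornerSub.p := by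
  refine Submodule.mem_sInf.mpr ?_
  rintro _ ⟨B, -, h1, rfl⟩
  exact h1 ⟨x, rfl⟩

theorem ι_cornerBr_mem (y : Gm) (z : G0) (x : Gp) : ι K (A.cornerBr y z x) ∈ A.cornerSub.z := by
  rw [← corner_pm]
  exact A.cornerSub.pm_mem _ (A.tmul_one_mem x) _ (A.tmul_ι_mem y z)

/-- The elements of degree `0` in the subalgebra generated by `G₋₁ G₀` and `G₁`. -/
def zeroSub : Submodule K G0 := A.cornerSub.z.comap (ι K : G0 →ₗ⁅K⁆ Env K G0).toLinearMap

theorem zeroSub_lie_mem {a b : G0} (ha : a ∈ A.zeroSub) (hb : b ∈ A.zeroSub) :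
    ⁅a, b⁆ ∈ A.zeroSub :=
  (congrArg (· ∈ A.cornerSub.z) (A.corner_zz a b)).mp (A.cornerSub.zz_mem _ ha _ hb)

/-- If the subalgebra taken in the local cartanification contains all of the degree `0` part, then
the local cartanification is a model. -/
theorem exists_isModel (hz : A.zeroSub = ⊤) :
    ∃ ζ π ν, A.IsModel A.localCartanification ζ π ν := by
  let ζ : G0 →ₗ[K] A.cornerSub.z := (ι K : G0 →ₗ⁅K⁆ Env K G0).toLinearMap.codRestrict _
    fun a => (hz ▸ Submodule.mem_top : a ∈ A.zeroSub)
  let π₀ : Gp →ₗ[K] A.cornerSub.p :=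
    ((TensorProduct.mk K Gp (Env K G0)).flip 1).codRestrict _ A.tmul_one_mem
  let ν₀ : Gm →ₗ[K] G0 →ₗ[K] A.cornerSub.m := LinearMap.mk₂ K
    (fun y z => ⟨y ⊗ₜ ι K z, A.tmul_ι_mem y z⟩)
    (fun y y' z => Subtype.ext (TensorProduct.add_tmul _ _ _))
    (fun c y z => Subtype.ext (TensorProduct.smul_tmul' _ _ _).symm)
    (fun y z z' => Subtype.ext (by simp only [map_add, TensorProduct.tmul_add]; rfl))
    (fun c y z => Subtype.ext (by simp only [map_smul, TensorProduct.tmul_smul]; rfl))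
  let I := A.cornerSub.toLocalAlgebra.maxPeripheral
  have hζ : Function.Surjective ζ := fun ⟨w, hw⟩ => by
    obtain ⟨a, rfl⟩ := A.cornerSub_z_le hw
    exact ⟨a, rfl⟩
  have hπ₀ : Function.Surjective π₀ := fun ⟨w, hw⟩ => by
    obtain ⟨a, rfl⟩ := A.cornerSub_p_le hw
    exact ⟨a, rfl⟩
  have hν₀ : ∀ w, w ∈ Submodule.span K {w | ∃ y z, ν₀ y z = w} := fun ⟨w, hw⟩ => by
    have h1 := A.cornerSub_m_le hw
    have h2 : A.spanSub.m = (Submodule.span K {w | ∃ y z, ν₀ y z = w}).map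
        A.cornerSub.m.subtype := by
      rw [Submodule.map_span]
      refine congrArg (Submodule.span K) (Set.ext fun w => ⟨?_, ?_⟩)
      · rintro ⟨y, z, rfl⟩
        exact ⟨ν₀ y z, ⟨y, z, rfl⟩, rfl⟩
      · rintro ⟨_, ⟨y, z, rfl⟩, rfl⟩
        exact ⟨y, z, rfl⟩
    rw [h2] at h1
    obtain ⟨w', hw', h3⟩ := h1
    have : w' = ⟨w, hw⟩ := Subtype.ext h3
    rwa [← this]
  have hpm₀ : ∀ x y b, A.cornerSub.toLocalAlgebra.pm (π₀ x) (ν₀ y b) = ζ (A.cornerBr y b x) :=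
    fun x y b => Subtype.ext (A.corner_pm x y b)
  have hzm₀ : ∀ a y b, A.cornerSub.toLocalAlgebra.zm (ζ a) (ν₀ y b) = ν₀ ⁅a, y⁆ b + ν₀ y ⁅a, b⁆ :=
    fun a y b => Subtype.ext (A.corner_zm a y b)
  have hzp₀ : ∀ a x, A.cornerSub.toLocalAlgebra.zp (ζ a) (π₀ x) = π₀ ⁅a, x⁆ :=
    fun a x => Subtype.ext (A.corner_zp a x)
  have hzz : ∀ a b, A.cornerSub.toLocalAlgebra.zz (ζ a) (ζ b) = ζ ⁅a, b⁆ :=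
    fun a b => Subtype.ext (A.corner_zz a b)
  have hderiv : ∀ a x w, A.cornerSub.toLocalAlgebra.pm (π₀ x)
      (A.cornerSub.toLocalAlgebra.zm (ζ a) w) =
      A.cornerSub.toLocalAlgebra.zz (ζ a) (A.cornerSub.toLocalAlgebra.pm (π₀ x) w) -
        A.cornerSub.toLocalAlgebra.pm (π₀ ⁅a, x⁆) w := by
    intro a x w
    induction hν₀ w using Submodule.span_induction with
    | mem w hw =>
      obtain ⟨y, z, rfl⟩ := hw
      rw [hzm₀, map_add, hpm₀, hpm₀, hpm₀, hpm₀, hzz, ← map_add, ← map_sub, cornerBr_lie]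
    | zero => simp only [map_zero, sub_zero]
    | add v w _ _ hv hw => simp only [map_add, hv, hw]; abel
    | smul c w _ hw => simp only [map_smul, hw, smul_sub]
  refine ⟨ζ, I.p.mkQ ∘ₗ π₀, ν₀.compr₂ I.m.mkQ, hζ, I.p.mkQ_surjective.comp hπ₀, fun w => ?_, hzz,
    fun a y b => ?_, fun a x => congrArg I.p.mkQ (hzp₀ a x), fun x y b => hpm₀ x y b,
    fun w hw => ?_, fun h a b hab => ι_injective h (congrArg Subtype.val hab)⟩
  · obtain ⟨w, rfl⟩ := I.m.mkQ_surjective w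
    have h1 := Submodule.mem_map_of_mem (f := I.m.mkQ) (hν₀ w)
    rw [Submodule.map_span] at h1
    refine Submodule.span_mono ?_ h1
    rintro _ ⟨_, ⟨y, z, rfl⟩, rfl⟩
    exact ⟨y, z, rfl⟩
  · have h1 := congrArg I.m.mkQ (hzm₀ a y b)
    rw [map_add] at h1
    exact h1
  · obtain ⟨w, rfl⟩ := I.m.mkQ_surjective w
    rw [Submodule.mkQ_apply, Submodule.Quotient.mk_eq_zero]
    -- The elements of degree `-1` that are annihilated by all of degree `1` form an ideal which does
    -- not meet degree `0`, so they vanish in the quotient.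
    let N : A.cornerSub.toLocalAlgebra.PeripheralIdeal :=
      { m := ⨅ x, LinearMap.ker (A.cornerSub.toLocalAlgebra.pm (π₀ x))
        p := ⊥
        zm_mem := fun a w hw => by
          obtain ⟨a, rfl⟩ := hζ a
          simp only [Submodule.mem_iInf, LinearMap.mem_ker] at hw ⊢
          intro x
          rw [hderiv, hw, map_zero, hw, sub_zero]
        zp_mem := fun a p hp => by
          rw [(Submodule.mem_bot K).mp hp, map_zero]; exact zero_mem _
        pm_left := fun p hp w => by
          rw [(Submodule.mem_bot K).mp hp, map_zero, LinearMap.zero_apply]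
        pm_right := fun p w hw => by
          obtain ⟨x, rfl⟩ := hπ₀ p
          simp only [Submodule.mem_iInf, LinearMap.mem_ker] at hw
          exact hw x }
    refine (le_iSup (fun I : A.cornerSub.toLocalAlgebra.PeripheralIdeal => I.m) N) ?_
    exact (Submodule.mem_iInf _).mpr hw

end

end ContragredientLocal

theorem superComm_single_odd {K A : Type*} [Field K] [Ring A] [Algebra K A] (a b : A) :
    superComm K A (Laurent.single K A 1 a) (Laurent.single K A (-1) b) =
      Laurent.single K A 0 (a * b + b * a) := by
  rw [superComm_single, show sgn 1 (-1) = -1 by simp [sgn], neg_one_smul, sub_neg_eq_add]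
  rfl

/-! ### The minimal Lie superalgebra with a given local part -/

namespace LocalAlgebra

variable {K : Type u} {Lm L0 Lp : Type v} [Field K] [AddCommGroup Lm] [Module K Lm]
  [AddCommGroup L0] [Module K L0] [AddCommGroup Lp] [Module K Lp] (Q : LocalAlgebra K Lm L0 Lp)

local notation "br" => Min.bracket Gen.deg Gen.deg Q.relators

theorem proj_eq {x y : FreeNonUnitalNonAssocAlgebra K (Gen Lm L0 Lp)} (h : Q.Rel (x - y)) :
    Min.proj Gen.deg Gen.deg Q.relators x = Min.proj Gen.deg Gen.deg Q.relators y := by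
  have h1 := Min.proj_rel (d := Gen.deg) (d' := Gen.deg) (R := Q.relators) (Or.inr h)
  rwa [map_sub, sub_eq_zero] at h1

/-- The map from the component of degree `-1` of the local algebra. -/
noncomputable def neg : Lm →ₗ[K] Q.Minimal where
  toFun y := Min.gen _ _ _ (.neg y)
  map_add' y z := by
    have h := Q.proj_eq (x := (Gen.neg (y + z)).of K) (y := (Gen.neg y).of K + (Gen.neg z).of K)
      (by rw [← sub_sub]; exact Rel.neg_add y z)
    rw [map_add] at h
    exact h
  map_smul' c y := by
    have h := Q.proj_eq (Rel.neg_smul c y)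
    rw [map_smul] at h
    exact h

/-- The map from the component of degree `0` of the local algebra. -/
noncomputable def zero : L0 →ₗ[K] Q.Minimal where
  toFun y := Min.gen _ _ _ (.zero y)
  map_add' y z := by
    have h := Q.proj_eq (x := (Gen.zero (y + z)).of K) (y := (Gen.zero y).of K + (Gen.zero z).of K)
      (by rw [← sub_sub]; exact Rel.zero_add y z)
    rw [map_add] at h
    exact h
  map_smul' c y := by
    have h := Q.proj_eq (Rel.zero_smul c y)
    rw [map_smul] at h
    exact h

/-- The map from the component of degree `1` of the local algebra. -/
noncomputable def pos : Lp →ₗ[K] Q.Minimal where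
  toFun y := Min.gen _ _ _ (.pos y)
  map_add' y z := by
    have h := Q.proj_eq (x := (Gen.pos (y + z)).of K) (y := (Gen.pos y).of K + (Gen.pos z).of K)
      (by rw [← sub_sub]; exact Rel.pos_add y z)
    rw [map_add] at h
    exact h
  map_smul' c y := by
    have h := Q.proj_eq (Rel.pos_smul c y)
    rw [map_smul] at h
    exact h

theorem neg_mem (y : Lm) : Q.neg y ∈ Min.grade Gen.deg Gen.deg Q.relators (-1) :=
  Min.gen_mem (Gen.neg y)

theorem zero_mem (a : L0) : Q.zero a ∈ Min.grade Gen.deg Gen.deg Q.relators 0 :=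
  Min.gen_mem (Gen.zero a)

theorem pos_mem (x : Lp) : Q.pos x ∈ Min.grade Gen.deg Gen.deg Q.relators 1 :=
  Min.gen_mem (Gen.pos x)

theorem br_zero_zero (a b : L0) : br (Q.zero a) (Q.zero b) = Q.zero (Q.zz a b) :=
  Q.proj_eq (Rel.zz a b)

theorem br_zero_neg (a : L0) (y : Lm) : br (Q.zero a) (Q.neg y) = Q.neg (Q.zm a y) :=
  Q.proj_eq (Rel.zm a y)

theorem br_zero_pos (a : L0) (x : Lp) : br (Q.zero a) (Q.pos x) = Q.pos (Q.zp a x) :=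
  Q.proj_eq (Rel.zp a x)

theorem br_pos_neg (x : Lp) (y : Lm) : br (Q.pos x) (Q.neg y) = Q.zero (Q.pm x y) :=
  Q.proj_eq (Rel.pm x y)

theorem br_neg_pos (x : Lp) (y : Lm) : br (Q.neg y) (Q.pos x) = Q.zero (Q.pm x y) := by
  have h := Min.skew (Q.neg_mem y) (Q.pos_mem x)
  rw [show sgn (-1) 1 = -1 by simp [sgn], neg_one_smul, ← sub_eq_add_neg, sub_eq_zero] at h
  rw [h, br_pos_neg]

theorem br_neg_zero (a : L0) (y : Lm) : br (Q.neg y) (Q.zero a) = -Q.neg (Q.zm a y) := by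
  have h := Min.skew (Q.neg_mem y) (Q.zero_mem a)
  rw [Min.sgn_zero_right, one_smul, br_zero_neg] at h
  exact eq_neg_of_add_eq_zero_left h

theorem br_pos_zero (a : L0) (x : Lp) : br (Q.pos x) (Q.zero a) = -Q.pos (Q.zp a x) := by
  have h := Min.skew (Q.pos_mem x) (Q.zero_mem a)
  rw [Min.sgn_zero_right, one_smul, br_zero_pos] at h
  exact eq_neg_of_add_eq_zero_left h

/-- An element of the component of degree `0` that acts as the grading element. -/
theorem exists_isGradingElement {l : L0} (h0 : ∀ a, Q.zz l a = 0) (hm : ∀ y, Q.zm l y = -y)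
    (hp : ∀ x, Q.zp l x = x) :
    ∃ ℓ, IsGradingElement Gen.deg Gen.deg (presBracket Gen.deg Q.relators)
      (relIdeal Gen.deg Q.relators).mkQ ℓ := by
  have key : ∀ x, Q.Rel x → (relIdeal Gen.deg Q.relators).mkQ x = 0 := fun x hx =>
    (Submodule.Quotient.mk_eq_zero _).mpr (subset_idealGen _ _ (Or.inr hx))
  have hmul : ∀ x y, presBracket Gen.deg Q.relators ((relIdeal Gen.deg Q.relators).mkQ x)
    ((relIdeal Gen.deg Q.relators).mkQ y) = (relIdeal Gen.deg Q.relators).mkQ (x * y) :=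
    fun x y => rfl
  refine ⟨(relIdeal Gen.deg Q.relators).mkQ ((Gen.zero l).of K),
    of_mem_wordSpan _ Gen.deg (Gen.zero l), fun x => ?_⟩
  rw [hmul]
  rcases x with y | a | x
  · have h1 := key _ (Rel.zm l y)
    have h2 := key _ (Rel.neg_smul (-1) y)
    rw [map_sub, sub_eq_zero] at h1 h2
    rw [hm] at h1
    rw [neg_one_smul, map_smul] at h2
    refine h1.trans (h2.trans ?_)
    simp only [Gen.deg, Int.cast_neg, Int.cast_one]
    rfl
  · have h1 := key _ (Rel.zz l a)
    have h2 := key _ (Rel.zero_smul 0 (0 : L0))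
    rw [map_sub, sub_eq_zero] at h1 h2
    rw [h0] at h1
    rw [zero_smul, zero_smul, map_zero] at h2
    refine h1.trans (h2.trans ?_)
    simp only [Gen.deg, Int.cast_zero, zero_smul]
  · have h1 := key _ (Rel.zp l x)
    rw [map_sub, sub_eq_zero, hp] at h1
    refine h1.trans ?_
    simp only [Gen.deg, Int.cast_one, one_smul]
    rfl

section

variable [CharZero K] {ℓ : Pres Gen.deg Q.relators}
  (hℓ : IsGradingElement Gen.deg Gen.deg (presBracket Gen.deg Q.relators)
      (relIdeal Gen.deg Q.relators).mkQ ℓ)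

include hℓ

/-- The minimal Lie superalgebra is transitive in positive degrees. -/
theorem eq_zero_of_br_neg {s : Q.Minimal} {n : ℤ} (hn : 2 ≤ n)
    (hs : s ∈ Min.grade Gen.deg Gen.deg Q.relators n) (hs' : ∀ y, br (Q.neg y) s = 0) :
    s = 0 := by
  have hq := Min.isLieQuot Gen.deg Gen.deg Q.relators
  obtain ⟨J, hsJ, hJ, hJ'⟩ := hq.exists_stable Gen.deg
    (Np := Set.range Q.pos) (N₀ := Set.range Q.zero) (Nm := Set.range Q.neg) (s := s) (n := n)
    (by
      rintro _ ((⟨i, rfl⟩ | ⟨i, rfl⟩) | ⟨i, rfl⟩)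
      exacts [⟨_, Q.pos_mem _⟩, ⟨_, Q.zero_mem _⟩, ⟨_, Q.neg_mem _⟩])
    (by rintro _ ⟨i, rfl⟩; exact Q.pos_mem _)
    (by rintro _ ⟨i, rfl⟩; exact Q.zero_mem _)
    (by
      rintro _ ⟨i, rfl⟩ _ ⟨j, rfl⟩
      rw [br_zero_pos]; exact Submodule.subset_span ⟨_, rfl⟩)
    (by
      rintro _ ⟨j, rfl⟩ _ ⟨i, rfl⟩
      rw [br_neg_zero, ← map_neg]; exact Submodule.subset_span ⟨_, rfl⟩)
    (by
      rintro _ ⟨j, rfl⟩ _ ⟨i, rfl⟩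
      rw [br_neg_pos]; exact Submodule.subset_span ⟨_, rfl⟩)
    (by
      rintro (y | a | x)
      exacts [Or.inr ⟨y, rfl⟩, Or.inl (Or.inr ⟨a, rfl⟩), Or.inl (Or.inl ⟨x, rfl⟩)])
    hn hs (by rintro _ ⟨y, rfl⟩; exact hs' y)
  have hid : IsIdeal br J := hq.isIdeal (Min.isGradingElement hℓ) hJ'
  have := Min.eq_bot_of_le hℓ hid hJ
  rw [this] at hsJ
  exact hsJ

end

/-! ### The free module over the component of degree `-1` -/

/-- The identities that make the component of degree `-1` a module over the component of degree `0`,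
and the bracket of odd elements equivariant. -/
structure IsLie : Prop where
  zz_zm : ∀ a b y, Q.zm (Q.zz a b) y = Q.zm a (Q.zm b y) - Q.zm b (Q.zm a y)
  zz_pm : ∀ a p y, Q.zz a (Q.pm p y) = Q.pm (Q.zp a p) y + Q.pm p (Q.zm a y)

section Fock

variable {ι : Type*} (b : Module.Basis ι K Lm)

/-- The left multiplication by elements of degree `-1` in the tensor algebra, which is realised as
the space spanned by words in a basis. -/
noncomputable def cre : Lm →ₗ[K] Module.End K (List ι →₀ K) :=
  b.constr K fun i => Finsupp.lmapDomain K K (List.cons i)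

/-- The value of `der` at a word. -/
noncomputable def derWord : List ι → (L0 →ₗ[K] (List ι →₀ K))
  | [] => 0
  | i :: w => (cre b).flip (Finsupp.single w 1) ∘ₗ Q.zm.flip (b i) + cre b (b i) ∘ₗ derWord w

/-- The action of elements of degree `0` by derivations of the tensor algebra. -/
noncomputable def der : L0 →ₗ[K] Module.End K (List ι →₀ K) :=
  LinearMap.flip (Finsupp.lsum K fun w => LinearMap.toSpanSingleton K _ (Q.derWord b w))

/-- The value of `ann` at a word. -/
noncomputable def annWord : List ι → (Lp →ₗ[K] (List ι →₀ K))
  | [] => 0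
  | i :: w => (Q.der b).flip (Finsupp.single w 1) ∘ₗ Q.pm.flip (b i) - cre b (b i) ∘ₗ annWord w

/-- The action of elements of degree `1` on the tensor algebra. -/
noncomputable def ann : Lp →ₗ[K] Module.End K (List ι →₀ K) :=
  LinearMap.flip (Finsupp.lsum K fun w => LinearMap.toSpanSingleton K _ (Q.annWord b w))

theorem cre_single (i w) : cre b (b i) (Finsupp.single w 1) = Finsupp.single (i :: w) 1 := by
  simp [cre]

theorem der_single (a w) : Q.der b a (Finsupp.single w 1) = Q.derWord b w a := by
  simp [der]

theorem ann_single (p w) : Q.ann b p (Finsupp.single w 1) = Q.annWord b w p := by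
  simp [ann]

theorem der_cre (a : L0) (y : Lm) :
    Q.der b a * cre b y = cre b y * Q.der b a + cre b (Q.zm a y) := by
  let f : Lm →ₗ[K] Module.End K (List ι →₀ K) := LinearMap.mulLeft K (Q.der b a) ∘ₗ cre b
  let g : Lm →ₗ[K] Module.End K (List ι →₀ K) :=
    LinearMap.mulRight K (Q.der b a) ∘ₗ cre b + cre b ∘ₗ Q.zm a
  suffices h : f = g from LinearMap.congr_fun h y
  refine b.ext fun i => Finsupp.lhom_ext' fun w => LinearMap.ext_ring ?_
  change Q.der b a (cre b (b i) (Finsupp.single w 1)) =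
    cre b (b i) (Q.der b a (Finsupp.single w 1)) + cre b (Q.zm a (b i)) (Finsupp.single w 1)
  rw [cre_single, der_single, der_single, derWord, add_comm]
  rfl

theorem ann_cre (p : Lp) (y : Lm) :
    Q.ann b p * cre b y + cre b y * Q.ann b p = Q.der b (Q.pm p y) := by
  let f : Lm →ₗ[K] Module.End K (List ι →₀ K) :=
    LinearMap.mulLeft K (Q.ann b p) ∘ₗ cre b + LinearMap.mulRight K (Q.ann b p) ∘ₗ cre b
  suffices h : f = Q.der b ∘ₗ Q.pm p from LinearMap.congr_fun h y
  refine b.ext fun i => Finsupp.lhom_ext' fun w => LinearMap.ext_ring ?_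
  change Q.ann b p (cre b (b i) (Finsupp.single w 1)) +
    cre b (b i) (Q.ann b p (Finsupp.single w 1)) = Q.der b (Q.pm p (b i)) (Finsupp.single w 1)
  rw [cre_single, ann_single, ann_single, annWord]
  exact sub_add_cancel _ _

variable {Q} (hQ : Q.IsLie)

include hQ

theorem der_der (a c : L0) :
    Q.der b a * Q.der b c = Q.der b c * Q.der b a + Q.der b (Q.zz a c) := by
  refine Finsupp.lhom_ext' fun w => LinearMap.ext_ring ?_
  simp only [LinearMap.comp_apply, Finsupp.lsingle_apply, Module.End.mul_apply,
    LinearMap.add_apply]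
  induction w with
  | nil => simp [der_single, derWord]
  | cons i w ih =>
    have h : ∀ a y v, Q.der b a (cre b y v) = cre b y (Q.der b a v) + cre b (Q.zm a y) v :=
      fun a y v => LinearMap.congr_fun (Q.der_cre b a y) v
    rw [← cre_single b]
    simp only [h, map_add, ih, hQ.zz_zm, map_sub, LinearMap.sub_apply]
    abel

theorem der_ann (a : L0) (p : Lp) :
    Q.der b a * Q.ann b p = Q.ann b p * Q.der b a + Q.ann b (Q.zp a p) := by
  refine Finsupp.lhom_ext' fun w => LinearMap.ext_ring ?_
  simp only [LinearMap.comp_apply, Finsupp.lsingle_apply, Module.End.mul_apply,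
    LinearMap.add_apply]
  induction w with
  | nil => simp [der_single, derWord, ann_single, annWord]
  | cons i w ih =>
    have h : ∀ a y v, Q.der b a (cre b y v) = cre b y (Q.der b a v) + cre b (Q.zm a y) v :=
      fun a y v => LinearMap.congr_fun (Q.der_cre b a y) v
    have h' : ∀ p y v, Q.ann b p (cre b y v) = Q.der b (Q.pm p y) v - cre b y (Q.ann b p v) :=
      fun p y v => eq_sub_of_add_eq (LinearMap.congr_fun (Q.ann_cre b p y) v)
    have h'' : ∀ v, Q.der b a (Q.der b (Q.pm p (b i)) v) =
        Q.der b (Q.pm p (b i)) (Q.der b a v) + Q.der b (Q.zz a (Q.pm p (b i))) v :=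
      fun v => by
        have h1 := LinearMap.congr_fun (der_der b hQ a (Q.pm p (b i))) v
        rwa [Module.End.mul_apply, LinearMap.add_apply, Module.End.mul_apply] at h1
    rw [← cre_single b]
    generalize Finsupp.single w (1 : K) = v at ih ⊢
    rw [h' p, map_sub, h'', h a (b i) (Q.ann b p v), h a (b i) v, map_add (Q.ann b p),
      h' p (b i) (Q.der b a v), h' p (Q.zm a (b i)) v, h' (Q.zp a p), ih, map_add (cre b (b i)),
      hQ.zz_pm, map_add (Q.der b), LinearMap.add_apply]
    abel

/-- An element of degree `1` that becomes zero in the minimal Lie superalgebra acts trivially on the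
tensor algebra. -/
theorem ann_eq_zero {p : Lp} (h : (relIdeal Gen.deg Q.relators).mkQ ((Gen.pos p).of K) = 0) :
    Q.ann b p = 0 := by
  let ρ : Gen Lm L0 Lp → Laurent (Module.End K (List ι →₀ K)) := fun x =>
    Laurent.single K _ (Gen.deg x) (match x with
      | .neg y => cre b y
      | .zero a => Q.der b a
      | .pos x => Q.ann b x)
  have hle : relIdeal Gen.deg Q.relators ≤ LinearMap.ker (eval (superComm K _) ρ) := by
    refine relIdeal_le_ker_eval superComm_isGradedLie (fun x => ⟨_, rfl⟩) ?_
    rintro x (_ | _ | _ | _ | _ | _ | ⟨a, c⟩ | ⟨a, y⟩ | ⟨a, p⟩ | ⟨p, y⟩) <;>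
      simp only [Gen.of, map_sub, map_smul, eval_mul, eval_of]
    · simp [Gen.deg]
    · simp [Gen.deg]
    · simp [Gen.deg]
    · simp [Gen.deg]
    · simp [Gen.deg]
    · simp [Gen.deg]
    · rw [superComm_single, der_der b hQ]; simp [Gen.deg]
    · rw [superComm_single, der_cre]; simp [Gen.deg]
    · rw [superComm_single, der_ann b hQ]; simp [Gen.deg]
    · change superComm K _ (Laurent.single K _ 1 _) (Laurent.single K _ (-1) _) -
        Laurent.single K _ 0 _ = 0
      rw [superComm_single_odd, ann_cre, sub_self]
  have h1 := hle ((Submodule.Quotient.mk_eq_zero _).mp h)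
  rw [LinearMap.mem_ker, Gen.of, eval_of] at h1
  exact Laurent.single_eq_zero.mp h1

/-- If an element `p` of degree `1` becomes zero in the minimal Lie superalgebra, then
`[[p, y], y'] = 0` for all `y`, `y'`. This is read off from the action of `p` on the word `y y'`. -/
theorem zm_pm_eq_zero [CharZero K] {ℓ : Pres Gen.deg Q.relators}
    (hℓ : IsGradingElement Gen.deg Gen.deg (presBracket Gen.deg Q.relators)
      (relIdeal Gen.deg Q.relators).mkQ ℓ) {p : Lp} (h : Q.pos p = 0) (y y' : Lm) :
    Q.zm (Q.pm p y) y' = 0 := by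
  let b := Module.Basis.ofVectorSpace K Lm
  have h1 := ann_eq_zero b hQ (Min.eq_zero_of_ofPres_eq_zero hℓ (Submodule.mem_sup_right
    (of_mem_wordSpan (relIdeal Gen.deg Q.relators).mkQ Gen.deg (Gen.pos p))) h)
  have h2 : ∀ v, Q.der b v (Finsupp.single [] 1) = 0 := fun v => by rw [der_single]; rfl
  have hd : ∀ a y v, Q.der b a (cre b y v) = cre b y (Q.der b a v) + cre b (Q.zm a y) v :=
    fun a y v => LinearMap.congr_fun (Q.der_cre b a y) v
  have ha : ∀ p y v, Q.ann b p (cre b y v) = Q.der b (Q.pm p y) v - cre b y (Q.ann b p v) :=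
    fun p y v => eq_sub_of_add_eq (LinearMap.congr_fun (Q.ann_cre b p y) v)
  have h4 : Q.ann b p (cre b y (cre b y' (Finsupp.single [] 1))) = 0 := by
    rw [h1, LinearMap.zero_apply]
  rw [ha, h1, LinearMap.zero_apply, map_zero, sub_zero, hd, h2, map_zero, zero_add] at h4
  have h5 : ∀ y, cre b y (Finsupp.single [] 1) = 0 → y = 0 := fun y hy => by
    have h6 : Finsupp.lmapDomain K K (fun i => [i]) (b.repr y) = cre b y (Finsupp.single [] 1) := by
      rw [cre, b.constr_apply, Finsupp.lmapDomain_apply, Finsupp.mapDomain,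
        LinearMap.finsupp_sum_apply]
      simp [Finsupp.sum]
    rw [hy, Finsupp.lmapDomain_apply] at h6
    have h7 := Finsupp.mapDomain_injective (M := K) (f := fun i => [i])
      (fun i j h => List.singleton_injective h) (h6.trans Finsupp.mapDomain_zero.symm)
    exact b.repr.map_eq_zero_iff.mp h7
  exact h5 _ h4

end Fock

end LocalAlgebra

namespace ContragredientLocal.IsModel

variable {K : Type u} {Gm G0 Gp : Type u} [Field K] [LieRing G0]
  [LieAlgebra K G0] [AddCommGroup Gm] [Module K Gm] [LieRingModule G0 Gm] [LieModule K G0 Gm]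
  [AddCommGroup Gp] [Module K Gp] [LieRingModule G0 Gp] [LieModule K G0 Gp]
  {A : ContragredientLocal K Gm G0 Gp} {Lm L0 Lp : Type u} [AddCommGroup Lm] [Module K Lm]
    [AddCommGroup L0] [Module K L0] [AddCommGroup Lp] [Module K Lp]
    {Q : LocalAlgebra K Lm L0 Lp} {ζ : G0 →ₗ[K] L0} {π : Gp →ₗ[K] Lp}
    {ν : Gm →ₗ[K] G0 →ₗ[K] Lm} (hM : A.IsModel Q ζ π ν)

include hM

theorem neg_induction {p : Lm → Prop} (h : ∀ y b, p (ν y b)) (h0 : p 0)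
    (hadd : ∀ v w, p v → p w → p (v + w)) (hsmul : ∀ (c : K) w, p w → p (c • w))
    (w : Lm) : p w := by
  induction hM.neg_span w using Submodule.span_induction with
  | mem w hw => obtain ⟨y, b, rfl⟩ := hw; exact h y b
  | zero => exact h0
  | add v w _ _ hv hw => exact hadd v w hv hw
  | smul c w _ hw => exact hsmul c w hw

theorem isLie : Q.IsLie where
  zz_zm a b w := by
    obtain ⟨a, rfl⟩ := hM.zero_surj a
    obtain ⟨b, rfl⟩ := hM.zero_surj b
    rw [hM.zz]
    induction w using hM.neg_induction with
    | h y c =>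
      simp only [hM.zm, map_add, lie_lie, map_sub, LinearMap.sub_apply]; abel
    | h0 => simp only [map_zero, sub_zero]
    | hadd v w hv hw => simp only [map_add, hv, hw]; abel
    | hsmul c w hw => simp only [map_smul, hw, smul_sub]
  zz_pm a x w := by
    obtain ⟨a, rfl⟩ := hM.zero_surj a
    obtain ⟨x, rfl⟩ := hM.pos_surj x
    rw [hM.zp]
    induction w using hM.neg_induction with
    | h y c =>
      rw [hM.zm, map_add, hM.pm, hM.pm, hM.pm, hM.pm, hM.zz, ← map_add, ← map_add,
        A.cornerBr_lie, add_sub_cancel]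
    | h0 => simp only [map_zero, add_zero]
    | hadd v w hv hw => simp only [map_add, hv, hw]; abel
    | hsmul c w hw => simp only [map_smul, hw, smul_add]

theorem br_zero_zero (a b : G0) : Min.bracket _ _ _ (Q.zero (ζ a)) (Q.zero (ζ b)) =
    Q.zero (ζ ⁅a, b⁆) := by rw [Q.br_zero_zero, hM.zz]

theorem br_zero_pos (a : G0) (x : Gp) : Min.bracket _ _ _ (Q.zero (ζ a)) (Q.pos (π x)) =
    Q.pos (π ⁅a, x⁆) := by rw [Q.br_zero_pos, hM.zp]

theorem br_pos_zero (a : G0) (x : Gp) : Min.bracket _ _ _ (Q.pos (π x)) (Q.zero (ζ a)) =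
    -Q.pos (π ⁅a, x⁆) := by rw [Q.br_pos_zero, hM.zp]

theorem br_zero_neg (a : G0) (y : Gm) (b : G0) :
    Min.bracket _ _ _ (Q.zero (ζ a)) (Q.neg (ν y b)) =
      Q.neg (ν ⁅a, y⁆ b) + Q.neg (ν y ⁅a, b⁆) := by rw [Q.br_zero_neg, hM.zm, map_add]

theorem br_pos_neg (x : Gp) (y : Gm) (b : G0) :
    Min.bracket _ _ _ (Q.pos (π x)) (Q.neg (ν y b)) = Q.zero (ζ (A.cornerBr y b x)) := by
  rw [Q.br_pos_neg, hM.pm]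

theorem exists_isGradingElement :
    ∃ ℓ, IsGradingElement LocalAlgebra.Gen.deg LocalAlgebra.Gen.deg
      (presBracket LocalAlgebra.Gen.deg Q.relators)
      (relIdeal LocalAlgebra.Gen.deg Q.relators).mkQ ℓ := by
  refine Q.exists_isGradingElement (l := ζ A.L) (fun a => ?_) (fun w => ?_) fun x => ?_
  · obtain ⟨a, rfl⟩ := hM.zero_surj a
    rw [hM.zz, A.L_zero, map_zero]
  · induction w using hM.neg_induction with
    | h y c => rw [hM.zm, A.L_zero, A.L_neg, map_zero, add_zero, map_neg, LinearMap.neg_apply]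
    | h0 => rw [map_zero, neg_zero]
    | hadd v w hv hw => rw [map_add, hv, hw, neg_add]
    | hsmul c w hw => rw [map_smul, hw, smul_neg]
  · obtain ⟨x, rfl⟩ := hM.pos_surj x
    rw [hM.zp, A.L_pos]

variable {ι : Type*} {e : ι → G0} {e₀ : Gp}
  (hgen : ∀ X : Submodule K Gp, e₀ ∈ X → (∀ i, ∀ x ∈ X, ⁅e i, x⁆ ∈ X) → X = ⊤)

include hgen

/-- A subspace of degree `-1` that is stable under the operators that generate the component of
degree `1` from the element `e_0`, and that commutes with `e_0`, is zero. -/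
theorem eq_zero_of_stable {X : Submodule K Lm} (hX : ∀ i, ∀ w ∈ X, Q.zm (ζ (e i)) w ∈ X)
    (hX' : ∀ w ∈ X, Q.pm (π e₀) w = 0) : ∀ w ∈ X, w = 0 := by
  let Y : Submodule K Gp :=
    { carrier := {x | ∀ w ∈ X, Q.pm (π x) w = 0}
      add_mem' := fun ha hb w hw => by
        rw [map_add, map_add, LinearMap.add_apply, ha w hw, hb w hw, add_zero]
      zero_mem' := fun w hw => by rw [map_zero, map_zero, LinearMap.zero_apply]
      smul_mem' := fun c x hx w hw => by
        rw [map_smul, map_smul, LinearMap.smul_apply, hx w hw, smul_zero] }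
  have hY : Y = ⊤ := by
    refine hgen Y hX' fun i x hx w hw => ?_
    have h1 := hM.isLie.zz_pm (ζ (e i)) (π x) w
    rw [hx w hw, map_zero, hx _ (hX i w hw), add_zero, hM.zp] at h1
    exact h1.symm
  exact fun w hw => hM.eq_zero_of_pm w fun x => (hY ▸ Submodule.mem_top : x ∈ Y) w hw

end ContragredientLocal.IsModel

namespace Triple

variable {K : Type u} [Field K] [CharZero K] (D : Triple K)

/-! ### The local cartanification of `𝓑` -/

theorem pos_gen (hε : ∀ j, D.lam j ≠ 0 → D.ε j = 1) (X : Submodule K D.ContraPos) (h0 : D.e₀ ∈ X)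
    (hX : ∀ i, ∀ x ∈ X, ⁅D.eB i, x⁆ ∈ X) : X = ⊤ := by
  rw [eq_top_iff]
  refine (D.local_eqB hε).2.1.symm.le.trans (opClosure_le ?_ ?_)
  · exact Submodule.span_le.mpr (Set.singleton_subset_iff.mpr h0)
  · rintro _ ⟨i, rfl⟩ v hv
    have h1 := hX i v hv
    rw [show D.eB i = D.frameB.θ (D.chev.e i) from (D.frameB.θ_e i).symm] at h1
    exact h1

theorem neg_gen (hε : ∀ j, D.lam j ≠ 0 → D.ε j = 1) (X : Submodule K D.ContraNeg) (h0 : D.f₀ ∈ X)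
    (hX : ∀ i, ∀ x ∈ X, ⁅D.fB i, x⁆ ∈ X) : X = ⊤ := by
  rw [eq_top_iff]
  refine (D.local_eqB hε).2.2.symm.le.trans (opClosure_le ?_ ?_)
  · exact Submodule.span_le.mpr (Set.singleton_subset_iff.mpr h0)
  · rintro _ ⟨i, rfl⟩ v hv
    have h1 := hX i v hv
    rw [show D.fB i = D.frameB.θ (D.chev.f i) from (D.frameB.θ_f i).symm] at h1
    exact h1

theorem zero_gen (hε : ∀ j, D.lam j ≠ 0 → D.ε j = 1) (X : LieSubalgebra K D.ContraZero)
    (h0 : D.h none ∈ X) (he : ∀ i, D.eB i ∈ X) (hf : ∀ i, D.fB i ∈ X) : X = ⊤ := by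
  have h1 : X.comap D.frameB.θ = ⊤ := D.chev.gen _
    (fun i => by rw [LieSubalgebra.mem_comap, Frame.θ_e]; exact he i)
    (fun i => by rw [LieSubalgebra.mem_comap, Frame.θ_f]; exact hf i)
  rw [eq_top_iff]
  intro z _
  obtain ⟨x, a, rfl⟩ := D.exists_zero_eq hε z
  have h2 : x ∈ X.comap D.frameB.θ := h1 ▸ LieSubalgebra.mem_top x
  exact add_mem h2 (X.smul_mem a h0)

section

variable (T : D.chev.Grading) (hT : T.lam = D.lam) (hc : T.c = D.c)
  (hε : ∀ j, D.lam j ≠ 0 → D.ε j = 1)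

include hT hc hε

theorem isLowest_ePos : T.IsLowest (Submodule.span K {D.frameB.ePos}) (-D.cWeight) :=
  D.frameB.isLowest_pos T hT hc (D.local_eqB hε).2.1

theorem isLowest_fNeg : T.swap.IsLowest (Submodule.span K {D.fNeg}) (-D.cWeight) := by
  refine D.frameB.isLowest_neg T D.cWeight (D.local_eqB hε).2.2 ?_ (fun k _ => D.isNegBase.e_mem k)
    D.isNegBase.h_mem ?_ ?_
  · intro k hk v hv
    obtain ⟨a, rfl⟩ := Submodule.mem_span_singleton.mp hv
    have h1 := D.pow_f_fNeg k
    rw [← hT, hk, zero_add, pow_one, LieModule.toEnd_apply_apply] at h1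
    rw [lie_smul, h1, smul_zero]; exact zero_mem _
  · intro j hj v hv
    obtain ⟨a, rfl⟩ := Submodule.mem_span_singleton.mp hv
    rw [lie_smul, e_fNeg, smul_zero]
  · intro v hv
    obtain ⟨a, rfl⟩ := Submodule.mem_span_singleton.mp hv
    rw [hc, lie_smul, c_fNeg, smul_comm]

theorem lie_e₀_of_neg {x : D.LieAlg} (hx : ⁅D.c, x⁆ = -x) : ⁅D.frameB.θ x, D.e₀⁆ = 0 :=
  (D.isLowest_ePos T hT hc hε).lie_eq_zero (by rw [hc, hx])
    (Submodule.mem_span_singleton_self D.frameB.ePos)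

theorem exists_lie_e₀ {x : D.LieAlg} (hx : ⁅D.c, x⁆ = 0) :
    ∃ a : K, ⁅D.frameB.θ x, D.e₀⁆ = a • D.e₀ := by
  obtain ⟨a, ha⟩ := Submodule.mem_span_singleton.mp ((D.isLowest_ePos T hT hc hε).lie_mem
    (by rw [hc, hx]) (Submodule.mem_span_singleton_self D.frameB.ePos))
  exact ⟨a, ha.symm⟩

theorem lie_f₀_of_pos {x : D.LieAlg} (hx : ⁅D.c, x⁆ = x) : ⁅D.frameB.θ x, D.f₀⁆ = 0 :=
  (D.isLowest_fNeg T hT hc hε).lie_eq_zero (x := x)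
    (by change ⁅-T.c, x⁆ = -x; rw [neg_lie, hc, hx])
    (Submodule.mem_span_singleton_self D.fNeg)

theorem exists_lie_f₀ {x : D.LieAlg} (hx : ⁅D.c, x⁆ = 0) :
    ∃ a : K, ⁅D.frameB.θ x, D.f₀⁆ = a • D.f₀ := by
  obtain ⟨a, ha⟩ := Submodule.mem_span_singleton.mp ((D.isLowest_fNeg T hT hc hε).lie_mem (x := x)
    (by change ⁅-T.c, x⁆ = 0; rw [neg_lie, hc, hx, neg_zero])
    (Submodule.mem_span_singleton_self D.fNeg))
  exact ⟨a, ha.symm⟩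

end

end Triple

namespace Triple

variable {K : Type u} [Field K] [CharZero K] {D : Triple K}
  {Φ : D.ContraNeg →ₗ[K] D.ContraPos →ₗ[K] K} (hΦ : D.IsInvariantForm Φ)

theorem br_e₀_f₀ : (D.localPart Φ hΦ).br D.e₀ D.f₀ = D.h none := D.pairing_ePos_fNeg

theorem form_f₀_e₀ : (D.localPart Φ hΦ).form D.f₀ D.e₀ = -1 := hΦ.normalised

theorem form_lie (y : D.ContraNeg) (z : D.ContraZero) (x : D.ContraPos) :
    (D.localPart Φ hΦ).form y ⁅z, x⁆ = -(D.localPart Φ hΦ).form ⁅z, y⁆ x := by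
  rw [← (D.localPart Φ hΦ).form_invariant, map_neg, LinearMap.neg_apply]

theorem cornerBr_of_lie_f₀ {z : D.ContraZero} (hz : ⁅z, D.f₀⁆ = 0) :
    (D.localPart Φ hΦ).cornerBr D.f₀ z D.e₀ = z + ⁅D.h none, z⁆ := by
  have h1 := (D.localPart Φ hΦ).lie_br z D.e₀ D.f₀
  rw [hz, map_zero, add_zero, br_e₀_f₀] at h1
  rw [ContragredientLocal.cornerBr, form_lie, hz, ← h1, form_f₀_e₀, map_zero, LinearMap.zero_apply,
    neg_zero, zero_smul, neg_one_smul, ← lie_skew]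
  abel

theorem cornerBr_of_lie_e₀ {z : D.ContraZero} (hz : ⁅z, D.e₀⁆ = 0) :
    (D.localPart Φ hΦ).cornerBr D.f₀ z D.e₀ = z := by
  rw [ContragredientLocal.cornerBr, hz, form_f₀_e₀]
  simp

theorem h₀_lie_e₀ : ⁅D.h none, D.e₀⁆ = 0 := D.frameB.h₀e₀

theorem f_lie_e₀ (i : Fin D.r) : ⁅D.fB i, D.e₀⁆ = 0 := D.frameB.fe₀ i

theorem e_lie_f₀ (i : Fin D.r) : ⁅D.eB i, D.f₀⁆ = 0 := by
  have := D.e_fNeg i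
  rwa [Frame.neg_lie_def, Frame.θ_e] at this

theorem h_lie_f₀ (i : Fin D.r) : ⁅D.h (some i), D.f₀⁆ = (D.lam i : K) • D.f₀ := by
  have := D.h_fNeg i
  rwa [Frame.neg_lie_def, Frame.θ_h] at this

theorem h₀_lie_f₀ : ⁅D.h none, D.f₀⁆ = 0 := D.h₀_fNeg

theorem e_lie_e₀ {k : Fin D.r} (hk : D.lam k = 0) : ⁅D.eB k, D.e₀⁆ = 0 := by
  have := D.frameB.se₀ k
  rw [hk, zero_add, pow_one] at this
  exact this

theorem f_lie_f₀ {k : Fin D.r} (hk : D.lam k = 0) : ⁅D.fB k, D.f₀⁆ = 0 := by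
  have := D.pow_f_fNeg k
  rw [hk, zero_add, pow_one, LieModule.toEnd_apply_apply, Frame.neg_lie_def, Frame.θ_f] at this
  exact this

theorem f_lie_f_lie_f₀ {j : Fin D.r} (hj : D.lam j = 1) : ⁅D.fB j, ⁅D.fB j, D.f₀⁆⁆ = 0 := by
  have := D.pow_f_fNeg j
  rw [hj, pow_succ, pow_one, Module.End.mul_apply, LieModule.toEnd_apply_apply,
    LieModule.toEnd_apply_apply, Frame.neg_lie_def, Frame.neg_lie_def, Frame.θ_f] at this
  exact this

section

variable (hε : ∀ j, D.lam j ≠ 0 → D.ε j = 1)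

include hε

/-- All of the degree `0` part of `𝓑` occurs in the local cartanification of `𝓑`. -/
theorem zeroSub_eq_top : (D.localPart Φ hΦ).zeroSub = ⊤ := by
  let X : LieSubalgebra K D.ContraZero :=
    { (D.localPart Φ hΦ).zeroSub with
      lie_mem' := (D.localPart Φ hΦ).zeroSub_lie_mem }
  have hmem : ∀ y z x, (D.localPart Φ hΦ).cornerBr y z x ∈ X :=
    (D.localPart Φ hΦ).ι_cornerBr_mem
  have hX : X = ⊤ := by
    refine D.zero_gen hε X ?_ (fun i => ?_) fun i => ?_
    · rw [← cornerBr_of_lie_e₀ hΦ h₀_lie_e₀]; exact hmem _ _ _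
    · by_cases hi : D.lam i = 0
      · rw [← cornerBr_of_lie_e₀ hΦ (e_lie_e₀ hi)]; exact hmem _ _ _
      have hi' : (D.lam i : K) ≠ 0 := by exact_mod_cast hi
      have h1 := hmem D.f₀ (D.h none) ⁅D.eB i, D.e₀⁆
      have h2 : ⁅D.h none, D.eB i⁆ = -((D.lam i : K) • D.eB i) := by
        have := D.frameB.h₀e i
        rw [hε i hi, div_one] at this
        exact this
      have h3 : ⁅D.h none, ⁅D.eB i, D.e₀⁆⁆ = -((D.lam i : K) • ⁅D.eB i, D.e₀⁆) := by
        rw [leibniz_lie, h2, h₀_lie_e₀, lie_zero, add_zero, neg_lie, smul_lie]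
      have h4 : (D.localPart Φ hΦ).form D.f₀ ⁅D.eB i, D.e₀⁆ = 0 := by
        rw [form_lie, e_lie_f₀, map_zero, LinearMap.zero_apply, neg_zero]
      have h5 : (D.localPart Φ hΦ).br ⁅D.eB i, D.e₀⁆ D.f₀ = (D.lam i : K) • D.eB i := by
        have := (D.localPart Φ hΦ).lie_br (D.eB i) D.e₀ D.f₀
        rw [e_lie_f₀, map_zero, add_zero, br_e₀_f₀, ← lie_skew, h2, neg_neg] at this
        exact this.symm
      rw [ContragredientLocal.cornerBr, h3, map_neg, map_smul, h4, smul_zero, neg_zero, zero_smul,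
        zero_smul, sub_zero, zero_sub, map_neg, LinearMap.neg_apply, neg_neg, map_smul,
        LinearMap.smul_apply, h5, smul_smul] at h1
      exact (X.toSubmodule.smul_mem_iff (mul_ne_zero hi' hi')).mp h1
    · rw [← cornerBr_of_lie_e₀ hΦ (f_lie_e₀ i)]; exact hmem _ _ _
  exact congrArg LieSubalgebra.toSubmodule hX

theorem faithful [LieAlgebra.IsSimple K D.LieAlg] (z : D.ContraZero)
    (hz : ∀ x : D.ContraPos, ⁅z, x⁆ = 0) : z = 0 := by
  obtain ⟨x, a, rfl⟩ := D.exists_zero_eq hε z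
  obtain ⟨rfl, rfl⟩ := D.frameB.eq_zero_of_lie_eq_zero D.e₀_ne_zero hε hz
  rw [map_zero, zero_smul, add_zero]

end

section

variable {Lm L0 Lp : Type u} [AddCommGroup Lm] [Module K Lm] [AddCommGroup L0] [Module K L0]
  [AddCommGroup Lp] [Module K Lp] {Q : LocalAlgebra K Lm L0 Lp} {ζ : D.ContraZero →ₗ[K] L0}
  {π : D.ContraPos →ₗ[K] Lp} {ν : D.ContraNeg →ₗ[K] D.ContraZero →ₗ[K] Lm}
  {hΦ : D.IsInvariantForm Φ} (hM : (D.localPart Φ hΦ).IsModel Q ζ π ν)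
  (hε : ∀ j, D.lam j ≠ 0 → D.ε j = 1)

include hM

theorem zm_e (i : Fin D.r) (z : D.ContraZero) :
    Q.zm (ζ (D.eB i)) (ν D.f₀ z) = ν D.f₀ ⁅D.eB i, z⁆ := by
  rw [hM.zm, e_lie_f₀, map_zero, LinearMap.zero_apply, zero_add]

include hε

section

variable (T : D.chev.Grading) (hT : T.lam = D.lam) (hc : T.c = D.c)

include hT hc

/-- The product `f_0 x` vanishes for `x` of degree `1` in `𝔤`, since these products span a subspace
that is annihilated by `e_0` and stable under the `e_i`. -/
theorem ν_eq_zero_of_pos {x : D.LieAlg} (hx : ⁅D.c, x⁆ = x) : ν D.f₀ (D.frameB.θ x) = 0 := by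
  let X : Submodule K Lm := (LinearMap.ker (LieAlgebra.ad K D.LieAlg D.c - 1)).map
    (ν D.f₀ ∘ₗ D.frameB.θ.toLinearMap)
  have hmem : ∀ x : D.LieAlg, ⁅D.c, x⁆ = x → ν D.f₀ (D.frameB.θ x) ∈ X := fun x hx =>
    ⟨x, sub_eq_zero.mpr hx, rfl⟩
  refine hM.eq_zero_of_stable (D.pos_gen hε) (X := X) ?_ ?_ _ (hmem x hx)
  · rintro i _ ⟨y, hy, rfl⟩
    have hy' : ⁅D.c, y⁆ = y := sub_eq_zero.mp hy
    change Q.zm (ζ (D.eB i)) (ν D.f₀ (D.frameB.θ y)) ∈ X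
    rw [zm_e hM, show D.eB i = D.frameB.θ (D.chev.e i) from (D.frameB.θ_e i).symm,
      ← LieHom.map_lie]
    refine hmem _ ?_
    by_cases hi : T.lam i = 0
    · have h1 := T.ce i
      rw [hi, Nat.cast_zero, zero_smul, hc] at h1
      rw [leibniz_lie, h1, hy', zero_lie, zero_add]
    · rw [T.lie_eq_zero (Chev.Grading.IsLowest.e_of_lam_ne_zero T hi) (by rw [hc, hy']), lie_zero]
  · rintro _ ⟨y, hy, rfl⟩
    have hy' : ⁅D.c, y⁆ = y := sub_eq_zero.mp hy
    change Q.pm (π D.e₀) (ν D.f₀ (D.frameB.θ y)) = 0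
    rw [hM.pm, cornerBr_of_lie_f₀ hΦ (D.lie_f₀_of_pos T hT hc hε hy'),
      show ⁅D.h none, D.frameB.θ y⁆ = _ from D.frameB.h₀_lie hε y, hy', add_neg_cancel, map_zero]

theorem ν_e {j : Fin D.r} (hj : D.lam j ≠ 0) : ν D.f₀ (D.eB j) = 0 := by
  rw [show D.eB j = D.frameB.θ (D.chev.e j) from (D.frameB.θ_e j).symm]
  refine ν_eq_zero_of_pos hM hε T hT hc ?_
  rw [← hc]
  exact Chev.Grading.IsLowest.e_of_lam_ne_zero T (by rwa [hT])

/-- The product of `f_0` with `h_0 + L` vanishes. Its bracket with `e_0` is zero because `L` is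
central in `𝓑₀` and `[h_0 + L, e_0] = e_0`. -/
theorem ν_h₀_add : ν D.f₀ (D.h none + D.gradingElement) = 0 := by
  have hL : ∀ z : D.ContraZero, ⁅z, D.gradingElement⁆ = 0 := fun z => by
    rw [← lie_skew, neg_eq_zero]; exact (D.localPart Φ hΦ).L_zero z
  refine hM.eq_zero_of_stable (D.pos_gen hε)
    (X := Submodule.span K {ν D.f₀ (D.h none + D.gradingElement)}) ?_ ?_ _
    (Submodule.mem_span_singleton_self _)
  · intro i w hw
    obtain ⟨a, rfl⟩ := Submodule.mem_span_singleton.mp hw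
    have h1 : ⁅D.eB i, D.h none⁆ = ((D.lam i : K) / D.ε i) • D.eB i := by
      rw [← lie_skew, show ⁅D.h none, D.eB i⁆ = _ from D.frameB.h₀e i, neg_neg]; rfl
    rw [map_smul, zm_e hM, lie_add, hL, add_zero, h1, map_smul]
    by_cases hi : D.lam i = 0
    · rw [hi, Nat.cast_zero, zero_div, zero_smul, smul_zero]; exact zero_mem _
    · rw [ν_e hM hε T hT hc hi, smul_zero, smul_zero]; exact zero_mem _
  · intro w hw
    obtain ⟨a, rfl⟩ := Submodule.mem_span_singleton.mp hw
    have h1 : ⁅D.h none + D.gradingElement, D.e₀⁆ = D.e₀ := by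
      rw [add_lie, h₀_lie_e₀, zero_add]
      exact (D.localPart Φ hΦ).L_pos D.e₀
    rw [map_smul, hM.pm, ContragredientLocal.cornerBr, h1, form_f₀_e₀, br_e₀_f₀,
      show (D.localPart Φ hΦ).L = D.gradingElement from rfl,
      show (-1 : K) • D.gradingElement - (-1 : K) • (D.h none + D.gradingElement) - D.h none = 0 by
        module, map_zero, smul_zero]

/-- The Serre relations for the elements `f_j` and `f_0 h_i`. -/
theorem ν_serre {j : Fin D.r} (hj : D.lam j ≠ 0) {i : Option (Fin D.r)}
    (hi : ∀ k, i = some k → D.lam k = 0) :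
    Q.zm (ζ (D.fB j)) (Q.zm (ζ (D.fB j)) (ν D.f₀ (D.h i))) = 0 := by
  have hj1 : D.lam j = 1 := by
    have h1 := T.lam_le j
    rw [hT] at h1
    omega
  have hcomm : ∀ a b w, Q.zm (ζ a) (Q.zm (ζ b) w) =
      Q.zm (ζ b) (Q.zm (ζ a) w) + Q.zm (ζ ⁅a, b⁆) w := fun a b w => by
    rw [← hM.zz, hM.isLie.zz_zm]; abel
  set s := Q.zm (ζ (D.fB j)) (Q.zm (ζ (D.fB j)) (ν D.f₀ (D.h i))) with hs
  have heh : ∀ l, ⁅D.eB l, D.h i⁆ = -(D.B i (some l) • D.eB l) := fun l => by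
    rw [← lie_skew, neg_inj]
    exact Min.zero_ext (D.bracket_h_e i (some l))
  have hef : ∀ l, l ≠ j → ⁅D.eB l, D.fB j⁆ = 0 := fun l hl => D.frameB.ef_ne l j hl
  -- For `l = j` this is a computation in the `sl₂`-triple of `j`, where `f_0 h_i` is a highest weight
  -- vector of weight `1`. For `l ≠ j` it follows from `[f_j, [f_j, f_0]] = 0`.
  have hes : ∀ l, Q.zm (ζ (D.eB l)) s = 0 := by
    intro l
    by_cases hl : l = j
    · subst hl
      have hv : Q.zm (ζ (D.eB l)) (ν D.f₀ (D.h i)) = 0 := by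
        rw [zm_e hM, heh, map_neg, map_smul, ν_e hM hε T hT hc hj, smul_zero, neg_zero]
      have hhv : Q.zm (ζ (D.h (some l))) (ν D.f₀ (D.h i)) = ν D.f₀ (D.h i) := by
        rw [hM.zm, h_lie_f₀, hj1, Nat.cast_one, one_smul,
          show ⁅D.h (some l), D.h i⁆ = 0 from Min.zero_ext (D.bracket_h_h _ _), map_zero, add_zero]
      have hhf : ⁅D.h (some l), D.fB l⁆ = -((2 : K) • D.fB l) := by
        have := D.frameB.hf l l
        rw [D.A_diag l] at this
        exact_mod_cast this
      have hel : ⁅D.eB l, D.fB l⁆ = D.h (some l) := D.frameB.ef l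
      have h2 : Q.zm (ζ (D.eB l)) (Q.zm (ζ (D.fB l)) (ν D.f₀ (D.h i))) = ν D.f₀ (D.h i) := by
        rw [hcomm, hv, map_zero, zero_add, hel, hhv]
      rw [hs, hcomm, h2, hel, hcomm, hhv, hhf, map_neg, map_smul, map_neg, LinearMap.neg_apply,
        map_smul, LinearMap.smul_apply]
      module
    · have h1 : ∀ w, Q.zm (ζ (D.eB l)) (Q.zm (ζ (D.fB j)) w) =
          Q.zm (ζ (D.fB j)) (Q.zm (ζ (D.eB l)) w) := fun w => by
        rw [hcomm, hef l hl, map_zero, map_zero, LinearMap.zero_apply, add_zero]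
      have h2 : ⁅D.fB j, D.eB l⁆ = 0 := by rw [← lie_skew, hef l hl, neg_zero]
      rw [hs, h1, h1, zm_e hM, heh, map_neg, map_smul]
      simp only [map_neg, map_smul, hM.zm, h2, map_zero, add_zero, f_lie_f_lie_f₀ hj1,
        LinearMap.zero_apply, smul_zero, neg_zero]
  refine hM.eq_zero_of_stable (D.pos_gen hε) (X := Submodule.span K {s}) ?_ ?_ _
    (Submodule.mem_span_singleton_self _)
  · intro l w hw
    obtain ⟨a, rfl⟩ := Submodule.mem_span_singleton.mp hw
    rw [map_smul, hes, smul_zero]; exact zero_mem _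
  · intro w hw
    obtain ⟨a, rfl⟩ := Submodule.mem_span_singleton.mp hw
    have h1 : ∀ w, Q.pm (π D.e₀) (Q.zm (ζ (D.fB j)) w) =
        Q.zz (ζ (D.fB j)) (Q.pm (π D.e₀) w) := fun w => by
      rw [hM.isLie.zz_pm, hM.zp, f_lie_e₀, map_zero, map_zero, LinearMap.zero_apply, zero_add]
    have h2 : ⁅D.h i, D.e₀⁆ = 0 := by
      cases i with
      | none => exact h₀_lie_e₀
      | some k =>
        have := D.frameB.he₀ k
        rw [hi k rfl, Nat.cast_zero, zero_smul, neg_zero] at this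
        exact this
    have h3 : ⁅D.fB j, D.h i⁆ = D.B i (some j) • D.fB j := by
      rw [← lie_skew, neg_eq_iff_eq_neg]
      exact Min.zero_ext (D.bracket_h_f i (some j))
    rw [map_smul, hs, h1, h1, hM.pm, cornerBr_of_lie_e₀ hΦ h2, hM.zz, hM.zz, h3, lie_smul,
      lie_self, smul_zero, map_zero, smul_zero]

end

end

end Triple

/-! ### The components of degree `0` and `1` of the cartanification -/

namespace ContragredientLocal

variable {K : Type u} {Gm G0 Gp : Type u} [Field K] [LieRing G0]
  [LieAlgebra K G0] [AddCommGroup Gm] [Module K Gm] [LieRingModule G0 Gm] [LieModule K G0 Gm]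
  [AddCommGroup Gp] [Module K Gp] [LieRingModule G0 Gp] [LieModule K G0 Gp]
  (A : ContragredientLocal K Gm G0 Gp)

theorem cornerBr_add_left (y y' : Gm) (z : G0) (x : Gp) :
    A.cornerBr (y + y') z x = A.cornerBr y z x + A.cornerBr y' z x := by
  simp only [cornerBr, map_add, LinearMap.add_apply]; module

theorem cornerBr_smul_left (c : K) (y : Gm) (z : G0) (x : Gp) :
    A.cornerBr (c • y) z x = c • A.cornerBr y z x := by
  simp only [cornerBr, map_smul, LinearMap.smul_apply, smul_eq_mul]; module

theorem cornerBr_add (y : Gm) (z z' : G0) (x : Gp) :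
    A.cornerBr y (z + z') x = A.cornerBr y z x + A.cornerBr y z' x := by
  simp only [cornerBr, map_add, LinearMap.add_apply, add_lie]; module

theorem cornerBr_smul (c : K) (y : Gm) (z : G0) (x : Gp) :
    A.cornerBr y (c • z) x = c • A.cornerBr y z x := by
  simp only [cornerBr, map_smul, LinearMap.smul_apply, smul_lie, smul_eq_mul]; module

theorem cornerBr_zero_right (y : Gm) (z : G0) : A.cornerBr y z 0 = 0 := by
  simp [cornerBr]

end ContragredientLocal

namespace Triple

variable {K : Type u} [Field K] [CharZero K] {D : Triple K}
  {Φ : D.ContraNeg →ₗ[K] D.ContraPos →ₗ[K] K}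

theorem fB_ne_zero (j : Fin D.r) : D.fB j ≠ 0 := fun h => by
  have h1 : D.h (some j) = 0 := by
    rw [show D.h (some j) = ⁅D.eB j, D.fB j⁆ from (D.frameB.ef j).symm, h, lie_zero]
  have h2 : ⁅D.h (some j), D.eB j⁆ = (2 : K) • D.eB j := by
    have := D.frameB.he j j
    rw [D.A_diag j] at this
    exact_mod_cast this
  rw [h1, zero_lie] at h2
  exact D.genB_e_ne_zero (some j) (congrArg (Min.zeroIncl _ _ _)
    ((smul_eq_zero.mp h2.symm).resolve_left two_ne_zero))

variable {Lm L0 Lp : Type u} [AddCommGroup Lm] [Module K Lm] [AddCommGroup L0] [Module K L0]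
  [AddCommGroup Lp] [Module K Lp] {Q : LocalAlgebra K Lm L0 Lp} {ζ : D.ContraZero →ₗ[K] L0}
  {π : D.ContraPos →ₗ[K] Lp} {ν : D.ContraNeg →ₗ[K] D.ContraZero →ₗ[K] Lm}

section

variable (hΦ : D.IsInvariantForm Φ) (hε : ∀ j, D.lam j ≠ 0 → D.ε j = 1)
  (T : D.chev.Grading) (hT : T.lam = D.lam) (hc : T.c = D.c)

include hε hT hc

/-- The elements `[e_0, y z]` commute with `e_0`. -/
theorem cornerBr_lie_e₀ (y : D.ContraNeg) (z : D.ContraZero) :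
    ⁅(D.localPart Φ hΦ).cornerBr y z D.e₀, D.e₀⁆ = 0 := by
  let Y : Submodule K D.ContraNeg :=
    { carrier := {y | ∀ z, ⁅(D.localPart Φ hΦ).cornerBr y z D.e₀, D.e₀⁆ = 0}
      add_mem' := fun ha hb z => by
        rw [ContragredientLocal.cornerBr_add_left, add_lie, ha, hb, add_zero]
      zero_mem' := fun z => by
        rw [← zero_smul K (0 : D.ContraNeg), ContragredientLocal.cornerBr_smul_left, zero_smul,
          zero_lie]
      smul_mem' := fun c a ha z => by
        rw [ContragredientLocal.cornerBr_smul_left, smul_lie, ha, smul_zero] }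
  have hY : Y = ⊤ := by
    refine D.neg_gen hε Y (fun z => ?_) fun i y hy z => ?_
    · obtain ⟨x, a, rfl⟩ := D.exists_zero_eq hε z
      -- The components of degrees `1`, `0` and `-1` of `x` are treated separately.
      obtain ⟨x₁, x₀, x₂, rfl, h1, h0, h2⟩ := T.exists_add x
      rw [hc] at h1 h0 h2
      obtain ⟨b, hb⟩ := D.exists_lie_e₀ T hT hc hε h0
      have h3 : (D.localPart Φ hΦ).cornerBr D.f₀ (D.frameB.θ x₁) D.e₀ = 0 := by
        rw [cornerBr_of_lie_f₀ hΦ (D.lie_f₀_of_pos T hT hc hε h1),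
          show ⁅D.h none, D.frameB.θ x₁⁆ = _ from D.frameB.h₀_lie hε x₁, h1, add_neg_cancel]
      have h4 : ⁅D.frameB.θ x₂, D.e₀⁆ = 0 := D.lie_e₀_of_neg T hT hc hε h2
      have h5 : (D.localPart Φ hΦ).cornerBr D.f₀ (D.frameB.θ x₀) D.e₀ =
          (-b) • D.gradingElement + D.frameB.θ x₀ - b • D.h none := by
        rw [ContragredientLocal.cornerBr, hb, map_smul, map_smul, LinearMap.smul_apply,
          form_f₀_e₀, br_e₀_f₀, show (D.localPart Φ hΦ).L = D.gradingElement from rfl, smul_eq_mul]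
        module
      have h6 : ⁅D.gradingElement, D.e₀⁆ = D.e₀ := (D.localPart Φ hΦ).L_pos D.e₀
      rw [map_add, map_add, ContragredientLocal.cornerBr_add, ContragredientLocal.cornerBr_add,
        ContragredientLocal.cornerBr_add, h3, h5, cornerBr_of_lie_e₀ hΦ h4,
        ContragredientLocal.cornerBr_smul,
        show D.frameB.h₀ = D.h none from rfl, cornerBr_of_lie_e₀ hΦ h₀_lie_e₀, add_lie, add_lie,
        add_lie, sub_lie, add_lie, smul_lie, smul_lie, smul_lie, h6, hb, h4, h₀_lie_e₀, zero_lie]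
      module
    · have h1 := (D.localPart Φ hΦ).cornerBr_lie (D.fB i) y z D.e₀
      rw [f_lie_e₀, ContragredientLocal.cornerBr_zero_right, sub_zero] at h1
      rw [eq_sub_of_add_eq h1, sub_lie, hy, lie_lie, hy, f_lie_e₀, lie_zero, lie_zero, sub_zero,
        sub_zero]
  exact (hY ▸ Submodule.mem_top : y ∈ Y) z

end

variable {hΦ : D.IsInvariantForm Φ} (hM : (D.localPart Φ hΦ).IsModel Q ζ π ν)
  (hε : ∀ j, D.lam j ≠ 0 → D.ε j = 1)
  (T : D.chev.Grading) (hT : T.lam = D.lam) (hc : T.c = D.c)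

include hM hε hT hc

/-- The element `e_0` of the cartanification commutes with itself. -/
theorem br_pos_e₀_pos_e₀ : Min.bracket LocalAlgebra.Gen.deg LocalAlgebra.Gen.deg Q.relators
    (Q.pos (π D.e₀)) (Q.pos (π D.e₀)) = 0 := by
  obtain ⟨ℓ, hℓ⟩ := hM.exists_isGradingElement
  refine Q.eq_zero_of_br_neg hℓ (n := 1 + 1) (by norm_num)
    (Min.bracket_mem (Q.pos_mem _) (Q.pos_mem _)) fun w => ?_
  induction w using hM.neg_induction with
  | h y z =>
    have h1 := Min.jacobi (Q.neg_mem (ν y z)) (Q.pos_mem (π D.e₀)) (Q.pos (π D.e₀))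
    rw [Q.br_neg_pos, hM.pm, hM.br_zero_pos, hM.br_pos_zero, cornerBr_lie_e₀ hΦ hε T hT hc,
      map_zero, map_zero, neg_zero, smul_zero, sub_zero, sub_zero] at h1
    exact h1
  | h0 => rw [map_zero, map_zero, LinearMap.zero_apply]
  | hadd v w hv hw => rw [map_add, map_add, LinearMap.add_apply, hv, hw, add_zero]
  | hsmul c w hw => rw [map_smul, map_smul, LinearMap.smul_apply, hw, smul_zero]

variable [LieAlgebra.IsSimple K D.LieAlg]

omit hT hc T in
theorem pos_e₀_ne_zero : Q.pos (π D.e₀) ≠ 0 := by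
  intro h
  obtain ⟨ℓ, hℓ⟩ := hM.exists_isGradingElement
  obtain ⟨j, hj⟩ := D.exists_lam_ne_zero
  have h1 := LocalAlgebra.zm_pm_eq_zero hM.isLie hℓ h (ν D.f₀ (D.h none)) (ν D.f₀ (D.fB j))
  have h2 : ⁅D.h none, D.fB j⁆ = (D.lam j : K) • D.fB j := by
    have := D.frameB.h₀f j
    rw [hε j hj, div_one] at this
    exact this
  rw [hM.pm, cornerBr_of_lie_e₀ hΦ h₀_lie_e₀, hM.zm, h₀_lie_f₀, h2, map_zero,
    LinearMap.zero_apply, zero_add, map_smul, smul_eq_zero] at h1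
  have h3 := hM.pm D.e₀ D.f₀ (D.fB j)
  rw [h1.resolve_left (by exact_mod_cast hj), map_zero, cornerBr_of_lie_e₀ hΦ (f_lie_e₀ j)] at h3
  exact fB_ne_zero j (hM.zero_inj (faithful hε) (h3.symm.trans (map_zero ζ).symm))

variable [FiniteDimensional K D.LieAlg]

/-- The component `𝓑₁` embeds into the cartanification, being generated by `e_0` as a `𝔤`-module. -/
theorem pos_injective : Function.Injective (Q.pos ∘ₗ π) := by
  let N : LieSubmodule K D.LieAlg D.frameB.PosMod :=
    { (LinearMap.ker (Q.pos ∘ₗ π) : Submodule K D.ContraPos) with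
      lie_mem := fun {g x} hx => by
        have h1 := hM.br_zero_pos (D.frameB.θ g) x
        rw [show Q.pos (π x) = 0 from hx, map_zero] at h1
        exact h1.symm }
  have hN : N = ⊥ := by
    refine (D.isLowest_ePos T hT hc hε).eq_bot (fun j _ => ⟨D.lam j + 1, fun v hv => ?_⟩) N
      fun v hv hv' => ?_
    · obtain ⟨a, rfl⟩ := Submodule.mem_span_singleton.mp hv
      rw [map_smul, Frame.pow_e_ePos, smul_zero]
    · obtain ⟨a, rfl⟩ := Submodule.mem_span_singleton.mp hv'
      have h1 : a • Q.pos (π D.e₀) = 0 := by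
        rw [← map_smul, ← map_smul]; exact hv
      rw [(smul_eq_zero.mp h1).resolve_right (pos_e₀_ne_zero hM hε), zero_smul]
  rw [← LinearMap.ker_eq_bot, Submodule.eq_bot_iff]
  intro x hx
  have hx' : x ∈ N := hx
  rw [hN] at hx'
  exact hx'

/-- The component `𝓑₀` embeds into the cartanification, since it acts faithfully on `𝓑₁`. -/
theorem zero_injective : Function.Injective (Q.zero ∘ₗ ζ) := by
  rw [injective_iff_map_eq_zero]
  intro a ha
  refine faithful hε a fun x => pos_injective hM hε T hT hc ?_
  have h1 := hM.br_zero_pos a x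
  rw [show Q.zero (ζ a) = 0 from ha, map_zero, LinearMap.zero_apply] at h1
  exact h1.symm.trans (map_zero _).symm

end Triple

/-! ### The relations of `W` in the cartanification -/

namespace ContragredientLocal.IsModel

variable {K : Type u} {Gm G0 Gp : Type u} [Field K] [LieRing G0]
  [LieAlgebra K G0] [AddCommGroup Gm] [Module K Gm] [LieRingModule G0 Gm] [LieModule K G0 Gm]
  [AddCommGroup Gp] [Module K Gp] [LieRingModule G0 Gp] [LieModule K G0 Gp]
  {A : ContragredientLocal K Gm G0 Gp} {Lm L0 Lp : Type u} [AddCommGroup Lm] [Module K Lm]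
    [AddCommGroup L0] [Module K L0] [AddCommGroup Lp] [Module K Lp]
    {Q : LocalAlgebra K Lm L0 Lp} {ζ : G0 →ₗ[K] L0} {π : Gp →ₗ[K] Lp}
    {ν : Gm →ₗ[K] G0 →ₗ[K] Lm} (hM : A.IsModel Q ζ π ν)

include hM

theorem br_zero_pow_zero (a b : G0) (n : ℕ) :
    (Min.bracket LocalAlgebra.Gen.deg LocalAlgebra.Gen.deg Q.relators (Q.zero (ζ a)) ^ n)
      (Q.zero (ζ b)) = Q.zero (ζ ((LieAlgebra.ad K G0 a ^ n) b)) := by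
  induction n with
  | zero => rfl
  | succ n ih =>
    rw [pow_succ', Module.End.mul_apply, ih, hM.br_zero_zero, pow_succ', Module.End.mul_apply,
      LieAlgebra.ad_apply]

theorem br_zero_pow_pos (a : G0) (x : Gp) (n : ℕ) :
    (Min.bracket LocalAlgebra.Gen.deg LocalAlgebra.Gen.deg Q.relators (Q.zero (ζ a)) ^ n)
      (Q.pos (π x)) = Q.pos (π ((LieModule.toEnd K G0 Gp a ^ n) x)) := by
  induction n with
  | zero => rfl
  | succ n ih =>
    rw [pow_succ', Module.End.mul_apply, ih, hM.br_zero_pos, pow_succ', Module.End.mul_apply,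
      LieModule.toEnd_apply_apply]

end ContragredientLocal.IsModel

namespace Triple

variable {K : Type u} [Field K] [CharZero K] {D : Triple K}
  {Φ : D.ContraNeg →ₗ[K] D.ContraPos →ₗ[K] K}

omit [CharZero K] in
theorem B_some_self (i : Fin D.r) : D.B (some i) (some i) = 2 := by
  change ((D.A i i : ℤ) : K) = 2
  rw [D.A_diag]; norm_num

theorem eq_of_natCast_eq {i j : Fin D.r} {n : ℕ} (hn : (n : K) = 1 - D.B (some i) (some j)) :
    i ≠ j ∧ n = (-D.A i j).toNat + 1 := by
  have hij : i ≠ j := by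
    rintro rfl
    rw [B_some_self] at hn
    have h1 : ((n + 1 : ℕ) : K) = 0 := by push_cast; rw [hn]; ring
    exact absurd (Nat.cast_eq_zero.mp h1) (Nat.succ_ne_zero n)
  exact ⟨hij, Nat.cast_injective (R := K) (hn.trans (D.natCast_eq hij).symm)⟩

omit [CharZero K] in
theorem B_some_none (i : Fin D.r) : D.B (some i) none = -(D.lam i : K) := rfl

omit [CharZero K] in
theorem B_none_some (i : Fin D.r) : D.B none (some i) = -((D.lam i : K) / D.ε i) := rfl

omit [CharZero K] in
theorem h_lie_e (i : Option (Fin D.r)) (j : Fin D.r) :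
    ⁅D.h i, D.eB j⁆ = D.B i (some j) • D.eB j := Min.zero_ext (D.bracket_h_e i (some j))

omit [CharZero K] in
theorem h_lie_f (i : Option (Fin D.r)) (j : Fin D.r) :
    ⁅D.h i, D.fB j⁆ = -(D.B i (some j) • D.fB j) := Min.zero_ext (D.bracket_h_f i (some j))

omit [CharZero K] in
theorem h_lie_h (i j : Option (Fin D.r)) : ⁅D.h i, D.h j⁆ = 0 := Min.zero_ext (D.bracket_h_h i j)

omit [CharZero K] in
theorem h_lie_e₀ (i : Option (Fin D.r)) : ⁅D.h i, D.e₀⁆ = D.B i none • D.e₀ :=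
  Min.pos_ext (D.bracket_h_e i none)

omit [CharZero K] in
theorem h_lie_f₀' (i : Option (Fin D.r)) : ⁅D.h i, D.f₀⁆ = -(D.B i none • D.f₀) :=
  Min.neg_ext (D.bracket_h_f i none)

theorem e_lie_h (i : Option (Fin D.r)) (j : Fin D.r) :
    ⁅D.eB j, D.h i⁆ = -(D.B i (some j) • D.eB j) := by rw [← lie_skew, h_lie_e]

theorem f_lie_h (i : Option (Fin D.r)) (j : Fin D.r) :
    ⁅D.fB j, D.h i⁆ = D.B i (some j) • D.fB j := by rw [← lie_skew, h_lie_f, neg_neg]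

omit [CharZero K] in
theorem B_indexK_none (i : D.IndexK) : D.B i.1 none = 0 := by
  obtain ⟨_ | k, hk⟩ := i
  · rfl
  · rw [B_some_none, hk k rfl, Nat.cast_zero, neg_zero]

variable {Lm L0 Lp : Type u} [AddCommGroup Lm] [Module K Lm] [AddCommGroup L0] [Module K L0]
  [AddCommGroup Lp] [Module K Lp] {Q : LocalAlgebra K Lm L0 Lp} {ζ : D.ContraZero →ₗ[K] L0}
  {π : D.ContraPos →ₗ[K] Lp} {ν : D.ContraNeg →ₗ[K] D.ContraZero →ₗ[K] Lm}

variable (Q ζ π ν) in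
/-- The elements of the cartanification that correspond to the generators of `W`. -/
noncomputable def cartGen : D.GenW → Q.Minimal
  | .e none => Q.pos (π D.e₀)
  | .e (some i) => Q.zero (ζ (D.eB i))
  | .f i => Q.zero (ζ (D.fB i))
  | .h i => Q.zero (ζ (D.h i))
  | .f0 i => Q.neg (ν D.f₀ (D.h i.1))

omit [CharZero K] in
theorem cartGen_mem (x : D.GenW) : cartGen Q ζ π ν x ∈
    Min.grade LocalAlgebra.Gen.deg LocalAlgebra.Gen.deg Q.relators (GenW.deg x) := by
  rcases x with (_ | i) | i | i | i
  exacts [Q.pos_mem _, Q.zero_mem _, Q.zero_mem _, Q.zero_mem _, Q.neg_mem _]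

variable {hΦ : D.IsInvariantForm Φ} (hM : (D.localPart Φ hΦ).IsModel Q ζ π ν)
  (hε : ∀ j, D.lam j ≠ 0 → D.ε j = 1)
  (T : D.chev.Grading) (hT : T.lam = D.lam) (hc : T.c = D.c)

include hM

theorem br_e_f₀z (i : Fin D.r) (z : D.ContraZero) :
    Min.bracket _ _ _ (Q.zero (ζ (D.eB i))) (Q.neg (ν D.f₀ z)) = Q.neg (ν D.f₀ ⁅D.eB i, z⁆) := by
  rw [Q.br_zero_neg, zm_e hM]

theorem br_f_f₀z {k : Fin D.r} (hk : D.lam k = 0) (z : D.ContraZero) :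
    Min.bracket _ _ _ (Q.zero (ζ (D.fB k))) (Q.neg (ν D.f₀ z)) = Q.neg (ν D.f₀ ⁅D.fB k, z⁆) := by
  rw [hM.br_zero_neg, f_lie_f₀ hk, map_zero, LinearMap.zero_apply, map_zero, zero_add]

include hε hT hc

/-- The relations of `W` hold in the cartanification. -/
theorem eval_cartGen {x : FreeNonUnitalNonAssocAlgebra K D.GenW} (hx : x ∈ D.relW) :
    eval (Min.bracket LocalAlgebra.Gen.deg LocalAlgebra.Gen.deg Q.relators)
      (cartGen Q ζ π ν) x = 0 := by
  rcases hx with i | ⟨i, j, hij⟩ | ⟨i, j⟩ | ⟨i, j⟩ | i | ⟨i, j⟩ | ⟨i, j, n, hn⟩ | ⟨i, j, n, hn⟩ |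
    ⟨k, hk, i⟩ | ⟨k, l, i, hk, hl, hkl⟩ | ⟨j, i, n, hj, hn⟩ | ⟨j, i, hj⟩ | ⟨k, i, hk⟩ |
    ⟨k, i, hk⟩ | ⟨j, k, i, hj, hk⟩ <;>
    simp only [we, wf, wh, wf0, map_sub, map_add, map_smul, eval_mul, eval_of, eval_ad_pow]
  · rw [cartGen, cartGen, cartGen, hM.br_zero_zero, show ⁅D.eB i, D.fB i⁆ = D.h (some i) from
      D.frameB.ef i, sub_self]
  · cases i with
    | none =>
      rw [cartGen, cartGen, hM.br_pos_zero, f_lie_e₀, map_zero, map_zero, neg_zero]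
    | some i =>
      rw [cartGen, cartGen, hM.br_zero_zero, show ⁅D.eB i, D.fB j⁆ = 0 from
        D.frameB.ef_ne i j fun h => hij (congrArg some h), map_zero, map_zero]
  · rw [cartGen, cartGen, hM.br_zero_zero, h_lie_f, map_neg, map_smul, map_neg, map_smul,
      neg_add_cancel]
  · cases j with
    | none => rw [cartGen, cartGen, hM.br_zero_pos, h_lie_e₀, map_smul, map_smul, sub_self]
    | some j => rw [cartGen, cartGen, hM.br_zero_zero, h_lie_e, map_smul, map_smul, sub_self]
  · rw [cartGen, cartGen, cartGen, hM.br_pos_neg, cornerBr_of_lie_e₀ hΦ, sub_self]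
    rw [h_lie_e₀, B_indexK_none, zero_smul]
  · rw [cartGen, cartGen, hM.br_zero_neg, h_lie_h, map_zero, map_zero, add_zero, h_lie_f₀',
      map_neg, map_smul, LinearMap.neg_apply, LinearMap.smul_apply, map_neg, map_smul,
      neg_add_cancel]
  · rcases i with _ | i <;> rcases j with _ | j
    · have h1 : n = 1 := by
        have : (n : K) = ((1 : ℕ) : K) := by
          rw [hn, show D.B none none = 0 from rfl, sub_zero, Nat.cast_one]
        exact_mod_cast this
      rw [h1, pow_one, cartGen, br_pos_e₀_pos_e₀ hM hε T hT hc]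
    · by_cases hj : D.lam j = 0
      · have h1 : n = 1 := by
          have : (n : K) = ((1 : ℕ) : K) := by
            rw [hn, B_none_some, hj, Nat.cast_zero, zero_div, neg_zero, sub_zero, Nat.cast_one]
          exact_mod_cast this
        rw [h1, pow_one, cartGen, cartGen, hM.br_pos_zero, e_lie_e₀ hj, map_zero, map_zero,
          neg_zero]
      · have hj1 : D.lam j = 1 := by
          have h1 := T.lam_le j
          rw [hT] at h1
          omega
        have h1 : n = 2 := by
          have : (n : K) = ((2 : ℕ) : K) := by
            rw [hn, B_none_some, hj1, hε j hj]; norm_num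
          exact_mod_cast this
        have h2 := Min.jacobi (Q.pos_mem (π D.e₀)) (Q.pos_mem (π D.e₀)) (Q.zero (ζ (D.eB j)))
        rw [br_pos_e₀_pos_e₀ hM hε T hT hc, map_zero, LinearMap.zero_apply, sub_zero,
          show sgn 1 1 = -1 by simp [sgn], neg_one_smul, sub_neg_eq_add, ← two_smul K,
          smul_eq_zero] at h2
        rw [h1, pow_succ, pow_one, Module.End.mul_apply]
        exact h2.resolve_left two_ne_zero
    · have h1 : n = D.lam i + 1 := by
        have : (n : K) = ((D.lam i + 1 : ℕ) : K) := by
          rw [hn, B_some_none]; push_cast; ring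
        exact_mod_cast this
      rw [cartGen, cartGen, hM.br_zero_pow_pos, h1,
        show (LieModule.toEnd K D.ContraZero D.ContraPos (D.eB i) ^ (D.lam i + 1)) D.e₀ = 0 from
        D.frameB.se₀ i, map_zero, map_zero]
    · obtain ⟨hij, rfl⟩ := eq_of_natCast_eq hn
      rw [cartGen, cartGen, hM.br_zero_pow_zero,
        show (LieAlgebra.ad K D.ContraZero (D.eB i) ^ _) (D.eB j) = 0 from D.frameB.se i j hij,
        map_zero, map_zero]
  · obtain ⟨hij, rfl⟩ := eq_of_natCast_eq hn
    rw [cartGen, cartGen, hM.br_zero_pow_zero,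
      show (LieAlgebra.ad K D.ContraZero (D.fB i) ^ _) (D.fB j) = 0 from D.frameB.sf i j hij,
      map_zero, map_zero]
  · rw [cartGen, cartGen, cartGen, cartGen, br_f_f₀z hM hk, f_lie_h, map_smul, map_smul, map_smul,
      br_e_f₀z hM, show ⁅D.eB k, D.fB k⁆ = D.h (some k) from D.frameB.ef k]
    exact sub_self _
  · rw [cartGen, cartGen, cartGen, br_f_f₀z hM hl, f_lie_h, map_smul, map_smul, map_smul,
      br_e_f₀z hM, show ⁅D.eB k, D.fB l⁆ = 0 from D.frameB.ef_ne k l hkl, map_zero, map_zero,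
      smul_zero]
  · have hj1 : D.lam j = 1 := by
      have h1 := T.lam_le j
      rw [hT] at h1
      omega
    have h1 : n = 2 := by
      have : (n : K) = ((2 : ℕ) : K) := by
        rw [hn, B_some_none, hj1]; norm_num
      exact_mod_cast this
    rw [h1, pow_succ, pow_one, Module.End.mul_apply, cartGen, cartGen, Q.br_zero_neg,
      Q.br_zero_neg, ν_serre hM hε T hT hc hj i.2, map_zero]
  · rw [cartGen, cartGen, br_e_f₀z hM, e_lie_h, map_neg, map_smul, ν_e hM hε T hT hc hj,
      smul_zero, neg_zero, map_zero]
  · rw [cartGen, cartGen, br_e_f₀z hM, br_e_f₀z hM, e_lie_h, lie_neg, lie_smul, lie_self,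
      smul_zero, neg_zero, map_zero, map_zero]
  · rw [cartGen, cartGen, br_f_f₀z hM hk, br_f_f₀z hM hk, f_lie_h, lie_smul, lie_self,
      smul_zero, map_zero, map_zero]
  · have h1 : ⁅D.c, ⁅D.chev.e j, D.chev.e k⁆⁆ = ⁅D.chev.e j, D.chev.e k⁆ := by
      have h2 := T.ce k
      have h3 := Chev.Grading.IsLowest.e_of_lam_ne_zero T (j := j) (by rwa [hT])
      rw [hT, hk, Nat.cast_zero, zero_smul] at h2
      rw [← hc, leibniz_lie, h2, lie_zero, add_zero, h3]
    have h2 := ν_eq_zero_of_pos hM hε T hT hc h1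
    rw [LieHom.map_lie, Frame.θ_e, Frame.θ_e] at h2
    rw [cartGen, cartGen, cartGen, br_e_f₀z hM, br_e_f₀z hM, e_lie_h, lie_neg, lie_smul, map_neg,
      map_smul, show ν D.f₀ ⁅D.eB j, D.eB k⁆ = 0 from h2, smul_zero, neg_zero, map_zero]

end Triple

/-! ### Generators of the cartanification -/

namespace Triple

variable {K : Type u} [Field K] [CharZero K] {D : Triple K}
  {Φ : D.ContraNeg →ₗ[K] D.ContraPos →ₗ[K] K}

variable {Lm L0 Lp : Type u} [AddCommGroup Lm] [Module K Lm] [AddCommGroup L0] [Module K L0]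
  [AddCommGroup Lp] [Module K Lp] {Q : LocalAlgebra K Lm L0 Lp} {ζ : D.ContraZero →ₗ[K] L0}
  {π : D.ContraPos →ₗ[K] Lp} {ν : D.ContraNeg →ₗ[K] D.ContraZero →ₗ[K] Lm}

/-- The coefficients of the grading element with respect to the elements `h_j` with `λ_j ≠ 0` are
not all zero. -/
theorem exists_inv_ne_zero : ∃ j, D.lam j ≠ 0 ∧ D.B⁻¹ none (some j) ≠ 0 := by
  by_contra! h
  have h1 : (D.B⁻¹ * D.B) none none = 1 := by
    rw [Matrix.nonsing_inv_mul _ (isUnit_iff_ne_zero.mpr D.B_det), Matrix.one_apply_eq]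
  rw [Matrix.mul_apply, Fintype.sum_option, show D.B none none = 0 from rfl, mul_zero, zero_add,
    Finset.sum_eq_zero fun j _ => ?_] at h1
  · exact zero_ne_one h1
  · by_cases hj : D.lam j = 0
    · rw [B_some_none, hj, Nat.cast_zero, neg_zero, mul_zero]
    · rw [h j hj, zero_mul]

variable {hΦ : D.IsInvariantForm Φ} (hM : (D.localPart Φ hΦ).IsModel Q ζ π ν)
  (hε : ∀ j, D.lam j ≠ 0 → D.ε j = 1)
  (T : D.chev.Grading) (hT : T.lam = D.lam) (hc : T.c = D.c)
  [LieAlgebra.IsSimple K D.LieAlg]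

include hM hε hT hc

/-- The elements of the cartanification that correspond to the generators of `W` generate it. -/
theorem eq_top_of_cartGen_mem {S : Submodule K Q.Minimal} (hS : ∀ x, cartGen Q ζ π ν x ∈ S)
    (hbr : ∀ x ∈ S, ∀ y ∈ S,
      Min.bracket LocalAlgebra.Gen.deg LocalAlgebra.Gen.deg Q.relators x y ∈ S) : S = ⊤ := by
  have hzero : ∀ a, Q.zero (ζ a) ∈ S := by
    let X : LieSubalgebra K D.ContraZero :=
      { S.comap (Q.zero ∘ₗ ζ) with
        lie_mem' := fun {a b} ha hb => by
          have h1 := hbr _ ha _ hb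
          rw [LinearMap.comp_apply, LinearMap.comp_apply, hM.br_zero_zero] at h1
          exact h1 }
    have hX : X = ⊤ := D.zero_gen hε X (hS (.h none)) (fun i => hS (.e (some i)))
      fun i => hS (.f i)
    exact fun a => (hX ▸ LieSubalgebra.mem_top a : a ∈ X)
  have hpos : ∀ x, Q.pos (π x) ∈ S := by
    have hX : S.comap (Q.pos ∘ₗ π) = ⊤ := D.pos_gen hε _ (hS (.e none)) fun i x hx => by
      have h1 := hbr _ (hzero (D.eB i)) _ hx
      rw [LinearMap.comp_apply, hM.br_zero_pos] at h1
      exact h1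
    exact fun x => (hX ▸ Submodule.mem_top : x ∈ S.comap (Q.pos ∘ₗ π))
  -- The products with `f_0` that belong to `S`.
  let Y : Submodule K D.ContraZero := S.comap (Q.neg ∘ₗ ν D.f₀)
  have hYlie : ∀ z b : D.ContraZero, ∀ a : K, ⁅z, D.f₀⁆ = a • D.f₀ → b ∈ Y → ⁅z, b⁆ ∈ Y := by
    intro z b a hz hb
    have h1 := hbr _ (hzero z) _ hb
    rw [LinearMap.comp_apply, hM.br_zero_neg, hz, map_smul, LinearMap.smul_apply, map_smul] at h1
    exact (add_mem_cancel_left (S.smul_mem a hb)).mp h1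
  have hY0 : ∀ i : D.IndexK, D.h i.1 ∈ Y := fun i => hS (.f0 i)
  have hYn : D.h none ∈ Y := hY0 ⟨none, fun _ h => by cases h⟩
  -- As `f_0 (h_0 + L) = 0`, the product `f_0 L` belongs to `S`. Since `L` involves the element `h_i`
  -- with `λ_i ≠ 0`, this yields `f_0 h_i ∈ S`.
  have hYL : D.gradingElement ∈ Y := by
    have h1 : D.h none + D.gradingElement ∈ Y := by
      change Q.neg (ν D.f₀ _) ∈ S
      rw [ν_h₀_add hM hε T hT hc, map_zero]; exact S.zero_mem
    exact (add_mem_cancel_left hYn).mp h1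
  have hYh : ∀ i, D.h (some i) ∈ Y := by
    intro i
    by_cases hi : D.lam i = 0
    · exact hY0 (D.toK i hi)
    obtain ⟨j, hj, hjB⟩ := exists_inv_ne_zero (D := D)
    have hone : ∀ l, D.lam l ≠ 0 → l = i := fun l hl => T.eq_of_lam_ne_zero D.A_det D.A_diag
      D.chev_e_ne_zero (by rwa [hT]) (by rwa [hT])
    obtain rfl := hone j hj
    rw [gradingElement, Fintype.sum_option] at hYL
    have h1 := (add_mem_cancel_left (Y.smul_mem _ hYn)).mp hYL
    rw [← Finset.add_sum_erase _ _ (Finset.mem_univ j)] at h1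
    have h2 : ∑ l ∈ Finset.univ.erase j, D.B⁻¹ none (some l) • D.h (some l) ∈ Y :=
      sum_mem fun l hl => Y.smul_mem _ (hY0 (D.toK l (by
        by_contra hl'
        exact (Finset.mem_erase.mp hl).1 (hone l hl'))))
    exact (Y.smul_mem_iff hjB).mp ((add_mem_cancel_right h2).mp h1)
  have hYe : ∀ i, D.eB i ∈ Y := by
    intro i
    have h1 := hYlie (D.eB i) (D.h (some i)) 0 (by rw [zero_smul, e_lie_f₀]) (hYh i)
    rw [e_lie_h, B_some_self, ← neg_smul] at h1
    exact (Y.smul_mem_iff (neg_ne_zero.mpr two_ne_zero)).mp h1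
  have hYf : ∀ i, D.fB i ∈ Y := by
    intro i
    by_cases hi : D.lam i = 0
    · have h1 := hYlie (D.fB i) (D.h (some i)) 0 (by rw [zero_smul, f_lie_f₀ hi]) (hYh i)
      rw [f_lie_h, B_some_self] at h1
      exact (Y.smul_mem_iff two_ne_zero).mp h1
    -- Two applications of `f_i` to `f_0 e_i = 0` express `(f_i f_0) h_i` by `f_0 f_i`.
    have hi1 : D.lam i = 1 := by
      have h1 := T.lam_le i
      rw [hT] at h1
      omega
    have hfe : ⁅D.fB i, D.eB i⁆ = -D.h (some i) := by
      rw [← lie_skew, show ⁅D.eB i, D.fB i⁆ = D.h (some i) from D.frameB.ef i]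
    have h1 := hM.zm (D.fB i) D.f₀ (D.eB i)
    rw [ν_e hM hε T hT hc hi, map_zero, hfe, map_neg] at h1
    have h2 := hM.zm (D.fB i) ⁅D.fB i, D.f₀⁆ (D.eB i)
    rw [f_lie_f_lie_f₀ hi1, map_zero, LinearMap.zero_apply, zero_add, hfe, map_neg,
      eq_neg_of_add_eq_zero_left h1.symm, neg_neg, hM.zm, f_lie_h, B_some_self, map_smul] at h2
    have h3 := hbr _ (hzero (D.fB i)) _ (hYh i)
    rw [LinearMap.comp_apply, hM.br_zero_neg, f_lie_h, B_some_self, map_smul, ← map_add] at h3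
    have h4 : ν ⁅D.fB i, D.f₀⁆ (D.h (some i)) + (2 : K) • ν D.f₀ (D.fB i) = ν D.f₀ (D.fB i) := by
      have h5 : (2 : K) • ν ⁅D.fB i, D.f₀⁆ (D.h (some i)) + (2 : K) • ν D.f₀ (D.fB i) = 0 := by
        rw [two_smul, add_assoc, h2, add_neg_cancel]
      rw [← smul_add, smul_eq_zero] at h5
      have h6 := h5.resolve_left two_ne_zero
      rw [two_smul, ← add_assoc, h6, zero_add]
    rw [h4] at h3
    exact h3
  have hYθ : ∀ x : D.LieAlg, D.frameB.θ x ∈ Y := by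
    let N : Submodule K D.LieAlg := Y.comap D.frameB.θ.toLinearMap
    have hNe : ∀ i, D.chev.e i ∈ N := fun i => by
      change D.frameB.θ (D.chev.e i) ∈ Y
      rw [Frame.θ_e]; exact hYe i
    have hNf : ∀ i, D.chev.f i ∈ N := fun i => by
      change D.frameB.θ (D.chev.f i) ∈ Y
      rw [Frame.θ_f]; exact hYf i
    have hstab : ∀ x y : D.LieAlg, (⁅D.c, x⁆ = x ∨ ⁅D.c, x⁆ = 0) → y ∈ N → ⁅x, y⁆ ∈ N := by
      intro x y hx hy
      change D.frameB.θ ⁅x, y⁆ ∈ Y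
      rw [LieHom.map_lie]
      rcases hx with hx | hx
      · exact hYlie _ _ 0 (by rw [D.lie_f₀_of_pos T hT hc hε hx, zero_smul]) hy
      · obtain ⟨a, ha⟩ := D.exists_lie_f₀ T hT hc hε hx
        exact hYlie _ _ a ha hy
    have hNlie : ∀ i, ∀ x ∈ N, ⁅D.chev.f i, x⁆ ∈ N := by
      intro i x hx
      by_cases hi : T.lam i = 0
      · refine hstab _ _ (Or.inr ?_) hx
        have h1 := T.cf i
        rwa [hi, Nat.cast_zero, zero_smul, neg_zero, hc] at h1
      -- The degree of `f_i` is `-1`, so only the components of `x` of nonnegative degree matter.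
      obtain ⟨x₁, x₀, x₂, rfl, h1, h0, h2⟩ := T.exists_add x
      have h3 : ⁅D.chev.f i, x₂⁆ = 0 := T.swap.lie_eq_zero (x := D.chev.f i) (y := x₂)
        (Chev.Grading.IsLowest.e_of_lam_ne_zero T.swap (j := i) hi)
        (by change ⁅-T.c, x₂⁆ = x₂; rw [neg_lie, h2, neg_neg])
      rw [lie_add, lie_add, h3, add_zero, ← lie_skew (D.chev.f i) x₁, ← lie_skew (D.chev.f i) x₀]
      rw [hc] at h1 h0
      exact add_mem (neg_mem (hstab _ _ (Or.inl h1) (hNf i)))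
        (neg_mem (hstab _ _ (Or.inr h0) (hNf i)))
    have hNlie' : ∀ i, ∀ x ∈ N, ⁅D.chev.e i, x⁆ ∈ N := by
      intro i x hx
      refine hstab _ _ ?_ hx
      by_cases hi : T.lam i = 0
      · have h1 := T.ce i
        rw [hi, Nat.cast_zero, zero_smul, hc] at h1
        exact Or.inr h1
      · have h1 := Chev.Grading.IsLowest.e_of_lam_ne_zero T hi
        rw [hc] at h1
        exact Or.inl h1
    let I : LieIdeal K D.LieAlg :=
      { N with lie_mem := fun {g x} hx => D.chev.lie_mem hNlie' hNlie g x hx }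
    have hI : I = ⊤ := (LieAlgebra.IsSimple.eq_bot_or_eq_top (R := K) I).resolve_left fun h => by
      obtain ⟨j, -⟩ := D.exists_lam_ne_zero
      have h1 : D.chev.e j ∈ I := hNe j
      rw [h] at h1
      exact D.chev_e_ne_zero j h1
    exact fun x => (hI ▸ LieSubmodule.mem_top x : x ∈ I)
  have hYtop : ∀ z, z ∈ Y := fun z => by
    obtain ⟨x, a, rfl⟩ := D.exists_zero_eq hε z
    exact add_mem (hYθ x) (Y.smul_mem a hYn)
  have hneg : ∀ y z, Q.neg (ν y z) ∈ S := by
    let X : Submodule K D.ContraNeg := ⨅ z, S.comap (Q.neg ∘ₗ ν.flip z)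
    have hX : X = ⊤ := by
      refine D.neg_gen hε X ((Submodule.mem_iInf _).mpr hYtop) fun i y hy => ?_
      rw [Submodule.mem_iInf] at hy ⊢
      intro z
      have h1 := hbr _ (hzero (D.fB i)) _ (hy z)
      rw [LinearMap.comp_apply, LinearMap.flip_apply, hM.br_zero_neg] at h1
      have h2 : Q.neg (ν y ⁅D.fB i, z⁆) ∈ S := hy _
      exact (add_mem_cancel_right h2).mp h1
    exact fun y => (Submodule.mem_iInf _).mp (hX ▸ Submodule.mem_top : y ∈ X)
  have hgen : ∀ x : LocalAlgebra.Gen Lm L0 Lp,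
      Min.gen LocalAlgebra.Gen.deg LocalAlgebra.Gen.deg Q.relators x ∈ S := by
    rintro (w | a | x)
    · change Q.neg w ∈ S
      induction w using hM.neg_induction with
      | h y z => exact hneg y z
      | h0 => rw [map_zero]; exact S.zero_mem
      | hadd v w hv hw => rw [map_add]; exact add_mem hv hw
      | hsmul c w hw => rw [map_smul]; exact S.smul_mem c hw
    · obtain ⟨a, rfl⟩ := hM.zero_surj a; exact hzero a
    · obtain ⟨x, rfl⟩ := hM.pos_surj x; exact hpos x
  exact (Min.isLieQuot _ _ _).eq_top_of_gen hgen fun x y hy => hbr _ (hgen x) y hy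

end Triple

namespace Triple

variable {K : Type u} [Field K] (D : Triple K)

/-! ### The tensor hierarchy algebra -/

section Relations

variable {D} {E : Type*} [AddCommGroup E] [Module K E] {br : E →ₗ[K] E →ₗ[K] E}
  {π : FreeNonUnitalNonAssocAlgebra K D.GenW →ₗ[K] E} (h : IsLieQuot GenW.deg br π)
  (hR : ∀ x ∈ D.relW, π x = 0)

include h hR

theorem relW_mul {x y z : FreeNonUnitalNonAssocAlgebra K D.GenW} (hz : D.RelW (x * y - z)) :
    br (π x) (π y) = π z := by
  have h1 := hR _ hz
  rwa [map_sub, h.map_mul, sub_eq_zero] at h1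

theorem relW_h_h (i j : Option (Fin D.r)) : br (π (D.wh i)) (π (D.wh j)) = 0 := by
  have hmem := of_mem_wordSpan π (GenW.deg (D := D))
  have key : ∀ {n : ℤ} {x y : E} {a : K}, x ∈ wordSpan π GenW.deg n →
      br (π (D.wh i)) x = a • x → br (π (D.wh i)) y = -(a • y) →
      br (π (D.wh i)) (br x y) = 0 := fun hx h1 h2 => by
    have h0 : π (D.wh i) ∈ wordSpan π GenW.deg 0 := hmem (.h i)
    rw [h.jacobi h0 hx, h1, h2, Min.sgn_zero_left, one_smul, map_neg, map_smul, map_smul,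
      LinearMap.smul_apply, add_neg_cancel]
  have he : ∀ j, br (π (D.wh i)) (π (D.we j)) = D.B i j • π (D.we j) := fun j => by
    rw [relW_mul h hR (RelW.he i j), map_smul]
  cases j with
  | none =>
    have h1 := RelW.hf0 (D := D) i ⟨none, by simp⟩
    rw [← sub_neg_eq_add] at h1
    have h2 := relW_mul h hR h1
    rw [map_neg, map_smul] at h2
    exact (congrArg _ (relW_mul h hR (RelW.ef0 (D := D) ⟨none, by simp⟩)).symm).trans
      (key (hmem (.e none)) (he none) h2)
  | some j =>
    have h1 := RelW.hf (D := D) i j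
    rw [← sub_neg_eq_add] at h1
    have h2 := relW_mul h hR h1
    rw [map_neg, map_smul] at h2
    exact (congrArg _ (relW_mul h hR (RelW.ef (D := D) j)).symm).trans
      (key (hmem (.e (some j))) (he _) h2)

theorem exists_isGradingElementW_of_isLieQuot :
    ∃ ℓ, IsGradingElement GenW.deg GenW.deg br π ℓ := by
  have hr : ∀ j, ∑ i, D.B⁻¹ none i * D.B i j = (1 : Matrix _ _ K) none j := fun j => by
    rw [← Matrix.nonsing_inv_mul _ (isUnit_iff_ne_zero.mpr D.B_det), Matrix.mul_apply]
  refine ⟨∑ i, D.B⁻¹ none i • π (D.wh i), sum_mem fun i _ => Submodule.smul_mem _ _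
    (of_mem_wordSpan π (GenW.deg (D := D)) (.h i)), fun x => ?_⟩
  rw [map_sum, LinearMap.sum_apply]
  simp only [map_smul, LinearMap.smul_apply]
  rcases x with j | j | j | j
  · have h1 : ∀ i, D.B⁻¹ none i • br (π (D.wh i)) (π (D.we j)) =
        (D.B⁻¹ none i * D.B i j) • π (D.we j) := fun i => by
      rw [relW_mul h hR (RelW.he i j), map_smul, smul_smul]
    refine (Finset.sum_congr rfl fun i _ => h1 i).trans ?_
    rw [← Finset.sum_smul, hr]
    cases j <;> simp [GenW.deg, we]
  · have h1 : ∀ i, D.B⁻¹ none i • br (π (D.wh i)) (π (D.wf j)) =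
        -((D.B⁻¹ none i * D.B i (some j)) • π (D.wf j)) := fun i => by
      have h1 := RelW.hf (D := D) i j
      rw [← sub_neg_eq_add] at h1
      rw [relW_mul h hR h1, map_neg, map_smul, smul_neg, smul_smul]
    refine (Finset.sum_congr rfl fun i _ => h1 i).trans ?_
    rw [Finset.sum_neg_distrib, ← Finset.sum_smul, hr]
    simp [GenW.deg]
  · refine (Finset.sum_eq_zero fun i _ => ?_).trans (by simp [GenW.deg])
    exact (congrArg _ (relW_h_h h hR i j)).trans (smul_zero _)
  · have h1 : ∀ i, D.B⁻¹ none i • br (π (D.wh i)) (π (D.wf0 j)) =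
        -((D.B⁻¹ none i * D.B i none) • π (D.wf0 j)) := fun i => by
      have h1 := RelW.hf0 (D := D) i j
      rw [← sub_neg_eq_add] at h1
      rw [relW_mul h hR h1, map_neg, map_smul, smul_neg, smul_smul]
    refine (Finset.sum_congr rfl fun i _ => h1 i).trans ?_
    rw [Finset.sum_neg_distrib, ← Finset.sum_smul, hr]
    simp [GenW.deg, wf0]

end Relations

theorem exists_isGradingElementW : ∃ ℓ, IsGradingElement GenW.deg GenW.deg
    (presBracket GenW.deg D.relW) (relIdeal GenW.deg D.relW).mkQ ℓ :=
  exists_isGradingElementW_of_isLieQuot (presBracket_isLieQuot GenW.deg D.relW)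
    fun _ hx => (Submodule.Quotient.mk_eq_zero _).mpr (subset_idealGen _ _ (Or.inr hx))

/-- The bracket of `W`. -/
noncomputable def brW : D.W →ₗ[K] D.W →ₗ[K] D.W := Min.bracket GenW.deg GenW.deg D.relW

/-- The generators of `W`. -/
noncomputable def genW (x : D.GenW) : D.W := Min.gen _ _ _ x

theorem isLieQuotW : IsLieQuot GenW.deg D.brW (Min.proj GenW.deg GenW.deg D.relW) :=
  Min.isLieQuot _ _ _

variable {D} in
theorem proj_relW {x : FreeNonUnitalNonAssocAlgebra K D.GenW} (hx : x ∈ D.relW) :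
    Min.proj GenW.deg GenW.deg D.relW x = 0 := Min.proj_rel (Or.inr hx)

variable {D} in
theorem brW_proj {x y z : FreeNonUnitalNonAssocAlgebra K D.GenW} (hz : D.RelW (x * y - z)) :
    D.brW (Min.proj _ _ _ x) (Min.proj _ _ _ y) = Min.proj _ _ _ z :=
  relW_mul D.isLieQuotW (fun _ => proj_relW) hz

theorem brW_h_e (i j) : D.brW (D.genW (.h i)) (D.genW (.e j)) = D.B i j • D.genW (.e j) :=
  (brW_proj (RelW.he i j)).trans (map_smul _ _ _)

theorem brW_h_f (i j) : D.brW (D.genW (.h i)) (D.genW (.f j)) =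
    -(D.B i (some j) • D.genW (.f j)) := by
  have h1 := RelW.hf (D := D) i j
  rw [← sub_neg_eq_add] at h1
  refine (brW_proj h1).trans ?_
  rw [map_neg, map_smul]; rfl

theorem brW_h_f0 (i j) : D.brW (D.genW (.h i)) (D.genW (.f0 j)) =
    -(D.B i none • D.genW (.f0 j)) := by
  have h1 := RelW.hf0 (D := D) i j
  rw [← sub_neg_eq_add] at h1
  refine (brW_proj h1).trans ?_
  rw [map_neg, map_smul]; rfl

theorem brW_h_h (i j) : D.brW (D.genW (.h i)) (D.genW (.h j)) = 0 :=
  relW_h_h D.isLieQuotW (fun _ => proj_relW) i j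

theorem brW_e_f (i) : D.brW (D.genW (.e (some i))) (D.genW (.f i)) = D.genW (.h (some i)) :=
  brW_proj (RelW.ef i)

theorem brW_e_f_ne {i : Option (Fin D.r)} {j} (hij : i ≠ some j) :
    D.brW (D.genW (.e i)) (D.genW (.f j)) = 0 := proj_relW (RelW.ef_ne i j hij)

theorem genW_mem (x : D.GenW) : D.genW x ∈ Min.grade GenW.deg GenW.deg D.relW (GenW.deg x) :=
  Min.gen_mem x

variable {D} in
theorem brW_pow (x y : FreeNonUnitalNonAssocAlgebra K D.GenW) (n : ℕ) :
    (D.brW (Min.proj _ _ _ x) ^ n) (Min.proj _ _ _ y) = Min.proj _ _ _ ((ad x ^ n) y) := by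
  induction n with
  | zero => rfl
  | succ n ih =>
    rw [pow_succ', Module.End.mul_apply, ih, pow_succ', Module.End.mul_apply]
    rfl

/-- The elements `e_i` of `W`. -/
noncomputable def eW (i : Fin D.r) : Min.Zero GenW.deg GenW.deg D.relW :=
  ⟨D.genW (.e (some i)), D.genW_mem (.e (some i))⟩

/-- The elements `f_i` of `W`. -/
noncomputable def fW (i : Fin D.r) : Min.Zero GenW.deg GenW.deg D.relW :=
  ⟨D.genW (.f i), D.genW_mem (.f i)⟩

/-- The elements `h_i` of `W`. -/
noncomputable def hW (i : Option (Fin D.r)) : Min.Zero GenW.deg GenW.deg D.relW :=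
  ⟨D.genW (.h i), D.genW_mem (.h i)⟩

/-- The element `e_0` of `W`. -/
noncomputable def e₀W : Min.Pos GenW.deg GenW.deg D.relW :=
  ⟨D.genW (.e none), D.genW_mem (.e none)⟩

variable [CharZero K]

/-- The generators of `W` of degrees `0` and `1`. -/
noncomputable def frameW : D.Frame GenW.deg GenW.deg D.relW where
  e := D.eW
  f := D.fW
  h i := D.hW (some i)
  h₀ := D.hW none
  e₀ := D.e₀W
  hh i j := Min.zero_ext (D.brW_h_h _ _)
  ef i := Min.zero_ext (D.brW_e_f _)
  ef_ne i j hij := Min.zero_ext (D.brW_e_f_ne fun h => hij (Option.some.inj h))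
  he i j := Min.zero_ext (D.brW_h_e _ _)
  hf i j := Min.zero_ext (D.brW_h_f _ _)
  se i j hij := Min.zero_ext (by
    refine (Min.zeroIncl_ad_pow (D.eW i) (D.eW j) _).trans ?_
    rw [map_zero]
    exact (brW_pow _ _ _).trans (proj_relW (RelW.serre_e _ _ _ (D.natCast_eq hij))))
  sf i j hij := Min.zero_ext (by
    refine (Min.zeroIncl_ad_pow (D.fW i) (D.fW j) _).trans ?_
    rw [map_zero]
    exact (brW_pow _ _ _).trans (proj_relW (RelW.serre_f _ _ _ (D.natCast_eq hij))))
  h₀e j := Min.zero_ext (by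
    refine (D.brW_h_e none (some j)).trans ?_
    rw [B_none_some, neg_smul]; rfl)
  h₀f j := Min.zero_ext (by
    refine (D.brW_h_f none j).trans ?_
    rw [B_none_some, neg_smul, neg_neg]; rfl)
  he₀ i := Min.pos_ext (by
    refine (D.brW_h_e (some i) none).trans ?_
    rw [B_some_none, neg_smul]; rfl)
  h₀e₀ := Min.pos_ext (by
    refine (D.brW_h_e none none).trans ?_
    change (0 : K) • _ = _
    rw [zero_smul, map_zero])
  fe₀ i := Min.pos_ext (by
    refine (D.isLieQuotW.skew (D.genW_mem (.f i)) (D.genW_mem (.e none))).trans ?_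
    rw [D.brW_e_f_ne (by simp), smul_zero, neg_zero, map_zero])
  se₀ i := Min.pos_ext (by
    refine (Min.posIncl_toEnd_pow (D.eW i) D.e₀W _).trans ?_
    rw [map_zero]
    refine (brW_pow _ _ _).trans (proj_relW (RelW.serre_e _ _ _ ?_))
    rw [B_some_none]
    push_cast; ring)

/-- The elements `f_{0i}` of `W`. -/
noncomputable def f0W (i : D.IndexK) : D.frameW.NegMod :=
  ⟨D.genW (.f0 i), D.genW_mem (.f0 i)⟩

/-- The span of the elements `f_{0i}`. -/
noncomputable def f0Span : Submodule K D.frameW.NegMod := Submodule.span K (Set.range D.f0W)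

variable {D}

theorem negIncl_e_lie (i : Fin D.r) (v : D.frameW.NegMod) :
    D.frameW.negIncl ⁅D.chev.e i, v⁆ = D.brW (D.genW (.e (some i))) (D.frameW.negIncl v) := by
  rw [Frame.neg_lie_def, Frame.θ_e]; rfl

theorem negIncl_f_lie (i : Fin D.r) (v : D.frameW.NegMod) :
    D.frameW.negIncl ⁅D.chev.f i, v⁆ = D.brW (D.genW (.f i)) (D.frameW.negIncl v) := by
  rw [Frame.neg_lie_def, Frame.θ_f]; rfl

theorem neg_ext {v w : D.frameW.NegMod} (h : D.frameW.negIncl v = D.frameW.negIncl w) : v = w :=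
  Min.neg_ext h

theorem h_lie_f0W (i : Fin D.r) (j : D.IndexK) :
    ⁅D.chev.h i, D.f0W j⁆ = (D.lam i : K) • D.f0W j := by
  rw [Frame.neg_lie_def, Frame.θ_h]
  refine Min.neg_ext ((D.brW_h_f0 (some i) j).trans ?_)
  rw [B_some_none, neg_smul, neg_neg]; rfl

theorem h₀_lie_f0W (j : D.IndexK) : ⁅D.frameW.h₀, D.f0W j⁆ = 0 := by
  refine Min.neg_ext ((D.brW_h_f0 none j).trans ?_)
  change -((0 : K) • _) = _
  rw [zero_smul, neg_zero]
  exact (map_zero D.frameW.negIncl).symm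

theorem pairing_f0W (j : D.IndexK) : D.frameW.pairing D.frameW.ePos (D.f0W j) = D.hW j.1 :=
  Min.zero_ext (brW_proj (RelW.ef0 j))

theorem e_f_lie_f0W {k l : Fin D.r} (hk : D.lam k = 0) (hl : D.lam l = 0) (i : D.IndexK) :
    ⁅D.chev.e k, ⁅D.chev.f l, D.f0W i⁆⁆ =
      if k = l then D.B i.1 (some k) • D.f0W (D.toK k hk) else 0 := by
  apply neg_ext
  rw [negIncl_e_lie, negIncl_f_lie]
  split_ifs with h
  · subst h
    refine (brW_proj (RelW.eff0 k hk i)).trans ?_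
    rw [map_smul, map_smul]; rfl
  · rw [map_zero]
    exact proj_relW (RelW.eff0_ne k l i hk hl h)

theorem e_lie_f0W {j : Fin D.r} (hj : D.lam j ≠ 0) (i : D.IndexK) :
    ⁅D.chev.e j, D.f0W i⁆ = 0 := by
  apply neg_ext
  rw [negIncl_e_lie, map_zero]
  exact proj_relW (RelW.ef0_J j i hj)

theorem e_e_lie_f0W {k : Fin D.r} (hk : D.lam k = 0) (i : D.IndexK) :
    ⁅D.chev.e k, ⁅D.chev.e k, D.f0W i⁆⁆ = 0 := by
  apply neg_ext
  rw [negIncl_e_lie, negIncl_e_lie, map_zero]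
  exact proj_relW (RelW.eef0 k i hk)

theorem f_f_lie_f0W {k : Fin D.r} (hk : D.lam k = 0) (i : D.IndexK) :
    ⁅D.chev.f k, ⁅D.chev.f k, D.f0W i⁆⁆ = 0 := by
  apply neg_ext
  rw [negIncl_f_lie, negIncl_f_lie, map_zero]
  exact proj_relW (RelW.fff0 k i hk)

theorem pow_f_lie_f0W {j : Fin D.r} (hj : D.lam j ≠ 0) (i : D.IndexK) :
    (LieModule.toEnd K D.LieAlg D.frameW.NegMod (D.chev.f j) ^ (D.lam j + 1)) (D.f0W i) = 0 := by
  have h1 : ∀ n, D.frameW.negIncl ((LieModule.toEnd K D.LieAlg D.frameW.NegMod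
      (D.chev.f j) ^ n) (D.f0W i)) = (D.brW (D.genW (.f j)) ^ n) (D.genW (.f0 i)) := by
    intro n
    induction n with
    | zero => rfl
    | succ n ih =>
      rw [pow_succ', Module.End.mul_apply, LieModule.toEnd_apply_apply, pow_succ',
        Module.End.mul_apply, ← ih, negIncl_f_lie]
  apply neg_ext
  rw [h1, map_zero]
  refine (brW_pow _ _ _).trans (proj_relW (RelW.serre_f0 j i _ hj ?_))
  rw [B_some_none]
  push_cast; ring

theorem e_e_lie_f0W' {j k : Fin D.r} (hj : D.lam j ≠ 0) (hk : D.lam k = 0) (i : D.IndexK) :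
    ⁅D.chev.e j, ⁅D.chev.e k, D.f0W i⁆⁆ = 0 := by
  apply neg_ext
  rw [negIncl_e_lie, negIncl_e_lie, map_zero]
  exact proj_relW (RelW.eef0_J j k i hj hk)

end Triple

/-! ### The homomorphism in degree `-1` -/

namespace Triple

variable {K : Type u} [Field K] [CharZero K] {D : Triple K}

/-- The elements of degree `-1` of `W` generated by the elements `f_{0i}` under the generators of
degree zero with respect to the grading of `𝔤`. -/
noncomputable def negBase (T : D.chev.Grading) : Submodule K D.frameW.NegMod :=
  opClosure {t | ∃ k, T.lam k = 0 ∧ (t = LieModule.toEnd K D.LieAlg D.frameW.NegMod (D.chev.e k) ∨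
      t = LieModule.toEnd K D.LieAlg D.frameW.NegMod (D.chev.f k))} D.f0Span

variable {Φ : D.ContraNeg →ₗ[K] D.ContraPos →ₗ[K] K}

variable {Lm L0 Lp : Type u} [AddCommGroup Lm] [Module K Lm] [AddCommGroup L0] [Module K L0]
  [AddCommGroup Lp] [Module K Lp] {Q : LocalAlgebra K Lm L0 Lp} {ζ : D.ContraZero →ₗ[K] L0}
  {π : D.ContraPos →ₗ[K] Lp} {ν : D.ContraNeg →ₗ[K] D.ContraZero →ₗ[K] Lm}

theorem f0Span_le {X : Submodule K D.frameW.NegMod} (h : ∀ i, D.f0W i ∈ X) : D.f0Span ≤ X :=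
  Submodule.span_le.mpr (by rintro _ ⟨i, rfl⟩; exact h i)

section Core

variable (T : D.chev.Grading) (hT : T.lam = D.lam)

theorem h_lie_f0Span (i : Fin D.r) {v : D.frameW.NegMod} (hv : v ∈ D.f0Span) :
    ⁅D.chev.h i, v⁆ = (D.lam i : K) • v := by
  exact Module.End.mem_eigenspace_iff.mp (f0Span_le (X := (LieModule.toEnd K D.LieAlg
    D.frameW.NegMod (D.chev.h i)).eigenspace (D.lam i : K)) (fun j =>
    Module.End.mem_eigenspace_iff.mpr (h_lie_f0W i j)) hv)

include hT

/-- All elements `f_{0i}` have weight `λ`, and products of two generators `e_k`, `f_l` of degree zero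
map their span to itself. -/
theorem isCore_f0Span : T.IsCore D.f0Span (fun i => (D.lam i : K)) := by
  have hef : ∀ k l, T.lam k = 0 → T.lam l = 0 → ∀ v ∈ D.f0Span,
      ⁅D.chev.e k, ⁅D.chev.f l, v⁆⁆ ∈ D.f0Span := by
    intro k l hk hl v hv
    rw [hT] at hk hl
    refine f0Span_le (X := D.f0Span.comap (LieModule.toEnd K D.LieAlg D.frameW.NegMod
      (D.chev.e k) ∘ₗ LieModule.toEnd K D.LieAlg D.frameW.NegMod (D.chev.f l))) (fun i => ?_) hv
    change ⁅D.chev.e k, ⁅D.chev.f l, D.f0W i⁆⁆ ∈ D.f0Span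
    rw [e_f_lie_f0W hk hl]
    split_ifs
    · exact Submodule.smul_mem _ _ (Submodule.subset_span ⟨_, rfl⟩)
    · exact zero_mem _
  refine ⟨fun i v hv => h_lie_f0Span i hv, fun k hk => by rw [← hT, hk, Nat.cast_zero], hef,
    fun k l hk hl v hv => ?_⟩
  rw [leibniz_lie]
  refine add_mem ?_ (hef l k hl hk v hv)
  by_cases hkl : k = l
  · subst hkl
    rw [← lie_skew, D.chev.ef, neg_lie, h_lie_f0Span k hv]
    exact neg_mem (Submodule.smul_mem _ _ hv)
  · rw [D.chev.fe_ne k l hkl, zero_lie]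
    exact zero_mem _

theorem f0Span_le_maxGenEigenspace_e {k : Fin D.r} (hk : T.lam k = 0) : D.f0Span ≤
    (LieModule.toEnd K D.LieAlg D.frameW.NegMod (D.chev.e k)).maxGenEigenspace 0 := by
  refine f0Span_le fun i => ?_
  rw [Module.End.mem_maxGenEigenspace]
  refine ⟨2, ?_⟩
  rw [zero_smul, sub_zero, pow_two]
  exact e_e_lie_f0W (by rwa [hT] at hk) i

omit hT in
theorem f0Span_le_maxGenEigenspace_f (k : Fin D.r) : D.f0Span ≤
    (LieModule.toEnd K D.LieAlg D.frameW.NegMod (D.chev.f k)).maxGenEigenspace 0 := by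
  refine f0Span_le fun i => ?_
  rw [Module.End.mem_maxGenEigenspace]
  by_cases hk : D.lam k = 0
  · refine ⟨2, ?_⟩
    rw [zero_smul, sub_zero, pow_two]
    exact f_f_lie_f0W hk i
  · refine ⟨D.lam k + 1, ?_⟩
    rw [zero_smul, sub_zero]
    exact pow_f_lie_f0W hk i

end Core

/-- The restriction of a homomorphism from `W` to the component of degree `-1`. -/
noncomputable def negHom (φ : D.W →ₗ[K] Q.Minimal) : D.frameW.NegMod →ₗ[K] Q.Minimal :=
  φ ∘ₗ D.frameW.negIncl

variable {hΦ : D.IsInvariantForm Φ} (hM : (D.localPart Φ hΦ).IsModel Q ζ π ν)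
  {φ : D.W →ₗ[K] Q.Minimal} (hφ : ∀ x, φ (D.genW x) = cartGen Q ζ π ν x)
  (hbr : ∀ x y, φ (D.brW x y) = Min.bracket LocalAlgebra.Gen.deg LocalAlgebra.Gen.deg Q.relators
    (φ x) (φ y))

omit [CharZero K] in
include hφ in
theorem map_hW (i : Option (Fin D.r)) :
    φ (Min.zeroIncl GenW.deg GenW.deg D.relW (D.hW i)) = Q.zero (ζ (D.h i)) := hφ (.h i)

include hφ in
theorem negHom_f0W (i : D.IndexK) : negHom φ (D.f0W i) = Q.neg (ν D.f₀ (D.h i.1)) := hφ (.f0 i)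

section

include hM hφ hbr

theorem map_θ (x : D.LieAlg) : φ (Min.zeroIncl GenW.deg GenW.deg D.relW (D.frameW.θ x)) =
    Q.zero (ζ (D.frameB.θ x)) := by
  let Y : LieSubalgebra K D.LieAlg :=
    { LinearMap.eqLocus (φ ∘ₗ Min.zeroIncl GenW.deg GenW.deg D.relW ∘ₗ D.frameW.θ.toLinearMap)
        (Q.zero ∘ₗ ζ ∘ₗ D.frameB.θ.toLinearMap) with
      lie_mem' := fun {a b} ha hb => by
        have ha' : φ (Min.zeroIncl GenW.deg GenW.deg D.relW (D.frameW.θ a)) =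
          Q.zero (ζ (D.frameB.θ a)) := ha
        have hb' : φ (Min.zeroIncl GenW.deg GenW.deg D.relW (D.frameW.θ b)) =
          Q.zero (ζ (D.frameB.θ b)) := hb
        change φ (Min.zeroIncl GenW.deg GenW.deg D.relW (D.frameW.θ ⁅a, b⁆)) =
          Q.zero (ζ (D.frameB.θ ⁅a, b⁆))
        rw [LieHom.map_lie, LieHom.map_lie, Min.zeroIncl_lie, ← hM.br_zero_zero, ← ha', ← hb']
        exact hbr _ _ }
  have h1 : x ∈ Y := by
    rw [D.chev.gen Y (fun j => ?_) fun j => ?_]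
    · trivial
    · change φ (Min.zeroIncl GenW.deg GenW.deg D.relW (D.frameW.θ (D.chev.e j))) =
          Q.zero (ζ (D.frameB.θ (D.chev.e j)))
      rw [Frame.θ_e, Frame.θ_e]; exact hφ (.e (some j))
    · change φ (Min.zeroIncl GenW.deg GenW.deg D.relW (D.frameW.θ (D.chev.f j))) =
          Q.zero (ζ (D.frameB.θ (D.chev.f j)))
      rw [Frame.θ_f, Frame.θ_f]; exact hφ (.f j)
  exact h1

theorem negHom_lie (x : D.LieAlg) (v : D.frameW.NegMod) : negHom φ ⁅x, v⁆ =
    Min.bracket LocalAlgebra.Gen.deg LocalAlgebra.Gen.deg Q.relators (Q.zero (ζ (D.frameB.θ x)))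
      (negHom φ v) := by
  rw [← map_θ hM hφ hbr x]
  exact hbr _ _

/-- The kernel of the homomorphism in degree `-1`. -/
noncomputable def negKer : LieSubmodule K D.LieAlg D.frameW.NegMod :=
  { LinearMap.ker (negHom φ) with
    lie_mem := fun {x v} hv => by
      have hv' : negHom φ v = 0 := hv
      change negHom φ ⁅x, v⁆ = 0
      rw [negHom_lie hM hφ hbr, hv', map_zero] }

end

variable (hε : ∀ j, D.lam j ≠ 0 → D.ε j = 1) (T : D.chev.Grading) (hT : T.lam = D.lam)
  (hc : T.c = D.c) [LieAlgebra.IsSimple K D.LieAlg] [FiniteDimensional K D.LieAlg]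

include hM hφ hε hT hc

/-- The homomorphism is injective on the span of the elements `f_{0i}`. A combination `z` of the
`h_i` with `i = 0` or `λ_i = 0` commutes with `e_0`, so that `[e_0, f_0 z] = z`. Hence `f_0 z = 0`
implies `z = 0`, and the rows of `B` are linearly independent. -/
theorem eq_zero_of_negHom_eq_zero_of_mem_f0Span {v : D.frameW.NegMod} (hv : v ∈ D.f0Span)
    (h : negHom φ v = 0) : v = 0 := by
  obtain ⟨a, rfl⟩ := (Submodule.mem_span_range_iff_exists_fun K).mp hv
  have h1 : negHom φ (∑ i, a i • D.f0W i) = Q.neg (ν D.f₀ (∑ i, a i • D.h i.1)) := by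
    simp only [map_sum, map_smul, negHom_f0W hφ]
  set z : D.ContraZero := ∑ i, a i • D.h i.1 with hz
  have hze : ∀ j : Fin D.r, ⁅z, D.eB j⁆ = (∑ i, a i * D.B i.1 (some j)) • D.eB j := fun j => by
    rw [hz, sum_lie, Finset.sum_smul]
    exact Finset.sum_congr rfl fun i _ => by rw [smul_lie, h_lie_e, smul_smul]
  have hz0 : ⁅z, D.e₀⁆ = 0 := by
    rw [hz, sum_lie]
    exact Finset.sum_eq_zero fun i _ => by
      rw [smul_lie, h_lie_e₀, B_indexK_none, zero_smul, smul_zero]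
  have h2 : z = 0 := by
    refine zero_injective hM hε T hT hc ?_
    change Q.zero (ζ z) = Q.zero (ζ 0)
    rw [← cornerBr_of_lie_e₀ hΦ hz0, ← hM.br_pos_neg, ← h1, h, map_zero, map_zero, map_zero]
  have h3 : ∀ j, ∑ i : D.IndexK, a i * D.B i.1 j = 0 := by
    rintro (_ | j)
    · exact Finset.sum_eq_zero fun i _ => by rw [B_indexK_none, mul_zero]
    · have h4 := hze j
      rw [h2, zero_lie, eq_comm, smul_eq_zero] at h4
      exact h4.resolve_right fun h5 =>
        D.genB_e_ne_zero (some j) (congrArg (Min.zeroIncl _ _ _) h5)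
  -- The coefficients, extended by zero, are annihilated by the invertible matrix `B`.
  let b : Option (Fin D.r) → K := fun i =>
    if hi : ∀ j, i = some j → D.lam j = 0 then a ⟨i, hi⟩ else 0
  have hb : b = 0 := by
    refine Matrix.eq_zero_of_vecMul_eq_zero D.B_det (funext fun j => ?_)
    rw [Matrix.vecMul, dotProduct, Pi.zero_apply, ← h3 j]
    refine (Fintype.sum_of_injective Subtype.val Subtype.val_injective _ _ (fun i hi => ?_)
      fun i => ?_).symm
    · rw [show b i = 0 from dif_neg fun h => hi ⟨⟨i, h⟩, rfl⟩, zero_mul]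
    · rw [show b i.1 = a i from dif_pos i.2]
  have ha : ∀ i, a i = 0 := fun i => by
    have := congrFun hb i.1
    simp only [b, dif_pos i.2] at this
    exact this
  simp [ha]

/-- The homomorphism is injective on the vectors generated by the elements `f_{0i}` under the
generators of degree zero. -/
theorem eq_zero_of_negHom_eq_zero (hbr : ∀ x y, φ (D.brW x y) =
      Min.bracket LocalAlgebra.Gen.deg LocalAlgebra.Gen.deg Q.relators (φ x) (φ y))
    {v : D.frameW.NegMod} (hv : v ∈ negBase T) (h : negHom φ v = 0) : v = 0 :=
  (isCore_f0Span T hT).eq_zero_of_mem D.A_det D.A_diag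
    (D.chev.eq_zero_of_mulVec_nonpos D.A_det D.A_diag D.chev_e_ne_zero)
    (fun _ hk => f0Span_le_maxGenEigenspace_e T hT hk)
    (fun k _ => f0Span_le_maxGenEigenspace_f k) (negKer hM hφ hbr)
    (fun _ hv hv' => eq_zero_of_negHom_eq_zero_of_mem_f0Span hM hφ hε T hT hc hv' hv) h hv

end Triple

/-! ### The generators `e_j` with `λ_j ≠ 0` in degree `-1` of `W` -/

namespace Triple

variable {K : Type u} [Field K] [CharZero K] {D : Triple K}

theorem chev_e_lie_e [LieAlgebra.IsSimple K D.LieAlg] {j k : Fin D.r} (hjk : j ≠ k)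
    (h : D.A j k = 0) : ⁅D.chev.e j, D.chev.e k⁆ = 0 := by
  have h1 : ⁅D.eB j, D.eB k⁆ = 0 := by
    have h1 := D.frameB.se j k hjk
    rw [h, neg_zero, Int.toNat_zero, zero_add, pow_one] at h1
    exact h1
  refine D.frameB.eq_zero_of_θ_lie_eq_zero D.e₀_ne_zero fun v => ?_
  rw [LieHom.map_lie, Frame.θ_e, Frame.θ_e]
  exact (congrArg (fun z : D.ContraZero => ⁅z, v⁆) h1).trans (zero_lie v)

/-- A vector with weight at most `-2` for `h_j` that is annihilated by `f_j` and `e_j²` is zero. -/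
theorem eq_zero_of_weight_le {j : Fin D.r} {x : D.LieAlg} {a : ℤ} (ha : a ≤ -2)
    (hh : ⁅D.chev.h j, x⁆ = (a : K) • x) (hf : ⁅D.chev.f j, x⁆ = 0)
    (he : ⁅D.chev.e j, ⁅D.chev.e j, x⁆⁆ = 0) : x = 0 := by
  have h1 : ⁅D.chev.f j, ⁅D.chev.e j, x⁆⁆ = (-a : K) • x := by
    rw [leibniz_lie, hf, lie_zero, add_zero, D.chev.fe, neg_lie, hh, neg_smul]
  have h2 : ⁅D.chev.h j, ⁅D.chev.e j, x⁆⁆ = ((a + 2 : ℤ) : K) • ⁅D.chev.e j, x⁆ := by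
    rw [leibniz_lie, D.chev.he, hh, smul_lie, lie_smul, ← add_smul,
      show D.chev.A j j = 2 from D.A_diag j]
    congr 1; push_cast; ring
  have h3 : ((-(2 * a + 2) : ℤ) : K) • ⁅D.chev.e j, x⁆ = 0 := by
    have h4 := leibniz_lie (D.chev.f j) (D.chev.e j) ⁅D.chev.e j, x⁆
    rw [he, lie_zero, D.chev.fe, neg_lie, h2, h1, lie_smul, ← neg_smul, ← add_smul] at h4
    rw [h4]
    congr 1; push_cast; ring
  rw [(smul_eq_zero.mp h3).resolve_left (Int.cast_ne_zero.mpr (by omega)), lie_zero, eq_comm,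
    smul_eq_zero] at h1
  exact h1.resolve_left (neg_ne_zero.mpr (Int.cast_ne_zero.mpr (by omega)))

theorem e_lie_negBase {T : D.chev.Grading} {k : Fin D.r} (hk : T.lam k = 0) {v : D.frameW.NegMod}
    (hv : v ∈ negBase T) : ⁅D.chev.e k, v⁆ ∈ negBase T :=
  opClosure_stable (S := {t | ∃ k, T.lam k = 0 ∧
    (t = LieModule.toEnd K D.LieAlg D.frameW.NegMod (D.chev.e k) ∨
      t = LieModule.toEnd K D.LieAlg D.frameW.NegMod (D.chev.f k))}) ⟨k, hk, Or.inl rfl⟩ hv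

theorem f_lie_negBase {T : D.chev.Grading} {k : Fin D.r} (hk : T.lam k = 0) {v : D.frameW.NegMod}
    (hv : v ∈ negBase T) : ⁅D.chev.f k, v⁆ ∈ negBase T :=
  opClosure_stable (S := {t | ∃ k, T.lam k = 0 ∧
    (t = LieModule.toEnd K D.LieAlg D.frameW.NegMod (D.chev.e k) ∨
      t = LieModule.toEnd K D.LieAlg D.frameW.NegMod (D.chev.f k))}) ⟨k, hk, Or.inr rfl⟩ hv

theorem f0W_mem_negBase (T : D.chev.Grading) (i : D.IndexK) : D.f0W i ∈ negBase T :=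
  le_opClosure _ _ (Submodule.subset_span ⟨i, rfl⟩)

theorem negBase_le {T : D.chev.Grading} {X : Submodule K D.frameW.NegMod}
    (h0 : ∀ i, D.f0W i ∈ X) (he : ∀ k, T.lam k = 0 → ∀ v ∈ X, ⁅D.chev.e k, v⁆ ∈ X)
    (hf : ∀ k, T.lam k = 0 → ∀ v ∈ X, ⁅D.chev.f k, v⁆ ∈ X) : negBase T ≤ X :=
  opClosure_le (f0Span_le h0) (by
    rintro _ ⟨k, hk, rfl | rfl⟩ v hv
    exacts [he k hk v hv, hf k hk v hv])

variable {Φ : D.ContraNeg →ₗ[K] D.ContraPos →ₗ[K] K}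

variable {Lm L0 Lp : Type u} [AddCommGroup Lm] [Module K Lm] [AddCommGroup L0] [Module K L0]
  [AddCommGroup Lp] [Module K Lp] {Q : LocalAlgebra K Lm L0 Lp} {ζ : D.ContraZero →ₗ[K] L0}
  {π : D.ContraPos →ₗ[K] Lp} {ν : D.ContraNeg →ₗ[K] D.ContraZero →ₗ[K] Lm}

variable (T : D.chev.Grading) (φ : D.W →ₗ[K] Q.Minimal) (ν) in
/-- The properties of a nonempty product `v` of generators `e_k` of degree zero acting on some
`f_{0i}`, whose image in the cartanification is `f_0 x`. They are preserved by a further `e_k`. The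
index `j` is fixed and has `λ_j ≠ 0`. -/
structure IsNegWord (j : Fin D.r) (v : D.frameW.NegMod) (x : D.LieAlg) : Prop where
  mem : v ∈ negBase T
  e_lie : ⁅D.chev.e j, v⁆ = 0
  hom : negHom φ v = Q.neg (ν D.f₀ (D.frameB.θ x))
  lie_f₀ : ⁅D.frameB.θ x, D.f₀⁆ = 0
  stable : ∀ w ∈ negBase T, ⁅x, w⁆ ∈ negBase T
  c_lie : ⁅T.c, x⁆ = 0
  f_lie : ⁅D.chev.f j, x⁆ = 0
  weight : ⁅D.chev.e j, x⁆ = 0 ∧ ⁅D.chev.h j, x⁆ = 0 ∨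
    ∃ a : ℤ, a ≤ -1 ∧ ⁅D.chev.h j, x⁆ = (a : K) • x

variable {hΦ : D.IsInvariantForm Φ} (hM : (D.localPart Φ hΦ).IsModel Q ζ π ν)
  {φ : D.W →ₗ[K] Q.Minimal} (hφ : ∀ x, φ (D.genW x) = cartGen Q ζ π ν x)
  (hbr : ∀ x y, φ (D.brW x y) = Min.bracket LocalAlgebra.Gen.deg LocalAlgebra.Gen.deg Q.relators
    (φ x) (φ y))
  (hε : ∀ j, D.lam j ≠ 0 → D.ε j = 1) {T : D.chev.Grading} (hT : T.lam = D.lam)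
  (hc : T.c = D.c) [LieAlgebra.IsSimple K D.LieAlg] [FiniteDimensional K D.LieAlg]

omit [CharZero K] [LieAlgebra.IsSimple K D.LieAlg] [FiniteDimensional K D.LieAlg] in
include hT in
theorem c_lie_e_of_lam {k : Fin D.r} (hk : D.lam k = 0) : ⁅T.c, D.chev.e k⁆ = 0 := by
  have := T.ce k
  rwa [hT, hk, Nat.cast_zero, zero_smul] at this

include hM hφ hbr hT

omit [FiniteDimensional K D.LieAlg] in
theorem isNegWord_e_lie_f0W {j k : Fin D.r} (hj : D.lam j ≠ 0) (hk : D.lam k = 0) (i : D.IndexK) :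
    IsNegWord ν T φ j ⁅D.chev.e k, D.f0W i⁆ (-(D.B i.1 (some k) • D.chev.e k)) := by
  have hk' : T.lam k = 0 := by rwa [hT]
  have hjk : j ≠ k := by rintro rfl; exact hj hk
  refine ⟨e_lie_negBase hk' (f0W_mem_negBase T i), e_e_lie_f0W' hj hk i, ?_, ?_, fun w hw => ?_,
    ?_, ?_, ?_⟩
  · rw [negHom_lie hM hφ hbr, negHom_f0W hφ, Frame.θ_e]
    refine (br_e_f₀z hM k _).trans ?_
    rw [e_lie_h, map_neg, map_neg, map_smul, map_smul, map_neg D.frameB.θ, map_neg, map_neg,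
      map_smul D.frameB.θ, map_smul, map_smul, Frame.θ_e]
    rfl
  · rw [map_neg, map_smul, Frame.θ_e, neg_lie, smul_lie]
    exact neg_eq_zero.mpr ((congrArg _ (e_lie_f₀ k)).trans (smul_zero _))
  · rw [neg_lie, smul_lie]
    exact neg_mem (Submodule.smul_mem _ _ (e_lie_negBase hk' hw))
  · rw [lie_neg, lie_smul, c_lie_e_of_lam hT hk, smul_zero, neg_zero]
  · rw [lie_neg, lie_smul, D.chev.fe_ne j k hjk, smul_zero, neg_zero]
  · have hw : ⁅D.chev.h j, -(D.B i.1 (some k) • D.chev.e k)⁆ =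
        (D.A j k : K) • -(D.B i.1 (some k) • D.chev.e k) := by
      rw [lie_neg, lie_smul, D.chev.he, smul_neg, smul_comm]; rfl
    rcases eq_or_ne (D.A j k) 0 with h | h
    · refine Or.inl ⟨?_, by rw [hw, h, Int.cast_zero, zero_smul]⟩
      rw [lie_neg, lie_smul, chev_e_lie_e hjk h, smul_zero, neg_zero]
    · have := D.A_nonpos j k hjk
      exact Or.inr ⟨D.A j k, by omega, hw⟩

include hε hc

/-- The induction step for a further factor `e_k`. Unless `e_k` commutes with `e_j`, the new product
is either expressed by the action of `x`, which then commutes with `e_j`, on `e_k f_{0k}`, or it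
vanishes; both are inferred from the cartanification. -/
theorem IsNegWord.e_lie_e {j k : Fin D.r} {v : D.frameW.NegMod} {x : D.LieAlg}
    (h : IsNegWord ν T φ j v x) (hj : D.lam j ≠ 0) (hk : D.lam k = 0) :
    IsNegWord ν T φ j ⁅D.chev.e k, v⁆ ⁅D.chev.e k, x⁆ := by
  have hk' : T.lam k = 0 := by rwa [hT]
  have hjk : j ≠ k := by rintro rfl; exact hj hk
  have hmem := e_lie_negBase hk' h.mem
  have hhom : negHom φ ⁅D.chev.e k, v⁆ = Q.neg (ν D.f₀ (D.frameB.θ ⁅D.chev.e k, x⁆)) := by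
    rw [negHom_lie hM hφ hbr, h.hom, LieHom.map_lie, Frame.θ_e]
    exact br_e_f₀z hM k _
  have hcl : ⁅T.c, ⁅D.chev.e k, x⁆⁆ = 0 := by
    rw [leibniz_lie, c_lie_e_of_lam hT hk, h.c_lie, zero_lie, lie_zero, add_zero]
  have hfl : ⁅D.chev.f j, ⁅D.chev.e k, x⁆⁆ = 0 := by
    rw [leibniz_lie, D.chev.fe_ne j k hjk, h.f_lie, zero_lie, lie_zero, add_zero]
  have hw : ∀ a : ℤ, ⁅D.chev.h j, x⁆ = (a : K) • x →
      ⁅D.chev.h j, ⁅D.chev.e k, x⁆⁆ = ((D.A j k + a : ℤ) : K) • ⁅D.chev.e k, x⁆ := fun a ha => by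
    rw [leibniz_lie, D.chev.he, ha, lie_smul, smul_lie, ← add_smul, Int.cast_add]; rfl
  have hA := D.A_nonpos j k hjk
  refine ⟨hmem, ?_, hhom, ?_, fun w hw => ?_, hcl, hfl, ?_⟩
  · rcases eq_or_ne (D.A j k) 0 with h0 | h0
    · rw [leibniz_lie, chev_e_lie_e hjk h0, h.e_lie, zero_lie, lie_zero, add_zero]
    rcases h.weight with ⟨h1, -⟩ | ⟨a, ha, h1⟩
    · -- The product `e_k v` is equal to `x (e_k f_{0k}) / 2`, where `x` commutes with `e_j`.
      have hX : ⁅D.chev.e k, v⁆ =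
          (2⁻¹ : K) • ⁅x, ⁅D.chev.e k, D.f0W (D.toK k hk)⁆⁆ := by
        rw [← sub_eq_zero]
        refine eq_zero_of_negHom_eq_zero hM hφ hε T hT hc hbr (sub_mem hmem (Submodule.smul_mem _ _
          (h.stable _ (e_lie_negBase hk' (f0W_mem_negBase T _))))) ?_
        have h2 : negHom φ ⁅D.chev.e k, D.f0W (D.toK k hk)⁆ =
            -((2 : K) • Q.neg (ν D.f₀ (D.eB k))) := by
          rw [negHom_lie hM hφ hbr, negHom_f0W hφ, Frame.θ_e]
          refine (br_e_f₀z hM k _).trans ?_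
          rw [e_lie_h, show D.B (D.toK k hk).1 (some k) = 2 from B_some_self k, map_neg, map_neg,
            map_smul, map_smul]
        rw [map_sub, map_smul, negHom_lie hM hφ hbr x, h2, map_neg, map_smul, hM.br_zero_neg,
          hhom, h.lie_f₀, map_zero, LinearMap.zero_apply, map_zero, zero_add, LieHom.map_lie,
          Frame.θ_e, show D.frameB.e k = D.eB k from rfl, ← lie_skew, map_neg, map_neg, smul_neg,
          smul_smul, inv_mul_cancel₀ two_ne_zero, one_smul, sub_self]
      rw [hX, lie_smul, leibniz_lie, h1, zero_lie, e_e_lie_f0W' hj hk, lie_zero, add_zero,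
        smul_zero]
    · -- Here `[e_k, x]` has weight at most `-2` for `h_j`, which forces it to vanish.
      have h2 : ⁅D.chev.e k, x⁆ = 0 := by
        refine eq_zero_of_weight_le (by omega) (hw a h1) hfl ?_
        have hej := Chev.Grading.IsLowest.e_of_lam_ne_zero T (j := j) (by rwa [hT])
        refine T.lie_eq_zero hej ?_
        rw [leibniz_lie, hej, hcl, lie_zero, add_zero]
      rw [eq_zero_of_negHom_eq_zero hM hφ hε T hT hc hbr hmem (by
        rw [hhom, h2, map_zero, map_zero, map_zero]), lie_zero]
  · rw [LieHom.map_lie, Frame.θ_e]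
    refine (lie_lie (D.eB k) (D.frameB.θ x) D.f₀).trans ?_
    rw [h.lie_f₀, e_lie_f₀, lie_zero, lie_zero, sub_zero]
  · rw [lie_lie]
    exact sub_mem (e_lie_negBase hk' (h.stable w hw)) (h.stable _ (e_lie_negBase hk' hw))
  · rcases h.weight with ⟨h1, h2⟩ | ⟨a, ha, h1⟩
    · rcases eq_or_ne (D.A j k) 0 with h0 | h0
      · refine Or.inl ⟨?_, ?_⟩
        · rw [leibniz_lie, chev_e_lie_e hjk h0, h1, zero_lie, lie_zero, add_zero]
        · rw [hw 0 (by rw [h2, Int.cast_zero, zero_smul]), h0, add_zero, Int.cast_zero, zero_smul]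
      · exact Or.inr ⟨_, by omega, hw 0 (by rw [h2, Int.cast_zero, zero_smul])⟩
    · exact Or.inr ⟨_, by omega, hw a h1⟩

/-- The generators `e_j` with `λ_j ≠ 0` annihilate the vectors generated by the elements `f_{0i}`
under the generators of degree zero. -/
theorem e_lie_eq_zero_of_mem_negBase {j : Fin D.r} (hj : D.lam j ≠ 0) {v : D.frameW.NegMod}
    (hv : v ∈ negBase T) : ⁅D.chev.e j, v⁆ = 0 := by
  let X : Submodule K D.frameW.NegMod :=
    LinearMap.ker (LieModule.toEnd K D.LieAlg D.frameW.NegMod (D.chev.e j))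
  have h0 : D.f0Span ≤ X := f0Span_le fun i => e_lie_f0W hj i
  refine (isCore_f0Span T hT).eq_sup_words X (fun n => ?_) (fun n => ?_) hv
  · cases n with
    | zero => exact h0
    | succ n =>
      refine le_trans ?_ (Submodule.span_le (s := {v | ∃ x, IsNegWord ν T φ j v x}).mpr
        fun v ⟨x, hv⟩ => hv.e_lie)
      induction n with
      | zero =>
        refine Chev.Grading.IsCore.words_succ_le fun k hk v hv => ?_
        rw [hT] at hk
        exact f0Span_le (X := (Submodule.span K {v | ∃ x, IsNegWord ν T φ j v x}).comap
          (LieModule.toEnd K D.LieAlg D.frameW.NegMod (D.chev.e k))) (fun i =>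
            Submodule.subset_span ⟨_, isNegWord_e_lie_f0W hM hφ hbr hT hj hk i⟩) hv
      | succ n ih =>
        refine Chev.Grading.IsCore.words_succ_le fun k hk v hv => ?_
        rw [hT] at hk
        refine (Submodule.span_le (p := (Submodule.span K {v | ∃ x, IsNegWord ν T φ j v x}).comap
          (LieModule.toEnd K D.LieAlg D.frameW.NegMod (D.chev.e k)))).mpr ?_ (ih hv)
        rintro v ⟨x, hx⟩
        exact Submodule.subset_span ⟨_, hx.e_lie_e hM hφ hbr hε hT hc hj hk⟩
  · induction n with
    | zero => exact h0
    | succ n ih =>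
      refine Chev.Grading.IsCore.words_succ_le fun k hk v hv => ?_
      have hk' : D.lam k = 0 := by rw [← hT]; exact hk
      have h1 : ⁅D.chev.e j, v⁆ = 0 := ih hv
      change ⁅D.chev.e j, ⁅D.chev.f k, v⁆⁆ = 0
      rw [leibniz_lie, D.chev.ef_ne j k (by rintro rfl; exact hj hk'), h1, zero_lie, lie_zero,
        add_zero]

end Triple

/-! ### The isomorphism -/

namespace Triple

variable {K : Type u} [Field K] [CharZero K] {D : Triple K}

theorem finiteDimensional_contraZero [FiniteDimensional K D.LieAlg]
    (hε : ∀ j, D.lam j ≠ 0 → D.ε j = 1) : FiniteDimensional K D.ContraZero := by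
  have h1 : Function.Surjective (D.frameB.θ.toLinearMap.coprod
      (LinearMap.toSpanSingleton K D.ContraZero D.frameB.h₀)) := fun z => by
    obtain ⟨x, a, rfl⟩ := D.exists_zero_eq hε z
    exact ⟨(x, a), rfl⟩
  exact Module.Finite.of_surjective _ h1

theorem h_lie_negBase {T : D.chev.Grading} (i : Fin D.r) {v : D.frameW.NegMod}
    (hv : v ∈ negBase T) : ⁅D.chev.h i, v⁆ ∈ negBase T := by
  have h1 : negBase T ≤ negBase T ⊓ (negBase T).comap
      (LieModule.toEnd K D.LieAlg D.frameW.NegMod (D.chev.h i)) := by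
    refine negBase_le (fun j => ⟨f0W_mem_negBase T j, ?_⟩) (fun k hk v hv => ?_) fun k hk v hv => ?_
    · change ⁅D.chev.h i, D.f0W j⁆ ∈ negBase T
      rw [h_lie_f0W]
      exact Submodule.smul_mem _ _ (f0W_mem_negBase T j)
    · refine ⟨e_lie_negBase hk hv.1, ?_⟩
      change ⁅D.chev.h i, ⁅D.chev.e k, v⁆⁆ ∈ negBase T
      rw [leibniz_lie, D.chev.he, smul_lie]
      exact add_mem (Submodule.smul_mem _ _ (e_lie_negBase hk hv.1)) (e_lie_negBase hk hv.2)
    · refine ⟨f_lie_negBase hk hv.1, ?_⟩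
      change ⁅D.chev.h i, ⁅D.chev.f k, v⁆⁆ ∈ negBase T
      rw [leibniz_lie, D.chev.hf, neg_lie, smul_lie]
      exact add_mem (neg_mem (Submodule.smul_mem _ _ (f_lie_negBase hk hv.1)))
        (f_lie_negBase hk hv.2)
  exact (h1 hv).2

section

variable {T : D.chev.Grading} (hT : T.lam = D.lam)

include hT

theorem h₀_lie_negBase {v : D.frameW.NegMod} (hv : v ∈ negBase T) : ⁅D.frameW.h₀, v⁆ = 0 := by
  have h1 : negBase T ≤ LinearMap.ker (LieModule.toEnd K (Min.Zero GenW.deg GenW.deg D.relW)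
      D.frameW.NegMod D.frameW.h₀) := by
    refine negBase_le h₀_lie_f0W (fun k hk v hv => ?_) fun k hk v hv => ?_
    · have hv' : ⁅D.frameW.h₀, v⁆ = 0 := hv
      rw [hT] at hk
      change ⁅D.frameW.h₀, ⁅D.frameW.θ (D.chev.e k), v⁆⁆ = 0
      rw [leibniz_lie, hv', lie_zero, add_zero, Frame.θ_e, D.frameW.h₀e, hk, Nat.cast_zero,
        zero_div, zero_smul, neg_zero, zero_lie]
    · have hv' : ⁅D.frameW.h₀, v⁆ = 0 := hv
      rw [hT] at hk
      change ⁅D.frameW.h₀, ⁅D.frameW.θ (D.chev.f k), v⁆⁆ = 0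
      rw [leibniz_lie, hv', lie_zero, add_zero, Frame.θ_f, D.frameW.h₀f, hk, Nat.cast_zero,
        zero_div, zero_smul, zero_lie]
  exact h1 hv

omit hT in
theorem c_lie_negBase (hc : T.c = D.c) {v : D.frameW.NegMod} (hv : v ∈ negBase T) :
    ⁅T.c, v⁆ = D.cWeight • v := by
  have h1 : negBase T ≤ (LieModule.toEnd K D.LieAlg D.frameW.NegMod T.c).eigenspace D.cWeight := by
    refine negBase_le (fun i => ?_) (fun k hk v hv => ?_) fun k hk v hv => ?_ <;>
      rw [Module.End.mem_eigenspace_iff] at * <;> rw [LieModule.toEnd_apply_apply] at *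
    · rw [hc, c, sum_lie, cWeight, Finset.sum_smul]
      exact Finset.sum_congr rfl fun l _ => by rw [smul_lie, h_lie_f0W, smul_smul]
    · rw [leibniz_lie, hv, T.ce, hk, Nat.cast_zero, zero_smul, zero_lie, zero_add, lie_smul]
    · rw [leibniz_lie, hv, T.cf, hk, Nat.cast_zero, zero_smul, neg_zero, zero_lie, zero_add,
        lie_smul]
  exact Module.End.mem_eigenspace_iff.mp (h1 hv)

theorem pairing_negBase (hε : ∀ j, D.lam j ≠ 0 → D.ε j = 1) {v : D.frameW.NegMod}
    (hv : v ∈ negBase T) : D.frameW.pairing D.frameW.ePos v ∈ D.frameW.even := by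
  have hθ : ∀ x, D.frameW.θ x ∈ D.frameW.even := fun x =>
    D.frameW.mem_even.mpr ⟨x, 0, by rw [zero_smul, add_zero]⟩
  have key : ∀ x, ⁅x, D.frameW.ePos⁆ = 0 → ∀ v, D.frameW.pairing D.frameW.ePos v ∈ D.frameW.even →
      D.frameW.pairing D.frameW.ePos ⁅x, v⁆ ∈ D.frameW.even := fun x hx v hv => by
    have h1 := D.frameW.lie_pairing (D.frameW.θ x) D.frameW.ePos v
    rw [show ⁅D.frameW.θ x, D.frameW.ePos⁆ = 0 from hx, map_zero, LinearMap.zero_apply,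
      zero_add] at h1
    exact (congrArg (· ∈ D.frameW.even) h1).mp (D.frameW.lie_mem_even hε (hθ x) hv)
  have h1 : negBase T ≤ D.frameW.even.comap (D.frameW.pairing D.frameW.ePos) := by
    refine negBase_le (fun i => ?_) (fun k hk v hv => key _ ?_ v hv) fun k _ v hv =>
      key _ (D.frameW.f_ePos k) v hv
    · rw [Submodule.mem_comap, pairing_f0W]
      obtain ⟨_ | k, hk⟩ := i
      · exact D.frameW.mem_even.mpr ⟨0, 1, by rw [map_zero, one_smul, zero_add]; rfl⟩
      · have := hθ (D.chev.h k)
        rw [Frame.θ_h] at this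
        exact this
    · rw [hT] at hk
      have := D.frameW.pow_e_ePos k
      rwa [hk, zero_add, pow_one] at this
  exact h1 hv

end

variable {Φ : D.ContraNeg →ₗ[K] D.ContraPos →ₗ[K] K}

variable {Lm L0 Lp : Type u} [AddCommGroup Lm] [Module K Lm] [AddCommGroup L0] [Module K L0]
  [AddCommGroup Lp] [Module K Lp] {Q : LocalAlgebra K Lm L0 Lp} {ζ : D.ContraZero →ₗ[K] L0}
  {π : D.ContraPos →ₗ[K] Lp} {ν : D.ContraNeg →ₗ[K] D.ContraZero →ₗ[K] Lm}
  {hΦ : D.IsInvariantForm Φ} (hM : (D.localPart Φ hΦ).IsModel Q ζ π ν)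
  {φ : D.W →ₗ[K] Q.Minimal} (hφ : ∀ x, φ (D.genW x) = cartGen Q ζ π ν x)
  (hbr : ∀ x y, φ (D.brW x y) = Min.bracket LocalAlgebra.Gen.deg LocalAlgebra.Gen.deg Q.relators
    (φ x) (φ y))
  (hε : ∀ j, D.lam j ≠ 0 → D.ε j = 1) {T : D.chev.Grading} (hT : T.lam = D.lam)
  (hc : T.c = D.c) [LieAlgebra.IsSimple K D.LieAlg] [FiniteDimensional K D.LieAlg]

include hM hφ hbr hε hT hc

/-- The subspace `negBase` generates the component of degree `-1` of `W`. It is stable under all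
`e_i`, because those with `λ_i ≠ 0` annihilate it. -/
theorem isNegBaseW : D.frameW.IsNegBase (negBase T) where
  h_mem i _ hv := h_lie_negBase i hv
  e_mem i v hv := by
    by_cases hi : D.lam i = 0
    · exact e_lie_negBase (by rwa [hT]) hv
    · rw [e_lie_eq_zero_of_mem_negBase hM hφ hbr hε hT hc hi hv]
      exact zero_mem _
  h₀_mem v hv := by rw [h₀_lie_negBase hT hv]; exact zero_mem _
  e₀_mem _ hv := pairing_negBase hT hε hv
  gen x := by
    rcases x with (_ | i) | i | (_ | i) | i
    · exact Or.inr (Or.inr (Or.inl rfl))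
    · exact Or.inl ⟨D.chev.e i, by rw [Frame.θ_e]; rfl⟩
    · exact Or.inl ⟨D.chev.f i, by rw [Frame.θ_f]; rfl⟩
    · exact Or.inr (Or.inl rfl)
    · exact Or.inl ⟨D.chev.h i, by rw [Frame.θ_h]; rfl⟩
    · exact Or.inr (Or.inr (Or.inr ⟨D.f0W i, f0W_mem_negBase T i, rfl⟩))

/-- The components of degree `0` and `±1` of `W`. -/
theorem local_eqW :
    D.frameW.even = ⊤ ∧
    opClosure (Set.range fun i => LieModule.toEnd K D.LieAlg D.frameW.PosMod (D.chev.e i))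
      (Submodule.span K {D.frameW.ePos}) = ⊤ ∧
    opClosure (Set.range fun i => LieModule.toEnd K D.LieAlg D.frameW.NegMod (D.chev.f i))
      (negBase T) = ⊤ := by
  obtain ⟨ℓ, hℓ⟩ := D.exists_isGradingElementW
  exact (isNegBaseW hM hφ hbr hε hT hc).local_eq hε (Min.isGradingElement hℓ)

theorem finiteDimensional_negBase : FiniteDimensional K (negBase T) := by
  have := finiteDimensional_contraZero hε
  let R : Submodule K Q.Minimal := LinearMap.range (Q.neg ∘ₗ ν D.f₀)
  have h1 : negBase T ≤ R.comap (negHom φ) := by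
    refine negBase_le (fun i => ⟨D.h i.1, (negHom_f0W hφ i).symm⟩) (fun k hk v hv => ?_)
      fun k hk v hv => ?_ <;> obtain ⟨z, hz⟩ := hv
    · refine ⟨⁅D.eB k, z⁆, ?_⟩
      rw [negHom_lie hM hφ hbr, ← hz, Frame.θ_e]
      exact (br_e_f₀z hM k z).symm
    · refine ⟨⁅D.fB k, z⁆, ?_⟩
      rw [hT] at hk
      rw [negHom_lie hM hφ hbr, ← hz, Frame.θ_f]
      exact (br_f_f₀z hM hk z).symm
  refine Module.Finite.of_injective ((negHom φ ∘ₗ (negBase T).subtype).codRestrict R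
    fun v => h1 v.2) ((injective_iff_map_eq_zero _).mpr fun v hv => Subtype.ext ?_)
  exact eq_zero_of_negHom_eq_zero hM hφ hε T hT hc hbr v.2 (congrArg Subtype.val hv)

theorem exists_pow_f_eq_zero (j : Fin D.r) : ∃ n : ℕ, ∀ v ∈ negBase T,
    (LieModule.toEnd K D.LieAlg D.frameW.NegMod (D.chev.f j) ^ n) v = 0 := by
  have := finiteDimensional_negBase hM hφ hbr hε hT hc
  let t := LieModule.toEnd K D.LieAlg D.frameW.NegMod (D.chev.f j)
  have h1 : negBase T ≤ t.maxGenEigenspace 0 := by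
    refine negBase_le (fun i => f0Span_le_maxGenEigenspace_f j (Submodule.subset_span ⟨i, rfl⟩))
      (fun k _ v hv => ?_) fun k _ v hv => ?_
    exacts [D.chev.swap.lie_mem_maxGenEigenspace (by
        change D.chev.A.det ≠ 0
        exact D.A_det) j _ hv, D.chev.swap.lie_mem_maxGenEigenspace D.A_det j _ hv]
  obtain ⟨s, hs⟩ : (negBase T).FG := (Submodule.fg_top _).mp Module.Finite.fg_top
  have h2 : ∀ v : D.frameW.NegMod, ∃ n : ℕ, v ∈ s → (t ^ n) v = 0 := fun v => by
    by_cases hv : v ∈ s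
    · have h3 : v ∈ t.maxGenEigenspace 0 := h1 (hs ▸ Submodule.subset_span hv)
      rw [Module.End.mem_maxGenEigenspace, zero_smul, sub_zero] at h3
      exact ⟨h3.choose, fun _ => h3.choose_spec⟩
    · exact ⟨0, fun h => absurd h hv⟩
  choose n hn using h2
  refine ⟨s.sup n, fun v hv => ?_⟩
  have h3 : negBase T ≤ LinearMap.ker (t ^ s.sup n) := by
    rw [← hs]
    refine Submodule.span_le.mpr fun v hv => ?_
    exact Module.End.pow_map_zero_of_le (Finset.le_sup hv) (hn v hv)
  exact h3 hv

theorem eq_zero_of_mem_grade_zero {x : D.W} (hx : x ∈ Min.grade GenW.deg GenW.deg D.relW 0)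
    (h : φ x = 0) : x = 0 := by
  let x' : Min.Zero GenW.deg GenW.deg D.relW := ⟨x, hx⟩
  have h1 : x' ∈ D.frameW.even := by
    rw [(local_eqW hM hφ hbr hε hT hc).1]; exact Submodule.mem_top
  obtain ⟨y, a, hy⟩ := D.frameW.mem_even.mp h1
  have h2 : φ (Min.zeroIncl GenW.deg GenW.deg D.relW (D.frameW.θ y + a • D.frameW.h₀)) = 0 := by
    rw [← hy]; exact h
  rw [map_add, map_smul, map_add, map_smul, map_θ hM hφ hbr,
    show D.frameW.h₀ = D.hW none from rfl, map_hW hφ, ← map_smul, ← map_smul, ← map_add,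
    ← map_add] at h2
  have h3 : D.frameB.θ y + a • D.h none = 0 :=
    zero_injective hM hε T hT hc (h2.trans (map_zero (Q.zero ∘ₗ ζ)).symm)
  obtain ⟨rfl, rfl⟩ := D.frameB.eq_zero_of_add_eq_zero D.e₀_ne_zero hε h3
  rw [map_zero, zero_smul, add_zero] at hy
  exact congrArg Subtype.val hy

/-- The homomorphism is injective in degree `1`, since the component of degree `1` of `W` is
generated by `e_0` as a `𝔤`-module and the image of `e_0` is not zero. -/
theorem eq_zero_of_mem_grade_one {x : D.W} (hx : x ∈ Min.grade GenW.deg GenW.deg D.relW 1)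
    (h : φ x = 0) : x = 0 := by
  let N : LieSubmodule K D.LieAlg D.frameW.PosMod :=
    { LinearMap.ker (φ ∘ₗ D.frameW.posIncl) with
      lie_mem := fun {x v} hv => by
        have hv' : φ (D.frameW.posIncl v) = 0 := hv
        change φ (D.brW (Min.zeroIncl GenW.deg GenW.deg D.relW (D.frameW.θ x))
          (D.frameW.posIncl v)) = 0
        rw [hbr, hv', map_zero] }
  have hN : N = ⊥ := by
    refine (D.frameW.isLowest_pos T hT hc (local_eqW hM hφ hbr hε hT hc).2.1).eq_bot
      (fun j hj => ⟨D.lam j + 1, fun v hv => ?_⟩) N fun v hv hv' => ?_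
    · obtain ⟨a, rfl⟩ := Submodule.mem_span_singleton.mp hv
      rw [map_smul, D.frameW.pow_e_ePos, smul_zero]
    · obtain ⟨a, rfl⟩ := Submodule.mem_span_singleton.mp hv'
      have h1 : φ (D.frameW.posIncl (a • D.frameW.ePos)) = 0 := hv
      rw [map_smul, map_smul, show φ (D.frameW.posIncl D.frameW.ePos) = Q.pos (π D.e₀) from
        hφ (.e none), smul_eq_zero] at h1
      rw [h1.resolve_right (pos_e₀_ne_zero hM hε), zero_smul]
  have h1 : (⟨x, hx⟩ : Min.Pos GenW.deg GenW.deg D.relW) = 0 :=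
    (LieSubmodule.mem_bot (R := K) (L := D.LieAlg) (M := D.frameW.PosMod) _).mp (hN ▸ h)
  exact congrArg Subtype.val h1

/-- The homomorphism is injective in degree `-1`. Its kernel is a `𝔤`-submodule, hence it vanishes if
it intersects `negBase`, the part of lowest degree for the opposite grading of `𝔤`, trivially. -/
theorem eq_zero_of_mem_grade_neg_one {x : D.W}
    (hx : x ∈ Min.grade GenW.deg GenW.deg D.relW (-1)) (h : φ x = 0) : x = 0 := by
  have := finiteDimensional_negBase hM hφ hbr hε hT hc
  have hN : negKer hM hφ hbr = ⊥ := by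
    refine (D.frameW.isLowest_neg T D.cWeight (local_eqW hM hφ hbr hε hT hc).2.2
      (fun k hk v hv => f_lie_negBase hk hv) (fun k hk v hv => e_lie_negBase hk hv)
      (fun i v hv => h_lie_negBase i hv)
      (fun j hj v hv => e_lie_eq_zero_of_mem_negBase hM hφ hbr hε hT hc (by rwa [← hT]) hv)
      fun v hv => c_lie_negBase hc hv).eq_bot
      (fun j _ => exists_pow_f_eq_zero hM hφ hbr hε hT hc j) _
      fun v hv hv' => eq_zero_of_negHom_eq_zero hM hφ hε T hT hc hbr hv' hv
  have h1 : (⟨x, hx⟩ : Min.Neg GenW.deg GenW.deg D.relW) = 0 :=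
    (LieSubmodule.mem_bot (R := K) (L := D.LieAlg) (M := D.frameW.NegMod) _).mp (hN ▸ h)
  exact congrArg Subtype.val h1

omit hM hφ hbr in
/-- `W` is isomorphic to every minimal Lie superalgebra whose local part is a model of the local
cartanification. -/
theorem exists_equiv (hQ : ∃ ζ π ν, (D.localPart Φ hΦ).IsModel Q ζ π ν) :
    ∃ ψ : D.W ≃ₗ[K] Q.Minimal,
      (∀ x y, ψ (Min.bracket GenW.deg GenW.deg D.relW x y) =
        Min.bracket LocalAlgebra.Gen.deg LocalAlgebra.Gen.deg Q.relators (ψ x) (ψ y)) ∧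
      ∀ k : ℤ, (Min.grade GenW.deg GenW.deg D.relW k).map ψ.toLinearMap =
        Min.grade LocalAlgebra.Gen.deg LocalAlgebra.Gen.deg Q.relators k := by
  obtain ⟨ζ, π, ν, hM⟩ := hQ
  obtain ⟨ℓ, hℓ⟩ := D.exists_isGradingElementW
  obtain ⟨ℓ₂, hℓ₂⟩ := hM.exists_isGradingElement
  obtain ⟨φ, hφ, hbr, hgr, hsur⟩ := Min.exists_hom hℓ₂
    (cartGen Q ζ π ν) cartGen_mem (fun x hx => eval_cartGen hM hε T hT hc hx)
    fun S hS hbr => eq_top_of_cartGen_mem hM hε T hT hc hS hbr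
  exact Min.exists_equiv hℓ hℓ₂ φ hbr hgr hsur
    (fun _ => eq_zero_of_mem_grade_neg_one hM hφ hbr hε hT hc)
    (fun _ => eq_zero_of_mem_grade_zero hM hφ hbr hε hT hc)
    fun _ => eq_zero_of_mem_grade_one hM hφ hbr hε hT hc

end Triple

namespace Triple

variable {K : Type u} [Field K] [CharZero K] {D : Triple K}

theorem eps_eq_one (hlam : D.lambda = D.lambdaUp) (j : Fin D.r) (hj : D.lam j ≠ 0) :
    D.ε j = 1 := by
  have h1 : (D.lam j : K) = D.lam j / D.ε j := congrFun hlam j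
  rw [eq_div_iff (D.ε_ne j)] at h1
  exact (mul_eq_left₀ (Nat.cast_ne_zero.mpr hj)).mp h1

end Triple

end Cartanification

theorem theorem4p2 {K : Type*} [Field K] [IsAlgClosed K] [CharZero K]
    (D : Cartanification.Triple K)
    (hsimple : LieAlgebra.IsSimple K D.LieAlg) (hfin : FiniteDimensional K D.LieAlg)
    (hmin : D.IsPseudoMinuscule D.lambda) (hlam : D.lambda = D.lambdaUp) :
    (∃! Φ : D.ContraNeg →ₗ[K] D.ContraPos →ₗ[K] K, D.IsInvariantForm Φ) ∧
    ∀ (Φ : D.ContraNeg →ₗ[K] D.ContraPos →ₗ[K] K) (hΦ : D.IsInvariantForm Φ),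
      ∃ φ : D.W ≃ₗ[K] (D.localPart Φ hΦ).Cartanified,
        (∀ x y, φ (Cartanification.Min.bracket _ _ _ x y) =
          Cartanification.Min.bracket _ _ _ (φ x) (φ y)) ∧
        ∀ k : ℤ, (Cartanification.Min.grade _ _ _ k).map φ.toLinearMap =
          Cartanification.Min.grade _ _ _ k := by
  have := hsimple
  have := hfin
  have hε := Cartanification.Triple.eps_eq_one hlam
  exact ⟨D.existsUnique_isInvariantForm hε, fun Φ hΦ =>
    Cartanification.Triple.exists_equiv hε (T := D.grading hmin D.chev_e_ne_zero) rfl rfl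
      ((D.localPart Φ hΦ).exists_isModel (Cartanification.Triple.zeroSub_eq_top hΦ hε))⟩
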